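/- For a graph $G$ and distinct vertices $u,v$, let $\mathrm{sd}_G(u,v)=|(N_G(u)\setminus\{v\})\,\triangle\,(N_G(v)\setminus\{u\})|$, and let the symmetric difference $\mathrm{sd}(G)$ be the least integer $d\ge 0$ such that every induced subgraph $H$ of $G$ with at least two vertices contains two vertices $u\neq v$ with $\mathrm{sd}_H(u,v)\le d$. For all constants $\beta>0$ and $c>0$ there is a randomized algorithm (on a word RAM with words of $\Theta(\log n)$ bits) that solves All-Pairs Shortest Path on the $n$-vertex undirected, unweighted graphs $G$ with $\mathrm{sd}(G)\le \beta n^{1/3}$, given by their adjacency matrices. The algorithm is Las Vegas: it halts almost surely, and whenever it halts, its output is correct, i.e. it consists of all pairwise distances in $G$ and of a shortest-path tree rooted at each vertex. There is a constant $C$ depending only on $\beta$ and $c$ such that, for every such graph with $n\ge 2$ vertices, with probability at least $1-n^{-c}$ the algorithm halts within $C\, n^{7/3}\log_2^2 n$ steps. -/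

import Mathlib

/-! ### Symmetric difference of a graph -/

/-- The symmetric difference of two vertices `u`, `v` of `G`: the size of
`(N(u) \ {v}) ∆ (N(v) \ {u})`. -/
noncomputable def sdPair {V : Type*} (G : SimpleGraph V) (u v : V) : ℕ :=
  (symmDiff (G.neighborSet u \ {v}) (G.neighborSet v \ {u})).ncard

/-- The symmetric difference of a (finite) graph `G`: the least `d` such that every induced
subgraph with at least two vertices has two distinct vertices of symmetric difference
(inside that induced subgraph) at most `d`. -/
noncomputable def symmetricDifference {V : Type*} (G : SimpleGraph V) : ℕ :=
  sInf {d : ℕ | ∀ S : Set V, S.Nontrivial →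
    ∃ u v : S, u ≠ v ∧ sdPair (G.induce S) u v ≤ d}

/-! ### Randomized word RAM

A machine has words of `w` bits (natural numbers below `2 ^ w`), registers indexed by `ℕ`
(a program mentions only finitely many of them) and a memory of words that is addressed through
registers. Control flow is structured (sequence, conditional, while loop). Each step performs one
instruction, one test, or one control transfer. The stack of pending commands never gets
longer than a bound given by the program text, so a step costs constant time on a word RAM
with jumps. -/

namespace WordRAM

/-- The arithmetic operations and comparisons on words. -/
inductive Op where
  | add | sub | mul | div | mod | lt | eq

/-- The result of an operation on words of `w` bits. Addition, subtraction and multiplication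
are modulo `2 ^ w`; `div` and `mod` are quotient and remainder; a comparison yields `1` or `0`. -/
def Op.eval (w : ℕ) : Op → ℕ → ℕ → ℕ
  | .add, x, y => (x + y) % 2 ^ w
  | .sub, x, y => (x + (2 ^ w - y)) % 2 ^ w
  | .mul, x, y => (x * y) % 2 ^ w
  | .div, x, y => (x / y) % 2 ^ w
  | .mod, x, y => (x % y) % 2 ^ w
  | .lt, x, y => if x < y then 1 % 2 ^ w else 0
  | .eq, x, y => if x = y then 1 % 2 ^ w else 0

/-- Programs. All arguments of type `ℕ` are names of registers, except the constant in `const`. -/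
inductive Prog where
  /-- `dst := k` -/
  | const (dst k : ℕ)
  /-- `dst := a o b` -/
  | op (o : Op) (dst a b : ℕ)
  /-- `dst := memory[addr]` -/
  | load (dst addr : ℕ)
  /-- `memory[addr] := src` -/
  | store (addr src : ℕ)
  /-- `dst :=` a uniformly random word -/
  | rand (dst : ℕ)
  /-- first `p`, then `q` -/
  | seq (p q : Prog)
  /-- if `r ≠ 0` then `p` else `q` -/
  | ite (r : ℕ) (p q : Prog)
  /-- while `r ≠ 0` do `p` -/
  | loop (r : ℕ) (p : Prog)

/-- Contents of the registers and of the memory. -/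
structure State where
  reg : ℕ → ℕ
  mem : ℕ → ℕ

/-- Assignment to a register. -/
def State.setReg (s : State) (r x : ℕ) : State :=
  { s with reg := Function.update s.reg r x }

/-- Assignment to a memory cell. -/
def State.setMem (s : State) (a x : ℕ) : State :=
  { s with mem := Function.update s.mem a x }

/-- A configuration: the stack of commands that remain to be executed, and the state. -/
structure Config where
  todo : List Prog
  state : State

/-- The machine has halted when nothing remains to be executed. -/
def Config.Halted (c : Config) : Prop := c.todo = []

/-- One step on words of `w` bits; `x` is the random word available in this step. A halted
machine does not move. -/
def stepWith (w x : ℕ) : Config → Config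
  | ⟨[], s⟩ => ⟨[], s⟩
  | ⟨.const d k :: l, s⟩ => ⟨l, s.setReg d (k % 2 ^ w)⟩
  | ⟨.op o d a b :: l, s⟩ => ⟨l, s.setReg d (o.eval w (s.reg a) (s.reg b))⟩
  | ⟨.load d a :: l, s⟩ => ⟨l, s.setReg d (s.mem (s.reg a))⟩
  | ⟨.store a b :: l, s⟩ => ⟨l, s.setMem (s.reg a) (s.reg b)⟩
  | ⟨.rand d :: l, s⟩ => ⟨l, s.setReg d x⟩
  | ⟨.seq p q :: l, s⟩ => ⟨p :: q :: l, s⟩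
  | ⟨.ite r p q :: l, s⟩ => ⟨(if s.reg r ≠ 0 then p else q) :: l, s⟩
  | ⟨.loop r p :: l, s⟩ => ⟨if s.reg r ≠ 0 then p :: .loop r p :: l else l, s⟩

/-- The distribution of the configuration after one step: a fresh uniformly random word is
drawn in every step. -/
noncomputable def step (w : ℕ) (c : Config) : PMF Config :=
  (PMF.uniformOfFintype (Fin (2 ^ w))).map fun x => stepWith w x c

/-- The distribution of the configuration after `t` steps from `c`. -/
noncomputable def run (w : ℕ) : ℕ → Config → PMF Config
  | 0, c => PMF.pure c
  | t + 1, c => (step w c).bind (run w t)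

/-- The probability that the machine, started in `c`, has halted after at most `t` steps. -/
noncomputable def haltProb (w t : ℕ) (c : Config) : ENNReal :=
  (run w t c).toOuterMeasure {d | d.Halted}

end WordRAM

/-! ### All-Pairs Shortest Path -/

open Classical in
/-- The initial state for a graph `G` on `{0, …, n - 1}`: register `0` holds `n`, the cells
`0, …, n ^ 2 - 1` hold the adjacency matrix of `G` row by row, and all else is `0`. -/
noncomputable def apspInput {n : ℕ} (G : SimpleGraph (Fin n)) : WordRAM.State where
  reg := fun r => if r = 0 then n else 0
  mem := fun a => if ∃ i j : Fin n, a = (i : ℕ) * n + j ∧ G.Adj i j then 1 else 0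

/-- The state `s` holds a solution of All-Pairs Shortest Path on `G`: cell `i * n + j` contains the
distance from `i` to `j` in `G` (and `n` if `j` cannot be reached from `i`), and, if `j ≠ i`
is reachable from `i`, cell `n ^ 2 + i * n + j` contains the parent of `j` in a shortest-path
tree rooted at `i`. -/
def IsAPSPOutput {n : ℕ} (G : SimpleGraph (Fin n)) (s : WordRAM.State) : Prop :=
  ∀ i j : Fin n,
    (G.Reachable i j → s.mem ((i : ℕ) * n + j) = G.dist i j) ∧
    (¬ G.Reachable i j → s.mem ((i : ℕ) * n + j) = n) ∧
    (G.Reachable i j → i ≠ j → ∃ p : Fin n, s.mem (n ^ 2 + (i : ℕ) * n + j) = p ∧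
      G.Adj p j ∧ G.dist i p + 1 = G.dist i j)

/-! The algorithm arranges the vertices so that the ones of the adjacency matrix form few
rectangles, and runs breadth-first search from every vertex on a sparse digraph that stands for
these rectangles.

Order. Let `s` be the cube root of `n`, rounded up. A trial samples `q = n / (D * s)` vertices and
partitions the remaining vertices by their adjacency to the sampled ones among them; every class
keeps its least member, and each other member is eliminated with this one as its partner. While more
than `2 * s` vertices remain, the hypothesis on twins, applied to shrinking subsets, yields a forest
of `2 * s` pairs that differ in O(s) vertices (`exists_forest`). A trial separates each of them with
probability at most 1/4, so by Markov's inequality at least `s` vertices disappear with probability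
at least 1/2 (`avg_slow_le`). The potential `2 ^ (#S / s)` thus shrinks by a factor 3/4 on average
(`avg_remain_le`), and `A * s ^ 2` trials leave at most `2 * s` vertices with high probability. On
the other hand, two vertices that differ in more than Δ = Θ(s log n) remaining vertices are hardly
ever put into one class (`avg_bad_le`). If the cost of an eliminated pair is the number of remaining
vertices that tell it apart, the total cost is then at most `n * Δ`. Putting the eliminated vertices
back in reverse order, each right behind its partner, gives an order in which the matrix has at most
8 times this cost many 2 × 2 windows with distinct rows and distinct columns (`corners_ord_le`).

Digraph. Whenever a run of ones in a row is not repeated in the next row, one such window is used up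
(`card_stops_le`), so the ones split into at most `8 * n * Δ` rectangles. With nodes for all
intervals whose length is a power of two, a rectangle needs four edges, and there is a path from row
`k` to column `j` if and only if the entry is one (`Reach.sound_leaf`, `Reach.complete`). A
breadth-first search enters each node of the digraph at most once, so all searches together take
time O(n (n log n + n Δ)), which is O(n^(7/3) log n); the trials take O(n^2 s).

Las Vegas. Chance affects only the number of rectangles: every sequence of samples leads to a valid
order and a correct output (`wp_solve`), and for fixed `n` and word length the number of steps is
bounded (`apsp_allRuns`). The random numbers are drawn in advance by a single loop (`fill_sure`,
`fill_prob`); probabilities are iterated averages `avg` over the drawn sequence.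

Programs. Code is verified on abstract states with variables, arrays and a clock, by
total-correctness rules for `wp` that the relation `Sim` transfers to the word RAM. Range conditions
on all intermediate values make word arithmetic agree with that of natural numbers. -/

namespace WordRAM

/-! ### Deterministic execution -/

/-- `DSteps w t c c'`: whatever the random words are, `t` steps lead from `c` to `c'`. -/
inductive DSteps (w : ℕ) : ℕ → Config → Config → Prop where
  | refl (c : Config) : DSteps w 0 c c
  | head {t : ℕ} {c c₁ c' : Config} (h : ∀ x, stepWith w x c = c₁) (h' : DSteps w t c₁ c') :
      DSteps w (t + 1) c c'

theorem DSteps.trans {w t₁ t₂ : ℕ} {c₁ c₂ c₃ : Config} (h₁ : DSteps w t₁ c₁ c₂)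
    (h₂ : DSteps w t₂ c₂ c₃) : DSteps w (t₁ + t₂) c₁ c₃ := by
  induction h₁ with
  | refl c => simpa using h₂
  | @head t _ _ _ h _ ih =>
    have := DSteps.head h (ih h₂)
    rwa [show t + 1 + t₂ = t + t₂ + 1 by ring]

theorem DSteps.one {w : ℕ} {c c' : Config} (h : ∀ x, stepWith w x c = c') : DSteps w 1 c c' :=
  .head h (.refl _)

/-- The effect of a deterministic instruction. -/
def stepA (w : ℕ) : Prog → State → State
  | .const d k, s => s.setReg d (k % 2 ^ w)
  | .op o d a b, s => s.setReg d (o.eval w (s.reg a) (s.reg b))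
  | .load d a, s => s.setReg d (s.mem (s.reg a))
  | .store a b, s => s.setMem (s.reg a) (s.reg b)
  | _, s => s

/-- Deterministic instructions. -/
def IsAtom : Prog → Prop
  | .const _ _ | .op _ _ _ _ | .load _ _ | .store _ _ => True
  | _ => False

/-- The effect of a list of deterministic instructions. -/
def execP (w : ℕ) (L : List Prog) (s : State) : State := L.foldl (fun s i => stepA w i s) s

/-- The instructions of a list, one after the other. -/
def seqL : List Prog → Prog
  | [] => .const 100 0
  | i :: L => .seq i (seqL L)

theorem execP_append (w : ℕ) (L L' : List Prog) (s : State) :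
    execP w (L ++ L') s = execP w L' (execP w L s) := by simp [execP]

theorem execP_cons (w : ℕ) (i : Prog) (L : List Prog) (s : State) :
    execP w (i :: L) s = execP w L (stepA w i s) := rfl

theorem execP_nil (w : ℕ) (s : State) : execP w [] s = s := rfl

/-- Each instruction takes two steps, one to unfold `seq` and one to run. The last step is the
filler `const 100 0` at the end of the list; the simulation relation does not look at register
`100`. -/
theorem dsteps_seqL (w : ℕ) (L : List Prog) (hL : ∀ i ∈ L, IsAtom i) (s : State) (l : List Prog) :
    DSteps w (2 * L.length + 1) ⟨seqL L :: l, s⟩ ⟨l, (execP w L s).setReg 100 0⟩ := by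
  induction L generalizing s with
  | nil => exact .one fun x => by simp [stepWith, execP, seqL]
  | cons i L ih =>
    have h1 : DSteps w 1 ⟨seqL (i :: L) :: l, s⟩ ⟨i :: seqL L :: l, s⟩ := .one fun x => rfl
    have h2 : DSteps w 1 ⟨i :: seqL L :: l, s⟩ ⟨seqL L :: l, stepA w i s⟩ := by
      have := hL i (by simp)
      refine .one fun x => ?_
      cases i <;> simp_all [IsAtom, stepA, stepWith]
    have h3 := ih (fun i hi => hL i (by simp [hi])) (stepA w i s)
    have := (h1.trans h2).trans h3
    rw [List.length_cons, show 2 * (L.length + 1) + 1 = 1 + 1 + (2 * L.length + 1) by ring]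
    exact this

/-! ### Abstract states: variables, input/output cells, arrays, elapsed time -/

/-- A state of the abstract machine: variables, input/output cells, arrays, and elapsed time. -/
@[ext] structure ASt where
  v : ℕ → ℕ
  raw : ℕ → ℕ
  arr : ℕ → ℕ → ℕ
  time : ℕ

namespace ASt

/-- Assignment to a variable. -/
def set (a : ASt) (x y : ℕ) : ASt := { a with v := Function.update a.v x y }
/-- Assignment to an array entry. -/
def put (a : ASt) (id i y : ℕ) : ASt :=
  { a with arr := Function.update a.arr id (Function.update (a.arr id) i y) }
/-- Assignment to an input/output cell. -/
def putRaw (a : ASt) (i y : ℕ) : ASt := { a with raw := Function.update a.raw i y }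
/-- Time passes. -/
def tick (a : ASt) (k : ℕ) : ASt := { a with time := a.time + k }
/-- The variables below `k`. -/
def low (a : ASt) (k : ℕ) : ℕ → ℕ := fun x => if x < k then a.v x else 0

variable (a : ASt) (x y z i k id id' : ℕ)

@[simp] theorem set_v : (a.set x y).v z = if z = x then y else a.v z := by
  simp [set, Function.update_apply]
@[simp] theorem set_raw : (a.set x y).raw = a.raw := rfl
@[simp] theorem set_arr : (a.set x y).arr = a.arr := rfl
@[simp] theorem set_time : (a.set x y).time = a.time := rfl
@[simp] theorem put_v : (a.put id i y).v = a.v := rfl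
@[simp] theorem put_raw : (a.put id i y).raw = a.raw := rfl
@[simp] theorem put_arr : (a.put id i y).arr id' =
    if id' = id then Function.update (a.arr id) i y else a.arr id' := by
  simp only [put, Function.update_apply]
@[simp] theorem put_time : (a.put id i y).time = a.time := rfl
@[simp] theorem putRaw_v : (a.putRaw i y).v = a.v := rfl
@[simp] theorem putRaw_raw : (a.putRaw i y).raw = Function.update a.raw i y := rfl
@[simp] theorem putRaw_arr : (a.putRaw i y).arr = a.arr := rfl
@[simp] theorem putRaw_time : (a.putRaw i y).time = a.time := rfl
@[simp] theorem tick_v : (a.tick k).v = a.v := rfl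
@[simp] theorem tick_raw : (a.tick k).raw = a.raw := rfl
@[simp] theorem tick_arr : (a.tick k).arr = a.arr := rfl
@[simp] theorem tick_time : (a.tick k).time = a.time + k := rfl
@[simp] theorem tick_tick (k' : ℕ) : (a.tick k).tick k' = a.tick (k + k') := by
  simp [tick, add_assoc]
@[simp] theorem low_tick (k' : ℕ) : (a.tick k').low k = a.low k := rfl
@[simp] theorem low_put : (a.put id i y).low k = a.low k := rfl
@[simp] theorem low_putRaw : (a.putRaw i y).low k = a.low k := rfl
@[simp] theorem low_set (h : k ≤ x) : (a.set x y).low k = a.low k := by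
  funext z
  simp only [low, set_v]
  split_ifs <;> first | rfl | omega

end ASt

theorem ASt.v_eq {a b : ASt} {k : ℕ} (h : b.low k = a.low k) (x : ℕ) (hx : x < k) :
    b.v x = a.v x := by
  have := congrFun h x
  simpa [ASt.low, hx] using this

theorem ASt.low_mono {a b : ASt} {k k' : ℕ} (h : b.low k = a.low k) (hk : k' ≤ k) :
    b.low k' = a.low k' := by
  funext x
  by_cases hx : x < k'
  · simp [ASt.low, hx, ASt.v_eq h x (by omega)]
  · simp [ASt.low, hx]

/-- Parameters of the implementation: word length, a bound on all values, the size of the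
input/output area, and that words are long enough for these. -/
structure Mach where
  w : ℕ
  V : ℕ
  B : ℕ
  fits : B + 32 * V + 32 ≤ 2 ^ w
  Vpos : 32 < V

namespace Mach
theorem V_lt (M : Mach) : M.V < 2 ^ M.w := by have := M.fits; have := M.Vpos; omega
end Mach

/-- The machine state `s` implements the abstract state `a`. -/
structure Sim (M : Mach) (a : ASt) (s : State) : Prop where
  regs : ∀ x < 40, s.reg x = a.v x
  base : s.reg 40 = M.B
  raw : ∀ x < M.B, s.mem x = a.raw x
  -- The arrays are interleaved behind the input/output area: none needs a declared length, and
  -- residues modulo 32 keep them apart.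
  arr : ∀ id < 32, ∀ i, s.mem (M.B + 32 * i + id) = a.arr id i

/-- Expressions. -/
inductive Ex where
  | lit (k : ℕ)
  | var (x : ℕ)
  | op (o : Op) (a b : Ex)
  | get (id : ℕ) (e : Ex)
  | raw (e : Ex)

instance : Add Ex := ⟨.op .add⟩
instance : Sub Ex := ⟨.op .sub⟩
instance : Mul Ex := ⟨.op .mul⟩
instance : Div Ex := ⟨.op .div⟩
instance : Mod Ex := ⟨.op .mod⟩
instance (n : ℕ) : OfNat Ex n := ⟨.lit n⟩

/-- Operations on natural numbers. -/
def Op.nat : Op → ℕ → ℕ → ℕ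
  | .add, x, y => x + y
  | .sub, x, y => x - y
  | .mul, x, y => x * y
  | .div, x, y => x / y
  | .mod, x, y => x % y
  | .lt, x, y => if x < y then 1 else 0
  | .eq, x, y => if x = y then 1 else 0

theorem Op.lt_le (x y : ℕ) : Op.lt.nat x y ≤ 1 := by
  simp only [Op.nat]
  split_ifs <;> omega

theorem Op.eq_le (x y : ℕ) : Op.eq.nat x y ≤ 1 := by
  simp only [Op.nat]
  split_ifs <;> omega

/-- The condition for an operation on words of `2 ^ w > V` to agree with that on numbers. -/
def Op.ok (V : ℕ) : Op → ℕ → ℕ → Prop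
  | .sub, x, y => y ≤ x ∧ x < V
  | .lt, _, _ => True
  | .eq, _, _ => True
  | o, x, y => o.nat x y < V

theorem Op.eval_eq {w V : ℕ} (hV : V < 2 ^ w) (h1 : 1 < V) {o : Op} {x y : ℕ} (h : o.ok V x y) :
    o.eval w x y = o.nat x y := by
  cases o <;> simp only [Op.ok, Op.nat, Op.eval] at *
  case sub =>
    rw [show x + (2 ^ w - y) = (x - y) + 2 ^ w by omega, Nat.add_mod_right]
    exact Nat.mod_eq_of_lt (by omega)
  case lt => rw [Nat.mod_eq_of_lt (show 1 < 2 ^ w by omega)]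
  case eq => rw [Nat.mod_eq_of_lt (show 1 < 2 ^ w by omega)]
  all_goals exact Nat.mod_eq_of_lt (by omega)

namespace Ex

/-- Value of an expression. -/
def eval : Ex → ASt → ℕ
  | lit k, _ => k
  | var x, a => a.v x
  | op o e f, a => o.nat (e.eval a) (f.eval a)
  | get id e, a => a.arr id (e.eval a)
  | raw e, a => a.raw (e.eval a)

/-- All intermediate values are in range. -/
def safe (M : Mach) : Ex → ASt → Prop
  | lit k, _ => k < M.V
  | var x, _ => x < 40
  | op o e f, a => e.safe M a ∧ f.safe M a ∧ o.ok M.V (e.eval a) (f.eval a)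
  | get id e, a => e.safe M a ∧ id < 32 ∧ e.eval a < M.V
  | raw e, a => e.safe M a ∧ e.eval a < M.B

/-- The register that holds the value. -/
def loc : Ex → ℕ → ℕ
  | var x, _ => x
  | _, t => t

/-- Code that evaluates an expression using registers from `t` on. -/
def code : Ex → ℕ → List Prog
  | lit k, t => [.const t k]
  | var _, _ => []
  | op o e f, t => e.code t ++ f.code (t + 1) ++ [.op o t (e.loc t) (f.loc (t + 1))]
  | get id e, t => e.code t ++ [.const (t + 1) 32, .op .mul t (e.loc t) (t + 1), .op .add t t 40,
      .const (t + 1) id, .op .add t t (t + 1), .load t t]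
  | raw e, t => e.code t ++ [.load t (e.loc t)]

/-- The length of the code. -/
def len : Ex → ℕ
  | lit _ => 1
  | var _ => 0
  | op _ e f => e.len + f.len + 1
  | get _ e => e.len + 6
  | raw e => e.len + 1

theorem length_code (e : Ex) (t : ℕ) : (e.code t).length = e.len := by
  induction e generalizing t <;> simp_all [code, len]
  omega

theorem code_atom (e : Ex) (t : ℕ) : ∀ i ∈ e.code t, IsAtom i := by
  induction e generalizing t with
  | lit k => simp [code, IsAtom]
  | var x => simp [code]
  | op o e f ihe ihf =>
    intro i hi
    simp only [code, List.mem_append, List.mem_singleton] at hi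
    rcases hi with (hi | hi) | rfl
    · exact ihe _ i hi
    · exact ihf _ i hi
    · simp [IsAtom]
  | get id e ih =>
    intro i hi
    simp only [code, List.mem_append, List.mem_cons, List.not_mem_nil, or_false] at hi
    rcases hi with hi | rfl | rfl | rfl | rfl | rfl | rfl
    · exact ih _ i hi
    all_goals simp [IsAtom]
  | raw e ih =>
    intro i hi
    simp only [code, List.mem_append, List.mem_singleton] at hi
    rcases hi with hi | rfl
    · exact ih _ i hi
    · simp [IsAtom]

end Ex

@[simp] theorem State.setReg_reg (s : State) (r x z : ℕ) :
    (s.setReg r x).reg z = if z = r then x else s.reg z := by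
  simp [State.setReg, Function.update_apply]
@[simp] theorem State.setReg_mem (s : State) (r x : ℕ) : (s.setReg r x).mem = s.mem := rfl
@[simp] theorem State.setMem_mem (s : State) (r x z : ℕ) :
    (s.setMem r x).mem z = if z = r then x else s.mem z := by
  simp [State.setMem, Function.update_apply]
@[simp] theorem State.setMem_reg (s : State) (r x : ℕ) : (s.setMem r x).reg = s.reg := rfl

/-- Address computation of an array entry. -/
theorem execP_addr (M : Mach) (s : State) (r t id i : ℕ) (hr : r ≤ t) (ht : 41 ≤ t)
    (hs : s.reg r = i) (hb : s.reg 40 = M.B) (hi : i < M.V) (hid : id < 32) :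
    execP M.w [.const (t + 1) 32, .op .mul t r (t + 1), .op .add t t 40,
      .const (t + 1) id, .op .add t t (t + 1)] s =
    ((((s.setReg (t + 1) 32).setReg t (i * 32)).setReg t (i * 32 + M.B)).setReg (t + 1) id).setReg t
      (M.B + 32 * i + id) := by
  have hf := M.fits
  have hV := M.V_lt
  have hVp := M.Vpos
  have e1 : 32 % 2 ^ M.w = 32 := Nat.mod_eq_of_lt (by omega)
  have e2 : i * 32 % 2 ^ M.w = i * 32 := Nat.mod_eq_of_lt (by omega)
  have e3 : (i * 32 + M.B) % 2 ^ M.w = i * 32 + M.B := Nat.mod_eq_of_lt (by omega)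
  have e4 : (i * 32 + M.B + id) % 2 ^ M.w = M.B + 32 * i + id := by
    rw [Nat.mod_eq_of_lt (by omega)]; ring
  have e5 : id % 2 ^ M.w = id := Nat.mod_eq_of_lt (by omega)
  have hrt : r ≠ t + 1 := by omega
  have h40 : (40 : ℕ) ≠ t := by omega
  have h40' : (40 : ℕ) ≠ t + 1 := by omega
  simp [execP_cons, execP_nil, stepA, Op.eval, hrt, hs, h40, h40', hb, e1, e2, e3, e4, e5]

/-- Code started at register `t` leaves all registers below `t` alone, so a left operand kept in
register `t` survives the evaluation of the right operand from `t + 1` on. Variables are used in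
place, which is why the result is looked up at `e.loc t`. -/
theorem Ex.exec_code (M : Mach) (a : ASt) (e : Ex) (t : ℕ) (ht : 41 ≤ t) (s : State)
    (hs : Sim M a s) (h : e.safe M a) :
    (execP M.w (e.code t) s).reg (e.loc t) = e.eval a ∧ (execP M.w (e.code t) s).mem = s.mem ∧
      ∀ r < t, (execP M.w (e.code t) s).reg r = s.reg r := by
  have hVp := M.Vpos
  have hV := M.V_lt
  have simt : ∀ s', s'.mem = s.mem → (∀ r < t, s'.reg r = s.reg r) → Sim M a s' := by
    intro s' h1 h2
    exact ⟨fun x hx => (h2 x (by omega)).trans (hs.regs x hx), (h2 40 (by omega)).trans hs.base,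
      by rw [h1]; exact hs.raw, by rw [h1]; exact hs.arr⟩
  induction e generalizing t s with
  | lit k =>
    simp only [Ex.safe] at h
    have : k % 2 ^ M.w = k := Nat.mod_eq_of_lt (by omega)
    refine ⟨by simp [code, loc, execP, stepA, eval, this], rfl, fun r hr => ?_⟩
    have : r ≠ t := by omega
    simp [code, execP, stepA, this]
  | var x => exact ⟨hs.regs x h, rfl, fun _ _ => rfl⟩
  | op o e f ihe ihf =>
    obtain ⟨h1, h2, h3⟩ := h
    obtain ⟨a1, a2, a3⟩ := ihe t ht s hs h1 simt
    set s1 := execP M.w (e.code t) s with hs1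
    have sim1 : Sim M a s1 := simt s1 a2 a3
    obtain ⟨b1, b2, b3⟩ := ihf (t + 1) (by omega) s1 sim1 h2 (by
      intro s' h1 h2
      exact simt s' (h1.trans a2) (fun r hr => (h2 r (by omega)).trans (a3 r hr)))
    set s2 := execP M.w (f.code (t + 1)) s1 with hs2
    have hl : e.loc t < t + 1 := by
      cases e <;> simp only [loc, Ex.safe] at * <;> omega
    have key : execP M.w ((op o e f).code t) s =
        s2.setReg t (o.nat (e.eval a) (f.eval a)) := by
      simp only [code, execP_append, ← hs1, ← hs2, execP_cons, execP_nil, stepA]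
      rw [b3 _ hl, a1, b1, Op.eval_eq hV (by omega) h3]
    rw [key]
    refine ⟨by simp [loc, eval], by simp [b2, a2], fun r hr => ?_⟩
    have : r ≠ t := by omega
    simp [this, b3 r (by omega), a3 r hr]
  | get id e ih =>
    obtain ⟨h1, h2, h3⟩ := h
    obtain ⟨a1, a2, a3⟩ := ih t ht s hs h1 simt
    set s1 := execP M.w (e.code t) s with hs1
    have hl : e.loc t ≤ t := by
      cases e <;> simp only [loc, Ex.safe] at * <;> omega
    have sim1 : Sim M a s1 := simt s1 a2 a3
    have key := execP_addr M s1 (e.loc t) t id (e.eval a) hl ht a1 sim1.base h3 h2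
    have key' : execP M.w ((get id e).code t) s = stepA M.w (.load t t) (execP M.w
        [.const (t + 1) 32, .op .mul t (e.loc t) (t + 1), .op .add t t 40,
          .const (t + 1) id, .op .add t t (t + 1)] s1) := by
      simp only [code, execP_append, ← hs1, execP_cons, execP_nil]
    rw [key', key]
    refine ⟨?_, by simp [stepA, a2], fun r hr => ?_⟩
    · simp [stepA, loc, eval, sim1.arr id h2]
    · have h1 : r ≠ t := by omega
      have h2 : r ≠ t + 1 := by omega
      simp [stepA, h1, h2, a3 r hr]
  | raw e ih =>
    obtain ⟨h1, h2⟩ := h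
    obtain ⟨a1, a2, a3⟩ := ih t ht s hs h1 simt
    set s1 := execP M.w (e.code t) s with hs1
    have sim1 : Sim M a s1 := simt s1 a2 a3
    have key : execP M.w ((raw e).code t) s = s1.setReg t (s1.mem (s1.reg (e.loc t))) := by
      simp only [code, execP_append, ← hs1, execP_cons, execP_nil, stepA]
    rw [key]
    refine ⟨?_, by simp [a2], fun r hr => ?_⟩
    · rw [a1, sim1.raw _ h2]
      simp [loc, eval]
    · have h1 : r ≠ t := by omega
      simp [h1, a3 r hr]

/-! ### Straight-line code -/

/-- Assignments. -/
inductive Ins where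
  | asg (x : ℕ) (e : Ex)
  | put (id : ℕ) (i e : Ex)
  | putRaw (i e : Ex)

namespace Ins

/-- Effect of an assignment. -/
def exec : Ins → ASt → ASt
  | asg x e, a => a.set x (e.eval a)
  | put id i e, a => a.put id (i.eval a) (e.eval a)
  | putRaw i e, a => a.putRaw (i.eval a) (e.eval a)

/-- All values are in range. -/
def safe (M : Mach) : Ins → ASt → Prop
  | asg x e, a => x < 40 ∧ e.safe M a ∧ e.eval a < M.V
  | put id i e, a => id < 32 ∧ i.safe M a ∧ i.eval a < M.V ∧ e.safe M a
  | putRaw i e, a => i.safe M a ∧ i.eval a < M.B ∧ e.safe M a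

/-- Machine code of an assignment. -/
def code : Ins → List Prog
  | asg x e => e.code 41 ++ [.const 42 0, .op .add x (e.loc 41) 42]
  | put id i e => e.code 41 ++ (i.code 42 ++ [.const 43 32, .op .mul 42 (i.loc 42) 43,
      .op .add 42 42 40, .const 43 id, .op .add 42 42 43] ++ [.store 42 (e.loc 41)])
  | putRaw i e => e.code 41 ++ (i.code 42 ++ [.store (i.loc 42) (e.loc 41)])

/-- Length of the machine code. -/
def len : Ins → ℕ
  | asg _ e => e.len + 2
  | put _ i e => e.len + i.len + 6
  | putRaw i e => e.len + i.len + 1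

theorem length_code (i : Ins) : i.code.length = i.len := by
  cases i <;> simp [code, len, Ex.length_code] <;> omega

theorem code_atom (i : Ins) : ∀ p ∈ i.code, IsAtom p := by
  intro p hp
  cases i with
  | asg x e =>
    simp only [code, List.mem_append, List.mem_cons, List.not_mem_nil, or_false] at hp
    rcases hp with hp | rfl | rfl
    · exact e.code_atom _ p hp
    all_goals simp [IsAtom]
  | put id i e =>
    simp only [code, List.mem_append, List.mem_cons, List.not_mem_nil, or_false] at hp
    rcases hp with hp | (hp | rfl | rfl | rfl | rfl | rfl) | rfl
    · exact e.code_atom _ p hp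
    · exact i.code_atom _ p hp
    all_goals simp [IsAtom]
  | putRaw i e =>
    simp only [code, List.mem_append, List.mem_cons, List.not_mem_nil, or_false] at hp
    rcases hp with hp | hp | rfl
    · exact e.code_atom _ p hp
    · exact i.code_atom _ p hp
    all_goals simp [IsAtom]

end Ins

theorem Sim.of_eq {M : Mach} {a : ASt} {s s' : State} (h : Sim M a s) (hm : s'.mem = s.mem)
    (hr : ∀ r < 41, s'.reg r = s.reg r) : Sim M a s' :=
  ⟨fun x hx => by rw [hr x (by omega)]; exact h.regs x hx, by rw [hr 40 (by omega)]; exact h.base,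
    by rw [hm]; exact h.raw, by rw [hm]; exact h.arr⟩

theorem Sim.tick {M : Mach} {a : ASt} {s : State} (h : Sim M a s) (k : ℕ) : Sim M (a.tick k) s :=
  ⟨h.regs, h.base, h.raw, h.arr⟩

theorem Ex.loc_lt {M : Mach} {e : Ex} {a : ASt} (h : e.safe M a) (t : ℕ) (ht : 41 ≤ t) :
    e.loc t < t + 1 := by
  cases e <;> simp only [loc, Ex.safe] at * <;> omega

theorem Ins.exec_code (M : Mach) (a : ASt) (i : Ins) (s : State) (hs : Sim M a s)
    (h : i.safe M a) : Sim M (i.exec a) (execP M.w i.code s) := by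
  have hVp := M.Vpos
  have hV := M.V_lt
  cases i with
  | asg x e =>
    obtain ⟨hx, h1, h2⟩ := h
    obtain ⟨a1, a2, a3⟩ := e.exec_code M a 41 (by omega) s hs h1
    simp only [code, execP_append]
    set s1 := execP M.w (e.code 41) s
    have hl := Ex.loc_lt h1 41 le_rfl
    have key : execP M.w [.const 42 0, .op .add x (e.loc 41) 42] s1 =
        (s1.setReg 42 0).setReg x (e.eval a) := by
      have : e.eval a % 2 ^ M.w = e.eval a := Nat.mod_eq_of_lt (by omega)
      simp [execP_cons, execP_nil, stepA, Op.eval, (show e.loc 41 ≠ 42 by omega), a1, this]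
    rw [key]
    have sim1 := hs.of_eq a2 a3
    refine ⟨fun y hy => ?_, ?_, fun y hy => ?_, fun id hid j => ?_⟩
    · have : y ≠ 42 := by omega
      simp only [exec, State.setReg_reg, ASt.set_v, this, if_false, sim1.regs y hy]
    · simp [(show (40:ℕ) ≠ x by omega), sim1.base]
    · simp [exec, sim1.raw y hy]
    · simp [exec, sim1.arr id hid]
  | put id i e =>
    obtain ⟨hid, h1, h2, h3⟩ := h
    obtain ⟨a1, a2, a3⟩ := e.exec_code M a 41 (by omega) s hs h3
    simp only [code, execP_append]
    set s1 := execP M.w (e.code 41) s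
    have sim1 := hs.of_eq a2 a3
    obtain ⟨b1, b2, b3⟩ := i.exec_code M a 42 (by omega) s1 sim1 h1
    set s2 := execP M.w (i.code 42) s1
    have sim2 := sim1.of_eq b2 fun r hr => b3 r (by omega)
    have hl := Ex.loc_lt h3 41 le_rfl
    have hl' := Ex.loc_lt h1 42 (by omega)
    rw [execP_addr M s2 (i.loc 42) 42 id (i.eval a) (by omega) (by omega) b1 sim2.base h2 hid]
    simp only [execP_cons, execP_nil, stepA]
    have hv : s2.reg (e.loc 41) = e.eval a := by rw [b3 _ hl, a1]
    refine ⟨fun y hy => ?_, ?_, fun y hy => ?_, fun id' hid' j => ?_⟩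
    · simp [(show y ≠ 42 by omega), (show y ≠ 43 by omega), sim2.regs y hy, exec]
    · simp [sim2.base]
    · simp only [State.setMem_mem, State.setReg_mem, exec, ASt.put_raw]
      rw [if_neg, sim2.raw y hy]
      simp only [State.setReg_reg, if_true]
      omega
    · simp only [State.setMem_mem, State.setReg_mem, exec, ASt.put_arr, sim2.arr id' hid' j]
      simp only [State.setReg_reg, if_true, (show e.loc 41 ≠ 42 by omega), (show e.loc 41 ≠ 43 by omega),
        if_false, hv]
      by_cases hh : id' = id
      · subst hh
        simp only [if_true, Function.update_apply]
        split_ifs <;> first | rfl | omega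
      · rw [if_neg (by omega), if_neg hh]
  | putRaw i e =>
    obtain ⟨h1, h2, h3⟩ := h
    obtain ⟨a1, a2, a3⟩ := e.exec_code M a 41 (by omega) s hs h3
    simp only [code, execP_append]
    set s1 := execP M.w (e.code 41) s
    have sim1 := hs.of_eq a2 a3
    obtain ⟨b1, b2, b3⟩ := i.exec_code M a 42 (by omega) s1 sim1 h1
    set s2 := execP M.w (i.code 42) s1
    have sim2 := sim1.of_eq b2 fun r hr => b3 r (by omega)
    have hl := Ex.loc_lt h3 41 le_rfl
    have hl' := Ex.loc_lt h1 42 (by omega)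
    simp only [execP_cons, execP_nil, stepA]
    have hv : s2.reg (e.loc 41) = e.eval a := by rw [b3 _ hl, a1]
    refine ⟨fun y hy => ?_, ?_, fun y hy => ?_, fun id' hid' j => ?_⟩
    · simp [sim2.regs y hy, exec]
    · simp [sim2.base]
    · simp [exec, b1, hv, Function.update_apply, sim2.raw y hy]
    · simp only [State.setMem_mem, exec, ASt.putRaw_arr, sim2.arr id' hid' j, b1]
      rw [if_neg (by omega)]

/-- Effect of a block of assignments. -/
def execB : List Ins → ASt → ASt
  | [], a => a
  | i :: L, a => execB L (i.exec a)

/-- All values in a block of assignments are in range. -/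
def safeB (M : Mach) : List Ins → ASt → Prop
  | [], _ => True
  | i :: L, a => i.safe M a ∧ safeB M L (i.exec a)

/-- Length of the machine code of a block. -/
def lenB : List Ins → ℕ
  | [] => 0
  | i :: L => i.len + lenB L

theorem execB_code (M : Mach) (L : List Ins) (a : ASt) (s : State) (hs : Sim M a s)
    (h : safeB M L a) : Sim M (execB L a) (execP M.w (L.flatMap Ins.code) s) := by
  induction L generalizing a s with
  | nil => exact hs
  | cons i L ih =>
    rw [List.flatMap_cons, execP_append]
    exact ih _ _ (i.exec_code M a s hs h.1) h.2

theorem length_flatMap_code (L : List Ins) : (L.flatMap Ins.code).length = lenB L := by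
  induction L with
  | nil => rfl
  | cons i L ih => simp only [List.flatMap_cons, List.length_append, ih, lenB, Ins.length_code]

/-- Machine code of a block of assignments. -/
def block (L : List Ins) : Prog := seqL (L.flatMap Ins.code)

/-- Total correctness: from `a`, the program `p` halts in a state that satisfies `Q`, and the
elapsed time is recorded in the state. -/
def wp (M : Mach) (p : Prog) (Q : ASt → Prop) (a : ASt) : Prop :=
  ∀ s, Sim M a s → ∃ t s' a', (∀ l, DSteps M.w t ⟨p :: l, s⟩ ⟨l, s'⟩) ∧ Sim M a' s' ∧
    a'.time = a.time + t ∧ Q a'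

variable {M : Mach}

theorem wp.mono {p : Prog} {Q Q' : ASt → Prop} {a : ASt} (h : wp M p Q a)
    (hQ : ∀ b, Q b → Q' b) : wp M p Q' a := by
  intro s hs
  obtain ⟨t, s', a', h1, h2, h3, h4⟩ := h s hs
  exact ⟨t, s', a', h1, h2, h3, hQ _ h4⟩

theorem execB_time (L : List Ins) (a : ASt) : (execB L a).time = a.time := by
  induction L generalizing a with
  | nil => rfl
  | cons i L ih => rw [execB, ih]; cases i <;> rfl

theorem wp_block {L : List Ins} {Q : ASt → Prop} {a : ASt} (hs : safeB M L a)
    (hQ : Q ((execB L a).tick (2 * lenB L + 1))) : wp M (block L) Q a := by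
  intro s hsim
  refine ⟨2 * lenB L + 1, (execP M.w (L.flatMap Ins.code) s).setReg 100 0,
    (execB L a).tick (2 * lenB L + 1), fun l => ?_, ?_, ?_, hQ⟩
  · have := dsteps_seqL M.w (L.flatMap Ins.code) (by
      intro i hi
      obtain ⟨j, _, hj⟩ := List.mem_flatMap.1 hi
      exact j.code_atom i hj) s l
    rwa [length_flatMap_code] at this
  · refine Sim.tick (Sim.of_eq (s' := (execP M.w (L.flatMap Ins.code) s).setReg 100 0)
      (execB_code M L a s hsim hs) rfl fun r hr => ?_) _
    simp [(show r ≠ 100 by omega)]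
  · simp [execB_time]

/-- The step that unfolds `seq` is charged at the end, so that `p` starts in the unchanged state
`a`. -/
theorem wp_seq {p q : Prog} {Q : ASt → Prop} {a : ASt}
    (h : wp M p (fun b => wp M q (fun b => Q (b.tick 1)) b) a) : wp M (.seq p q) Q a := by
  intro s hs
  obtain ⟨t, s', a', h1, h2, h3, h4⟩ := h s hs
  obtain ⟨t', s'', a'', k1, k2, k3, k4⟩ := h4 s' h2
  refine ⟨1 + t + t', s'', a''.tick 1, fun l => ?_, k2.tick 1, ?_, k4⟩
  · exact ((DSteps.one fun x => rfl).trans (h1 (q :: l))).trans (k1 l)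
  · simp only [ASt.tick_time, k3, h3]; ring

/-- Code that evaluates a condition into register `41`. -/
def evalTo (e : Ex) : Prog := seqL (e.code 41 ++ [.const 42 0, .op .add 41 (e.loc 41) 42])

/-- Conditional. -/
def cond (e : Ex) (p q : Prog) : Prog := .seq (evalTo e) (.ite 41 p q)

/-- While loop. -/
def whileDo (e : Ex) (p : Prog) : Prog := .seq (evalTo e) (.loop 41 (.seq p (evalTo e)))

theorem evalTo_spec (e : Ex) (a : ASt) (s : State) (hs : Sim M a s) (h : e.safe M a)
    (hv : e.eval a < M.V) :
    ∃ s', (∀ l, DSteps M.w (2 * e.len + 5) ⟨evalTo e :: l, s⟩ ⟨l, s'⟩) ∧ Sim M a s' ∧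
      s'.reg 41 = e.eval a := by
  have hV := M.V_lt
  obtain ⟨a1, a2, a3⟩ := e.exec_code M a 41 (by omega) s hs h
  have hl := Ex.loc_lt h 41 le_rfl
  have hd := fun l => dsteps_seqL M.w (e.code 41 ++ [.const 42 0, .op .add 41 (e.loc 41) 42]) (by
    intro i hi
    simp only [List.mem_append, List.mem_cons, List.not_mem_nil, or_false] at hi
    rcases hi with hi | rfl | rfl
    · exact e.code_atom _ i hi
    all_goals simp [IsAtom]) s l
  have key : execP M.w (e.code 41 ++ [.const 42 0, .op .add 41 (e.loc 41) 42]) s =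
      ((execP M.w (e.code 41) s).setReg 42 0).setReg 41 (e.eval a) := by
    have : e.eval a % 2 ^ M.w = e.eval a := Nat.mod_eq_of_lt (by omega)
    simp [execP_append, execP_cons, execP_nil, stepA, Op.eval, (show e.loc 41 ≠ 42 by omega), a1, this]
  rw [key] at hd
  refine ⟨(((execP M.w (e.code 41) s).setReg 42 0).setReg 41 (e.eval a)).setReg 100 0,
    fun l => ?_, ?_, ?_⟩
  · have := hd l
    simp only [List.length_append, Ex.length_code] at this
    exact this
  · refine (hs.of_eq a2 a3).of_eq (by simp) fun r hr => ?_
    simp [(show r ≠ 41 by omega), (show r ≠ 42 by omega), (show r ≠ 100 by omega)]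
  · simp

theorem cond_spec {e : Ex} {p q : Prog} {a : ASt} {s : State} (hs : Sim M a s) (h : e.safe M a)
    (hv : e.eval a < M.V) : ∃ s', (∀ l, DSteps M.w (2 * e.len + 7) ⟨cond e p q :: l, s⟩
      ⟨(if e.eval a ≠ 0 then p else q) :: l, s'⟩) ∧ Sim M a s' := by
  obtain ⟨s1, d1, sim1, r1⟩ := evalTo_spec e a s hs h hv
  refine ⟨s1, fun l => ?_, sim1⟩
  have := ((DSteps.one (w := M.w) (c := ⟨cond e p q :: l, s⟩) fun x => rfl).trans
    (d1 (.ite 41 p q :: l))).trans (DSteps.one (c' := ⟨(if e.eval a ≠ 0 then p else q) :: l, s1⟩)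
      fun x => by simp only [stepWith, r1])
  rwa [show 1 + (2 * e.len + 5) + 1 = 2 * e.len + 7 by ring] at this

theorem wp_cond {e : Ex} {p q : Prog} {Q : ASt → Prop} {a : ASt} (h : e.safe M a)
    (hv : e.eval a < M.V)
    (hp : e.eval a ≠ 0 → wp M p Q (a.tick (2 * e.len + 7)))
    (hq : e.eval a = 0 → wp M q Q (a.tick (2 * e.len + 7))) : wp M (cond e p q) Q a := by
  intro s hs
  obtain ⟨s1, hstep, sim1⟩ := cond_spec (p := p) (q := q) hs h hv
  have : wp M (if e.eval a ≠ 0 then p else q) Q (a.tick (2 * e.len + 7)) := by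
    by_cases h0 : e.eval a = 0
    · simpa [h0] using hq h0
    · simpa [h0] using hp h0
  obtain ⟨t, s', a', k1, k2, k3, k4⟩ := this s1 (sim1.tick _)
  exact ⟨2 * e.len + 7 + t, s', a', fun l => (hstep l).trans (k1 l), k2,
    by rw [k3, ASt.tick_time]; ring, k4⟩

/-- The index of the invariant is the termination measure, and the invariant describes the moments
right after an evaluation of the condition. Reaching the first one costs `2 * e.len + 6`; a round
costs `2 * e.len + 7` besides its body, for the test, the unfolding of `seq` and the new evaluation.
-/
theorem wp_while {e : Ex} {p : Prog} {Q : ASt → Prop} {a : ASt} (Inv : ℕ → ASt → Prop) (k₀ : ℕ)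
    (h0 : Inv k₀ (a.tick (2 * e.len + 6)))
    (hsafe : ∀ k b, Inv k b → e.safe M b ∧ e.eval b < M.V)
    (hstep : ∀ k b, Inv k b → e.eval b ≠ 0 →
      wp M p (fun b' => ∃ k' < k, Inv k' (b'.tick (2 * e.len + 7))) b)
    (hend : ∀ k b, Inv k b → e.eval b = 0 → Q (b.tick 1)) : wp M (whileDo e p) Q a := by
  have aux : ∀ k b s, Inv k b → Sim M b s → s.reg 41 = e.eval b →
      ∃ t s' a', (∀ l, DSteps M.w t ⟨.loop 41 (.seq p (evalTo e)) :: l, s⟩ ⟨l, s'⟩) ∧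
        Sim M a' s' ∧ a'.time = b.time + t ∧ Q a' := by
    intro k
    induction k using Nat.strong_induction_on with
    | _ k ih =>
    intro b s hI hs hr
    by_cases hz : e.eval b = 0
    · exact ⟨1, s, b.tick 1, fun l => .one fun x => by simp [stepWith, hr, hz], hs.tick 1, rfl,
        hend k b hI hz⟩
    · obtain ⟨t, s', b', k1, k2, k3, k', hk', k4⟩ := hstep k b hI hz s hs
      obtain ⟨hs1, hs2⟩ := hsafe k' _ k4
      obtain ⟨s1, d1, sim1, r1⟩ := evalTo_spec e _ s' (k2.tick (2 * e.len + 7)) hs1 hs2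
      obtain ⟨t', s'', a'', j1, j2, j3, j4⟩ := ih k' hk' _ s1 k4 sim1 r1
      refine ⟨1 + 1 + t + (2 * e.len + 5) + t', s'', a'', fun l => ?_, j2, ?_, j4⟩
      · have e1 : DSteps M.w 1 ⟨.loop 41 (.seq p (evalTo e)) :: l, s⟩
            ⟨.seq p (evalTo e) :: .loop 41 (.seq p (evalTo e)) :: l, s⟩ :=
          .one fun x => by simp [stepWith, hr, hz]
        exact (((e1.trans (.one fun x => rfl)).trans (k1 _)).trans (d1 _)).trans (j1 l)
      · rw [j3, ASt.tick_time, k3]; ring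
  intro s hs
  obtain ⟨hs1, hs2⟩ := hsafe k₀ _ h0
  obtain ⟨s1, d1, sim1, r1⟩ := evalTo_spec e _ s (hs.tick (2 * e.len + 6)) hs1 hs2
  obtain ⟨t, s', a', k1, k2, k3, k4⟩ := aux k₀ _ s1 h0 sim1 r1
  refine ⟨1 + (2 * e.len + 5) + t, s', a', fun l => ?_, k2, ?_, k4⟩
  · exact ((DSteps.one fun x => rfl).trans (d1 _)).trans (k1 l)
  · rw [k3, ASt.tick_time]; ring

/-- `for i < m do p`, where `i` and `m` are variables. -/
def forUp (i m : ℕ) (p : Prog) : Prog :=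
  .seq (block [.asg i 0]) (whileDo (.op .lt (.var i) (.var m)) (.seq p (block [.asg i (.var i + 1)])))

/-- The constants are exact costs: 15 for the initialisation and the first evaluation of the
condition, 19 per round for the increment and the loop overhead, 2 for leaving. The body must
preserve both the counter and the limit. -/
theorem wp_for {i m : ℕ} {p : Prog} {Q : ASt → Prop} {a : ASt} (N : ℕ) (Inv : ℕ → ASt → Prop)
    (hi : i < 40) (hm : m < 40) (him : i ≠ m) (hN : a.v m = N) (hNV : N < M.V)
    (h0 : Inv 0 ((a.set i 0).tick 15))
    (hs : ∀ k < N, ∀ b, Inv k b → b.v i = k → b.v m = N →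
      wp M p (fun c => c.v i = k ∧ c.v m = N ∧ Inv (k + 1) ((c.set i (k + 1)).tick 19)) b)
    (hQ : ∀ b, Inv N b → b.v i = N → b.v m = N → Q (b.tick 2)) : wp M (forUp i m p) Q a := by
  have hVp := M.Vpos
  refine wp_seq (wp_block ?_ ?_)
  · show (_ ∧ (0 < _) ∧ (0 < _)) ∧ True
    exact ⟨⟨hi, by omega, by omega⟩, trivial⟩
  show wp M _ _ (((a.set i 0).tick 7))
  refine wp_while (fun k b => ∃ j ≤ N, k = N - j ∧ b.v i = j ∧ b.v m = N ∧ Inv j b) N ?_ ?_ ?_ ?_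
  · exact ⟨0, by omega, by omega, by simp, by simp [him.symm, hN], h0⟩
  · rintro k b ⟨j, hj, -, hb1, hb2, -⟩
    refine ⟨⟨hi, hm, trivial⟩, ?_⟩
    have : (Ex.op .lt (.var i) (.var m)).eval b ≤ 1 := Op.lt_le _ _
    omega
  · rintro k b ⟨j, hj, hk, hb1, hb2, hI⟩ hc
    have hjN : j < N := by
      by_contra hh
      apply hc
      simp [Ex.eval, Op.nat, hb1, hb2, hh]
    refine wp_seq ((hs j hjN b hI hb1 hb2).mono ?_)
    rintro c ⟨c1, c2, c3⟩
    refine wp_block ?_ ?_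
    · show (_ ∧ (_ ∧ (1 < _) ∧ _ + 1 < _) ∧ _ + 1 < _) ∧ True
      have : (Ex.var i).eval c = j := c1
      simp only [this]
      exact ⟨⟨hi, ⟨hi, by omega, by omega⟩, by omega⟩, trivial⟩
    · refine ⟨N - (j + 1), by omega, j + 1, by omega, rfl, ?_⟩
      have : execB [Ins.asg i (Ex.var i + 1)] c = c.set i (j + 1) := by
        show c.set i (c.v i + 1) = _
        rw [c1]
      rw [this]
      exact ⟨by simp, by simp [him.symm, c2], c3⟩
  · rintro k b ⟨j, hj, hk, hb1, hb2, hI⟩ hc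
    have hjN : j = N := by
      by_contra hh
      have : j < N := by omega
      simp [Ex.eval, Op.nat, hb1, hb2, this] at hc
    subst hjN
    exact hQ b hI hb1 hb2

section simp

variable (a : ASt) (e f : Ex) (k x id : ℕ) (M : Mach)

@[simp] theorem Mach.small_lt (h : k ≤ 32) : k < M.V := lt_of_le_of_lt h M.Vpos

namespace Ex

@[simp] theorem eval_add : (e + f).eval a = e.eval a + f.eval a := rfl
@[simp] theorem eval_sub : (e - f).eval a = e.eval a - f.eval a := rfl
@[simp] theorem eval_mul : (e * f).eval a = e.eval a * f.eval a := rfl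
@[simp] theorem eval_div : (e / f).eval a = e.eval a / f.eval a := rfl
@[simp] theorem eval_mod : (e % f).eval a = e.eval a % f.eval a := rfl
@[simp] theorem eval_lt : (op .lt e f).eval a = if e.eval a < f.eval a then 1 else 0 := rfl
@[simp] theorem eval_eq : (op .eq e f).eval a = if e.eval a = f.eval a then 1 else 0 := rfl
@[simp] theorem eval_lit : (lit k).eval a = k := rfl
@[simp] theorem eval_ofNat : (ofNat(k) : Ex).eval a = k := rfl
@[simp] theorem eval_var : (var x).eval a = a.v x := rfl
@[simp] theorem eval_get : (get id e).eval a = a.arr id (e.eval a) := rfl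
@[simp] theorem eval_raw : (raw e).eval a = a.raw (e.eval a) := rfl

@[simp] theorem safe_add : (e + f).safe M a ↔
    e.safe M a ∧ f.safe M a ∧ e.eval a + f.eval a < M.V := Iff.rfl
@[simp] theorem safe_sub : (e - f).safe M a ↔
    e.safe M a ∧ f.safe M a ∧ f.eval a ≤ e.eval a ∧ e.eval a < M.V := Iff.rfl
@[simp] theorem safe_mul : (e * f).safe M a ↔
    e.safe M a ∧ f.safe M a ∧ e.eval a * f.eval a < M.V := Iff.rfl
@[simp] theorem safe_div : (e / f).safe M a ↔
    e.safe M a ∧ f.safe M a ∧ e.eval a / f.eval a < M.V := Iff.rfl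
@[simp] theorem safe_mod : (e % f).safe M a ↔
    e.safe M a ∧ f.safe M a ∧ e.eval a % f.eval a < M.V := Iff.rfl
@[simp] theorem safe_lt : (op .lt e f).safe M a ↔ e.safe M a ∧ f.safe M a :=
  ⟨fun h => ⟨h.1, h.2.1⟩, fun h => ⟨h.1, h.2, trivial⟩⟩
@[simp] theorem safe_eq : (op .eq e f).safe M a ↔ e.safe M a ∧ f.safe M a :=
  ⟨fun h => ⟨h.1, h.2.1⟩, fun h => ⟨h.1, h.2, trivial⟩⟩
@[simp] theorem safe_lit : (lit k).safe M a ↔ k < M.V := Iff.rfl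
@[simp] theorem safe_ofNat : (ofNat(k) : Ex).safe M a ↔ k < M.V := Iff.rfl
@[simp] theorem safe_var : (var x).safe M a ↔ x < 40 := Iff.rfl
@[simp] theorem safe_get : (get id e).safe M a ↔
    e.safe M a ∧ id < 32 ∧ e.eval a < M.V := Iff.rfl
@[simp] theorem safe_raw : (raw e).safe M a ↔ e.safe M a ∧ e.eval a < M.B := Iff.rfl

@[simp] theorem len_add : (e + f).len = e.len + f.len + 1 := rfl
@[simp] theorem len_sub : (e - f).len = e.len + f.len + 1 := rfl
@[simp] theorem len_mul : (e * f).len = e.len + f.len + 1 := rfl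
@[simp] theorem len_div : (e / f).len = e.len + f.len + 1 := rfl
@[simp] theorem len_mod : (e % f).len = e.len + f.len + 1 := rfl
@[simp] theorem len_op (o : Op) : (op o e f).len = e.len + f.len + 1 := rfl
@[simp] theorem len_lit : (lit k).len = 1 := rfl
@[simp] theorem len_ofNat : (ofNat(k) : Ex).len = 1 := rfl
@[simp] theorem len_var : (var x).len = 0 := rfl
@[simp] theorem len_get : (get id e).len = e.len + 6 := rfl
@[simp] theorem len_raw : (raw e).len = e.len + 1 := rfl

end Ex

attribute [simp] Ins.exec Ins.safe Ins.len execB safeB lenB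

end simp

end WordRAM

/-! ### Probability on the machine -/

namespace WordRAM

open Finset

/-! ### Halting probabilities -/

/-- In `step` the random word is coerced to `ℕ` by a monadic bind on the distribution; here the
coercion is moved into the mapped function. -/
theorem step_eq (w : ℕ) (c : Config) :
    step w c = (PMF.uniformOfFintype (Fin (2 ^ w))).map fun x => stepWith w x.val c := by
  have : (do let a ← PMF.uniformOfFintype (Fin (2 ^ w)); pure a.val : PMF ℕ) =
    (PMF.uniformOfFintype (Fin (2 ^ w))).map Fin.val := PMF.bind_pure_comp _ _
  rw [step, this, PMF.map_comp]
  rfl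

theorem haltProb_zero {w : ℕ} {c : Config} (h : c.Halted) : haltProb w 0 c = 1 := by
  simp [haltProb, run, PMF.toOuterMeasure_pure_apply, h]

theorem haltProb_le_one (w t : ℕ) (c : Config) : haltProb w t c ≤ 1 := by
  rw [haltProb, PMF.toOuterMeasure_apply, ← (run w t c).tsum_coe]
  exact ENNReal.tsum_le_tsum fun x => Set.indicator_le_self _ _ _

theorem haltProb_succ (w t : ℕ) (c : Config) :
    haltProb w (t + 1) c = ∑ x ∈ range (2 ^ w), ((2 ^ w : ℕ) : ENNReal)⁻¹ *
      haltProb w t (stepWith w x c) := by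
  rw [← Fin.sum_univ_eq_sum_range
    (fun x => ((2 ^ w : ℕ) : ENNReal)⁻¹ * haltProb w t (stepWith w x c)) (2 ^ w)]
  simp only [haltProb, run, step_eq]
  rw [PMF.bind_map, PMF.toOuterMeasure_bind_apply, tsum_fintype]
  simp [PMF.uniformOfFintype_apply]

theorem haltProb_succ_const {w t : ℕ} {c c' : Config} (h : ∀ x, stepWith w x c = c') :
    haltProb w (t + 1) c = haltProb w t c' := by
  rw [haltProb_succ]
  simp only [h, sum_const, card_range, nsmul_eq_mul, ← mul_assoc]
  rw [ENNReal.mul_inv_cancel, one_mul]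
  · simp
  · exact ENNReal.natCast_ne_top _

theorem haltProb_halted {w t : ℕ} {c : Config} (h : c.Halted) : haltProb w t c = 1 := by
  induction t with
  | zero => exact haltProb_zero h
  | succ t ih =>
    rw [haltProb_succ_const (c' := c), ih]
    intro x
    obtain ⟨l, s⟩ := c
    obtain rfl : l = [] := h
    rfl

theorem DSteps.haltProb {w k : ℕ} {c c' : Config} (h : DSteps w k c c') (t : ℕ) :
    haltProb w (k + t) c = haltProb w t c' := by
  induction h with
  | refl c => simp
  | @head k _ _ _ h _ ih => rw [show k + 1 + t = k + t + 1 by ring, haltProb_succ_const h, ih]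

/-- All runs from `c` of length `T` end in a configuration with property `B`. -/
def AllRuns (w : ℕ) (B : Config → Prop) : ℕ → Config → Prop
  | 0, c => B c
  | T + 1, c => ∀ x < 2 ^ w, AllRuns w B T (stepWith w x c)

variable {w : ℕ}

theorem DSteps.allRuns {k : ℕ} {c c' : Config} (h : DSteps w k c c') {B : Config → Prop} {T : ℕ}
    (hB : AllRuns w B T c') : AllRuns w B (k + T) c := by
  induction h with
  | refl c => simpa using hB
  | @head k _ _ _ h _ ih =>
    rw [show k + 1 + T = k + T + 1 by ring]
    intro x _
    rw [h]
    exact ih hB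

theorem stepWith_halted {c : Config} (h : c.Halted) (x : ℕ) : stepWith w x c = c := by
  obtain ⟨l, s⟩ := c
  obtain rfl : l = [] := h
  rfl

theorem AllRuns.succ {B : Config → Prop} (hB : ∀ c, B c → c.Halted) {T : ℕ} {c : Config}
    (h : AllRuns w B T c) : AllRuns w B (T + 1) c := by
  induction T generalizing c with
  | zero =>
    intro x _
    rw [stepWith_halted (hB c h)]
    exact h
  | succ T ih => exact fun x hx => ih (h x hx)

theorem AllRuns.mono {B : Config → Prop} (hB : ∀ c, B c → c.Halted) {T T' : ℕ} {c : Config}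
    (h : AllRuns w B T c) (hT : T ≤ T') : AllRuns w B T' c := by
  induction hT with
  | refl => exact h
  | step _ ih => exact ih.succ hB

/-- Only finitely many words can be drawn, so the maximum of the individual time bounds works for
all of them. This is why the algorithm halts within a fixed time and not merely almost surely. -/
theorem AllRuns.of_step {B : Config → Prop} (hB : ∀ c, B c → c.Halted) {c : Config}
    (h : ∀ x < 2 ^ w, ∃ T, AllRuns w B T (stepWith w x c)) : ∃ T, AllRuns w B T c := by
  choose! T hT using h
  refine ⟨(range (2 ^ w)).sup T + 1, fun x hx => (hT x hx).mono hB ?_⟩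
  exact le_sup (f := T) (mem_range.2 hx)

theorem run_halted {t : ℕ} {c : Config} (h : c.Halted) : run w t c = PMF.pure c := by
  induction t with
  | zero => rfl
  | succ t ih =>
    have : step w c = PMF.pure c := by
      simp only [step_eq, stepWith_halted h]
      exact PMF.map_const _ _
    rw [run, this, PMF.pure_bind, ih]

/-- Halted configurations do not move. Hence a configuration that has halted before time `T` is
still there at time `T`, and one that is seen later was already there. -/
theorem AllRuns.of_mem_support {B : Config → Prop} (hB : ∀ c, B c → c.Halted) {T : ℕ} {c : Config}
    (h : AllRuns w B T c) {t : ℕ} {d : Config} (hd : d ∈ (run w t c).support) (hh : d.Halted) :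
    B d := by
  induction T generalizing c t with
  | zero =>
    rw [run_halted (hB c h), PMF.support_pure, Set.mem_singleton_iff] at hd
    exact hd ▸ h
  | succ T ih =>
    cases t with
    | zero =>
      simp only [run, PMF.support_pure, Set.mem_singleton_iff] at hd
      subst hd
      -- The configuration has halted, so it does not matter which word is drawn; `0` is always
      -- available.
      have := h 0 (by positivity)
      rw [stepWith_halted hh] at this
      exact ih this (t := 0) (by simp [run])
    | succ t =>
      simp only [run, step_eq, PMF.mem_support_bind_iff, PMF.support_map, Set.mem_image] at hd
      obtain ⟨c', ⟨x, -, rfl⟩, hd⟩ := hd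
      exact ih (h x x.2) hd

theorem AllRuns.haltProb_eq {B : Config → Prop} (hB : ∀ c, B c → c.Halted) {T : ℕ} {c : Config}
    (h : AllRuns w B T c) : haltProb w T c = 1 := by
  induction T generalizing c with
  | zero => exact haltProb_zero (hB c h)
  | succ T ih =>
    rw [haltProb_succ, sum_congr rfl fun x hx => by rw [ih (h x (mem_range.1 hx))]]
    simp only [sum_const, card_range, nsmul_eq_mul, mul_one]
    exact ENNReal.mul_inv_cancel (by simp) (ENNReal.natCast_ne_top _)

/-! ### Iterated averages -/

/-- The sequence that starts with `x` and goes on with `ρ`. -/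
def consF (x : ℕ) (ρ : ℕ → ℕ) : ℕ → ℕ
  | 0 => x
  | i + 1 => ρ i

/-- The average of `F` over all sequences with entries below `M` and all entries from the `k`-th
on equal to `0`. -/
noncomputable def avg (M : ℕ) : ℕ → ((ℕ → ℕ) → ℝ) → ℝ
  | 0, F => F fun _ => 0
  | k + 1, F => (∑ x ∈ range M, avg M k fun ρ => F (consF x ρ)) / M

open Classical in
/-- The indicator function of a property. -/
noncomputable def ind {α : Type*} (P : α → Prop) (x : α) : ℝ := if P x then 1 else 0

/-! ### Filling an array with random numbers -/

/-- The body of the loop that fills array `0` with random numbers. -/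
def fillBody : Prog :=
  .seq (.rand 12) (block [.put 0 (.var 11) (.var 12 % .var 0), .asg 11 (.var 11 + 1)])

/-- The condition of that loop. -/
def fillCond : Ex := .op .lt (.var 11) (.var 5)

/-- The command that runs that loop, without the first evaluation of the condition. -/
def fillLoop : Prog := .loop 41 (.seq fillBody (evalTo fillCond))

/-- `b` arises from `a` when `k` entries of array `0` are filled with the remainders of `ρ`. -/
structure Filled (n k : ℕ) (ρ : ℕ → ℕ) (a b : ASt) : Prop where
  low : b.low 11 = a.low 11
  raw : b.raw = a.raw
  arr : ∀ id, id ≠ 0 → b.arr id = a.arr id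
  arr0 : ∀ j, b.arr 0 j = if j < a.v 11 then a.arr 0 j else ρ (j - a.v 11) % n
  time : b.time = a.time + 34 * k + 1

/-- A round takes 34 steps: 3 up to the random instruction, the draw, and 30 to store the remainder,
increment and evaluate the condition. The drawn word may exceed `M.V`; only its remainder modulo `n`
has to be in range. -/
theorem fill_iter {M : Mach} {a : ASt} {s : State} {N n : ℕ} (hs : Sim M a s) (h0 : a.v 0 = n)
    (hn : 0 < n) (hnV : n < M.V) (hN : a.v 5 = N) (hNV : N < M.V) (hi : a.v 11 < N)
    (h41 : s.reg 41 = fillCond.eval a) (l : List Prog) :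
    ∃ l', DSteps M.w 3 ⟨fillLoop :: l, s⟩ ⟨.rand 12 :: l', s⟩ ∧ ∀ x, ∃ s',
      DSteps M.w 30 ⟨l', s.setReg 12 x⟩ ⟨fillLoop :: l, s'⟩ ∧
      Sim M ((((a.set 12 x).put 0 (a.v 11) (x % n)).set 11 (a.v 11 + 1)).tick 34) s' ∧
      s'.reg 41 =
        fillCond.eval (((a.set 12 x).put 0 (a.v 11) (x % n)).set 11 (a.v 11 + 1)) := by
  have hVp := M.Vpos
  have hc : fillCond.eval a = 1 := by simp [fillCond, hN, hi]
  rw [hc] at h41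
  refine ⟨block [.put 0 (.var 11) (.var 12 % .var 0), .asg 11 (.var 11 + 1)] ::
    evalTo fillCond :: fillLoop :: l, ?_, fun x => ?_⟩
  · refine .head (c₁ := ⟨.seq fillBody (evalTo fillCond) :: fillLoop :: l, s⟩) (fun x => ?_)
      (.head (c₁ := ⟨fillBody :: evalTo fillCond :: fillLoop :: l, s⟩) (fun x => rfl)
        (.one fun x => rfl))
    simp [stepWith, fillLoop, h41]
  · have sim1 : Sim M (a.set 12 x) (s.setReg 12 x) := by
      refine ⟨fun y hy => ?_, ?_, hs.raw, hs.arr⟩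
      · simp [hs.regs y hy]
      · simp [hs.base]
    have hm : x % n < n := Nat.mod_lt _ hn
    have hwp : wp M (block [.put 0 (.var 11) (.var 12 % .var 0), .asg 11 (.var 11 + 1)])
        (fun b => b = (((a.set 12 x).put 0 (a.v 11) (x % n)).set 11 (a.v 11 + 1)).tick 23)
        (a.set 12 x) := by
      refine wp_block ?_ ?_
      · simp [h0]
        omega
      · simp [h0]
    obtain ⟨t, s1, a', d1, sim2, ht, rfl⟩ := hwp _ sim1
    simp only [ASt.tick_time, ASt.set_time, ASt.put_time, Nat.add_left_cancel_iff] at ht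
    subst ht
    obtain ⟨s', d2, sim3, r⟩ := evalTo_spec fillCond _ s1 (sim2.tick 4) (by simp [fillCond]) (by
      have : fillCond.eval (((((a.set 12 x).put 0 (a.v 11) (x % n)).set 11 (a.v 11 + 1)).tick 23).tick 4)
        ≤ 1 := Op.lt_le _ _
      omega)
    refine ⟨s', ?_, ?_, r⟩
    · exact (d1 (evalTo fillCond :: fillLoop :: l)).trans (d2 (fillLoop :: l))
    · exact sim3.tick 7
theorem Filled.cons {n k x : ℕ} {ρ : ℕ → ℕ} {a b : ASt}
    (h : Filled n k ρ ((((a.set 12 x).put 0 (a.v 11) (x % n)).set 11 (a.v 11 + 1)).tick 34) b) :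
    Filled n (k + 1) (consF x ρ) a b := by
  obtain ⟨h1, h2, h3, h4, h5⟩ := h
  refine ⟨by simpa using h1, by simpa using h2, fun id hid => by simpa [hid] using h3 id hid,
    fun j => ?_, ?_⟩
  · rw [h4]
    simp only [ASt.tick_v, ASt.set_v, if_true, ASt.tick_arr, ASt.set_arr, ASt.put_arr,
      Function.update_apply]
    rcases lt_trichotomy j (a.v 11) with hj | hj | hj
    · simp [hj, (show j < a.v 11 + 1 by omega), hj.ne]
    · simp [hj, consF]
    · obtain ⟨d, rfl⟩ : ∃ d, j = a.v 11 + 1 + d := ⟨j - (a.v 11 + 1), by omega⟩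
      rw [if_neg (by omega), if_neg (by omega), show a.v 11 + 1 + d - a.v 11 = d + 1 by omega]
      simp [consF]
  · rw [h5]
    simp only [ASt.tick_time, ASt.set_time, ASt.put_time]
    ring

theorem fill_done {M : Mach} {a : ASt} {s : State} (hs : Sim M a s)
    (hi : a.v 11 = a.v 5) (ha : ∀ j, a.v 11 ≤ j → a.arr 0 j = 0)
    (h41 : s.reg 41 = fillCond.eval a) (l : List Prog) (n : ℕ) :
    DSteps M.w 1 ⟨fillLoop :: l, s⟩ ⟨l, s⟩ ∧ Sim M (a.tick 1) s ∧
      Filled n 0 (fun _ => 0) a (a.tick 1) := by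
  refine ⟨.one fun x => ?_, hs.tick 1, ⟨rfl, rfl, fun _ _ => rfl, fun j => ?_, rfl⟩⟩
  · have : s.reg 41 = 0 := by simp [h41, fillCond, hi]
    simp [stepWith, fillLoop, this]
  · simp only [ASt.tick_arr, Nat.zero_mod]
    split_ifs with h
    · rfl
    · exact ha j (by omega)

/-- Filling the array: what holds for sure afterwards holds for sure. -/
theorem fill_sure {M : Mach} {B : Config → Prop} (hB : ∀ c, B c → c.Halted) {n N : ℕ} (hn : 0 < n)
    (hnV : n < M.V) (hNV : N < M.V) (l : List Prog) (k : ℕ) (a : ASt) (s : State) (hs : Sim M a s)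
    (h0 : a.v 0 = n) (hN : a.v 5 = N) (hi : a.v 11 + k = N) (ha : ∀ j, a.v 11 ≤ j → a.arr 0 j = 0)
    (h41 : s.reg 41 = fillCond.eval a)
    (h : ∀ ρ b s', Filled n k ρ a b → Sim M b s' → ∃ T, AllRuns M.w B T ⟨l, s'⟩) :
    ∃ T, AllRuns M.w B T ⟨fillLoop :: l, s⟩ := by
  induction k generalizing a s with
  | zero =>
    obtain ⟨d, sim, f⟩ := fill_done hs (by omega) ha h41 l n
    obtain ⟨T, hT⟩ := h _ _ _ f sim
    exact ⟨1 + T, d.allRuns hT⟩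
  | succ k ih =>
    obtain ⟨l', d1, hx⟩ := fill_iter hs h0 hn hnV hN hNV (by omega) h41 l
    suffices ∃ T, AllRuns M.w B T ⟨.rand 12 :: l', s⟩ by
      obtain ⟨T, hT⟩ := this
      exact ⟨3 + T, d1.allRuns hT⟩
    refine AllRuns.of_step hB fun x _ => ?_
    obtain ⟨s', d2, sim, r⟩ := hx x
    obtain ⟨T, hT⟩ := ih _ s' sim (by simp [h0]) (by simp [hN]) (by simp; omega) (by
      intro j hj
      simp only [ASt.tick_v, ASt.set_v, if_true] at hj
      simp [(show j ≠ a.v 11 by omega), ha j (by omega)]) r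
      (fun ρ b s'' hf => h _ b s'' hf.cons)
    exact ⟨30 + T, d2.allRuns hT⟩

/-- Filling the array: the probability to halt in time. -/
theorem fill_prob {M : Mach} {n N t : ℕ} (hn : 0 < n)
    (hnV : n < M.V) (hNV : N < M.V) (l : List Prog) (k : ℕ) (a : ASt) (s : State) (hs : Sim M a s)
    (h0 : a.v 0 = n) (hN : a.v 5 = N) (hi : a.v 11 + k = N) (ha : ∀ j, a.v 11 ≤ j → a.arr 0 j = 0)
    (h41 : s.reg 41 = fillCond.eval a) (P : (ℕ → ℕ) → Prop)
    (h : ∀ ρ b s', Filled n k ρ a b → Sim M b s' → P ρ → haltProb M.w t ⟨l, s'⟩ = 1) :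
    avg (2 ^ M.w) k (ind P) ≤ (haltProb M.w (34 * k + 1 + t) ⟨fillLoop :: l, s⟩).toReal := by
  induction k generalizing a s P with
  | zero =>
    obtain ⟨d, sim, f⟩ := fill_done hs (by omega) ha h41 l n
    rw [show 34 * 0 + 1 + t = 1 + t by ring, d.haltProb, avg, ind]
    split_ifs with hp
    · simp [h _ _ _ f sim hp]
    · positivity
  | succ k ih =>
    obtain ⟨l', d1, hx⟩ := fill_iter hs h0 hn hnV hN hNV (by omega) h41 l
    rw [show 34 * (k + 1) + 1 + t = 3 + ((30 + (34 * k + 1 + t)) + 1) by ring, d1.haltProb,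
      haltProb_succ, avg, ENNReal.toReal_sum, sum_div]
    · refine sum_le_sum fun x _ => ?_
      obtain ⟨s', d2, sim, r⟩ := hx x
      have := ih _ s' sim (by simp [h0]) (by simp [hN]) (by simp; omega) (by
        intro j hj
        simp only [ASt.tick_v, ASt.set_v, if_true] at hj
        simp [(show j ≠ a.v 11 by omega), ha j (by omega)]) r
        (fun ρ => P (consF x ρ)) (fun ρ b s'' hf => h _ b s'' hf.cons)
      rw [← d2.haltProb] at this
      rw [ENNReal.toReal_mul, div_eq_inv_mul]
      have e : (((2 ^ M.w : ℕ) : ENNReal)⁻¹).toReal = ((2 ^ M.w : ℕ) : ℝ)⁻¹ := by simp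
      rw [e]
      exact mul_le_mul_of_nonneg_left this (by positivity)
    · intro x _
      refine ENNReal.mul_ne_top ?_ (ne_top_of_le_ne_top ENNReal.one_ne_top (haltProb_le_one _ _ _))
      simp

end WordRAM

/-! ### Analysis of the random elimination -/

namespace WordRAM

open Finset

/-! ### Properties of iterated averages -/

theorem ind_le_one {α : Type*} (P : α → Prop) (x : α) : ind P x ≤ 1 := by
  unfold ind; split_ifs <;> norm_num

theorem ind_nonneg {α : Type*} (P : α → Prop) (x : α) : 0 ≤ ind P x := by
  unfold ind; split_ifs <;> norm_num

theorem ind_of {α : Type*} {P : α → Prop} {x : α} (h : P x) : ind P x = 1 := if_pos h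

theorem ind_of_not {α : Type*} {P : α → Prop} {x : α} (h : ¬ P x) : ind P x = 0 := if_neg h

theorem ind_le {α : Type*} {P : α → Prop} {x : α} {y : ℝ} (hy : 0 ≤ y) (h : P x → 1 ≤ y) :
    ind P x ≤ y := by
  unfold ind; split_ifs with hp
  · exact h hp
  · exact hy

variable {M : ℕ}

theorem avg_mono {k : ℕ} {F G : (ℕ → ℕ) → ℝ} (h : ∀ ρ, F ρ ≤ G ρ) : avg M k F ≤ avg M k G := by
  induction k generalizing F G with
  | zero => exact h _
  | succ k ih =>
    simp only [avg]
    gcongr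
    exact ih fun ρ => h _

theorem avg_const (hM : 0 < M) (k : ℕ) (y : ℝ) : avg M k (fun _ => y) = y := by
  induction k with
  | zero => rfl
  | succ k ih =>
    simp only [avg, ih, sum_const, card_range, nsmul_eq_mul]
    field_simp

theorem avg_add (k : ℕ) (F G : (ℕ → ℕ) → ℝ) :
    avg M k (fun ρ => F ρ + G ρ) = avg M k F + avg M k G := by
  induction k generalizing F G with
  | zero => rfl
  | succ k ih => simp only [avg, ih, sum_add_distrib, add_div]

theorem avg_mul_left (k : ℕ) (y : ℝ) (F : (ℕ → ℕ) → ℝ) :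
    avg M k (fun ρ => y * F ρ) = y * avg M k F := by
  induction k generalizing F with
  | zero => rfl
  | succ k ih => simp only [avg, ih, ← mul_sum, mul_div_assoc]

theorem avg_sum {α : Type*} (k : ℕ) (T : Finset α) (F : α → (ℕ → ℕ) → ℝ) :
    avg M k (fun ρ => ∑ i ∈ T, F i ρ) = ∑ i ∈ T, avg M k (F i) := by
  induction k generalizing F with
  | zero => rfl
  | succ k ih => simp only [avg, ih, sum_comm (s := range M), sum_div]

theorem avg_list_sum (hM : 0 < M) {α : Type*} (k : ℕ) (L : List α) (F : α → (ℕ → ℕ) → ℝ) :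
    avg M k (fun ρ => (L.map fun i => F i ρ).sum) = (L.map fun i => avg M k (F i)).sum := by
  induction L with
  | nil => simpa using avg_const hM k 0
  | cons i L ih => simp only [List.map_cons, List.sum_cons, avg_add, ih]

/-- The first `k` entries of `ρ`, then `σ`. -/
def appF (k : ℕ) (ρ σ : ℕ → ℕ) : ℕ → ℕ := fun i => if i < k then ρ i else σ (i - k)

theorem consF_appF (x k : ℕ) (ρ σ : ℕ → ℕ) :
    consF x (appF k ρ σ) = appF (k + 1) (consF x ρ) σ := by
  funext i
  cases i with
  | zero => simp [consF, appF]
  | succ i => simp [consF, appF]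

/-- Fubini for iterated averages. It allows conditioning on the samples of the first trial. -/
theorem avg_append (k l : ℕ) (F : (ℕ → ℕ) → ℝ) :
    avg M (k + l) F = avg M k fun ρ => avg M l fun σ => F (appF k ρ σ) := by
  induction k generalizing F with
  | zero =>
    have : ∀ σ : ℕ → ℕ, appF 0 (fun _ => 0) σ = σ := fun σ => by funext i; simp [appF]
    simp [avg, this]
  | succ k ih =>
    rw [show k + 1 + l = (k + l) + 1 by ring]
    simp only [avg, ih, consF_appF]

theorem card_mod_eq_le {n : ℕ} (M r : ℕ) :
    #{x ∈ range M | x % n = r} ≤ M / n + 1 := by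
  rw [← card_range (M / n + 1)]
  refine card_le_card_of_injOn (· / n) (fun x hx => ?_) fun x hx y hy h => ?_
  · simp only [coe_filter, mem_range, Set.mem_ofPred_eq] at hx
    simp only [coe_range, Set.mem_Iio]
    exact Nat.lt_succ_of_le (Nat.div_le_div_right hx.1.le)
  · simp only [coe_filter, mem_range, Set.mem_ofPred_eq] at hx hy
    simp only at h
    rw [← Nat.div_add_mod x n, ← Nat.div_add_mod y n, h, hx.2, hy.2]

theorem le_card_mod_eq {n : ℕ} (M r : ℕ) (hr : r < n) :
    M / n ≤ #{x ∈ range M | x % n = r} := by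
  rw [← card_range (M / n)]
  refine card_le_card_of_injOn (fun i => r + n * i) (fun i hi => ?_) fun x hx y hy h => ?_
  · simp only [coe_range, Set.mem_Iio] at hi
    simp only [coe_filter, mem_range, Set.mem_ofPred_eq]
    refine ⟨?_, by rw [Nat.add_mul_mod_self_left, Nat.mod_eq_of_lt hr]⟩
    calc r + n * i < n + n * i := by omega
      _ = n * (i + 1) := by ring
      _ ≤ n * (M / n) := Nat.mul_le_mul_left _ hi
      _ ≤ M := Nat.mul_div_le M n
  · simp only at h
    exact Nat.eq_of_mul_eq_mul_left (by omega : 0 < n) (by omega)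

theorem card_mod_mem {n : ℕ} (M : ℕ) (A : Finset ℕ) :
    #{x ∈ range M | x % n ∈ A} = ∑ r ∈ A, #{x ∈ range M | x % n = r} := by
  rw [card_eq_sum_card_fiberwise (f := (· % n)) (t := A)]
  · refine sum_congr rfl fun r hr => ?_
    congr 1
    ext x
    simp only [mem_filter, mem_range]
    constructor
    · rintro ⟨⟨h1, -⟩, h2⟩; exact ⟨h1, h2⟩
    · rintro ⟨h1, h2⟩; exact ⟨⟨h1, h2 ▸ hr⟩, h2⟩
  · intro x hx
    simp only [coe_filter, Set.mem_ofPred_eq] at hx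
    exact hx.2

/-- The number of words need not be a multiple of `n`, so a random word modulo `n` is not quite
uniform. As `n ≤ M`, a residue occurs at most `M / n + 1 ≤ 2 * M / n` times; the factor 2 is the
price. -/
theorem card_mod_mem_le {n M : ℕ} (hn : 0 < n) (hM : n ≤ M) (A : Finset ℕ) :
    (#{x ∈ range M | x % n ∈ A} : ℝ) / M ≤ 2 * #A / n := by
  have h : #{x ∈ range M | x % n ∈ A} ≤ #A * (M / n + 1) := by
    rw [card_mod_mem, ← smul_eq_mul]
    exact sum_le_card_nsmul _ _ _ fun r _ => card_mod_eq_le M r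
  have h2 : (M / n + 1) * n ≤ 2 * M := by
    have := Nat.div_mul_le_self M n
    linarith
  rw [div_le_div_iff₀ (by exact_mod_cast (by omega : 0 < M)) (by exact_mod_cast hn)]
  have : #{x ∈ range M | x % n ∈ A} * n ≤ 2 * #A * M := by
    calc _ ≤ #A * (M / n + 1) * n := Nat.mul_le_mul_right _ h
      _ = #A * ((M / n + 1) * n) := by ring
      _ ≤ #A * (2 * M) := Nat.mul_le_mul_left _ h2
      _ = _ := by ring
  exact_mod_cast this

/-- The converse estimate: a residue occurs at least `⌊M / n⌋` times, and for `n ≤ M` rounding down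
loses at most a factor 2. -/
theorem le_card_mod_mem {n M : ℕ} (hn : 0 < n) (hM : n ≤ M) {A : Finset ℕ} (hA : A ⊆ range n) :
    (#A : ℝ) / (2 * n) ≤ (#{x ∈ range M | x % n ∈ A} : ℝ) / M := by
  have h : #A * (M / n) ≤ #{x ∈ range M | x % n ∈ A} := by
    rw [card_mod_mem, ← smul_eq_mul]
    exact card_nsmul_le_sum _ _ _ fun r hr => le_card_mod_eq M r (mem_range.1 (hA hr))
  have h2 : M ≤ (M / n) * (2 * n) := by
    have h3 := Nat.div_add_mod M n
    have h4 := Nat.mod_lt M hn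
    have h5 : 1 ≤ M / n := (Nat.one_le_div_iff hn).2 hM
    nlinarith
  rw [div_le_div_iff₀ (by positivity) (by exact_mod_cast (by omega : 0 < M))]
  have : #A * M ≤ #{x ∈ range M | x % n ∈ A} * (2 * n) := by
    calc _ ≤ #A * ((M / n) * (2 * n)) := Nat.mul_le_mul_left _ h2
      _ = #A * (M / n) * (2 * n) := by ring
      _ ≤ _ := Nat.mul_le_mul_right _ h
  exact_mod_cast this

theorem sum_ind_range (M : ℕ) (P : ℕ → Prop) [DecidablePred P] :
    ∑ x ∈ range M, ind P x = #{x ∈ range M | P x} := by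
  rw [card_filter]
  push_cast
  refine sum_congr rfl fun x _ => ?_
  unfold ind
  split_ifs <;> rfl

/-- The union bound over the samples, obtained by splitting off the first one. -/
theorem avg_hit_le {n M : ℕ} (hn : 0 < n) (hM : n ≤ M) (A : Finset ℕ) (q : ℕ) :
    avg M q (ind fun ρ => ∃ j < q, ρ j % n ∈ A) ≤ q * (2 * #A / n) := by
  induction q with
  | zero => simp [avg, ind]
  | succ q ih =>
    have key : ∀ x, avg M q (fun ρ => ind (fun ρ => ∃ j < q + 1, ρ j % n ∈ A) (consF x ρ)) ≤
        ind (fun x => x % n ∈ A) x + q * (2 * #A / n) := by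
      intro x
      calc _ ≤ avg M q (fun ρ => ind (fun x => x % n ∈ A) x + ind (fun ρ => ∃ j < q, ρ j % n ∈ A) ρ) := by
            refine avg_mono fun ρ => ind_le (add_nonneg (ind_nonneg _ _) (ind_nonneg _ _)) ?_
            rintro ⟨j, hj, h⟩
            cases j with
            | zero =>
              rw [ind_of (P := fun x => x % n ∈ A) (x := x) h]
              linarith [ind_nonneg (fun ρ : ℕ → ℕ => ∃ j < q, ρ j % n ∈ A) ρ]
            | succ j =>
              rw [ind_of (P := fun ρ : ℕ → ℕ => ∃ j < q, ρ j % n ∈ A) ⟨j, by omega, h⟩]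
              linarith [ind_nonneg (fun x => x % n ∈ A) x]
        _ ≤ _ := by
            rw [avg_add, avg_const (by omega)]
            linarith
    rw [avg]
    have hM' : (0 : ℝ) < M := by exact_mod_cast (by omega : 0 < M)
    calc _ ≤ (∑ x ∈ range M, (ind (fun x => x % n ∈ A) x + q * (2 * #A / n))) / M := by
          gcongr with x _
          exact key x
      _ = (#{x ∈ range M | x % n ∈ A} : ℝ) / M + q * (2 * #A / n) := by
          rw [sum_add_distrib, sum_ind_range, sum_const, card_range, nsmul_eq_mul]
          field_simp
      _ ≤ _ := by
          have := card_mod_mem_le hn hM A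
          push_cast
          linarith

/-- Independence of the samples: the indicator is the product of one for the first sample and one
for the rest, and the average factorises. -/
theorem avg_miss_le {n M : ℕ} (hn : 0 < n) (hM : n ≤ M) {A : Finset ℕ} (hA : A ⊆ range n) (q : ℕ) :
    avg M q (ind fun ρ => ∀ j < q, ρ j % n ∉ A) ≤ (1 - (#A : ℝ) / (2 * n)) ^ q := by
  have hp : (0 : ℝ) ≤ 1 - (#A : ℝ) / (2 * n) := by
    have : (#A : ℝ) ≤ n := by exact_mod_cast (card_le_card hA).trans (card_range n).le
    rw [sub_nonneg, div_le_one (by positivity)]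
    linarith [(Nat.cast_nonneg n : (0 : ℝ) ≤ n)]
  induction q with
  | zero => simp [avg, ind]
  | succ q ih =>
    have key : ∀ x, avg M q (fun ρ => ind (fun ρ => ∀ j < q + 1, ρ j % n ∉ A) (consF x ρ)) ≤
        ind (fun x => x % n ∉ A) x * (1 - (#A : ℝ) / (2 * n)) ^ q := by
      intro x
      calc _ ≤ avg M q (fun ρ => ind (fun x => x % n ∉ A) x * ind (fun ρ => ∀ j < q, ρ j % n ∉ A) ρ) := by
            refine avg_mono fun ρ => ind_le (mul_nonneg (ind_nonneg _ _) (ind_nonneg _ _)) ?_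
            intro h
            rw [ind_of (P := fun x => x % n ∉ A) (x := x) (h 0 (by omega)),
              ind_of (P := fun ρ : ℕ → ℕ => ∀ j < q, ρ j % n ∉ A) (x := ρ)
                fun j hj => h (j + 1) (by omega)]
            norm_num
        _ ≤ _ := by
            rw [avg_mul_left]
            exact mul_le_mul_of_nonneg_left ih (ind_nonneg _ _)
    rw [avg]
    have hM' : (0 : ℝ) < M := by exact_mod_cast (by omega : 0 < M)
    calc _ ≤ (∑ x ∈ range M, ind (fun x => x % n ∉ A) x * (1 - (#A : ℝ) / (2 * n)) ^ q) / M := by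
          gcongr with x _
          exact key x
      _ = (#{x ∈ range M | x % n ∉ A} : ℝ) / M * (1 - (#A : ℝ) / (2 * n)) ^ q := by
          rw [← sum_mul, sum_ind_range]
          ring
      _ ≤ (1 - (#A : ℝ) / (2 * n)) * (1 - (#A : ℝ) / (2 * n)) ^ q := by
          refine mul_le_mul_of_nonneg_right ?_ (pow_nonneg hp _)
          have h1 := le_card_mod_mem hn hM hA
          have h2 : (#{x ∈ range M | x % n ∈ A} : ℝ) + #{x ∈ range M | x % n ∉ A} = M := by
            have := card_filter_add_card_filter_not (s := range M) (fun x => x % n ∈ A)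
            rw [card_range] at this
            exact_mod_cast this
          rw [← sub_eq_iff_eq_add'.2 h2.symm, sub_div, div_self hM'.ne']
          linarith
      _ = _ := by ring

/-! ### Elimination of near-twins found by sampling -/

/-- The vertices of `S` that tell `u` and `v` apart. -/
def dif (bt : ℕ → ℕ → ℕ) (S : Finset ℕ) (u v : ℕ) : Finset ℕ := {x ∈ S | bt u x ≠ bt v x}

/-- The least vertex of `S` with the same neighbours as `u` in `X`. -/
noncomputable def rep (bt : ℕ → ℕ → ℕ) (S X : Finset ℕ) (u : ℕ) : ℕ :=
  sInf {v | v ∈ S ∧ ∀ x ∈ X, bt v x = bt u x}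

/-- The vertices that represent themselves. -/
noncomputable def kept (bt : ℕ → ℕ → ℕ) (S X : Finset ℕ) : Finset ℕ := {u ∈ S | rep bt S X u = u}

/-- The sampled vertices that belong to `S`. -/
def smp (n q : ℕ) (ρ : ℕ → ℕ) (S : Finset ℕ) : Finset ℕ :=
  (range q).image (fun j => ρ j % n) ∩ S

/-- The sequence `ρ` from entry `k` on. -/
def shiftF (k : ℕ) (ρ : ℕ → ℕ) : ℕ → ℕ := fun j => ρ (k + j)

/-- The vertices that remain of `S` after `r` trials with `q` samples each. -/
noncomputable def remain (bt : ℕ → ℕ → ℕ) (n q : ℕ) (S : Finset ℕ) (ρ : ℕ → ℕ) : ℕ → Finset ℕ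
  | 0 => S
  | r + 1 => kept bt (remain bt n q S ρ r)
      (smp n q (shiftF (r * q) ρ) (remain bt n q S ρ r))

variable {bt : ℕ → ℕ → ℕ} {S X : Finset ℕ} {u v n q : ℕ}

theorem rep_spec (hu : u ∈ S) : rep bt S X u ∈ S ∧ ∀ x ∈ X, bt (rep bt S X u) x = bt u x :=
  Nat.sInf_mem (s := {v | v ∈ S ∧ ∀ x ∈ X, bt v x = bt u x}) ⟨u, hu, fun _ _ => rfl⟩

theorem rep_le (hv : v ∈ S) (h : ∀ x ∈ X, bt v x = bt u x) : rep bt S X u ≤ v :=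
  Nat.sInf_le ⟨hv, h⟩

theorem rep_congr (h : ∀ x ∈ X, bt u x = bt v x) : rep bt S X u = rep bt S X v := by
  unfold rep
  congr 1
  ext w
  simp only [Set.mem_ofPred_eq]
  exact and_congr_right fun _ => forall₂_congr fun x hx => by rw [h x hx]

theorem kept_subset : kept bt S X ⊆ S := filter_subset _ _

theorem rep_mem_kept (hu : u ∈ S) : rep bt S X u ∈ kept bt S X := by
  have := rep_spec (bt := bt) (X := X) hu
  exact mem_filter.2 ⟨this.1, rep_congr this.2⟩

theorem card_kept_le : #(kept bt S X) ≤ #(S.image (rep bt S X)) := by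
  refine card_le_card fun u hu => ?_
  have := mem_filter.1 hu
  exact mem_image.2 ⟨u, this.1, this.2⟩

theorem remain_subset (S : Finset ℕ) (ρ : ℕ → ℕ) (r : ℕ) : remain bt n q S ρ r ⊆ S := by
  induction r with
  | zero => exact Subset.rfl
  | succ r ih => exact kept_subset.trans ih

/-- The definition of `remain` splits off the last trial, whereas inductions with `avg_append` need
to split off the first. -/
theorem remain_succ (S : Finset ℕ) (ρ : ℕ → ℕ) (r : ℕ) :
    remain bt n q S ρ (r + 1) = remain bt n q (kept bt S (smp n q ρ S)) (shiftF q ρ) r := by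
  induction r with
  | zero =>
    have : shiftF 0 ρ = ρ := by funext j; simp [shiftF]
    simp [remain, this]
  | succ r ih =>
    rw [remain, ih, remain]
    congr 2
    funext j
    simp only [shiftF]
    congr 1
    ring

theorem smp_appF (q : ℕ) (ρ σ : ℕ → ℕ) : smp n q (appF q ρ σ) S = smp n q ρ S := by
  unfold smp
  congr 1
  refine image_congr fun j hj => ?_
  simp only [coe_range, Set.mem_Iio] at hj
  simp [appF, hj]

theorem shiftF_appF (q : ℕ) (ρ σ : ℕ → ℕ) : shiftF q (appF q ρ σ) = σ := by
  funext j
  simp [shiftF, appF]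

/-- Every set of at least two vertices contains a pair of `d`-twins. -/
def HasTwins (bt : ℕ → ℕ → ℕ) (n d : ℕ) : Prop :=
  ∀ S ⊆ range n, 2 ≤ #S → ∃ u ∈ S, ∃ v ∈ S, u ≠ v ∧ #(dif bt S u v) ≤ d

theorem card_dif_le_erase (w : ℕ) : #(dif bt S u v) ≤ #(dif bt (S.erase w) u v) + 1 := by
  have : dif bt S u v ⊆ insert w (dif bt (S.erase w) u v) := by
    intro x hx
    simp only [dif, mem_filter, mem_insert, mem_erase] at hx ⊢
    tauto
  exact (card_le_card this).trans (card_insert_le _ _)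

/-- A set with more than `t` vertices contains a forest of `t` pairs of near-twins. -/
theorem exists_forest {d : ℕ} (h : HasTwins bt n d) (t : ℕ) (S : Finset ℕ) (hS : S ⊆ range n)
    (ht : t + 1 ≤ #S) : ∃ L : List (ℕ × ℕ), L.length = t ∧
      (∀ p ∈ L, #(dif bt S p.1 p.2) ≤ d + t) ∧
      ∀ f : ℕ → ℕ, #(S.image f) + t ≤ #S + L.countP fun p => ¬ f p.1 = f p.2 := by
  induction t generalizing S with
  | zero => exact ⟨[], rfl, by simp, fun f => by simpa using card_image_le⟩
  | succ t ih =>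
    obtain ⟨u, hu, v, hv, huv, hd⟩ := h S hS (by omega)
    have hc := card_erase_of_mem hu
    obtain ⟨L, h1, h2, h3⟩ := ih (S.erase u) ((erase_subset _ _).trans hS) (by omega)
    refine ⟨(u, v) :: L, by simp [h1], ?_, fun f => ?_⟩
    · intro p hp
      rcases List.mem_cons.1 hp with rfl | hp
      · exact hd.trans (by omega)
      -- The pairs of `L` were found in `S.erase u`, and putting `u` back adds at most one to a
      -- difference; this accounts for `d + t` after `t` removals.
      · have := h2 p hp
        have := card_dif_le_erase (bt := bt) (S := S) (u := p.1) (v := p.2) u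
        omega
    -- The vertex `u` contributes a new value of `f` only if `f` separates it from `v`, whose value
    -- is already counted.
    · have h4 := h3 f
      have h5 : S.image f = insert (f u) ((S.erase u).image f) := by
        rw [← image_insert, insert_erase hu]
      rw [List.countP_cons]
      by_cases hf : f u = f v
      · have : S.image f = (S.erase u).image f := by
          rw [h5, insert_eq_self, mem_image]
          exact ⟨v, mem_erase.2 ⟨huv.symm, hv⟩, hf.symm⟩
        rw [this]
        simp only [hf, not_true_eq_false, decide_false, if_false, Bool.false_eq_true]
        omega
      · have := card_insert_le (f u) ((S.erase u).image f)
        rw [h5]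
        simp only [hf, not_false_eq_true, decide_true, if_true]
        omega

theorem mem_smp {ρ : ℕ → ℕ} {x : ℕ} : x ∈ smp n q ρ S ↔ (∃ j < q, ρ j % n = x) ∧ x ∈ S := by
  simp [smp]

theorem sum_ind_ge_countP (L : List (ℕ × ℕ)) (f : ℕ → ℕ) (P : ℕ × ℕ → Prop)
    (h : ∀ p ∈ L, f p.1 ≠ f p.2 → P p) :
    ((L.countP fun p => ¬ f p.1 = f p.2 : ℕ) : ℝ) ≤ (L.map fun p => ind P p).sum := by
  induction L with
  | nil => simp
  | cons p L ih =>
    have := ih fun p hp => h p (by simp [hp])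
    rw [List.countP_cons, List.map_cons, List.sum_cons]
    by_cases hf : f p.1 = f p.2
    · simp only [hf, not_true_eq_false, decide_false, if_false, Bool.false_eq_true, add_zero]
      linarith [ind_nonneg P p]
    · rw [ind_of (h p (by simp) hf)]
      simp only [hf, not_false_eq_true, decide_true, if_true]
      push_cast
      linarith

/-- A trial eliminates many vertices with probability at least `1 / 2`. -/
theorem avg_slow_le {M d τ : ℕ} (hn : 0 < n) (hM : n ≤ M) (h : HasTwins bt n d) (hS : S ⊆ range n)
    (hτ : 0 < τ) (hc : 2 * τ < #S) (hq : 8 * (q * (d + 2 * τ)) ≤ n) :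
    avg M q (ind fun ρ => #S < #(kept bt S (smp n q ρ S)) + τ) ≤ 1 / 2 := by
  obtain ⟨L, h1, h2, h3⟩ := exists_forest h (2 * τ) S hS (by omega)
  have hτ' : (0 : ℝ) < τ := by exact_mod_cast hτ
  -- Markov's inequality in pointwise form: the indicator of a slow trial is at most `1 / τ` times
  -- the number of separated forest pairs.
  have key : ∀ ρ, ind (fun ρ => #S < #(kept bt S (smp n q ρ S)) + τ) ρ ≤ (1 / τ : ℝ) *
      (L.map fun p => ind (fun ρ => ∃ j < q, ρ j % n ∈ dif bt S p.1 p.2) ρ).sum := by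
    intro ρ
    refine ind_le (mul_nonneg (by positivity) (List.sum_nonneg ?_)) fun hs => ?_
    · intro y hy
      obtain ⟨p, -, rfl⟩ := List.mem_map.1 hy
      exact ind_nonneg _ _
    · have h4 := h3 (rep bt S (smp n q ρ S))
      have h5 := card_kept_le (bt := bt) (S := S) (X := smp n q ρ S)
      have h6 := sum_ind_ge_countP L (rep bt S (smp n q ρ S))
        (fun p => ∃ j < q, ρ j % n ∈ dif bt S p.1 p.2) (by
          intro p _ hne
          by_contra hcon
          push Not at hcon
          refine hne (rep_congr fun x hx => ?_)
          obtain ⟨⟨j, hj, rfl⟩, hx⟩ := mem_smp.1 hx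
          have := hcon j hj
          simp only [dif, mem_filter, not_and, not_not] at this
          exact this hx)
      -- The forest allows at most `#S - 2 * τ` classes plus the number of separated pairs. A slow
      -- trial has more than `#S - τ` classes, so more than `τ` pairs are separated.
      have h7 : (τ : ℝ) ≤ (L.countP fun p => ¬ rep bt S (smp n q ρ S) p.1 =
          rep bt S (smp n q ρ S) p.2 : ℕ) := by
        exact_mod_cast (by omega)
      rw [div_mul_eq_mul_div, one_mul, le_div_iff₀ hτ', one_mul]
      exact h7.trans h6
  refine (avg_mono key).trans ?_
  rw [avg_mul_left, avg_list_sum (by omega)]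
  -- A pair differs in at most `d + 2 * τ` vertices, so it is separated with probability at most `2
  -- * q * (d + 2 * τ) / n ≤ 1 / 4` by `hq`. Over `2 * τ` pairs this makes `τ / 2` on average.
  have h8 : ∀ y ∈ L.map (fun p => avg M q (ind fun ρ => ∃ j < q, ρ j % n ∈ dif bt S p.1 p.2)),
      y ≤ 1 / 4 := by
    intro y hy
    obtain ⟨p, hp, rfl⟩ := List.mem_map.1 hy
    refine (avg_hit_le hn hM _ q).trans ?_
    have hn' : (0 : ℝ) < n := by exact_mod_cast hn
    have h9 : 8 * (q * #(dif bt S p.1 p.2)) ≤ n :=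
      le_trans (Nat.mul_le_mul_left _ (Nat.mul_le_mul_left _ (h2 p hp))) hq
    have h10 : 8 * ((q : ℝ) * #(dif bt S p.1 p.2)) ≤ n := by exact_mod_cast h9
    rw [← mul_div_assoc, div_le_iff₀ hn']
    linarith
  have h11 := List.sum_le_card_nsmul _ _ h8
  rw [List.length_map, h1, nsmul_eq_mul] at h11
  rw [div_mul_eq_mul_div, one_mul, div_le_iff₀ hτ']
  push_cast at h11
  linarith

/-- The potential `2 ^ (#S / τ)` never grows, and it is halved at least when `τ` vertices disappear,
which has probability at least 1/2 as long as more than `2 * τ` vertices remain. Once at most `2 *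
τ` remain, the event in question can no longer occur. -/
theorem avg_remain_le {M d τ : ℕ} (hn : 0 < n) (hM : n ≤ M) (h : HasTwins bt n d) (hτ : 0 < τ)
    (hq : 8 * (q * (d + 2 * τ)) ≤ n) (R : ℕ) (S : Finset ℕ) (hS : S ⊆ range n) :
    avg M (R * q) (ind fun ρ => 2 * τ < #(remain bt n q S ρ R)) ≤
      (3 / 4) ^ R * 2 ^ (#S / τ) := by
  by_cases hc : 2 * τ < #S
  swap
  · refine (avg_mono (G := fun _ => 0) fun ρ => ?_).trans ?_
    · rw [ind_of_not]
      have := card_le_card (remain_subset (bt := bt) (n := n) (q := q) S ρ R)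
      omega
    · rw [avg_const (by omega)]
      positivity
  induction R generalizing S with
  | zero =>
    simp only [zero_mul, avg, pow_zero, one_mul]
    exact (ind_le_one _ _).trans (one_le_pow₀ (by norm_num))
  | succ R ih =>
    rw [show (R + 1) * q = q + R * q by ring, avg_append]
    have hind : ∀ ρ σ, ind (fun ρ => 2 * τ < #(remain bt n q S ρ (R + 1))) (appF q ρ σ) =
        ind (fun σ => 2 * τ < #(remain bt n q (kept bt S (smp n q ρ S)) σ R)) σ := fun ρ σ => by
      unfold ind
      have : 2 * τ < #(remain bt n q S (appF q ρ σ) (R + 1)) ↔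
          2 * τ < #(remain bt n q (kept bt S (smp n q ρ S)) σ R) := by
        rw [remain_succ, smp_appF, shiftF_appF]
      by_cases h : 2 * τ < #(remain bt n q (kept bt S (smp n q ρ S)) σ R)
      · rw [if_pos h, if_pos (this.2 h)]
      · rw [if_neg h, if_neg (fun h' => h (this.1 h'))]
    simp only [hind]
    -- The last factor is 1 for a slow first trial and 1/2 otherwise; its average is at most `1 / 2
    -- + 1 / 2 * (1 / 2) = 3 / 4`.
    have key : ∀ ρ, avg M (R * q) (ind fun σ => 2 * τ <
        #(remain bt n q (kept bt S (smp n q ρ S)) σ R)) ≤ (3 / 4) ^ R * 2 ^ (#S / τ) *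
          (1 / 2 + 1 / 2 * ind (fun ρ => #S < #(kept bt S (smp n q ρ S)) + τ) ρ) := by
      intro ρ
      set S' := kept bt S (smp n q ρ S) with hS'
      have hsub : S' ⊆ S := kept_subset
      have hle := card_le_card hsub
      have h1 : avg M (R * q) (ind fun σ => 2 * τ < #(remain bt n q S' σ R)) ≤
          (3 / 4) ^ R * 2 ^ (#S' / τ) := by
        by_cases hc' : 2 * τ < #S'
        · exact ih S' (hsub.trans hS) hc'
        · refine (avg_mono (G := fun _ => 0) fun ρ => ?_).trans ?_
          · rw [ind_of_not]
            have := card_le_card (remain_subset (bt := bt) (n := n) (q := q) S' ρ R)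
            omega
          · rw [avg_const (by omega)]
            positivity
      refine h1.trans ?_
      rw [mul_assoc]
      refine mul_le_mul_of_nonneg_left ?_ (by positivity)
      by_cases hs : #S < #S' + τ
      · rw [ind_of (P := fun ρ => #S < #(kept bt S (smp n q ρ S)) + τ) hs]
        have : (2 : ℝ) ^ (#S' / τ) ≤ 2 ^ (#S / τ) :=
          pow_le_pow_right₀ (by norm_num) (Nat.div_le_div_right hle)
        linarith
      · rw [ind_of_not (P := fun ρ => #S < #(kept bt S (smp n q ρ S)) + τ) hs]
        have h2 : #S' / τ + 1 ≤ #S / τ := by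
          rw [← Nat.add_div_right _ hτ]
          exact Nat.div_le_div_right (by omega)
        have : (2 : ℝ) ^ (#S' / τ + 1) ≤ 2 ^ (#S / τ) := pow_le_pow_right₀ (by norm_num) h2
        rw [pow_succ] at this
        linarith
    refine (avg_mono key).trans ?_
    rw [avg_mul_left, avg_add, avg_const (by omega), avg_mul_left, pow_succ]
    have := avg_slow_le hn hM h hS hτ hc hq
    have h3 : (0 : ℝ) < (3 / 4) ^ R * 2 ^ (#S / τ) := by positivity
    nlinarith

/-- In trial `r`, some vertex is represented by a vertex that is not similar. -/
def BadTrial (bt : ℕ → ℕ → ℕ) (n q Δ : ℕ) (S : Finset ℕ) (ρ : ℕ → ℕ) (r : ℕ) : Prop :=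
  ∃ u ∈ remain bt n q S ρ r, Δ < #(dif bt (remain bt n q S ρ r) u
    (rep bt (remain bt n q S ρ r) (smp n q (shiftF (r * q) ρ) (remain bt n q S ρ r)) u))

/-- A vertex and its representative agree on all samples in `S`. A bad trial therefore has a pair
with more than `Δ` distinguishing vertices, none of which was sampled. This has probability at most
`(1 - Δ / (2 * n)) ^ q` for each of at most `n ^ 2` pairs. -/
theorem avg_badTrial_zero_le {M Δ : ℕ} (hn : 0 < n) (hM : n ≤ M) (hS : S ⊆ range n) :
    avg M q (ind fun ρ => BadTrial bt n q Δ S ρ 0) ≤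
      (n : ℝ) ^ 2 * Real.exp (-(Δ * q / (2 * n) : ℝ)) := by
  set T : Finset (ℕ × ℕ) := {p ∈ S ×ˢ S | Δ < #(dif bt S p.1 p.2)} with hT
  have key : ∀ ρ, ind (fun ρ => BadTrial bt n q Δ S ρ 0) ρ ≤
      ∑ p ∈ T, ind (fun ρ => ∀ j < q, ρ j % n ∉ dif bt S p.1 p.2) ρ := by
    intro ρ
    refine ind_le (sum_nonneg fun _ _ => ind_nonneg _ _) ?_
    rintro ⟨u, hu, hd⟩
    simp only [remain, zero_mul] at hu hd
    have hsh : shiftF 0 ρ = ρ := by funext j; simp [shiftF]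
    rw [hsh] at hd
    have hr := rep_spec (bt := bt) (X := smp n q ρ S) hu
    have hmem : (u, rep bt S (smp n q ρ S) u) ∈ T := by
      simp only [hT, mem_filter, mem_product]
      exact ⟨⟨hu, hr.1⟩, hd⟩
    have h1 := single_le_sum (f := fun p : ℕ × ℕ =>
      ind (fun ρ : ℕ → ℕ => ∀ j < q, ρ j % n ∉ dif bt S p.1 p.2) ρ)
      (fun _ _ => ind_nonneg _ _) hmem
    have h2 : ∀ j < q, ρ j % n ∉ dif bt S u (rep bt S (smp n q ρ S) u) := by
      intro j hj hmem
      have hx := mem_filter.1 hmem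
      exact hx.2 (hr.2 _ (mem_smp.2 ⟨⟨j, hj, rfl⟩, hx.1⟩)).symm
    exact (ind_of (P := fun ρ : ℕ → ℕ =>
      ∀ j < q, ρ j % n ∉ dif bt S u (rep bt S (smp n q ρ S) u)) h2).symm.le.trans h1
  refine (avg_mono key).trans ?_
  rw [avg_sum]
  have hn' : (0 : ℝ) < n := by exact_mod_cast hn
  have h1 : ∀ p ∈ T, avg M q (ind fun ρ => ∀ j < q, ρ j % n ∉ dif bt S p.1 p.2) ≤
      Real.exp (-(Δ * q / (2 * n) : ℝ)) := by
    intro p hp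
    have hp' := (mem_filter.1 hp).2
    have hsub : dif bt S p.1 p.2 ⊆ range n := (filter_subset _ _).trans hS
    refine (avg_miss_le hn hM hsub q).trans ?_
    have hle : (#(dif bt S p.1 p.2) : ℝ) ≤ n := by
      exact_mod_cast (card_le_card hsub).trans (card_range n).le
    have h0 : (0 : ℝ) ≤ 1 - (#(dif bt S p.1 p.2) : ℝ) / (2 * n) := by
      rw [sub_nonneg, div_le_one (by positivity)]
      linarith
    have h2 : 1 - (#(dif bt S p.1 p.2) : ℝ) / (2 * n) ≤ Real.exp (-(Δ / (2 * n) : ℝ)) := by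
      have := Real.add_one_le_exp (-(Δ / (2 * n) : ℝ))
      have h3 : (Δ : ℝ) / (2 * n) ≤ (#(dif bt S p.1 p.2) : ℝ) / (2 * n) := by gcongr
      linarith
    calc _ ≤ Real.exp (-(Δ / (2 * n) : ℝ)) ^ q := pow_le_pow_left₀ h0 h2 q
      _ = _ := by rw [← Real.exp_nat_mul]; congr 1; ring
  refine (sum_le_card_nsmul _ _ _ h1).trans ?_
  rw [nsmul_eq_mul]
  refine mul_le_mul_of_nonneg_right ?_ (Real.exp_pos _).le
  have h4 : #T ≤ n * n := by
    calc #T ≤ #(S ×ˢ S) := card_filter_le _ _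
      _ = #S * #S := card_product _ _
      _ ≤ n * n := by
        have := (card_le_card hS).trans (card_range n).le
        exact Nat.mul_le_mul this this
  rw [sq]
  exact_mod_cast h4

theorem badTrial_succ {Δ : ℕ} {ρ : ℕ → ℕ} {r : ℕ} : BadTrial bt n q Δ S ρ (r + 1) ↔
    BadTrial bt n q Δ (kept bt S (smp n q ρ S)) (shiftF q ρ) r := by
  have : shiftF ((r + 1) * q) ρ = shiftF (r * q) (shiftF q ρ) := by
    funext j
    simp only [shiftF]
    congr 1
    ring
  unfold BadTrial
  rw [remain_succ, this]

theorem badTrial_zero_appF {Δ : ℕ} {ρ σ : ℕ → ℕ} : BadTrial bt n q Δ S (appF q ρ σ) 0 ↔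
    BadTrial bt n q Δ S ρ 0 := by
  have h : ∀ ρ : ℕ → ℕ, shiftF 0 ρ = ρ := fun ρ => by funext j; simp [shiftF]
  simp only [BadTrial, remain, zero_mul, h, smp_appF]

/-- The union bound over the trials. The estimate for one trial holds for every set `S`, so it
applies to whatever the previous samples have left. -/
theorem avg_bad_le {M Δ : ℕ} (hn : 0 < n) (hM : n ≤ M) (R : ℕ) (S : Finset ℕ) (hS : S ⊆ range n) :
    avg M (R * q) (ind fun ρ => ∃ r < R, BadTrial bt n q Δ S ρ r) ≤
      R * ((n : ℝ) ^ 2 * Real.exp (-(Δ * q / (2 * n) : ℝ))) := by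
  induction R generalizing S with
  | zero => simp [avg, ind]
  | succ R ih =>
    rw [show (R + 1) * q = q + R * q by ring, avg_append]
    have key : ∀ ρ, avg M (R * q) (fun σ => ind (fun ρ => ∃ r < R + 1, BadTrial bt n q Δ S ρ r)
        (appF q ρ σ)) ≤ ind (fun ρ => BadTrial bt n q Δ S ρ 0) ρ +
          R * ((n : ℝ) ^ 2 * Real.exp (-(Δ * q / (2 * n) : ℝ))) := by
      intro ρ
      have h1 := ih (kept bt S (smp n q ρ S)) (kept_subset.trans hS)
      refine le_trans ?_ (add_le_add_right h1 _)
      rw [← avg_const (M := M) (by omega) (R * q) (ind (fun ρ => BadTrial bt n q Δ S ρ 0) ρ),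
        ← avg_add]
      refine avg_mono fun σ => ind_le (add_nonneg (ind_nonneg _ _) (ind_nonneg _ _)) ?_
      rintro ⟨r, hr, hb⟩
      cases r with
      | zero =>
        rw [badTrial_zero_appF] at hb
        rw [ind_of (P := fun ρ => BadTrial bt n q Δ S ρ 0) hb]
        linarith [ind_nonneg (fun ρ => ∃ r < R, BadTrial bt n q Δ (kept bt S (smp n q (appF q ρ σ) S)) ρ r) σ,
          ind_nonneg (fun σ => ∃ r < R, BadTrial bt n q Δ (kept bt S (smp n q ρ S)) σ r) σ]
      | succ r =>
        rw [badTrial_succ, shiftF_appF, smp_appF] at hb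
        rw [ind_of (P := fun σ => ∃ r < R, BadTrial bt n q Δ (kept bt S (smp n q ρ S)) σ r)
          ⟨r, by omega, hb⟩]
        linarith [ind_nonneg (fun ρ => BadTrial bt n q Δ S ρ 0) ρ]
    refine (avg_mono key).trans ?_
    rw [avg_add, avg_const (by omega)]
    have := avg_badTrial_zero_le (bt := bt) (q := q) (Δ := Δ) hn hM hS
    push_cast
    linarith

end WordRAM

/-! ### From elimination sequences to few rectangles -/

namespace WordRAM

open Finset

/-! ### Elimination sequences -/

/-- `L` is a list of pairs `(u, v)`; successively removing the vertices `u`, each of which has its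
partner `v` among the remaining vertices, leads from `S` to `T`. -/
def ElimTo : Finset ℕ → List (ℕ × ℕ) → Finset ℕ → Prop
  | S, [], T => S = T
  | S, p :: L, T => p.1 ∈ S ∧ p.2 ∈ S ∧ p.1 ≠ p.2 ∧ ElimTo (S.erase p.1) L T

/-- The total number of vertices that tell the members of the pairs apart. -/
def elimCost (bt : ℕ → ℕ → ℕ) : Finset ℕ → List (ℕ × ℕ) → ℕ
  | _, [] => 0
  | S, p :: L => #(dif bt S p.1 p.2) + elimCost bt (S.erase p.1) L

/-- The pairs of vertices and representatives that a trial eliminates. -/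
noncomputable def elimPairs (bt : ℕ → ℕ → ℕ) (n : ℕ) (S X : Finset ℕ) : List (ℕ × ℕ) :=
  ((List.range n).filter fun u => u ∈ S ∧ rep bt S X u ≠ u).map fun u => (u, rep bt S X u)

variable {bt : ℕ → ℕ → ℕ} {S T U X : Finset ℕ} {n q : ℕ}

theorem ElimTo.append {L L' : List (ℕ × ℕ)} (h : ElimTo S L T) (h' : ElimTo T L' U) :
    ElimTo S (L ++ L') U := by
  induction L generalizing S with
  | nil => exact h.symm ▸ h'
  | cons p L ih => exact ⟨h.1, h.2.1, h.2.2.1, ih h.2.2.2⟩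

theorem ElimTo.cost_append {L L' : List (ℕ × ℕ)} (h : ElimTo S L T) :
    elimCost bt S (L ++ L') = elimCost bt S L + elimCost bt T L' := by
  induction L generalizing S with
  | nil => simp [elimCost, show S = T from h]
  | cons p L ih => simp only [List.cons_append, elimCost, ih h.2.2.2]; ring

theorem ElimTo.card {L : List (ℕ × ℕ)} (h : ElimTo S L T) : #S = #T + L.length := by
  induction L generalizing S with
  | nil => simp [show S = T from h]
  | cons p L ih =>
    have := ih h.2.2.2
    have h2 := card_erase_add_one h.1
    rw [List.length_cons]
    omega

theorem dif_mono {u v : ℕ} (h : T ⊆ S) : #(dif bt T u v) ≤ #(dif bt S u v) :=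
  card_le_card (filter_subset_filter _ h)

/-- No partner `f u` is itself on the list, so partners survive until the end and the removals may
be done one by one. The cost is measured in shrinking sets and thus is at most what it would be in
`S`. -/
theorem elimTo_map (f : ℕ → ℕ) {Δ : ℕ} (l : List ℕ) (hl : l.Nodup) (T : Finset ℕ) (hT : T ⊆ S)
    (h : ∀ u ∈ l, u ∈ T ∧ f u ∈ T ∧ f u ∉ l) :
    ElimTo T (l.map fun u => (u, f u)) (T \ l.toFinset) ∧
      ((∀ u ∈ l, #(dif bt S u (f u)) ≤ Δ) →
        elimCost bt T (l.map fun u => (u, f u)) ≤ l.length * Δ) := by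
  induction l generalizing T with
  | nil => simp [ElimTo, elimCost]
  | cons u l ih =>
    obtain ⟨h1, h2, h3⟩ := h u (by simp)
    rw [List.nodup_cons] at hl
    obtain ⟨i1, i2⟩ := ih hl.2 (T.erase u) ((erase_subset _ _).trans hT) (by
      intro x hx
      obtain ⟨k1, k2, k3⟩ := h x (by simp [hx])
      simp only [List.mem_cons, not_or] at k3
      exact ⟨mem_erase.2 ⟨fun hh => hl.1 (hh ▸ hx), k1⟩, mem_erase.2 ⟨k3.1, k2⟩, k3.2⟩)
    simp only [List.mem_cons, not_or] at h3
    refine ⟨⟨h1, h2, fun hh => h3.1 hh.symm, ?_⟩, fun hd => ?_⟩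
    · have : T \ (u :: l).toFinset = T.erase u \ l.toFinset := by
        ext x
        simp only [List.toFinset_cons, mem_sdiff, mem_insert, mem_erase]
        tauto
      rw [this]
      exact i1
    · have j1 := i2 fun x hx => hd x (by simp [hx])
      have j2 := (dif_mono (bt := bt) (u := u) (v := f u) hT).trans (hd u (by simp))
      simp only [List.map_cons, elimCost, List.length_cons, Nat.add_mul, one_mul]
      omega

theorem elimTo_elimPairs (hS : S ⊆ range n) : ElimTo S (elimPairs bt n S X) (kept bt S X) := by
  have h := (elimTo_map (bt := bt) (S := S) (Δ := 0) (rep bt S X)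
    ((List.range n).filter fun u => u ∈ S ∧ rep bt S X u ≠ u) (List.nodup_range.filter _) S
    Subset.rfl (by
      intro u hu
      simp only [List.mem_filter, List.mem_range, decide_eq_true_eq] at hu
      have h1 := rep_mem_kept (bt := bt) (X := X) hu.2.1
      simp only [kept, mem_filter] at h1
      refine ⟨hu.2.1, h1.1, fun h2 => ?_⟩
      simp only [List.mem_filter, List.mem_range, decide_eq_true_eq] at h2
      exact h2.2.2 h1.2)).1
  have e : S \ ((List.range n).filter fun u => u ∈ S ∧ rep bt S X u ≠ u).toFinset = kept bt S X := by
    ext x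
    simp only [mem_sdiff, List.mem_toFinset, List.mem_filter, List.mem_range, decide_eq_true_eq,
      kept, mem_filter]
    constructor
    · rintro ⟨h1, h2⟩
      refine ⟨h1, ?_⟩
      by_contra h3
      exact h2 ⟨mem_range.1 (hS h1), h1, h3⟩
    · rintro ⟨h1, h2⟩
      exact ⟨h1, fun h3 => h3.2.2 h2⟩
  rw [e] at h
  exact h

theorem elimCost_elimPairs_le {Δ : ℕ} (h : ∀ u ∈ S, #(dif bt S u (rep bt S X u)) ≤ Δ) :
    elimCost bt S (elimPairs bt n S X) ≤ (elimPairs bt n S X).length * Δ := by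
  have := (elimTo_map (bt := bt) (S := S) (Δ := Δ) (rep bt S X)
    ((List.range n).filter fun u => u ∈ S ∧ rep bt S X u ≠ u) (List.nodup_range.filter _) S
    Subset.rfl (by
      intro u hu
      simp only [List.mem_filter, List.mem_range, decide_eq_true_eq] at hu
      have h1 := rep_mem_kept (bt := bt) (X := X) hu.2.1
      simp only [kept, mem_filter] at h1
      refine ⟨hu.2.1, h1.1, fun h2 => ?_⟩
      simp only [List.mem_filter, List.mem_range, decide_eq_true_eq] at h2
      exact h2.2.2 h1.2)).2 (by
      intro u hu
      simp only [List.mem_filter, List.mem_range, decide_eq_true_eq] at hu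
      exact h u hu.2.1)
  simpa [elimPairs] using this

/-- The pairs eliminated in the first `r` trials. -/
noncomputable def elims (bt : ℕ → ℕ → ℕ) (n q : ℕ) (ρ : ℕ → ℕ) : ℕ → List (ℕ × ℕ)
  | 0 => []
  | r + 1 => elims bt n q ρ r ++ elimPairs bt n (remain bt n q (range n) ρ r)
      (smp n q (shiftF (r * q) ρ) (remain bt n q (range n) ρ r))

/-- The complete elimination sequence. -/
noncomputable def allElims (bt : ℕ → ℕ → ℕ) (n q R : ℕ) (ρ : ℕ → ℕ) : List (ℕ × ℕ) :=
  elims bt n q ρ R ++ elimPairs bt n (remain bt n q (range n) ρ R) ∅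

theorem elimTo_elims (ρ : ℕ → ℕ) (r : ℕ) :
    ElimTo (range n) (elims bt n q ρ r) (remain bt n q (range n) ρ r) := by
  induction r with
  | zero => rfl
  | succ r ih => exact ih.append (elimTo_elimPairs (remain_subset _ _ _))

theorem elimCost_elims_le {Δ : ℕ} (ρ : ℕ → ℕ) (r : ℕ)
    (h : ∀ i < r, ¬ BadTrial bt n q Δ (range n) ρ i) :
    elimCost bt (range n) (elims bt n q ρ r) ≤ (elims bt n q ρ r).length * Δ := by
  induction r with
  | zero => simp [elims, elimCost]
  | succ r ih =>
    have h1 := ih fun i hi => h i (by omega)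
    have h2 : elimCost bt (remain bt n q (range n) ρ r) (elimPairs bt n (remain bt n q (range n) ρ r)
        (smp n q (shiftF (r * q) ρ) (remain bt n q (range n) ρ r))) ≤ _ :=
      elimCost_elimPairs_le (Δ := Δ) fun u hu => by
        by_contra h3
        exact h r (by omega) ⟨u, hu, not_le.1 h3⟩
    rw [elims, (elimTo_elims ρ r).cost_append, List.length_append, Nat.add_mul]
    omega

/-- Representatives are least members, so `0` always represents itself. Hence every complete
elimination ends in `{0}`, and `0` can serve as the fixed head of the order. -/
theorem zero_mem_remain (hn : 0 < n) (ρ : ℕ → ℕ) (r : ℕ) : 0 ∈ remain bt n q (range n) ρ r := by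
  induction r with
  | zero => simpa [remain] using hn
  | succ r ih =>
    simp only [remain, kept, mem_filter]
    exact ⟨ih, Nat.le_zero.1 (rep_le ih fun _ _ => rfl)⟩

theorem kept_empty (h : 0 ∈ S) : kept bt S ∅ = {0} := by
  have h0 : ∀ u, rep bt S ∅ u = 0 := fun u => Nat.le_zero.1 (rep_le h (by simp))
  ext u
  simp only [kept, h0, mem_filter, mem_singleton]
  constructor
  · rintro ⟨-, h⟩; exact h.symm
  · rintro rfl; exact ⟨h, rfl⟩

theorem elimTo_allElims (hn : 0 < n) (R : ℕ) (ρ : ℕ → ℕ) :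
    ElimTo (range n) (allElims bt n q R ρ) {0} := by
  refine (elimTo_elims ρ R).append ?_
  rw [← kept_empty (bt := bt) (zero_mem_remain hn ρ R)]
  exact elimTo_elimPairs (remain_subset _ _ _)

/-- Pairs from trials that are not bad cost at most `Δ` each. The pairs of the last round, which has
no samples, cost at most the number of vertices left over. There are fewer than `n` pairs in all. -/
theorem elimCost_allElims_le {Δ R : ℕ} (hn : 0 < n) (ρ : ℕ → ℕ)
    (h : ∀ i < R, ¬ BadTrial bt n q Δ (range n) ρ i)
    (hR : #(remain bt n q (range n) ρ R) ≤ Δ) :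
    elimCost bt (range n) (allElims bt n q R ρ) ≤ n * Δ := by
  have h1 := elimCost_elims_le ρ R h
  have h2 : elimCost bt (remain bt n q (range n) ρ R) (elimPairs bt n
      (remain bt n q (range n) ρ R) ∅) ≤ _ :=
    elimCost_elimPairs_le (Δ := Δ) fun u _ => (card_filter_le _ _).trans hR
  have h3 := (elimTo_allElims (bt := bt) (q := q) hn R ρ).card
  rw [allElims, List.length_append, card_range] at h3
  rw [allElims, (elimTo_elims ρ R).cost_append]
  calc _ ≤ ((elims bt n q ρ R).length + (elimPairs bt n (remain bt n q (range n) ρ R) ∅).length) * Δ := by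
        rw [Nat.add_mul]; omega
    _ ≤ n * Δ := Nat.mul_le_mul_right _ (by omega)

/-! ### The vertex order of an elimination sequence -/

/-- Insert `u` behind `v`. -/
def insAfter {α : Type*} [DecidableEq α] (v u : α) : List α → List α
  | [] => []
  | x :: l => if x = v then x :: u :: l else x :: insAfter v u l

/-- The vertex order of an elimination sequence. -/
def ord : List (ℕ × ℕ) → List ℕ
  | [] => [0]
  | p :: L => insAfter p.2 p.1 (ord L)

section insAfter
variable {α : Type*} [DecidableEq α] {u v : α}

theorem mem_insAfter {l : List α} (hv : v ∈ l) {x : α} :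
    x ∈ insAfter v u l ↔ x = u ∨ x ∈ l := by
  induction l with
  | nil => simp at hv
  | cons y l ih =>
    rw [insAfter]
    split_ifs with h
    · simp only [List.mem_cons]; tauto
    · have : v ∈ l := by
        rcases List.mem_cons.1 hv with h' | h'
        · exact absurd h'.symm h
        · exact h'
      simp only [List.mem_cons, ih this]; tauto

theorem nodup_insAfter {l : List α} (hv : v ∈ l) (hu : u ∉ l) (hl : l.Nodup) :
    (insAfter v u l).Nodup := by
  induction l with
  | nil => simp at hv
  | cons y l ih =>
    rw [insAfter]
    rw [List.nodup_cons] at hl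
    simp only [List.mem_cons, not_or] at hu
    split_ifs with h
    · simp only [List.nodup_cons, List.mem_cons, not_or]
      exact ⟨⟨fun h => hu.1 h.symm, hl.1⟩, hu.2, hl.2⟩
    · have : v ∈ l := by
        rcases List.mem_cons.1 hv with h' | h'
        · exact absurd h'.symm h
        · exact h'
      rw [List.nodup_cons, mem_insAfter this, not_or]
      exact ⟨⟨fun h => hu.1 h.symm, hl.1⟩, ih this hu.2 hl.2⟩

theorem insAfter_map {β : Type*} [DecidableEq β] (f : α → β) (hf : f.Injective) (l : List α) :
    (insAfter v u l).map f = insAfter (f v) (f u) (l.map f) := by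
  induction l with
  | nil => rfl
  | cons y l ih =>
    simp only [insAfter, List.map_cons, hf.eq_iff]
    split_ifs <;> simp [ih]

theorem insAfter_append {l : List α} (hv : v ∈ l) (l' : List α) :
    insAfter v u (l ++ l') = insAfter v u l ++ l' := by
  induction l with
  | nil => simp at hv
  | cons y l ih =>
    simp only [insAfter, List.cons_append]
    split_ifs with h
    · rfl
    · have : v ∈ l := by
        rcases List.mem_cons.1 hv with h' | h'
        · exact absurd h'.symm h
        · exact h'
      rw [ih this, List.cons_append]

end insAfter

theorem ElimTo.ord_spec {L : List (ℕ × ℕ)} (h : ElimTo S L {0}) :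
    (ord L).Nodup ∧ ∀ x, x ∈ ord L ↔ x ∈ S := by
  induction L generalizing S with
  | nil => simp [ord, show S = {0} from h]
  | cons p L ih =>
    obtain ⟨h1, h2, h3, h4⟩ := h
    obtain ⟨i1, i2⟩ := ih h4
    have hv : p.2 ∈ ord L := (i2 _).2 (mem_erase.2 ⟨h3.symm, h2⟩)
    have hu : p.1 ∉ ord L := fun h => by simpa using (i2 _).1 h
    refine ⟨nodup_insAfter hv hu i1, fun x => ?_⟩
    rw [ord, mem_insAfter hv, i2, mem_erase]
    by_cases hx : x = p.1
    · simp [hx, h1]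
    · simp [hx]

/-! ### Windows of the adjacency matrix -/

/-- The sum of `f` over all pairs of consecutive elements. -/
def adjSum {α : Type*} (f : α → α → ℕ) : List α → ℕ
  | x :: y :: l => f x y + adjSum f (y :: l)
  | _ => 0

section adjSum
variable {α : Type*}

theorem adjSum_mono {f g : α → α → ℕ} (h : ∀ x y, f x y ≤ g x y) (l : List α) :
    adjSum f l ≤ adjSum g l := by
  induction l with
  | nil => exact le_rfl
  | cons x l ih =>
    cases l with
    | nil => exact le_rfl
    | cons y l => exact add_le_add (h x y) ih

theorem adjSum_add (f g : α → α → ℕ) (l : List α) :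
    adjSum (fun x y => f x y + g x y) l = adjSum f l + adjSum g l := by
  induction l with
  | nil => rfl
  | cons x l ih =>
    cases l with
    | nil => rfl
    | cons y l => simp only [adjSum] at ih ⊢; omega

theorem adjSum_endpoints_le (δ : α → ℕ) (l : List α) :
    adjSum (fun x y => δ x + δ y) l ≤ 2 * (l.map δ).sum := by
  suffices h : ∀ x, adjSum (fun x y => δ x + δ y) (x :: l) + δ x ≤ 2 * ((x :: l).map δ).sum by
    cases l with
    | nil => simp [adjSum]
    | cons x l =>
      clear h
      suffices h : ∀ x, adjSum (fun x y => δ x + δ y) (x :: l) + δ x ≤ 2 * ((x :: l).map δ).sum by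
        have := h x; omega
      induction l with
      | nil => intro x; simp [adjSum]; omega
      | cons y l ih =>
        intro x
        have := ih y
        simp only [adjSum, List.map_cons, List.sum_cons] at this ⊢
        omega
  induction l with
  | nil => intro x; simp [adjSum]; omega
  | cons y l ih =>
    intro x
    have := ih y
    simp only [adjSum, List.map_cons, List.sum_cons] at this ⊢
    omega

/-- The pair `(v, y)` is replaced by `(v, u)` and `(u, y)`; each of the two changes adds at most
`A`. -/
theorem adjSum_insAfter_le [DecidableEq α] {f : α → α → ℕ} {u v : α} {A : ℕ} (h1 : f v u ≤ A)
    (h2 : ∀ y, f u y ≤ f v y + A) (l : List α) :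
    adjSum f (insAfter v u l) ≤ adjSum f l + 2 * A := by
  induction l with
  | nil => simp [insAfter, adjSum]
  | cons x l ih =>
    cases l with
    | nil =>
      simp only [insAfter]
      split_ifs with h
      · subst h; simp [adjSum]; omega
      · simp [adjSum]
    | cons y l =>
      rw [insAfter]
      split_ifs with h
      · subst h
        have := h2 y
        simp only [adjSum]
        omega
      · have : ∃ t, insAfter v u (y :: l) = y :: t := by
          rw [insAfter]; split_ifs <;> exact ⟨_, rfl⟩
        obtain ⟨t, ht⟩ := this
        rw [ht] at ih ⊢
        simp only [adjSum]
        omega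

theorem adjSum_eq_sum (f : α → α → ℕ) (d : α) (l : List α) :
    adjSum f l = ∑ k ∈ range (l.length - 1), f (l.getD k d) (l.getD (k + 1) d) := by
  induction l with
  | nil => simp [adjSum]
  | cons x l ih =>
    cases l with
    | nil => simp [adjSum]
    | cons y l =>
      rw [adjSum, ih]
      simp only [List.length_cons, Nat.add_sub_cancel]
      rw [sum_range_succ', add_comm]
      simp

end adjSum

/-- The matrix `bt`, with zeros at `none`. -/
def obt (bt : ℕ → ℕ → ℕ) : Option ℕ → Option ℕ → ℕ
  | some x, some y => bt x y
  | _, _ => 0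

/-- `1` if the two rows of a window or its two columns are equal, else `0`. -/
def window (a b c d : ℕ) : ℕ := if (a = c ∧ b = d) ∨ (a = b ∧ c = d) then 0 else 1

/-- The number of windows with distinct rows and distinct columns. -/
def corners (bt : ℕ → ℕ → ℕ) (l : List (Option ℕ)) : ℕ :=
  adjSum (fun x x' => adjSum (fun y y' =>
    window (obt bt x y) (obt bt x y') (obt bt x' y) (obt bt x' y')) l) l

/-- A list with `none` before and after it. -/
def pad (l : List ℕ) : List (Option ℕ) := none :: (l.map some ++ [none])

theorem obt_symm (h : ∀ x y, bt x y = bt y x) (x y : Option ℕ) : obt bt x y = obt bt y x := by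
  cases x <;> cases y <;> simp [obt, h]

/-- Whether a vertex tells `u` and `v` apart. -/
def tells (bt : ℕ → ℕ → ℕ) (u v : Option ℕ) (z : Option ℕ) : ℕ :=
  if obt bt u z = obt bt v z then 0 else 1

theorem window_row_le {a b c d a' b' : ℕ} :
    window a' b' c d ≤ window a b c d + ((if a' = a then 0 else 1) + if b' = b then 0 else 1) := by
  by_cases h1 : a' = a <;> by_cases h2 : b' = b <;> simp only [h1, h2, if_true, if_false] <;>
    unfold window <;> split_ifs <;> omega

theorem window_row_same {a b a' b' : ℕ} :
    window a' b' a b ≤ (if a = a' then 0 else 1) + if b = b' then 0 else 1 := by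
  unfold window; split_ifs <;> simp_all

theorem window_transpose (a b c d : ℕ) : window a b c d = window a c b d := by
  unfold window
  congr 1
  rw [or_comm]

theorem adjSum_le_of_le {α : Type*} {f g : α → α → ℕ} {δ : α → ℕ}
    (h : ∀ x y, f x y ≤ g x y + (δ x + δ y)) (l : List α) :
    adjSum f l ≤ adjSum g l + 2 * (l.map δ).sum := by
  have h1 := adjSum_mono h l
  have h2 := adjSum_endpoints_le δ l
  have h3 := adjSum_add g (fun x y => δ x + δ y) l
  omega

theorem adjSum_zero {α : Type*} (l : List α) : adjSum (fun _ _ => 0) l = 0 := by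
  induction l with
  | nil => rfl
  | cons x l ih =>
    cases l with
    | nil => rfl
    | cons y l => simpa [adjSum] using ih

theorem pad_insAfter {u v : ℕ} {l : List ℕ} (hv : v ∈ l) :
    pad (insAfter v u l) = none :: (insAfter (some v) (some u) (l.map some ++ [none])) := by
  rw [pad, insAfter_map some (Option.some_injective _), insAfter_append (by simpa using hv)]

/-- Row and column `u` are near copies of row and column `v`. Inserting the row and inserting the
column each create at most 4 windows per vertex that tells `u` and `v` apart. -/
theorem corners_insAfter_le (hs : ∀ x y, bt x y = bt y x) {u v : ℕ} {l : List ℕ} (hv : v ∈ l) :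
    corners bt (pad (insAfter v u l)) ≤
      corners bt (pad l) + 8 * ((pad (insAfter v u l)).map (tells bt (some u) (some v))).sum := by
  set δ := tells bt (some u) (some v) with hδ
  set P := pad l with hP
  set P' := pad (insAfter v u l) with hP'
  have hPP' : P' = insAfter (some v) (some u) P := by
    rw [hP', pad_insAfter hv, hP, pad, insAfter, if_neg (by simp)]
  have hle : (P.map δ).sum ≤ (P'.map δ).sum := by
    have : ∀ Q : List (Option ℕ), (Q.map δ).sum ≤ ((insAfter (some v) (some u) Q).map δ).sum := by
      intro Q
      induction Q with
      | nil => exact le_rfl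
      | cons x Q ih => rw [insAfter]; split_ifs <;> simp <;> omega
    rw [hPP']
    exact this P
  set w : Option ℕ → Option ℕ → Option ℕ → Option ℕ → ℕ := fun x x' y y' =>
    window (obt bt x y) (obt bt x y') (obt bt x' y) (obt bt x' y') with hw
  -- Only the row order changes here, with columns already in the new order. A distinguishing column
  -- lies in at most two windows of a pair of rows, and `adjSum_insAfter_le` doubles this.
  have row : adjSum (fun x x' => adjSum (w x x') P') P' ≤
      adjSum (fun x x' => adjSum (w x x') P') P + 2 * (2 * (P'.map δ).sum) := by
    conv_lhs => arg 2; rw [hPP']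
    refine adjSum_insAfter_le ?_ ?_ P
    · have h1 := adjSum_le_of_le (f := w (some v) (some u)) (g := fun _ _ => 0) (δ := δ) (by
        intro y y'
        rw [zero_add]
        exact window_row_same) P'
      rw [adjSum_zero, zero_add] at h1
      exact h1
    · intro z
      exact adjSum_le_of_le (f := w (some u) z) (g := w (some v) z) (δ := δ)
        (fun y y' => window_row_le) P'
  have hsym : ∀ x x' y y', w x x' y y' = w y y' x x' := by
    intro x x' y y'
    simp only [hw, obt_symm hs y, obt_symm hs y']
    exact window_transpose _ _ _ _
  -- For fixed consecutive rows the inserted column costs twice the number of these rows that tell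
  -- `u` and `v` apart; summing over pairs of rows doubles it again.
  have col : ∀ x x', adjSum (w x x') P' ≤ adjSum (w x x') P + (2 * δ x + 2 * δ x') := by
    intro x x'
    have := adjSum_insAfter_le (f := w x x') (u := some u) (v := some v) (A := δ x + δ x')
      (by rw [hsym]; exact window_row_same)
      (fun y => by rw [hsym x x' _ y, hsym x x' _ y]; exact window_row_le) P
    rw [← hPP'] at this
    omega
  have col' := adjSum_le_of_le (δ := fun x => 2 * δ x) col P
  rw [List.sum_map_mul_left] at col'
  show adjSum (fun x x' => adjSum (w x x') P') P' ≤ adjSum (fun x x' => adjSum (w x x') P) P + _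
  omega

theorem sum_tells {u v : ℕ} {l : List ℕ} (hl : l.Nodup) (h : ∀ x, x ∈ l ↔ x ∈ S) :
    ((pad l).map (tells bt (some u) (some v))).sum = #(dif bt S u v) := by
  have hS : S = l.toFinset := by ext x; simp [h]
  have h0 : tells bt (some u) (some v) none = 0 := by simp [tells, obt]
  simp only [pad, List.map_cons, List.map_append, List.map_nil, List.sum_cons, List.sum_append,
    List.sum_nil, h0, List.map_map]
  rw [dif, card_filter, hS, List.sum_toFinset _ hl]
  simp only [zero_add, add_zero]
  congr 1
  refine List.map_congr_left fun x _ => ?_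
  simp only [Function.comp_apply, tells, obt]
  split_ifs <;> simp_all

/-- Induction from the end of the elimination, where the order is `[0]` and the bordered matrix is
zero because `bt 0 0 = 0`. When `u` returns, the order comprises exactly `S`, so the bound of
`corners_insAfter_le` is 8 times the cost of the pair. -/
theorem corners_ord_le (hs : ∀ x y, bt x y = bt y x) (h0 : bt 0 0 = 0) {L : List (ℕ × ℕ)}
    (h : ElimTo S L {0}) : corners bt (pad (ord L)) ≤ 8 * elimCost bt S L := by
  induction L generalizing S with
  | nil => simp [ord, pad, corners, adjSum, obt, h0, window]
  | cons p L ih =>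
    have hsp := ElimTo.ord_spec h
    obtain ⟨h1, h2, h3, h4⟩ := h
    have i := ih h4
    have hv : p.2 ∈ ord L := (h4.ord_spec.2 _).2 (mem_erase.2 ⟨h3.symm, h2⟩)
    have := corners_insAfter_le hs (u := p.1) hv
    rw [ord, sum_tells hsp.1 hsp.2] at *
    rw [elimCost]
    omega

/-! ### Runs -/

/-- A matrix with zeros outside `{1, …, n}`. -/
structure IsBits (B : ℕ → ℕ → ℕ) (n : ℕ) : Prop where
  le_one : ∀ k p, B k p ≤ 1
  row : ∀ k p, B k p ≠ 0 → 1 ≤ k ∧ k ≤ n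
  col : ∀ k p, B k p ≠ 0 → 1 ≤ p ∧ p ≤ n

/-- `[p, e)` is a maximal interval of ones in row `k`. -/
structure Run (B : ℕ → ℕ → ℕ) (k p e : ℕ) : Prop where
  pos : 1 ≤ p
  lt : p < e
  left : B k (p - 1) = 0
  ones : ∀ x, p ≤ x → x < e → B k x = 1
  right : B k e = 0

/-- The end of the maximal interval of ones that starts at `p`, or `0`. -/
noncomputable def runEnd (B : ℕ → ℕ → ℕ) (k p : ℕ) : ℕ := sInf {e | Run B k p e}

variable {B : ℕ → ℕ → ℕ}

theorem Run.unique {k p e e' : ℕ} (h : Run B k p e) (h' : Run B k p e') : e = e' := by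
  by_contra hne
  rcases lt_or_gt_of_ne hne with hlt | hlt
  · have := h'.ones e h.lt.le hlt
    rw [h.right] at this; omega
  · have := h.ones e' h'.lt.le hlt
    rw [h'.right] at this; omega

theorem Run.runEnd_eq {k p e : ℕ} (h : Run B k p e) : runEnd B k p = e := by
  have : {e | Run B k p e} = {e} := by
    ext e'
    exact ⟨fun h' => h'.unique h, fun h' => by rw [Set.mem_singleton_iff] at h'; subst h'; exact h⟩
  rw [runEnd, this]
  exact csInf_singleton e

theorem run_runEnd {k p : ℕ} (h : runEnd B k p ≠ 0) : Run B k p (runEnd B k p) := by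
  have : {e | Run B k p e}.Nonempty := by
    by_contra hne
    rw [Set.not_nonempty_iff_eq_empty] at hne
    exact h (by rw [runEnd, hne, Nat.sInf_empty])
  exact Nat.sInf_mem this

theorem runEnd_eq_iff {k p e : ℕ} (he : e ≠ 0) : runEnd B k p = e ↔ Run B k p e :=
  ⟨fun h => h ▸ run_runEnd (h ▸ he), Run.runEnd_eq⟩

/-- The run that starts at `p` in row `k` does not continue in the next row. -/
def Stops (B : ℕ → ℕ → ℕ) (k p : ℕ) : Prop :=
  runEnd B k p ≠ 0 ∧ runEnd B (k + 1) p ≠ runEnd B k p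

/-- Suppose that all windows along the run have equal rows or equal columns. At its left end row `k`
reads 0, 1, so the columns differ and the rows must agree. Along the run, a one in the next row then
forces the following one. At the right end row `k` reads 1, 0, so the rows agree again. Thus the
next row has the same run. -/
theorem exists_window_of_stops {k p : ℕ} (h : Stops B k p) :
    ∃ x, p - 1 ≤ x ∧ x < runEnd B k p ∧
      window (B k x) (B k (x + 1)) (B (k + 1) x) (B (k + 1) (x + 1)) = 1 := by
  by_contra hcon
  push Not at hcon
  have hr := run_runEnd h.1
  set e := runEnd B k p with he
  have hw : ∀ x, p - 1 ≤ x → x < e → (B k x = B (k + 1) x ∧ B k (x + 1) = B (k + 1) (x + 1)) ∨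
      (B k x = B k (x + 1) ∧ B (k + 1) x = B (k + 1) (x + 1)) := by
    intro x h1 h2
    have := hcon x h1 h2
    unfold window at this
    by_contra h3
    rw [if_neg h3] at this
    exact this rfl
  have hp := hr.pos
  have hlt := hr.lt
  have hl := hr.left
  have h0 := hw (p - 1) le_rfl (by omega)
  rw [Nat.sub_add_cancel hp, hl, hr.ones p le_rfl hlt] at h0
  have hones : ∀ x, p ≤ x → x < e → B (k + 1) x = 1 := by
    intro x hx
    induction x, hx using Nat.le_induction with
    | base => intro _; omega
    | succ x hx ih =>
      intro hxe
      have h1 := ih (by omega)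
      have h2 := hw x (by omega) (by omega)
      rw [hr.ones x hx (by omega), hr.ones (x + 1) (by omega) hxe] at h2
      omega
  have hend := hw (e - 1) (by omega) (by omega)
  rw [Nat.sub_add_cancel (by omega), hr.ones (e - 1) (by omega) (by omega), hr.right] at hend
  have hend' : B (k + 1) e = 0 := by
    rcases hend with h | h
    · exact h.2.symm
    · exact absurd h.1 one_ne_zero
  refine h.2 ?_
  exact (Run.runEnd_eq ⟨hp, hlt, by omega, hones, hend'⟩)

-- The window for a run `[p, e)` starts in `[p - 1, e)`. For different runs of a row these intervals
-- are disjoint, since a zero precedes each run; so different stops get different windows.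
open Classical in
theorem card_stops_le (hB : IsBits B n) :
    #{x ∈ Icc 1 n ×ˢ Icc 1 n | Stops B x.1 x.2} ≤
      ∑ k ∈ range (n + 1), ∑ x ∈ range (n + 1),
        window (B k x) (B k (x + 1)) (B (k + 1) x) (B (k + 1) (x + 1)) := by
  choose! f hf using fun (y : ℕ × ℕ) (hy : Stops B y.1 y.2) => exists_window_of_stops hy
  have h1 : #{x ∈ range (n + 1) ×ˢ range (n + 1) |
      window (B x.1 x.2) (B x.1 (x.2 + 1)) (B (x.1 + 1) x.2) (B (x.1 + 1) (x.2 + 1)) = 1} =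
      ∑ k ∈ range (n + 1), ∑ x ∈ range (n + 1),
        window (B k x) (B k (x + 1)) (B (k + 1) x) (B (k + 1) (x + 1)) := by
    rw [card_filter, sum_product]
    refine sum_congr rfl fun k _ => sum_congr rfl fun x _ => ?_
    unfold window
    split_ifs <;> simp_all
  rw [← h1]
  refine card_le_card_of_injOn (fun y => (y.1, f y)) ?_ ?_
  · intro y hy
    simp only [coe_filter, mem_product, mem_Icc, Set.mem_ofPred_eq] at hy
    simp only [coe_filter, mem_product, mem_range, Set.mem_ofPred_eq]
    have h2 := hf y hy.2
    have hr := run_runEnd hy.2.1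
    have h3 := hr.lt
    have h4 := (hB.col y.1 (runEnd B y.1 y.2 - 1)
      (by rw [hr.ones _ (by omega) (by omega)]; omega)).2
    exact ⟨⟨by omega, by omega⟩, h2.2.2⟩
  · intro y hy z hz hyz
    simp only [coe_filter, mem_product, mem_Icc, Set.mem_ofPred_eq] at hy hz
    simp only [Prod.mk.injEq] at hyz
    have hy2 := hf y hy.2
    have hz2 := hf z hz.2
    have hry := run_runEnd hy.2.1
    have hrz := run_runEnd hz.2.1
    rw [← hyz.1, ← hyz.2] at hz2
    rw [← hyz.1] at hrz
    refine Prod.ext hyz.1 ?_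
    by_contra hne
    have hpy := hry.pos
    have hpz := hrz.pos
    have := hry.lt
    have := hrz.lt
    have := hrz.left
    have := hry.left
    rcases lt_or_gt_of_ne hne with hlt | hlt
    · rcases Nat.lt_or_ge (z.2 - 1) (runEnd B y.1 y.2) with h5 | h5
      · have := hry.ones (z.2 - 1) (by omega) h5
        omega
      · omega
    · rcases Nat.lt_or_ge (y.2 - 1) (runEnd B y.1 z.2) with h5 | h5
      · have := hrz.ones (y.2 - 1) (by omega) h5
        omega
      · omega

/-- The permuted matrix with a border of zeros. -/
def permBits (bt : ℕ → ℕ → ℕ) (l : List ℕ) (k p : ℕ) : ℕ :=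
  obt bt ((pad l).getD k none) ((pad l).getD p none)

theorem pad_getD {l : List ℕ} {k : ℕ} : (pad l).getD k none = if k = 0 then none else l[k - 1]? := by
  cases k with
  | zero => simp [pad]
  | succ k =>
    simp only [pad, List.getD_cons_succ, Nat.add_sub_cancel, Nat.add_eq_zero_iff, one_ne_zero,
      and_false, if_false]
    rcases lt_trichotomy k l.length with h | h | h
    · rw [List.getD_append _ _ _ _ (by simpa using h)]
      simp [h]
    · simp [h]
    · rw [List.getD_eq_default _ _ (by simp; omega)]
      simp; omega

theorem isBits_permBits (h1 : ∀ x y, bt x y ≤ 1) (l : List ℕ) :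
    IsBits (permBits bt l) l.length := by
  have key : ∀ k, (pad l).getD k none ≠ none → 1 ≤ k ∧ k ≤ l.length := by
    intro k
    rw [pad_getD]
    split_ifs with h
    · simp
    · intro h2
      rw [ne_eq, List.getElem?_eq_none_iff] at h2
      omega
  refine ⟨fun k p => ?_, fun k p h => key k fun h' => ?_, fun k p h => key p fun h' => ?_⟩
  · unfold permBits
    cases (pad l).getD k none <;> cases (pad l).getD p none <;> simp [obt, h1]
  · exact h (by rw [permBits, h']; rfl)
  · refine h ?_
    rw [permBits, h']
    cases (pad l).getD k none <;> rfl

open Classical in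
theorem card_stops_le_corners (h1 : ∀ x y, bt x y ≤ 1) (l : List ℕ) :
    #{x ∈ Icc 1 l.length ×ˢ Icc 1 l.length | Stops (permBits bt l) x.1 x.2} ≤
      corners bt (pad l) := by
  refine (card_stops_le (isBits_permBits h1 l)).trans (le_of_eq ?_)
  rw [corners, adjSum_eq_sum _ none]
  have hlen : (pad l).length - 1 = l.length + 1 := by simp [pad]
  rw [hlen]
  refine sum_congr rfl fun k _ => ?_
  rw [adjSum_eq_sum _ none, hlen]
  rfl

end WordRAM

/-! ### The interval digraph and its construction -/

namespace WordRAM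

open Finset

/-! ### A sparse digraph that represents the matrix -/

/-- The node that leads to all columns in `[i, i + P)`. -/
def colN (m P i : ℕ) : ℕ := 2 * (P * m + i)

/-- The node that can be reached from all rows in `[i, i + P)`. -/
def rowN (m P i : ℕ) : ℕ := 2 * (P * m + i) + 1

theorem node_inj {m P i P' i' : ℕ} (hi : i < m) (hi' : i' < m) (h : P * m + i = P' * m + i') :
    P = P' ∧ i = i' := by
  have h1 : (P * m + i) / m = P := by
    rw [mul_comm, Nat.mul_add_div (by omega), Nat.div_eq_of_lt hi, add_zero]
  have h2 : (P' * m + i') / m = P' := by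
    rw [mul_comm, Nat.mul_add_div (by omega), Nat.div_eq_of_lt hi', add_zero]
  have : P = P' := by rw [← h1, ← h2, h]
  subst this
  exact ⟨rfl, by omega⟩

/-- Edges that agree with the matrix `B`. -/
inductive SoundEdge (B : ℕ → ℕ → ℕ) (m : ℕ) : ℕ × ℕ → Prop where
  | row {P i P' i' : ℕ} (hi : i < m) (hi' : i' < m) (hP : P' ≤ m) (h : i' ≤ i) (h' : i + P ≤ i' + P') :
      SoundEdge B m (rowN m P i, rowN m P' i')
  | col {P i P' i' : ℕ} (hi : i < m) (hi' : i' < m) (hP : P' ≤ m) (h : i ≤ i') (h' : i' + P' ≤ i + P) :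
      SoundEdge B m (colN m P i, colN m P' i')
  | rect {P i P' i' : ℕ} (hi : i < m) (hi' : i' < m) (hP : P' ≤ m)
      (h : ∀ k j, i ≤ k → k < i + P → i' ≤ j → j < i' + P' → B k j = 1) :
      SoundEdge B m (rowN m P i, colN m P' i')

theorem SoundEdge.target_le {B : ℕ → ℕ → ℕ} {m x y : ℕ} (h : SoundEdge B m (x, y)) :
    y ≤ 2 * (m * m + m) + 1 := by
  generalize he : (x, y) = e at h
  cases h with
  | row hi hi' hP h h' =>
    have := Nat.mul_le_mul_right m hP
    simp only [rowN, Prod.mk.injEq] at he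
    omega
  | col hi hi' hP h h' =>
    have := Nat.mul_le_mul_right m hP
    simp only [colN, Prod.mk.injEq] at he
    omega
  | rect hi hi' hP h =>
    have := Nat.mul_le_mul_right m hP
    simp only [colN, Prod.mk.injEq] at he
    omega

/-- Reachability. -/
def Reach (E : List (ℕ × ℕ)) : ℕ → ℕ → Prop := Relation.ReflTransGen fun x y => (x, y) ∈ E

variable {B : ℕ → ℕ → ℕ} {n m : ℕ} {E : List (ℕ × ℕ)}

/-- An invariant along paths from the leaf of row `k`: a row node that is reached has an interval
containing `k`, and a column node that is reached has an interval on which row `k` is all ones.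
Parity of the numbers keeps the two kinds of nodes apart. -/
theorem Reach.sound (hE : ∀ e ∈ E, SoundEdge B m e) {k x : ℕ} (hk : k < m)
    (h : Reach E (rowN m 1 k) x) :
    (∃ P i, i < m ∧ x = rowN m P i ∧ i ≤ k ∧ k < i + P) ∨
      ∃ P i, i < m ∧ x = colN m P i ∧ ∀ j, i ≤ j → j < i + P → B k j = 1 := by
  induction h with
  | refl => exact Or.inl ⟨1, k, hk, rfl, le_rfl, by omega⟩
  | @tail x y _ hxy ih =>
    generalize he : (x, y) = e at hxy
    cases hE e hxy with
    | @row P i P' i' hi hi' hP h h' =>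
      simp only [Prod.mk.injEq] at he
      rcases ih with ⟨P₁, i₁, h1, h2, h3, h4⟩ | ⟨P₁, i₁, h1, h2, h3⟩
      · rw [h2, rowN, rowN] at he
        have hh : P₁ * m + i₁ = P * m + i := by omega
        obtain ⟨rfl, rfl⟩ := node_inj h1 hi hh
        exact Or.inl ⟨P', i', hi', he.2, by omega, by omega⟩
      · rw [h2, rowN, colN] at he
        omega
    | @col P i P' i' hi hi' hP h h' =>
      simp only [Prod.mk.injEq] at he
      rcases ih with ⟨P₁, i₁, h1, h2, h3, h4⟩ | ⟨P₁, i₁, h1, h2, h3⟩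
      · rw [h2, rowN, colN] at he
        omega
      · rw [h2, colN, colN] at he
        have hh : P₁ * m + i₁ = P * m + i := by omega
        obtain ⟨rfl, rfl⟩ := node_inj h1 hi hh
        exact Or.inr ⟨P', i', hi', he.2, fun j h5 h6 => h3 j (by omega) (by omega)⟩
    | @rect P i P' i' hi hi' hP h =>
      simp only [Prod.mk.injEq] at he
      rcases ih with ⟨P₁, i₁, h1, h2, h3, h4⟩ | ⟨P₁, i₁, h1, h2, h3⟩
      · rw [h2, rowN, rowN] at he
        have hh : P₁ * m + i₁ = P * m + i := by omega
        obtain ⟨rfl, rfl⟩ := node_inj h1 hi hh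
        exact Or.inr ⟨P', i', hi', he.2, fun j h5 h6 => h k j h3 h4 h5 h6⟩
      · rw [h2, rowN, colN] at he
        omega

theorem Reach.sound_leaf (hE : ∀ e ∈ E, SoundEdge B m e) {k j : ℕ} (hk : k < m) (hj : j < m)
    (h : Reach E (rowN m 1 k) (colN m 1 j)) : B k j = 1 := by
  rcases h.sound hE hk with ⟨P₁, i₁, h1, h2, h3, h4⟩ | ⟨P₁, i₁, h1, h2, h3⟩
  · simp only [rowN, colN] at h2; omega
  · simp only [colN] at h2
    have hh : 1 * m + j = P₁ * m + i₁ := by omega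
    obtain ⟨rfl, rfl⟩ := node_inj hj h1 hh
    exact h3 j le_rfl (by omega)

/-- The edges between intervals of lengths `2 ^ h` and `2 ^ (h + 1)`. -/
def HasTable (n m : ℕ) (E : List (ℕ × ℕ)) (h : ℕ) : Prop :=
  ∀ i, 1 ≤ i → i + 2 ^ (h + 1) ≤ n + 1 →
    (colN m (2 ^ (h + 1)) i, colN m (2 ^ h) i) ∈ E ∧
    (colN m (2 ^ (h + 1)) i, colN m (2 ^ h) (i + 2 ^ h)) ∈ E ∧
    (rowN m (2 ^ h) i, rowN m (2 ^ (h + 1)) i) ∈ E ∧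
    (rowN m (2 ^ h) (i + 2 ^ h), rowN m (2 ^ (h + 1)) i) ∈ E

/-- The edges for the rows `[a, k]` and the columns `[p, e)`. -/
def HasRect (m : ℕ) (E : List (ℕ × ℕ)) (a k p e : ℕ) : Prop :=
  ∃ g h, 2 ^ g ≤ k + 1 - a ∧ k + 1 - a < 2 * 2 ^ g ∧ 2 ^ h ≤ e - p ∧ e - p < 2 * 2 ^ h ∧
    (rowN m (2 ^ g) a, colN m (2 ^ h) p) ∈ E ∧
    (rowN m (2 ^ g) a, colN m (2 ^ h) (e - 2 ^ h)) ∈ E ∧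
    (rowN m (2 ^ g) (k + 1 - 2 ^ g), colN m (2 ^ h) p) ∈ E ∧
    (rowN m (2 ^ g) (k + 1 - 2 ^ g), colN m (2 ^ h) (e - 2 ^ h)) ∈ E

/-- Row `a` is the first of the consecutive rows up to `k` with the run that starts at `p` in row
`k`. -/
def IsTop (B : ℕ → ℕ → ℕ) (k p a : ℕ) : Prop :=
  1 ≤ a ∧ a ≤ k ∧ (∀ x, a ≤ x → x ≤ k → runEnd B x p = runEnd B k p) ∧
    runEnd B (a - 1) p ≠ runEnd B k p

theorem reach_row (h : ∀ g, HasTable n m E g) (g i k : ℕ) (hi : 1 ≤ i) (hn : i + 2 ^ g ≤ n + 1)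
    (h1 : i ≤ k) (h2 : k < i + 2 ^ g) : Reach E (rowN m 1 k) (rowN m (2 ^ g) i) := by
  induction g generalizing i with
  | zero =>
    have : k = i := by simp at h2; omega
    subst this
    exact .refl
  | succ g ih =>
    obtain ⟨-, -, h3, h4⟩ := h g i hi hn
    rw [pow_succ] at hn h2
    rcases Nat.lt_or_ge k (i + 2 ^ g) with hk | hk
    · exact (ih i hi (by omega) h1 hk).tail h3
    · exact (ih (i + 2 ^ g) (by omega) (by omega) hk (by omega)).tail h4

theorem reach_col (h : ∀ g, HasTable n m E g) (g i k : ℕ) (hi : 1 ≤ i) (hn : i + 2 ^ g ≤ n + 1)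
    (h1 : i ≤ k) (h2 : k < i + 2 ^ g) : Reach E (colN m (2 ^ g) i) (colN m 1 k) := by
  induction g generalizing i with
  | zero =>
    have : k = i := by simp at h2; omega
    subst this
    exact .refl
  | succ g ih =>
    obtain ⟨h3, h4, -, -⟩ := h g i hi hn
    rw [pow_succ] at hn h2
    rcases Nat.lt_or_ge k (i + 2 ^ g) with hk | hk
    · exact .head h3 (ih i hi (by omega) h1 hk)
    · exact .head h4 (ih (i + 2 ^ g) (by omega) (by omega) hk (by omega))

/-- An interval with length in `[2 ^ g, 2 * 2 ^ g)` is the union of its first and its last `2 ^ g`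
elements. The four edges serve the four combinations for rows and columns. -/
theorem reach_rect (h : ∀ g, HasTable n m E g) {a k p e x y : ℕ} (hr : HasRect m E a k p e)
    (ha : 1 ≤ a) (hk : k ≤ n) (hp : 1 ≤ p) (he : e ≤ n + 1) (h1 : a ≤ x) (h2 : x ≤ k) (h3 : p ≤ y)
    (h4 : y < e) : Reach E (rowN m 1 x) (colN m 1 y) := by
  obtain ⟨g, g', a1, a2, a3, a4, e1, e2, e3, e4⟩ := hr
  have r1 : x < a + 2 ^ g → Reach E (rowN m 1 x) (rowN m (2 ^ g) a) := fun hx =>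
    reach_row h g a x ha (by omega) h1 hx
  have r2 : ¬ x < a + 2 ^ g → Reach E (rowN m 1 x) (rowN m (2 ^ g) (k + 1 - 2 ^ g)) := fun hx =>
    reach_row h g _ x (by omega) (by omega) (by omega) (by omega)
  have c1 : y < p + 2 ^ g' → Reach E (colN m (2 ^ g') p) (colN m 1 y) := fun hx =>
    reach_col h g' p y hp (by omega) h3 hx
  have c2 : ¬ y < p + 2 ^ g' → Reach E (colN m (2 ^ g') (e - 2 ^ g')) (colN m 1 y) := fun hx =>
    reach_col h g' _ y (by omega) (by omega) (by omega) (by omega)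
  by_cases hx : x < a + 2 ^ g <;> by_cases hy : y < p + 2 ^ g'
  · exact (r1 hx).trans (.head e1 (c1 hy))
  · exact (r1 hx).trans (.head e2 (c2 hy))
  · exact (r2 hx).trans (.head e3 (c1 hy))
  · exact (r2 hx).trans (.head e4 (c2 hy))

theorem exists_run (hB : IsBits B n) {k j : ℕ} (h : B k j = 1) :
    ∃ p e, Run B k p e ∧ p ≤ j ∧ j < e := by
  have hj := hB.col k j (by omega)
  have h1 : ∃ p, p ≤ j ∧ 1 ≤ p ∧ (∀ x, p ≤ x → x ≤ j → B k x = 1) := ⟨j, le_rfl, hj.1,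
    fun x h1 h2 => by rw [le_antisymm h2 h1]; exact h⟩
  have h2 : ∃ e, j < e ∧ B k e = 0 := ⟨n + 1, by omega, by
    by_contra hne; have := hB.col k (n + 1) hne; omega⟩
  classical
  obtain ⟨p1, p2, p3⟩ := Nat.find_spec h1
  obtain ⟨e1, e2⟩ := Nat.find_spec h2
  refine ⟨Nat.find h1, Nat.find h2, ⟨p2, by omega, ?_, fun x hx1 hx2 => ?_, e2⟩, p1, e1⟩
  · by_contra hne
    have hle := hB.le_one k (Nat.find h1 - 1)
    have hge := (hB.col k _ hne).1
    refine Nat.find_min h1 (m := Nat.find h1 - 1) (by omega) ⟨by omega, hge, fun x hx1 hx2 => ?_⟩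
    rcases Nat.lt_or_ge x (Nat.find h1) with hx | hx
    · have : x = Nat.find h1 - 1 := by omega
      rw [this]; omega
    · exact p3 x hx hx2
  · rcases Nat.lt_or_ge j x with hx | hx
    · have := Nat.find_min h2 hx2
      have hle := hB.le_one k x
      by_contra hne
      exact this ⟨hx, by omega⟩
    · exact p3 x hx1 hx

/-- The entry lies in a run of its row. Follow this run downwards to the last row that repeats it:
there it stops, and the rectangle belonging to this stop reaches up at least to row `k`. -/
theorem Reach.complete (hB : IsBits B n) (ht : ∀ g, HasTable n m E g)
    (hr : ∀ k p, Stops B k p → ∃ a, IsTop B k p a ∧ HasRect m E a k p (runEnd B k p))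
    {k j : ℕ} (h : B k j = 1) : Reach E (rowN m 1 k) (colN m 1 j) := by
  obtain ⟨p, e, hrun, hpj, hje⟩ := exists_run hB h
  have hre := hrun.runEnd_eq
  have hlt := hrun.lt
  have hkn := hB.row k j (by omega)
  -- The run must stop at some point because all rows below row `n` are zero.
  have h2 : ∃ d, runEnd B (k + d) p ≠ e := ⟨n + 1, fun h => by
    have hr' := (runEnd_eq_iff (by omega)).1 h
    have := hB.row _ p (by rw [hr'.ones p le_rfl hr'.lt]; omega)
    omega⟩
  classical
  set d := Nat.find h2 with hd
  have hd1 : runEnd B (k + d) p ≠ e := Nat.find_spec h2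
  have hd2 : ∀ d' < d, runEnd B (k + d') p = e := fun d' hd' => not_not.1 (Nat.find_min h2 hd')
  have hd0 : d ≠ 0 := fun h0 => by rw [h0] at hd1; exact hd1 hre
  have he' : runEnd B (k + (d - 1)) p = e := hd2 (d - 1) (by omega)
  have hst : Stops B (k + (d - 1)) p := by
    refine ⟨by omega, ?_⟩
    rw [he', show k + (d - 1) + 1 = k + d by omega]
    exact hd1
  obtain ⟨a, ⟨a1, a2, a3, a4⟩, hrect⟩ := hr _ _ hst
  rw [he'] at hrect a3 a4
  -- If the top row were below row `k`, the row just above it would also be among those with the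
  -- same run.
  have hak : a ≤ k := by
    by_contra hcon
    refine a4 ?_
    have := hd2 (a - 1 - k) (by omega)
    rwa [show k + (a - 1 - k) = a - 1 by omega] at this
  have hr' := (runEnd_eq_iff (by omega)).1 he'
  have b1 := hB.row _ p (by rw [hr'.ones p le_rfl hr'.lt]; omega)
  have b2 := hB.col _ (e - 1) (by rw [hr'.ones (e - 1) (by omega) (by omega)]; omega)
  exact reach_rect ht hrect a1 b1.2 hrun.pos (by omega) hak (by omega) hpj hje

theorem soundEdge_rect {k p a e i P i' P' : ℕ} (ht : IsTop B k p a) (he : runEnd B k p = e)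
    (he0 : e ≠ 0) (hi : i < m) (hi' : i' < m) (h1 : a ≤ i) (h2 : i + P ≤ k + 1) (h3 : p ≤ i')
    (h4 : i' + P' ≤ e) (hP : P' ≤ m) : SoundEdge B m (rowN m P i, colN m P' i') := by
  refine .rect hi hi' hP fun x y hx1 hx2 hy1 hy2 => ?_
  have hr := (runEnd_eq_iff he0).1 ((ht.2.2.1 x (by omega) (by omega)).trans he)
  exact hr.ones y (by omega) (by omega)

/-! ### Adjacency lists in memory -/

/-- The targets of the edges that start at `x`. -/
def targets (E : List (ℕ × ℕ)) (x : ℕ) : List ℕ := (E.filter fun e => e.1 = x).map Prod.snd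

theorem mem_targets {x y : ℕ} : y ∈ targets E x ↔ (x, y) ∈ E := by
  simp [targets]

/-- The linked list that starts at cell `e` has the entries `l`; all its cells are at most `cnt`. -/
def IsChain (cnt : ℕ) (nxt tgt : ℕ → ℕ) : ℕ → List ℕ → Prop
  | e, [] => e = 0
  | e, y :: l => e ≠ 0 ∧ e ≤ cnt ∧ tgt e = y ∧ IsChain cnt nxt tgt (nxt e) l

/-- The state contains adjacency lists for the edges in `E`. -/
structure AdjRep (a : ASt) (E : List (ℕ × ℕ)) : Prop where
  count : a.v 6 = E.length
  chain : ∀ x, IsChain E.length (a.arr 12) (a.arr 13) (a.arr 11 x) (targets E x)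

theorem IsChain.le {cnt : ℕ} {nxt tgt : ℕ → ℕ} {e : ℕ} {l : List ℕ} (h : IsChain cnt nxt tgt e l) :
    e ≤ cnt := by
  cases l with
  | nil => rw [show e = 0 from h]; exact Nat.zero_le _
  | cons y l => exact h.2.1

theorem IsChain.update {cnt : ℕ} {nxt tgt : ℕ → ℕ} {e : ℕ} {l : List ℕ} (x y : ℕ)
    (h : IsChain cnt nxt tgt e l) :
    IsChain (cnt + 1) (Function.update nxt (cnt + 1) x) (Function.update tgt (cnt + 1) y) e l := by
  induction l generalizing e with
  | nil => exact h
  | cons z l ih =>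
    obtain ⟨h1, h2, h3, h4⟩ := h
    have hne : e ≠ cnt + 1 := by omega
    exact ⟨h1, by omega, by rw [Function.update_of_ne hne]; exact h3,
      by rw [Function.update_of_ne hne]; exact ih h4⟩

/-- Add the edge from the node in variable `x` to the node in variable `y`. -/
def addEdge (x y : ℕ) : Prog :=
  block [.asg 6 (.var 6 + 1), .put 13 (.var 6) (.var y), .put 12 (.var 6) (.get 11 (.var x)),
    .put 11 (.var x) (.var 6)]

/-- Nothing has changed but the edge count and the adjacency lists. -/
structure EdgeFrame (a b : ASt) : Prop where
  v : ∀ z, z ≠ 6 → b.v z = a.v z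
  raw : b.raw = a.raw
  arr : ∀ id, id ≠ 11 → id ≠ 12 → id ≠ 13 → b.arr id = a.arr id

theorem EdgeFrame.trans {a b c : ASt} (h : EdgeFrame a b) (h' : EdgeFrame b c) : EdgeFrame a c :=
  ⟨fun z hz => (h'.v z hz).trans (h.v z hz), h'.raw.trans h.raw,
    fun id h1 h2 h3 => (h'.arr id h1 h2 h3).trans (h.arr id h1 h2 h3)⟩

/-- Array `11` holds the heads of the lists, array `12` the successors and array `13` the targets.
The edge count in variable `6` is also the index of the newest cell; cells start at 1, so that 0 can
mark the end of a list. -/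
theorem wp_addEdge {M : Mach} {x y : ℕ} {a : ASt} (h : AdjRep a E) (hx : x < 40) (hy : y < 40)
    (hx6 : x ≠ 6) (hy6 : y ≠ 6) (hxV : a.v x < M.V) (hE : E.length + 1 < M.V) :
    wp M (addEdge x y) (fun b => AdjRep b ((a.v x, a.v y) :: E) ∧ EdgeFrame a b ∧
      b.time ≤ a.time + 60) a := by
  have hc := h.count
  have hch := (h.chain (a.v x)).le
  refine wp_block ?_ ?_
  · simp [hx, hy, hx6, hc]
    omega
  · have hx6' : ¬ 6 = x := Ne.symm hx6
    refine ⟨⟨by simp [hc], fun z => ?_⟩, ⟨fun z hz => by simp [hz], by simp,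
      fun id h1 h2 h3 => by simp [h1, h2, h3]⟩, by simp⟩
    have hz := (h.chain z).update (a.arr 11 (a.v x)) (a.v y)
    simp only [execB, Ins.exec, Ex.eval_add, Ex.eval_var, Ex.eval_ofNat, Ex.eval_get, hc,
      ASt.set_v, ASt.put_v, ASt.tick_arr, ASt.put_arr, ASt.set_arr, if_true, hx6, hy6, if_false]
    simp only [List.length_cons]
    by_cases hzx : z = a.v x
    · subst hzx
      have ht : targets ((a.v x, a.v y) :: E) (a.v x) = a.v y :: targets E (a.v x) := by
        simp [targets]
      rw [ht]
      simp [IsChain]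
      exact hz
    · have ht : targets ((a.v x, a.v y) :: E) z = targets E z := by
        simp [targets, Ne.symm hzx]
      rw [ht]
      simp [hzx]
      exact hz

/-- Add several edges. -/
def addEdges : List (ℕ × ℕ) → Prog
  | [] => block []
  | p :: L => .seq (addEdge p.1 p.2) (addEdges L)

theorem wp_addEdges {M : Mach} (L : List (ℕ × ℕ)) {a : ASt} {E : List (ℕ × ℕ)} (h : AdjRep a E)
    (hL : ∀ p ∈ L, p.1 < 40 ∧ p.2 < 40 ∧ p.1 ≠ 6 ∧ p.2 ≠ 6 ∧ a.v p.1 < M.V)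
    (hE : E.length + L.length < M.V) :
    wp M (addEdges L) (fun b => AdjRep b ((L.map fun p => (a.v p.1, a.v p.2)).reverse ++ E) ∧
      EdgeFrame a b ∧ b.time ≤ a.time + 61 * L.length + 1) a := by
  induction L generalizing a E with
  | nil =>
    refine wp_block trivial ?_
    exact ⟨⟨h.count, h.chain⟩, ⟨fun _ _ => rfl, rfl, fun _ _ _ _ => rfl⟩, le_rfl⟩
  | cons p L ih =>
    obtain ⟨p1, p2, p3, p4, p5⟩ := hL p (by simp)
    rw [List.length_cons] at hE
    refine wp_seq ((wp_addEdge h p1 p2 p3 p4 p5 (by omega)).mono ?_)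
    rintro b ⟨b1, b2, b3⟩
    refine (ih b1 (fun x hx => ?_) (by simp; omega)).mono ?_
    · obtain ⟨x1, x2, x3, x4, x5⟩ := hL x (by simp [hx])
      exact ⟨x1, x2, x3, x4, by rw [b2.v _ x3]; exact x5⟩
    · rintro c ⟨c1, c2, c3⟩
      have e : (L.map fun p => (b.v p.1, b.v p.2)) = L.map fun p => (a.v p.1, a.v p.2) := by
        refine List.map_congr_left fun x hx => ?_
        obtain ⟨x1, x2, x3, x4, x5⟩ := hL x (by simp [hx])
        rw [b2.v _ x3, b2.v _ x4]
      rw [e] at c1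
      refine ⟨⟨?_, ?_⟩, ?_, ?_⟩
      · have := c1.count
        simpa using this
      · have := c1.chain
        simpa using this
      · exact b2.trans ⟨c2.v, c2.raw, c2.arr⟩
      · simp only [ASt.tick_time, List.length_cons]; omega

end WordRAM

namespace WordRAM

open Finset

variable {B : ℕ → ℕ → ℕ} {n m l : ℕ} {E : List (ℕ × ℕ)} {M : Mach}

/-! ### The edges between intervals -/

/-- Only the edge count, the adjacency lists and variables from `l` on have changed. -/
structure GraphFrame (l : ℕ) (a b : ASt) : Prop where
  v : ∀ z, z < l → z ≠ 6 → b.v z = a.v z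
  raw : b.raw = a.raw
  arr : ∀ id, id ≠ 11 → id ≠ 12 → id ≠ 13 → b.arr id = a.arr id

theorem GraphFrame.trans {a b c : ASt} (h : GraphFrame l a b) (h' : GraphFrame l b c) :
    GraphFrame l a c :=
  ⟨fun z hz hz' => (h'.v z hz hz').trans (h.v z hz hz'), h'.raw.trans h.raw,
    fun id h1 h2 h3 => (h'.arr id h1 h2 h3).trans (h.arr id h1 h2 h3)⟩

theorem EdgeFrame.graphFrame {a b : ASt} (h : EdgeFrame a b) : GraphFrame l a b :=
  ⟨fun z _ hz => h.v z hz, h.raw, h.arr⟩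

theorem GraphFrame.rfl {a : ASt} : GraphFrame l a a := ⟨fun _ _ _ => Eq.refl _, Eq.refl _,
  fun _ _ _ _ => Eq.refl _⟩

theorem GraphFrame.set {a b : ASt} (h : GraphFrame l a b) {x : ℕ} (hx : l ≤ x) (y : ℕ) :
    GraphFrame l a (b.set x y) :=
  ⟨fun z hz hz' => by
    rw [ASt.set_v, if_neg (show z ≠ x by omega)]
    exact h.v z hz hz', h.raw, h.arr⟩

theorem GraphFrame.tick {a b : ASt} (h : GraphFrame l a b) (k : ℕ) : GraphFrame l a (b.tick k) :=
  ⟨h.v, h.raw, h.arr⟩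

theorem AdjRep.set {a : ASt} (h : AdjRep a E) {x : ℕ} (hx : x ≠ 6) (y : ℕ) :
    AdjRep (a.set x y) E :=
  ⟨by rw [ASt.set_v, if_neg hx.symm]; exact h.count, h.chain⟩

theorem AdjRep.tick {a : ASt} (h : AdjRep a E) (k : ℕ) : AdjRep (a.tick k) E :=
  ⟨h.count, h.chain⟩

/-- Compute the nodes for two halves (of length in variable `10`) of an interval. -/
def tableNodes : Prog :=
  block [.asg 14 (.var 10 * .var 1 + (.var 12 + 1)), .asg 15 (.var 14 + .var 10),
    .asg 16 (.var 11 * .var 1 + (.var 12 + 1)),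
    .asg 30 (.var 14 + .var 14 + 1), .asg 31 (.var 15 + .var 15 + 1),
    .asg 32 (.var 16 + .var 16 + 1),
    .asg 33 (.var 14 + .var 14), .asg 34 (.var 15 + .var 15), .asg 35 (.var 16 + .var 16)]

/-- Add the edges between intervals of lengths `P` and `2 * P`, in variables `10` and `11`. -/
def tableRow : Prog :=
  .seq (block [.asg 13 (.var 0 + 1 - .var 11)])
    (forUp 12 13 (.seq tableNodes (addEdges [(35, 33), (35, 34), (30, 32), (31, 32)])))

/-- Add all edges between intervals. -/
def tablePhase : Prog :=
  .seq (block [.asg 10 1, .asg 11 2])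
    (whileDo (.op .lt (.var 11) (.var 0 + 1))
      (.seq tableRow (block [.asg 10 (.var 11), .asg 11 (.var 11 + .var 11)])))

theorem HasTable.mono {E' : List (ℕ × ℕ)} {h : ℕ} (ht : HasTable n m E h) (hE : E ⊆ E') :
    HasTable n m E' h := fun i h1 h2 => by
  obtain ⟨a, b, c, d⟩ := ht i h1 h2
  exact ⟨hE a, hE b, hE c, hE d⟩

theorem wp_tableRow {a : ASt} {P h : ℕ} (h0 : a.v 0 = n) (h1 : a.v 1 = n + 2)
    (hP : P = 2 ^ h) (h10 : a.v 10 = P)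
    (h11 : a.v 11 = P + P) (hPn : P + P ≤ n) (hV : 2 * ((n + 1) * (n + 2)) < M.V)
    (hA : AdjRep a E) (hEV : E.length + 4 * n < M.V) (hE : ∀ e ∈ E, SoundEdge B (n + 2) e) :
    wp M tableRow (fun b => ∃ E', AdjRep b E' ∧ GraphFrame 10 a b ∧ E ⊆ E' ∧
      (∀ e ∈ E', SoundEdge B (n + 2) e) ∧ HasTable n (n + 2) E' h ∧
      E'.length ≤ E.length + 4 * n ∧ b.v 10 = P ∧ b.v 11 = P + P ∧
      b.time ≤ a.time + 600 * n + 50) a := by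
  have hVp := M.Vpos
  have hP1 : 1 ≤ P := by rw [hP]; exact Nat.one_le_two_pow
  have hnV : n + 2 < M.V := by nlinarith
  refine wp_seq (wp_block (by simp [h0, h11]; omega) ?_)
  simp only [execB, Ins.exec, lenB, Ins.len]
  refine wp_for (n + 1 - (P + P)) (fun k b => ∃ E', AdjRep b E' ∧ GraphFrame 10 a b ∧ E ⊆ E' ∧
      (∀ e ∈ E', SoundEdge B (n + 2) e) ∧
      (∀ i, 1 ≤ i → i ≤ k →
        (colN (n + 2) (P + P) i, colN (n + 2) P i) ∈ E' ∧
        (colN (n + 2) (P + P) i, colN (n + 2) P (i + P)) ∈ E' ∧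
        (rowN (n + 2) P i, rowN (n + 2) (P + P) i) ∈ E' ∧
        (rowN (n + 2) P (i + P), rowN (n + 2) (P + P) i) ∈ E') ∧
      E'.length = E.length + 4 * k ∧ b.v 10 = P ∧ b.v 11 = P + P ∧
      b.time ≤ a.time + 600 * k + 40) (by omega) (by omega) (by omega) (by simp [h0, h11])
      (by omega) ?_ ?_ ?_
  · refine ⟨E, ((hA.set (by omega) _).tick _ |>.set (by omega) _).tick _,
      ((((GraphFrame.rfl).set (by omega) _).tick _).set (by omega) _).tick _, List.Subset.refl _,
      hE, fun i h1 h2 => by omega, by simp, by simp [h10], by simp [h11], by simp⟩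
  · rintro k hk b ⟨E', b1, b2, b3, b4, b5, b6, b7, b8, b9⟩ hbk hbN
    have b0 : b.v 0 = n := (b2.v 0 (by omega) (by omega)).trans h0
    have b0' : b.v 1 = n + 2 := (b2.v 1 (by omega) (by omega)).trans h1
    have e1 : (P + P) * (n + 2) = P * (n + 2) + P * (n + 2) := by ring
    have e2 : (P + P) * (n + 2) ≤ n * (n + 2) := Nat.mul_le_mul_right _ hPn
    have e3 : (n + 1) * (n + 2) = n * (n + 2) + (n + 2) := by ring
    -- The products become atoms, which leaves only linear range conditions.
    generalize hX : (P + P) * (n + 2) = X at *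
    generalize hY : P * (n + 2) = Y at *
    refine wp_seq (wp_block ?_ ?_)
    · simp [b0', b7, b8, hbk, hX, hY]
      refine ⟨⟨⟨?_, ?_, ?_⟩, ?_⟩, ?_, ⟨⟨?_, ?_, ?_⟩, ?_⟩, ⟨?_, ?_⟩, ⟨?_, ?_⟩, ⟨?_, ?_⟩, ?_, ?_, ?_⟩ <;> omega
    · simp only [execB, Ins.exec, lenB, Ins.len]
      simp [b0', b7, b8, hbk, hX, hY]
      refine (wp_addEdges (E := E') _ (by
        refine AdjRep.tick ?_ _
        iterate 9 refine AdjRep.set ?_ (by omega) _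
        exact b1) ?_ ?_).mono ?_
      · simp
        omega
      · simp
        omega
      · rintro c ⟨c1, c2, c3⟩
        simp at c1
        simp at c3
        generalize hL : (_ :: _ :: _ :: _ :: E') = L at c1
        have e : GraphFrame 10 a c := by
          refine GraphFrame.trans ?_ c2.graphFrame
          refine GraphFrame.tick ?_ _
          iterate 9 refine GraphFrame.set ?_ (by omega) _
          exact b2
        refine ⟨by simp [c2.v, hbk], by simp [c2.v, hbN], L, ((c1.tick _).set (by omega) _).tick _,
          ((e.tick _).set (by omega) _).tick _, ?_, ?_, ?_, ?_, ?_, ?_, ?_⟩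
        · intro x hx
          simp [← hL, b3 hx]
        · have f1 : Y + (k + 1) + P = P * (n + 2) + (k + 1 + P) := by rw [← hY]; ring
          suffices hS : ∀ x ∈ L, SoundEdge B (n + 2) x from fun x y hx => hS _ hx
          intro x hx
          simp only [← hL, List.mem_cons] at hx
          rcases hx with rfl | rfl | rfl | rfl | hx
          · rw [f1, ← hX]
            simp only [← two_mul]
            exact .row (by omega) (by omega) (by omega) (by omega) (by omega)
          · rw [← hX, ← hY]
            simp only [← two_mul]
            exact .row (by omega) (by omega) (by omega) (by omega) (by omega)
          · rw [f1, ← hX]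
            simp only [← two_mul]
            exact .col (by omega) (by omega) (by omega) (by omega) (by omega)
          · rw [← hX, ← hY]
            simp only [← two_mul]
            exact .col (by omega) (by omega) (by omega) (by omega) (by omega)
          · exact b4 x hx
        · intro i hi hik
          rcases Nat.lt_or_ge k i with hki | hki
          · obtain rfl : i = k + 1 := by omega
            simp only [rowN, colN, hX, hY, two_mul, ← add_assoc]
            simp [← hL, ← add_assoc]
          · obtain ⟨g1, g2, g3, g4⟩ := b5 i hi hki
            simp [← hL, g1, g2, g3, g4]
        · simp [← hL, b6]; ring
        · simp [c2.v, b7]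
        · simp [c2.v, b8]
        · clear * - c3 b9
          linarith
  · rintro b ⟨E', b1, b2, b3, b4, b5, b6, b7, b8, b9⟩ hbk hbN
    refine ⟨E', (b1.tick _).tick _, (b2.tick _).tick _, b3, b4, ?_, by omega, by simp [b7], by simp [b8], ?_⟩
    · intro i hi hi2
      rw [pow_succ, mul_two, ← hP] at *
      exact b5 i hi (by omega)
    · simp; omega

/-- One pass per power of two, each adding at most `4 * n` edges. Only powers with `2 ^ (h + 1) ≤ n`
need a pass, whence the logarithm. -/
theorem wp_tablePhase {a : ASt} (h0 : a.v 0 = n) (h1 : a.v 1 = n + 2) (hn : 1 ≤ n)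
    (hV : 2 * ((n + 1) * (n + 2)) < M.V) (hA : AdjRep a [])
    (hlog : 4 * n * (Nat.log 2 n + 1) < M.V) :
    wp M tablePhase (fun b => ∃ E, AdjRep b E ∧ GraphFrame 10 a b ∧
      (∀ e ∈ E, SoundEdge B (n + 2) e) ∧ (∀ h, HasTable n (n + 2) E h) ∧
      E.length ≤ 4 * n * Nat.log 2 n ∧
      b.time ≤ a.time + 800 * n * (Nat.log 2 n + 1)) a := by
  have hVp := M.Vpos
  have hnV : n + 2 < M.V := by nlinarith
  refine wp_seq (wp_block (by simp) ?_)
  simp only [execB, Ins.exec, lenB, Ins.len]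
  refine wp_while (fun k b => ∃ h E, k = n + 1 - 2 ^ (h + 1) ∧ b.v 10 = 2 ^ h ∧
      b.v 11 = 2 ^ h + 2 ^ h ∧ 2 ^ h ≤ n ∧ AdjRep b E ∧ GraphFrame 10 a b ∧
      (∀ e ∈ E, SoundEdge B (n + 2) e) ∧ (∀ g < h, HasTable n (n + 2) E g) ∧
      E.length ≤ 4 * n * h ∧ b.time ≤ a.time + 700 * n * h + 30) (n - 1) ?_ ?_ ?_ ?_
  · refine ⟨0, [], by simp, by simp, by simp, by simpa using hn,
      (((hA.set (by omega) _).set (by omega) _).tick _).tick _,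
      (((GraphFrame.rfl.set (by omega) _).set (by omega) _).tick _).tick _, by simp,
      fun g hg => by omega, by simp, by simp⟩
  · rintro k b ⟨h, E, b1, b2, b3, b4, b5, b6, b7, b8, b9, b10⟩
    have b0 : b.v 0 = n := (b6.v 0 (by omega) (by omega)).trans h0
    refine ⟨by simp [b0]; omega, lt_of_le_of_lt (Op.lt_le _ _) (by omega)⟩
  · rintro k b ⟨h, E, b1, b2, b3, b4, b5, b6, b7, b8, b9, b10⟩ hc
    have b0 : b.v 0 = n := (b6.v 0 (by omega) (by omega)).trans h0
    have b0' : b.v 1 = n + 2 := (b6.v 1 (by omega) (by omega)).trans h1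
    have hP : 2 ^ h + 2 ^ h ≤ n := by
      simp [b0, b3] at hc
      omega
    have hh : h ≤ Nat.log 2 n := Nat.le_log_of_pow_le (by omega) b4
    have hEV : E.length + 4 * n < M.V := by
      have := Nat.mul_le_mul_left (4 * n) hh
      rw [mul_add] at hlog
      omega
    refine wp_seq ((wp_tableRow b0 b0' rfl b2 b3 hP hV b5 hEV b7).mono ?_)
    rintro c ⟨E', c1, c2, c3, c4, c5, c6, c7, c8, c9⟩
    refine wp_block (by simp [c8]; omega) ?_
    simp only [execB, Ins.exec, lenB, Ins.len]
    refine ⟨n + 1 - 2 ^ (h + 2), ?_, h + 1, E', rfl, ?_, ?_, ?_, ?_, ?_, c4, ?_, ?_, ?_⟩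
    · rw [b1, pow_succ, pow_succ]
      have := Nat.one_le_two_pow (n := h)
      omega
    · simp [c8, pow_succ, mul_two]
    · simp [c8, pow_succ, mul_two]
    · rw [pow_succ]; omega
    · exact (((c1.set (by omega) _).set (by omega) _).tick _).tick _ |>.tick _
    · exact ((((b6.trans c2).set (by omega) _).set (by omega) _).tick _).tick _ |>.tick _
    · intro g hg
      rcases Nat.lt_succ_iff_lt_or_eq.1 hg with hg | rfl
      · exact (b8 g hg).mono c3
      · exact c5
    · rw [mul_add]; omega
    · simp [mul_add]
      have e : 700 * n * h = 100 * (n * h) * 7 := by ring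
      omega
  · rintro k b ⟨h, E, b1, b2, b3, b4, b5, b6, b7, b8, b9, b10⟩ hc
    have b0 : b.v 0 = n := (b6.v 0 (by omega) (by omega)).trans h0
    have hP : n < 2 ^ h + 2 ^ h := by
      simp [b0, b3] at hc
      omega
    have hh : h ≤ Nat.log 2 n := Nat.le_log_of_pow_le (by omega) b4
    refine ⟨E, (b5.tick _).tick _, (b6.tick _).tick _, b7, fun g => ?_,
      b9.trans (Nat.mul_le_mul_left _ hh), ?_⟩
    · rcases Nat.lt_or_ge g h with hg | hg
      · exact b8 g hg
      -- For the remaining levels no interval of length `2 ^ (g + 1)` fits into `{1, …, n}`, and the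
      -- claim is vacuous.
      · intro i hi hi'
        have := Nat.pow_le_pow_right (n := 2) (by omega) hg
        rw [pow_succ] at hi'
        omega
    · have := Nat.mul_le_mul_left (700 * n) hh
      have e : 800 * n * (Nat.log 2 n + 1) = 700 * n * Nat.log 2 n + 100 * n * Nat.log 2 n + 800 * n := by
        ring
      simp
      omega

end WordRAM

namespace WordRAM

open Finset

variable {B : ℕ → ℕ → ℕ} {n m l : ℕ} {E : List (ℕ × ℕ)} {M : Mach}

@[simp] theorem ASt.set_set_self (a : ASt) (x y z : ℕ) : (a.set x y).set x z = a.set x z := by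
  simp [ASt.set]

@[simp] theorem ASt.tick_set (a : ASt) (x y k : ℕ) : (a.tick k).set x y = (a.set x y).tick k := rfl

@[simp] theorem ASt.tick_put (a : ASt) (id x y k : ℕ) :
    (a.tick k).put id x y = (a.put id x y).tick k := rfl

@[simp] theorem ASt.tick_putRaw (a : ASt) (x y k : ℕ) :
    (a.tick k).putRaw x y = (a.putRaw x y).tick k := rfl

/-! ### Powers of two -/

/-- Double variable `x` (which is `1` initially) while the result is at most variable `y`. -/
def doubling (x y : ℕ) : Prog :=
  .seq (block [.asg x 1])
    (whileDo (.op .lt (.var x + .var x) (.var y + 1)) (block [.asg x (.var x + .var x)]))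

/-- The linear bound on the time is crude but sufficient: it stays below the cost allowed for
finding the top of a rectangle. -/
theorem wp_doubling {x y N : ℕ} {a : ASt} (hx : x < 40) (hy : y < 40) (hxy : x ≠ y) (hN : a.v y = N)
    (h1 : 1 ≤ N) (hNV : N + N + 2 < M.V) :
    wp M (doubling x y) (fun b => ∃ g t, b = (a.set x (2 ^ g)).tick t ∧ 2 ^ g ≤ N ∧
      N < 2 * 2 ^ g ∧ t ≤ 30 * N + 40) a := by
  have hVp := M.Vpos
  refine wp_seq (wp_block (by simp [hx]) ?_)
  simp only [execB, Ins.exec, lenB, Ins.len]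
  refine wp_while (fun k b => ∃ g t, k = N + 1 - 2 ^ g ∧ b = (a.set x (2 ^ g)).tick t ∧ 2 ^ g ≤ N ∧
    t ≤ 30 * 2 ^ g + 10) N ?_ ?_ ?_ ?_
  · exact ⟨0, _, by simp, by simp; rfl, by simpa using h1, by simp⟩
  · rintro k b ⟨g, t, -, rfl, h3, -⟩
    refine ⟨by simp [hx, hy, hxy.symm, hN]; omega, lt_of_le_of_lt (Op.lt_le _ _) (by omega)⟩
  · rintro k b ⟨g, t, rfl, rfl, h3, h4⟩ hc
    simp [hxy.symm, hN] at hc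
    have h5 := Nat.one_le_two_pow (n := g)
    refine wp_block (by simp [hx]; omega) ?_
    refine ⟨N + 1 - 2 ^ (g + 1), ?_, g + 1, ?t, rfl, ?eq, ?_, ?_⟩
    case eq => simp [pow_succ, mul_two]; rfl
    all_goals rw [pow_succ]; omega
  · rintro k b ⟨g, t, rfl, rfl, h3, h4⟩ hc
    simp [hxy.symm, hN] at hc
    exact ⟨g, _, by simp; rfl, h3, by omega, by omega⟩

/-! ### The edges for rectangles of ones -/

/-- Decrease variable `26` to the first row with the run that ends at variable `24`. -/
def climb : Prog :=
  .seq (block [.asg 26 (.var 22)])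
    (whileDo (.op .eq (.get 10 ((.var 26 - 1) * .var 1 + .var 23)) (.var 24))
      (block [.asg 26 (.var 26 - 1)]))

/-- Array `10` contains the ends of runs. -/
def HasRuns (B : ℕ → ℕ → ℕ) (n : ℕ) (a : ASt) : Prop :=
  ∀ k p, k ≤ n + 1 → 1 ≤ p → p ≤ n → a.arr 10 (k * (n + 2) + p) = runEnd B k p

/-- The climb needs no test for the border: row 0 is zero, so its entry of array `10` is 0 and
differs from `e`. The row number is the termination measure. -/
theorem wp_climb {a : ASt} {k p e : ℕ} (hB : IsBits B n) (hF : HasRuns B n a) (h1 : a.v 1 = n + 2)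
    (h22 : a.v 22 = k) (h23 : a.v 23 = p) (h24 : a.v 24 = e) (he : runEnd B k p = e) (he0 : e ≠ 0)
    (hk : 1 ≤ k) (hkn : k ≤ n) (hp : 1 ≤ p) (hpn : p ≤ n) (hV : 2 * ((n + 1) * (n + 2)) < M.V) :
    wp M climb (fun b => ∃ x t, b = (a.set 26 x).tick t ∧ IsTop B k p x ∧ t ≤ 60 * n + 60) a := by
  have hVp := M.Vpos
  have hnV : n + 2 < M.V := by nlinarith
  refine wp_seq (wp_block (by simp [h22]; omega) ?_)
  simp only [execB, Ins.exec, lenB, Ins.len]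
  refine wp_while (fun x b => ∃ t, b = (a.set 26 x).tick t ∧ 1 ≤ x ∧ x ≤ k ∧
    (∀ y, x ≤ y → y ≤ k → runEnd B y p = e) ∧ t + 60 * x ≤ 60 * k + 50) k ?_ ?_ ?_ ?_
  · refine ⟨_, by simp [h22]; rfl, hk, le_rfl, fun y hy hy' => ?_, by omega⟩
    rw [le_antisymm hy' hy]; exact he
  · rintro x b ⟨t, rfl, hx1, hx2, hx3, hx4⟩
    have e1 : (x - 1) * (n + 2) ≤ n * (n + 2) := Nat.mul_le_mul_right _ (by omega)
    have e2 : (n + 1) * (n + 2) = n * (n + 2) + (n + 2) := by ring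
    refine ⟨by simp [h1, h23]; omega, lt_of_le_of_lt (Op.eq_le _ _) (by omega)⟩
  · rintro x b ⟨t, rfl, hx1, hx2, hx3, hx4⟩ hc
    simp [h1, h23, h24] at hc
    rw [hF _ _ (by omega) hp hpn] at hc
    have hr := (runEnd_eq_iff he0).1 hc
    have hx0 := (hB.row _ p (by rw [hr.ones p le_rfl hr.lt]; omega)).1
    refine wp_block (by simp; omega) ?_
    refine ⟨x - 1, by omega, _, by simp; rfl, by omega, by omega, fun y hy hy' => ?_, by omega⟩
    rcases Nat.lt_or_ge y x with h | h
    · rw [show y = x - 1 by omega]; exact hc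
    · exact hx3 y h hy'
  · rintro x b ⟨t, rfl, hx1, hx2, hx3, hx4⟩ hc
    simp [h1, h23, h24] at hc
    rw [hF _ _ (by omega) hp hpn] at hc
    refine ⟨x, _, by simp; rfl, ⟨hx1, hx2, fun y hy hy' => ?_, ?_⟩, by omega⟩
    · rw [hx3 y hy hy', he]
    · rwa [he]

/-- Compute the nodes for a rectangle. -/
def rectNodes : Prog :=
  block [.asg 38 (.var 36 * .var 1), .asg 39 (.var 37 * .var 1),
    .asg 32 (.var 38 + .var 26), .asg 35 (.var 38 + (.var 22 + 1 - .var 36)),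
    .asg 30 (.var 32 + .var 32 + 1), .asg 31 (.var 35 + .var 35 + 1),
    .asg 32 (.var 39 + .var 23), .asg 35 (.var 39 + (.var 24 - .var 37)),
    .asg 33 (.var 32 + .var 32), .asg 34 (.var 35 + .var 35)]

/-- Add the edges for a rectangle. -/
def emitRect : Prog :=
  .seq climb (.seq (block [.asg 27 (.var 22 + 1 - .var 26), .asg 28 (.var 24 - .var 23)])
    (.seq (doubling 36 27) (.seq (doubling 37 28) (.seq rectNodes
      (addEdges [(30, 33), (30, 34), (31, 33), (31, 34)])))))

/-- Time O(n) per rectangle is affordable: with `S` rectangles this is O(S n), and the `n` searches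
on the digraph take that long anyway. -/
theorem wp_emitRect {a : ASt} {k p e : ℕ} (hB : IsBits B n) (hF : HasRuns B n a)
    (h1 : a.v 1 = n + 2)
    (h22 : a.v 22 = k) (h23 : a.v 23 = p) (h24 : a.v 24 = e) (he : runEnd B k p = e) (he0 : e ≠ 0)
    (hk : 1 ≤ k) (hkn : k ≤ n) (hp : 1 ≤ p) (hpn : p ≤ n) (hV : 2 * ((n + 1) * (n + 2)) < M.V)
    (hA : AdjRep a E) (hEV : E.length + 4 < M.V) (hE : ∀ e ∈ E, SoundEdge B (n + 2) e) :
    wp M emitRect (fun b => ∃ E' x, AdjRep b E' ∧ GraphFrame 26 a b ∧ E ⊆ E' ∧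
      (∀ e ∈ E', SoundEdge B (n + 2) e) ∧ IsTop B k p x ∧ HasRect (n + 2) E' x k p e ∧
      E'.length = E.length + 4 ∧ b.time ≤ a.time + 200 * n + 900) a := by
  have hVp := M.Vpos
  have hnV : n + n + 4 < M.V := by nlinarith
  have hr := (runEnd_eq_iff he0).1 he
  have hpe := hr.lt
  have hen : e ≤ n + 1 := by
    have := (hB.col k (e - 1) (by rw [hr.ones (e - 1) (by omega) (by omega)]; omega)).2
    omega
  refine wp_seq ((wp_climb hB hF h1 h22 h23 h24 he he0 hk hkn hp hpn hV).mono ?_)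
  rintro b ⟨x, t, rfl, hx, ht⟩
  have hx1 := hx.1
  have hx2 := hx.2.1
  refine wp_seq (wp_block (by simp [h22, h23, h24]; omega) ?_)
  simp [h22, h23, h24]
  refine wp_seq ((wp_doubling (N := k + 1 - x) (by omega) (by omega) (by omega) (by simp)
    (by omega) (by omega)).mono ?_)
  rintro b ⟨g, t', rfl, hg1, hg2, ht'⟩
  refine wp_seq ((wp_doubling (N := e - p) (by omega) (by omega) (by omega) (by simp)
    (by omega) (by omega)).mono ?_)
  rintro b ⟨g', t'', rfl, hg1', hg2', ht''⟩
  have hP1 := Nat.one_le_two_pow (n := g)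
  have hQ1 := Nat.one_le_two_pow (n := g')
  have e1 : 2 ^ g * (n + 2) ≤ n * (n + 2) := Nat.mul_le_mul_right _ (by omega)
  have e2 : 2 ^ g' * (n + 2) ≤ n * (n + 2) := Nat.mul_le_mul_right _ (by omega)
  have e3 : (n + 1) * (n + 2) = n * (n + 2) + (n + 2) := by ring
  generalize hX : 2 ^ g * (n + 2) = X at *
  generalize hY : 2 ^ g' * (n + 2) = Y at *
  generalize hP : 2 ^ g = P at *
  generalize hQ : 2 ^ g' = Q at *
  refine wp_seq (wp_block ?_ ?_)
  · simp [h1, h22, h23, h24, hX, hY]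
    omega
  simp only [execB, Ins.exec, lenB, Ins.len]
  simp [h1, h22, h23, h24, hX, hY]
  refine (wp_addEdges (E := E) _ ?_ ?_ ?_).mono ?_
  · refine AdjRep.tick ?_ _
    iterate 15 refine AdjRep.set ?_ (by omega) _
    exact hA
  · simp
    omega
  · simp
    omega
  · rintro c ⟨c1, c2, c3⟩
    simp at c1
    simp at c3
    suffices hS : ∃ E' x, AdjRep (c.tick 5) E' ∧ GraphFrame 26 a (c.tick 5) ∧ E ⊆ E' ∧
        (∀ e ∈ E', SoundEdge B (n + 2) e) ∧ IsTop B k p x ∧ HasRect (n + 2) E' x k p e ∧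
        E'.length = E.length + 4 ∧ (c.tick 5).time ≤ a.time + 200 * n + 900 by
      simpa using hS
    generalize hL : (_ :: _ :: _ :: _ :: E) = L at c1
    have f1 : X + x + (X + x) + 1 = rowN (n + 2) P x := by rw [rowN, hX]; ring
    have f2 : X + (k + 1 - P) + (X + (k + 1 - P)) + 1 = rowN (n + 2) P (k + 1 - P) := by
      rw [rowN, hX]; ring
    have f3 : Y + p + (Y + p) = colN (n + 2) Q p := by rw [colN, hY]; ring
    have f4 : Y + (e - Q) + (Y + (e - Q)) = colN (n + 2) Q (e - Q) := by rw [colN, hY]; ring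
    rw [f1, f2, f3, f4] at hL
    refine ⟨L, x, c1.tick _, ?_, ?_, ?_, hx, ⟨g, g', ?_⟩, ?_, ?_⟩
    · refine GraphFrame.trans ?_ (c2.graphFrame.tick _)
      refine GraphFrame.tick ?_ _
      iterate 15 refine GraphFrame.set ?_ (by omega) _
      exact .rfl
    · intro x hx
      simp [← hL, hx]
    · intro y hy
      simp only [← hL, List.mem_cons] at hy
      rcases hy with rfl | rfl | rfl | rfl | hy
      · exact soundEdge_rect hx he he0 (by omega) (by omega) (by omega) (by omega) (by omega) (by omega) (by omega)
      · exact soundEdge_rect hx he he0 (by omega) (by omega) (by omega) (by omega) (by omega) (by omega) (by omega)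
      · exact soundEdge_rect hx he he0 (by omega) (by omega) (by omega) (by omega) (by omega) (by omega) (by omega)
      · exact soundEdge_rect hx he he0 (by omega) (by omega) (by omega) (by omega) (by omega) (by omega) (by omega)
      · exact hE y hy
    · rw [hP, hQ]
      refine ⟨hg1, hg2, hg1', hg2', ?_⟩
      simp [← hL]
    · simp [← hL]
    · simp
      omega

end WordRAM

namespace WordRAM

open Finset

variable {B : ℕ → ℕ → ℕ} {n m l : ℕ} {E : List (ℕ × ℕ)} {M : Mach}

open Classical in
/-- The number of stops in a row. -/
noncomputable def stopsIn (B : ℕ → ℕ → ℕ) (k j : ℕ) : ℕ :=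
  ∑ p ∈ range j, if Stops B (k + 1) (p + 1) then 1 else 0

/-- Add the edges for the rectangle that ends at row `20` and column `21`, if any. -/
def emitCell : Prog :=
  .seq (block [.asg 22 (.var 20 + 1), .asg 23 (.var 21 + 1),
      .asg 24 (.get 10 (.var 22 * .var 1 + .var 23)),
      .asg 25 (.get 10 ((.var 22 + 1) * .var 1 + .var 23))])
    (cond (.op .lt 0 (.var 24)) (cond (.op .eq (.var 24) (.var 25)) (block []) emitRect) (block []))

/-- Add the edges for all rectangles. -/
def emitPhase : Prog := forUp 20 0 (forUp 21 0 emitCell)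

/-- What the addition of edges for some rectangles preserves and achieves. -/
structure EmitRel (B : ℕ → ℕ → ℕ) (n : ℕ) (a b : ASt) (E E' : List (ℕ × ℕ)) : Prop where
  rep : AdjRep b E'
  v : ∀ z, z < 10 → z ≠ 6 → b.v z = a.v z
  raw : b.raw = a.raw
  arr : ∀ id, id ≠ 11 → id ≠ 12 → id ≠ 13 → b.arr id = a.arr id
  sub : E ⊆ E'
  sound : ∀ e ∈ E', SoundEdge B (n + 2) e

theorem HasRect.mono {E' : List (ℕ × ℕ)} {a k p e : ℕ} (h : HasRect m E a k p e) (hE : E ⊆ E') :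
    HasRect m E' a k p e := by
  obtain ⟨g, h, a1, a2, a3, a4, e1, e2, e3, e4⟩ := h
  exact ⟨g, h, a1, a2, a3, a4, hE e1, hE e2, hE e3, hE e4⟩

/-- The edges for the rectangle that ends at a given place are present. -/
def Emitted (B : ℕ → ℕ → ℕ) (n : ℕ) (E : List (ℕ × ℕ)) (k p : ℕ) : Prop :=
  Stops B k p → ∃ x, IsTop B k p x ∧ HasRect (n + 2) E x k p (runEnd B k p)

theorem Emitted.mono {E' : List (ℕ × ℕ)} {k p : ℕ} (h : Emitted B n E k p) (hE : E ⊆ E') :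
    Emitted B n E' k p := fun hs => by
  obtain ⟨x, h1, h2⟩ := h hs
  exact ⟨x, h1, h2.mono hE⟩

theorem runEnd_le (hB : IsBits B n) (k p : ℕ) : runEnd B k p ≤ n + 1 := by
  by_cases h : runEnd B k p = 0
  · omega
  · have hr := (runEnd_eq_iff h).1 rfl
    have hlt := hr.lt
    have := (hB.col k (runEnd B k p - 1) (by rw [hr.ones _ (by omega) (by omega)]; omega)).2
    omega

-- The two nested tests decide `Stops`: a run starts here, and the next row does not repeat it. The
-- expensive part of the time bound is charged to the stops only, so that summation gives a multiple
-- of their number.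
open Classical in
theorem wp_emitCell {a : ASt} {k p : ℕ} (hB : IsBits B n) (hF : HasRuns B n a)
    (h1 : a.v 1 = n + 2) (h20 : a.v 20 = k) (h21 : a.v 21 = p) (hkn : k < n) (hpn : p < n)
    (hV : 2 * ((n + 1) * (n + 2)) < M.V)
    (hA : AdjRep a E) (hEV : E.length + 4 < M.V) (hE : ∀ e ∈ E, SoundEdge B (n + 2) e) :
    wp M emitCell (fun b => ∃ E', EmitRel B n a b E E' ∧ b.v 20 = k ∧ b.v 21 = p ∧
      Emitted B n E' (k + 1) (p + 1) ∧
      E'.length ≤ E.length + 4 * (if Stops B (k + 1) (p + 1) then 1 else 0) ∧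
      b.time ≤ a.time + (200 * n + 900) * (if Stops B (k + 1) (p + 1) then 1 else 0) + 130) a := by
  have hVp := M.Vpos
  have hnV : n + n + 4 < M.V := by nlinarith
  have e1 : (k + 1) * (n + 2) ≤ n * (n + 2) := Nat.mul_le_mul_right _ (by omega)
  have e2 : (k + 1 + 1) * (n + 2) = (k + 1) * (n + 2) + (n + 2) := by ring
  have e3 : (n + 1) * (n + 2) = n * (n + 2) + (n + 2) := by ring
  have hf1 := runEnd_le hB (k + 1) (p + 1)
  have hf2 := runEnd_le hB (k + 1 + 1) (p + 1)
  rw [← hF _ _ (by omega) (by omega) (by omega)] at hf1 hf2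
  refine wp_seq (wp_block ?_ ?_)
  · simp [h1, h20, h21]
    omega
  simp only [execB, Ins.exec, lenB, Ins.len]
  simp only [Ex.eval_add, Ex.eval_mul, Ex.eval_var, Ex.eval_ofNat, Ex.eval_get, Ex.len_add,
    Ex.len_mul, Ex.len_var, Ex.len_ofNat, Ex.len_get, ASt.set_v, ASt.set_arr, h1, h20, h21]
  simp only [reduceIte, Nat.reduceEqDiff]
  rw [hF _ _ (by omega) (by omega) (by omega), hF _ _ (by omega) (by omega) (by omega)]
  generalize hb : ASt.tick _ _ = b
  have hbA : AdjRep b E := by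
    rw [← hb]
    exact ((((hA.set (by omega) _).set (by omega) _).set (by omega) _).set (by omega) _).tick _
  have hG : GraphFrame 22 a b := by
    rw [← hb]
    exact ((((GraphFrame.rfl.set (by omega) _).set (by omega) _).set (by omega) _).set
      (by omega) _).tick _
  have hb22 : b.v 22 = k + 1 := by simp [← hb]
  have hb23 : b.v 23 = p + 1 := by simp [← hb]
  have hb24 : b.v 24 = runEnd B (k + 1) (p + 1) := by simp [← hb]
  have hb25 : b.v 25 = runEnd B (k + 1 + 1) (p + 1) := by simp [← hb]
  have hbt : b.time = a.time + 61 := by simp [← hb]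
  clear hb
  have skip : ¬ Stops B (k + 1) (p + 1) → ∀ t ≤ 50, wp M (block []) (fun b => ∃ E',
      EmitRel B n a (b.tick 1) E E' ∧ (b.tick 1).v 20 = k ∧ (b.tick 1).v 21 = p ∧
      Emitted B n E' (k + 1) (p + 1) ∧
      E'.length ≤ E.length + 4 * (if Stops B (k + 1) (p + 1) then 1 else 0) ∧
      (b.tick 1).time ≤ a.time + (200 * n + 900) *
        (if Stops B (k + 1) (p + 1) then 1 else 0) + 130) (b.tick t) := by
    intro hs t ht
    refine wp_block trivial ⟨E, ⟨((hbA.tick t).tick _).tick _, fun z hz => hG.v z (by omega), hG.raw, hG.arr,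
      List.Subset.refl _, hE⟩, ?_, ?_, fun h => absurd h hs, by simp, ?_⟩
    · simp [hG.v, h20]
    · simp [hG.v, h21]
    · simp [hs]; omega
  refine wp_cond (by simp) (lt_of_le_of_lt (Op.lt_le _ _) (by omega)) (fun hc => ?_) fun hc => ?_
  · simp [hb24] at hc
    refine wp_cond (by simp) (lt_of_le_of_lt (Op.eq_le _ _) (by omega)) (fun hc' => ?_)
      fun hc' => ?_
    · simp [hb24, hb25] at hc'
      rw [ASt.tick_tick]
      exact skip (fun h => h.2 hc'.symm) _ (by simp)
    · simp [hb24, hb25] at hc'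
      have hs : Stops B (k + 1) (p + 1) := ⟨by omega, fun h => hc' h.symm⟩
      rw [ASt.tick_tick]
      refine (wp_emitRect (a := b.tick _) (e := runEnd B (k + 1) (p + 1)) hB (fun k p h1 h2 h3 => ?_)
        ((hG.v 1 (by omega) (by omega)).trans h1)
        hb22 hb23 hb24 rfl hs.1 (by omega) (by omega) (by omega) (by omega) hV (hbA.tick _) hEV
        hE).mono ?_
      · show b.arr 10 _ = _
        rw [hG.arr 10 (by omega) (by omega) (by omega)]
        exact hF k p h1 h2 h3
      · rintro c ⟨E', x, c1, c2, c3, c4, c5, c6, c7, c8⟩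
        refine ⟨E', ⟨c1.tick _, fun z hz hz' => ?_, ?_, fun id i1 i2 i3 => ?_, c3, c4⟩, ?_, ?_,
          fun _ => ⟨x, c5, c6⟩, ?_, ?_⟩
        · exact (c2.v z (by omega) hz').trans (hG.v z (by omega) hz')
        · exact c2.raw.trans hG.raw
        · exact (c2.arr id i1 i2 i3).trans (hG.arr id i1 i2 i3)
        · simp [c2.v, hG.v, h20]
        · simp [c2.v, hG.v, h21]
        · simp [hs, c7]
        · simp [hbt] at c8
          simp [hs]; linarith
  · simp [hb24] at hc
    exact skip (fun h => h.1 hc) _ (by simp)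

theorem EmitRel.refl {a : ASt} (hA : AdjRep a E) (hE : ∀ e ∈ E, SoundEdge B (n + 2) e) :
    EmitRel B n a a E E :=
  ⟨hA, fun _ _ _ => rfl, rfl, fun _ _ _ _ => rfl, List.Subset.refl _, hE⟩

theorem EmitRel.trans {a b c : ASt} {E E' E'' : List (ℕ × ℕ)} (h : EmitRel B n a b E E')
    (h' : EmitRel B n b c E' E'') : EmitRel B n a c E E'' :=
  ⟨h'.rep, fun z hz hz' => (h'.v z hz hz').trans (h.v z hz hz'), h'.raw.trans h.raw,
    fun id h1 h2 h3 => (h'.arr id h1 h2 h3).trans (h.arr id h1 h2 h3),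
    fun _ hx => h'.sub (h.sub hx), h'.sound⟩

theorem EmitRel.set {a b : ASt} {E E' : List (ℕ × ℕ)} (h : EmitRel B n a b E E') {x : ℕ}
    (hx : 10 ≤ x) (y : ℕ) : EmitRel B n a (b.set x y) E E' :=
  ⟨h.rep.set (by omega) y, fun z hz hz' => by
    rw [ASt.set_v, if_neg (show z ≠ x by omega)]; exact h.v z hz hz', h.raw, h.arr, h.sub, h.sound⟩

theorem EmitRel.tick {a b : ASt} {E E' : List (ℕ × ℕ)} (h : EmitRel B n a b E E') (k : ℕ) :
    EmitRel B n a (b.tick k) E E' :=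
  ⟨h.rep.tick k, h.v, h.raw, h.arr, h.sub, h.sound⟩

theorem HasRuns.of_arr {a b : ASt} (h : HasRuns B n a) (hb : b.arr 10 = a.arr 10) :
    HasRuns B n b := fun k p h1 h2 h3 => by
  rw [hb]; exact h k p h1 h2 h3

theorem stopsIn_succ (k j : ℕ) [Decidable (Stops B (k + 1) (j + 1))] :
    stopsIn B k (j + 1) = stopsIn B k j + if Stops B (k + 1) (j + 1) then 1 else 0 := by
  rw [stopsIn, sum_range_succ, stopsIn]
  congr

theorem wp_emitRow {a : ASt} {k : ℕ} (hB : IsBits B n) (hF : HasRuns B n a)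
    (h0 : a.v 0 = n) (h1 : a.v 1 = n + 2) (h20 : a.v 20 = k) (hkn : k < n)
    (hV : 2 * ((n + 1) * (n + 2)) < M.V)
    (hA : AdjRep a E) (hEV : E.length + 4 * stopsIn B k n + 4 < M.V)
    (hE : ∀ e ∈ E, SoundEdge B (n + 2) e) :
    wp M (forUp 21 0 emitCell) (fun b => ∃ E', EmitRel B n a b E E' ∧ b.v 20 = k ∧
      (∀ p < n, Emitted B n E' (k + 1) (p + 1)) ∧ E'.length ≤ E.length + 4 * stopsIn B k n ∧
      b.time ≤ a.time + (200 * n + 900) * stopsIn B k n + 150 * n + 20) a := by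
  classical
  have hVp := M.Vpos
  have hnV : n + n + 4 < M.V := by nlinarith
  refine wp_for n (fun p b => ∃ E', EmitRel B n a b E E' ∧ b.v 20 = k ∧
      (∀ p' < p, Emitted B n E' (k + 1) (p' + 1)) ∧ E'.length ≤ E.length + 4 * stopsIn B k p ∧
      b.time ≤ a.time + (200 * n + 900) * stopsIn B k p + 150 * p + 15) (by omega) (by omega)
      (by omega) h0 (by omega) ?_ ?_ ?_
  · exact ⟨E, ((EmitRel.refl hA hE).set (by omega) _).tick _, by simp [h20], by simp, by simp, by simp⟩
  · rintro p hp b ⟨E', b1, b2, b3, b4, b5⟩ hb21 hb0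
    have hmono : stopsIn B k p ≤ stopsIn B k n := sum_le_sum_of_subset (by
      intro x hx; simp at hx ⊢; omega)
    refine (wp_emitCell hB (hF.of_arr (b1.arr 10 (by omega) (by omega) (by omega)))
      ((b1.v 1 (by omega) (by omega)).trans h1) b2 hb21 hkn hp hV b1.rep (by omega) b1.sound).mono ?_
    rintro c ⟨E'', c1, c2, c3, c4, c5, c6⟩
    refine ⟨c3, (c1.v 0 (by omega) (by omega)).trans hb0, E'',
      ((b1.trans c1).set (by omega) _).tick _, by simp [c2], fun p' hp' => ?_, ?_, ?_⟩
    · rcases Nat.lt_succ_iff_lt_or_eq.1 hp' with h | rfl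
      · exact (b3 p' h).mono c1.sub
      · exact c4
    · rw [stopsIn_succ]; omega
    · rw [stopsIn_succ, mul_add]; simp only [ASt.tick_time, ASt.set_time]; omega
  · rintro b ⟨E', b1, b2, b3, b4, b5⟩ hb21 hb0
    exact ⟨E', b1.tick _, b2, b3, b4, by simp only [ASt.tick_time]; omega⟩

theorem wp_emitPhase {a : ASt} {S : ℕ} (hB : IsBits B n) (hF : HasRuns B n a)
    (h0 : a.v 0 = n) (h1 : a.v 1 = n + 2) (hS : ∑ k ∈ range n, stopsIn B k n = S)
    (hV : 2 * ((n + 1) * (n + 2)) < M.V)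
    (hA : AdjRep a E) (hEV : E.length + 4 * S + 4 < M.V)
    (hE : ∀ e ∈ E, SoundEdge B (n + 2) e) :
    wp M emitPhase (fun b => ∃ E', EmitRel B n a b E E' ∧
      (∀ k p, Emitted B n E' k p) ∧ E'.length ≤ E.length + 4 * S ∧
      b.time ≤ a.time + (200 * n + 900) * S + 150 * (n * n) + 50 * n + 20) a := by
  have hVp := M.Vpos
  have hnV : n + n + 4 < M.V := by nlinarith
  refine wp_for n (fun k b => ∃ E', EmitRel B n a b E E' ∧
      (∀ k' < k, ∀ p < n, Emitted B n E' (k' + 1) (p + 1)) ∧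
      E'.length ≤ E.length + 4 * ∑ i ∈ range k, stopsIn B i n ∧
      b.time ≤ a.time + (200 * n + 900) * ∑ i ∈ range k, stopsIn B i n + 150 * (k * n) + 50 * k + 15)
      (by omega) (by omega) (by omega) h0 (by omega) ?_ ?_ ?_
  · exact ⟨E, ((EmitRel.refl hA hE).set (by omega) _).tick _, by simp, by simp, by simp⟩
  · rintro k hk b ⟨E', b1, b2, b3, b4⟩ hb20 hb0
    have hmono : ∑ i ∈ range (k + 1), stopsIn B i n ≤ S := by
      rw [← hS]
      exact sum_le_sum_of_subset (by intro x hx; simp at hx ⊢; omega)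
    rw [sum_range_succ] at hmono
    refine (wp_emitRow hB (hF.of_arr (b1.arr 10 (by omega) (by omega) (by omega))) hb0
      ((b1.v 1 (by omega) (by omega)).trans h1) hb20 hk hV b1.rep (by omega) b1.sound).mono ?_
    rintro c ⟨E'', c1, c2, c3, c4, c5⟩
    refine ⟨c2, (c1.v 0 (by omega) (by omega)).trans hb0, E'',
      ((b1.trans c1).set (by omega) _).tick _, fun k' hk' p hp => ?_, ?_, ?_⟩
    · rcases Nat.lt_succ_iff_lt_or_eq.1 hk' with h | rfl
      · exact (b2 k' h p hp).mono c1.sub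
      · exact c3 p hp
    · rw [sum_range_succ]; omega
    · rw [sum_range_succ, mul_add]
      have : (k + 1) * n = k * n + n := by ring
      simp only [ASt.tick_time, ASt.set_time]; omega
  · rintro b ⟨E', b1, b2, b3, b4⟩ hb20 hb0
    rw [hS] at b3 b4
    refine ⟨E', b1.tick _, fun k p hs => ?_, b3, by simp only [ASt.tick_time]; omega⟩
    have hr := (runEnd_eq_iff hs.1).1 rfl
    have hone : B k p ≠ 0 := by rw [hr.ones p le_rfl hr.lt]; omega
    have h1 := hB.row k p hone
    have h2 := hB.col k p hone
    have := b2 (k - 1) (by omega) (p - 1) (by omega)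
    rw [Nat.sub_add_cancel h1.1, Nat.sub_add_cancel h2.1] at this
    exact this hs

end WordRAM

/-! ### Breadth-first search through the digraph -/

namespace WordRAM

open Finset

variable {B : ℕ → ℕ → ℕ} {n m : ℕ} {E : List (ℕ × ℕ)} {M : Mach} {ord : ℕ → ℕ}

/-! ### Breadth-first search: state -/

/-- What the search reads and does not change. -/
structure Env (n : ℕ) (E : List (ℕ × ℕ)) (ord : ℕ → ℕ) (a : ASt) : Prop where
  n_eq : a.v 0 = n
  m_eq : a.v 1 = n + 2
  adj : AdjRep a E
  ord_eq : ∀ k, 1 ≤ k → k ≤ n → a.arr 7 k = ord k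

theorem Env.of_eq {a b : ASt} (h : Env n E ord a) (hv : b.low 20 = a.low 20)
    (ha : ∀ id, id < 14 → b.arr id = a.arr id) : Env n E ord b :=
  ⟨(ASt.v_eq hv 0 (by omega)).trans h.n_eq, (ASt.v_eq hv 1 (by omega)).trans h.m_eq,
    ⟨(ASt.v_eq hv 6 (by omega)).trans h.adj.count, by
      rw [ha 11 (by omega), ha 12 (by omega), ha 13 (by omega)]; exact h.adj.chain⟩,
    by rw [ha 7 (by omega)]; exact h.ord_eq⟩

/-- The general assumptions on the parameters. -/
structure Params (B : ℕ → ℕ → ℕ) (n : ℕ) (E : List (ℕ × ℕ)) (ord : ℕ → ℕ) (M : Mach) : Prop where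
  pos : 1 ≤ n
  bits : IsBits B n
  sound : ∀ e ∈ E, SoundEdge B (n + 2) e
  complete : ∀ k j, B k j = 1 → Reach E (rowN (n + 2) 1 k) (colN (n + 2) 1 j)
  ord_lt : ∀ k, 1 ≤ k → k ≤ n → ord k < n
  ord_inj : ∀ k j, 1 ≤ k → k ≤ n → 1 ≤ j → j ≤ n → ord k = ord j → k = j
  fitsV : 2 * ((n + 2) * (n + 2) + (n + 2)) + 1 < M.V
  fitsE : n + E.length + 1 < M.V
  fitsB : M.B = 2 * (n * n)

/-- The entries of an array below `l.length`, from top to bottom. -/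
def StackRep (f : ℕ → ℕ) : List ℕ → Prop
  | [] => True
  | y :: l => f l.length = y ∧ StackRep f l

theorem StackRep.update {f : ℕ → ℕ} {l : List ℕ} (h : StackRep f l) {i : ℕ} (hi : l.length ≤ i)
    (y : ℕ) : StackRep (Function.update f i y) l := by
  induction l with
  | nil => trivial
  | cons z l ih =>
    rw [List.length_cons] at hi
    exact ⟨by rw [Function.update_of_ne (by omega)]; exact h.1, ih h.2 (by omega)⟩

/-- The nodes `F` are finished, the nodes `st` are on the stack. -/
structure Search (src : ℕ) (b : ASt) (F : Finset ℕ) (st : List ℕ) : Prop where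
  -- Marks are stamps with the number of the source. Sources are treated in increasing order and no
  -- stamp exceeds the current one, so marks of former searches need not be cleared. Array `15`
  -- works in the same way.
  vis : ∀ y, b.arr 14 y = src ↔ y ∈ F ∨ y ∈ st
  vis_le : ∀ y, b.arr 14 y ≤ src
  len : b.v 29 = st.length
  rep : StackRep (b.arr 17) st
  nodup : st.Nodup
  disj : ∀ y ∈ st, y ∉ F

theorem Search.of_eq {src : ℕ} {b c : ASt} {F : Finset ℕ} {st : List ℕ} (h : Search src b F st)
    (h14 : c.arr 14 = b.arr 14) (h17 : c.arr 17 = b.arr 17) (hv : c.v 29 = b.v 29) :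
    Search src c F st :=
  ⟨by rw [h14]; exact h.vis, by rw [h14]; exact h.vis_le, hv.trans h.len,
    by rw [h17]; exact h.rep, h.nodup, h.disj⟩

/-- Push the node in variable `33` if it has not been visited. -/
def pushNode : Prog :=
  cond (.op .eq (.get 14 (.var 33)) (.var 22)) (block [])
    (block [.put 14 (.var 33) (.var 22), .put 17 (.var 29) (.var 33), .asg 29 (.var 29 + 1)])

/-- Nothing but the stack has changed. -/
structure StackFrame (a b : ASt) : Prop where
  low : b.low 29 = a.low 29
  raw : b.raw = a.raw
  arr : ∀ id, id ≠ 14 → id ≠ 17 → b.arr id = a.arr id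

theorem StackFrame.trans {a b c : ASt} (h : StackFrame a b) (h' : StackFrame b c) :
    StackFrame a c :=
  ⟨h'.low.trans h.low, h'.raw.trans h.raw, fun id i j => (h'.arr id i j).trans (h.arr id i j)⟩

theorem wp_pushNode {src y : ℕ} {a : ASt} {F : Finset ℕ} {st : List ℕ} (h : Search src a F st)
    (h22 : a.v 22 = src) (h33 : a.v 33 = y) (hy : y < M.V)
    (hst : st.length + 1 < M.V) :
    wp M pushNode (fun b => ∃ st', Search src b F st' ∧ st ⊆ st' ∧ (y ∈ F ∨ y ∈ st') ∧
      (∀ z ∈ st', z ∈ st ∨ z = y) ∧ st'.length ≤ st.length + 1 ∧ StackFrame a b ∧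
      b.v 31 = a.v 31 ∧ b.time ≤ a.time + 80) a := by
  have hVp := M.Vpos
  have hlen := h.len
  refine wp_cond (by simp [h33, hy]) (lt_of_le_of_lt (Op.eq_le _ _) (by omega)) (fun hc => ?_)
    fun hc => ?_
  · simp [h33, h22] at hc
    refine wp_block trivial ⟨st, h.of_eq rfl rfl rfl, fun _ h => h, (h.vis y).1 hc,
      fun z hz => Or.inl hz, by omega, ⟨rfl, rfl, fun _ _ _ => rfl⟩, rfl, by simp⟩
  · simp [h33, h22] at hc
    have hy' : ¬ (y ∈ F ∨ y ∈ st) := fun hh => hc ((h.vis y).2 hh)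
    push Not at hy'
    refine wp_block (by simp [h33, h22, hlen]; omega) ⟨y :: st, ⟨fun z => ?_, fun z => ?_, ?_, ?_, ?_,
      ?_⟩, fun z hz => by simp [hz], by simp, fun z hz => ?_, by simp, ⟨by simp, by simp,
      fun id h1 h2 => by simp [h1, h2]⟩, by simp, by simp⟩
    · by_cases hz : z = y
      · simp [h33, h22, hz]
      · simp [h33, h22, hz, h.vis]
    · by_cases hz : z = y
      · simp [h33, h22, hz]
      · simp [h33, h22, hz, h.vis_le]
    · simp [hlen]
    · refine ⟨by simp [hlen, h33], ?_⟩
      simp [h33, hlen]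
      exact h.rep.update le_rfl _
    · exact List.nodup_cons.2 ⟨hy'.2, h.nodup⟩
    · intro z hz
      rcases List.mem_cons.1 hz with rfl | hz
      · exact hy'.1
      · exact h.disj z hz
    · rcases List.mem_cons.1 hz with rfl | hz
      · exact Or.inr rfl
      · exact Or.inl hz

/-- Push all nodes on the list that starts at variable `31`. -/
def scanEdges : Prog :=
  whileDo (.op .lt 0 (.var 31))
    (.seq (block [.asg 33 (.get 13 (.var 31)), .asg 31 (.get 12 (.var 31))]) pushNode)

theorem wp_scanEdges {src cnt : ℕ} {a : ASt} {F : Finset ℕ} {st r : List ℕ}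
    (h : Search src a F st) (h22 : a.v 22 = src) (hr : IsChain cnt (a.arr 12) (a.arr 13) (a.v 31) r)
    (hcnt : cnt < M.V) (hrV : ∀ y ∈ r, y < M.V)
    (hst : st.length + r.length + 1 < M.V) :
    wp M scanEdges (fun b => ∃ st', Search src b F st' ∧ st ⊆ st' ∧ (∀ y ∈ r, y ∈ F ∨ y ∈ st') ∧
      (∀ z ∈ st', z ∈ st ∨ z ∈ r) ∧ st'.length ≤ st.length + r.length ∧ StackFrame a b ∧
      b.time ≤ a.time + 150 * r.length + 20) a := by
  have hVp := M.Vpos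
  refine wp_while (fun k b => ∃ st' r₁ r₂, r = r₁ ++ r₂ ∧ k = r₂.length ∧
      IsChain cnt (b.arr 12) (b.arr 13) (b.v 31) r₂ ∧ Search src b F st' ∧ st ⊆ st' ∧
      (∀ y ∈ r₁, y ∈ F ∨ y ∈ st') ∧ (∀ z ∈ st', z ∈ st ∨ z ∈ r) ∧
      st'.length ≤ st.length + r₁.length ∧ StackFrame a b ∧
      b.time ≤ a.time + 150 * r₁.length + 15) r.length ?_ ?_ ?_ ?_
  · exact ⟨st, [], r, rfl, rfl, hr, h.of_eq rfl rfl rfl, fun _ h => h, by simp, fun z hz => Or.inl hz,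
      by simp, ⟨rfl, rfl, fun _ _ _ => rfl⟩, by simp⟩
  · rintro k b -
    exact ⟨by simp, lt_of_le_of_lt (Op.lt_le _ _) (by omega)⟩
  · rintro k b ⟨st', r₁, r₂, e1, e2, b1, b2, b3, b4, b5, b6, b7, b8⟩ hc
    simp [Nat.pos_iff_ne_zero] at hc
    cases r₂ with
    | nil => exact absurd b1 (by show ¬ _ = 0; omega)
    | cons y r₂ =>
      obtain ⟨c1, c2, c3, c4⟩ := b1
      have hl : r.length = r₁.length + (r₂.length + 1) := by simp [e1]
      have hyV := hrV y (by simp [e1])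
      have hnx := c4.le
      refine wp_seq (wp_block (by simp; omega) ?_)
      refine (wp_pushNode (src := src) (y := y) (F := F) (st := st') (b2.of_eq (by simp) (by simp) (by simp))
        ?_ ?_ hyV (by omega)).mono ?_
      · simpa using (ASt.v_eq b7.low 22 (by omega)).trans h22
      · simp [c3]
      · rintro d ⟨st'', d1, d2, d3, d4, d5, d6, d7, d8⟩
        simp at d7 d8
        refine ⟨r₂.length, by simp [e2], st'', r₁ ++ [y], r₂, by simp [e1], rfl, ?_,
          d1.of_eq rfl rfl rfl, fun z hz => d2 (b3 hz), fun z hz => ?_, fun z hz => ?_, ?_, ?_, ?_⟩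
        · have h12 := d6.arr 12 (by omega) (by omega)
          have h13 := d6.arr 13 (by omega) (by omega)
          simp at h12 h13 ⊢
          rw [d7, h12, h13]; exact c4
        · rcases List.mem_append.1 hz with hz | hz
          · exact (b4 z hz).imp id fun h => d2 h
          · rw [List.mem_singleton.1 hz]; exact d3
        · rcases d4 z hz with hz | rfl
          · exact b5 z hz
          · exact Or.inr (by simp [e1])
        · simp; omega
        · have := b7.trans (b := b) (c := d) ⟨d6.low.trans (by simp), d6.raw.trans (by simp),
            fun id h1 h2 => (d6.arr id h1 h2).trans (by simp)⟩
          exact ⟨this.low, this.raw, this.arr⟩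
        · simp; omega
  · rintro k b ⟨st', r₁, r₂, e1, e2, b1, b2, b3, b4, b5, b6, b7, b8⟩ hc
    simp [Nat.pos_iff_ne_zero] at hc
    cases r₂ with
    | cons y r₂ => exact absurd hc b1.1
    | nil =>
      simp only [List.append_nil] at e1
      subst e1
      exact ⟨st', b2.of_eq rfl rfl rfl, b3, b4, b5, b6, ⟨b7.low, b7.raw, b7.arr⟩, by simp; omega⟩

end WordRAM

namespace WordRAM

open Finset

variable {B : ℕ → ℕ → ℕ} {n m : ℕ} {E : List (ℕ × ℕ)} {M : Mach} {ord : ℕ → ℕ}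

/-! ### Breadth-first search: the queue -/

/-- The positions `q` have been seen from `src`, with distances `D` and parents `par`; everything
but the output for `src` is as in `raw0`. -/
structure Seen (B : ℕ → ℕ → ℕ) (n : ℕ) (E : List (ℕ × ℕ)) (ord raw0 : ℕ → ℕ) (src : ℕ) (b : ASt)
    (q : List ℕ) (D par : ℕ → ℕ) : Prop where
  env : Env n E ord b
  v22 : b.v 22 = src
  v23 : b.v 23 = ord src * n
  len : b.v 25 = q.length
  nodup : q.Nodup
  rng : ∀ j ∈ q, 1 ≤ j ∧ j ≤ n
  seen : ∀ j, b.arr 15 j = src ↔ j ∈ q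
  seen_le : ∀ j, b.arr 15 j ≤ src
  queue : ∀ i < q.length, b.arr 16 i = q.getD i 0
  dist : ∀ j ∈ q, b.raw (ord src * n + ord j) = D j
  nodist : ∀ j, 1 ≤ j → j ≤ n → j ∉ q → b.raw (ord src * n + ord j) = n
  parent : ∀ j ∈ q, j ≠ src → b.raw (n * n + (ord src * n + ord j)) = ord (par j)
  other : ∀ y, (∀ x < n, y ≠ ord src * n + x ∧ y ≠ n * n + (ord src * n + x)) → b.raw y = raw0 y
  mem : src ∈ q
  dist_src : D src = 0
  tree : ∀ j ∈ q, j ≠ src → par j ∈ q ∧ B (par j) j = 1 ∧ D j = D (par j) + 1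
  sorted : q.Pairwise fun i j => D i ≤ D j
  -- This keeps all distances below the number of seen positions, so that they fit into a word.
  bound : ∀ i < q.length, D (q.getD i 0) ≤ i

theorem Seen.of_eq {raw0 : ℕ → ℕ} {src : ℕ} {b c : ASt} {q : List ℕ} {D par : ℕ → ℕ}
    (h : Seen B n E ord raw0 src b q D par) (hv : c.low 20 = b.low 20) (h22 : c.v 22 = b.v 22)
    (h23 : c.v 23 = b.v 23) (h25 : c.v 25 = b.v 25) (hr : c.raw = b.raw)
    (ha : ∀ id, id ≠ 14 → id ≠ 17 → c.arr id = b.arr id) :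
    Seen B n E ord raw0 src c q D par := by
  obtain ⟨a1, a2, a3, a4, a5, a6, a7, a8, a9, a10, a11, a12, a13, a14, a15, a16, a17, a18⟩ := h
  refine ⟨a1.of_eq hv fun id hid => ha id (by omega) (by omega), h22.trans a2, h23.trans a3,
    h25.trans a4, a5, a6, ?_, ?_, ?_, ?_, ?_, ?_, ?_, a14, a15, a16, a17, a18⟩
  · rw [ha 15 (by omega) (by omega)]; exact a7
  · rw [ha 15 (by omega) (by omega)]; exact a8
  · rw [ha 16 (by omega) (by omega)]; exact a9
  all_goals rw [hr]; assumption

theorem Seen.length_le {raw0 : ℕ → ℕ} {src : ℕ} {b : ASt} {q : List ℕ} {D par : ℕ → ℕ}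
    (h : Seen B n E ord raw0 src b q D par) : q.length ≤ n := by
  have := card_le_card (s := q.toFinset) (t := Icc 1 n) fun j hj => by
    have := h.rng j (by simpa using hj)
    simpa using this
  rw [List.toFinset_card_of_nodup h.nodup] at this
  simpa using this

theorem Seen.dist_le {raw0 : ℕ → ℕ} {src : ℕ} {b : ASt} {q : List ℕ} {D par : ℕ → ℕ}
    (h : Seen B n E ord raw0 src b q D par) {j : ℕ} (hj : j ∈ q) : D j < q.length := by
  obtain ⟨i, hi, rfl⟩ := List.getElem_of_mem hj
  have := h.bound i hi
  rw [List.getD_eq_getElem _ _ hi] at this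
  omega

/-- The search has seen more positions, at distance at most `D k + 1`. -/
structure Grow (k : ℕ) (q : List ℕ) (D : ℕ → ℕ) (q' : List ℕ) (D' : ℕ → ℕ) : Prop where
  pre : q <+: q'
  eq : ∀ j ∈ q, D' j = D j
  bound : ∀ j ∈ q', D' j ≤ D k + 1

theorem Grow.trans {k : ℕ} {q q' q'' : List ℕ} {D D' D'' : ℕ → ℕ} (h : Grow k q D q' D')
    (h' : Grow k q' D' q'' D'') (hk : k ∈ q) : Grow k q D q'' D'' :=
  ⟨h.pre.trans h'.pre, fun j hj => (h'.eq j (h.pre.subset hj)).trans (h.eq j hj), fun j hj => by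
    have := h'.bound j hj
    rwa [h.eq k hk] at this⟩

/-- If the node in variable `30` is a column that has not been seen, it enters the queue. -/
def visitLeaf : Prog :=
  cond (.op .eq (.var 30 % 2) 0)
    (.seq (block [.asg 34 (.var 30 / 2)])
      (cond (.op .eq (.var 34 / .var 1) 1)
        (.seq (block [.asg 32 (.var 34 - .var 1)])
          (cond (.op .eq (.get 15 (.var 32)) (.var 22)) (block [])
            (block [.put 15 (.var 32) (.var 22), .put 16 (.var 25) (.var 32),
              .asg 25 (.var 25 + 1), .asg 33 (.var 23 + .get 7 (.var 32)),
              .putRaw (.var 33) (.var 27),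
              .putRaw (.var 0 * .var 0 + .var 33) (.var 28)])))
        (block [])))
    (block [])

/-- What a visit does not change. -/
structure VisitFrame (a b : ASt) : Prop where
  low : b.low 25 = a.low 25
  v : ∀ z, 26 ≤ z → z < 32 → b.v z = a.v z
  arr : ∀ id, id ≠ 15 → id ≠ 16 → b.arr id = a.arr id

/-- Column nodes have even numbers, and the quotient of the halved number by `m` is the length of
the interval; leaves have length 1. -/
theorem eq_colN_iff {x : ℕ} (hm : 0 < m) :
    (x % 2 = 0 ∧ x / 2 / m = 1) ↔ ∃ j < m, x = colN m 1 j := by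
  constructor
  · rintro ⟨h1, h2⟩
    have h3 := Nat.div_add_mod (x / 2) m
    rw [h2, mul_one] at h3
    refine ⟨x / 2 % m, Nat.mod_lt _ hm, ?_⟩
    rw [colN]
    omega
  · rintro ⟨j, hj, rfl⟩
    refine ⟨by simp [colN], ?_⟩
    rw [colN, Nat.mul_div_cancel_left _ (by omega), one_mul, Nat.add_div_left _ hm,
      Nat.div_eq_of_lt hj]

/-- The result of a visit. -/
def VisitPost (B : ℕ → ℕ → ℕ) (n : ℕ) (E : List (ℕ × ℕ)) (ord raw0 : ℕ → ℕ) (src k x : ℕ)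
    (q : List ℕ) (D : ℕ → ℕ) (a b : ASt) : Prop :=
  ∃ q' D' par', Seen B n E ord raw0 src b q' D' par' ∧ Grow k q D q' D' ∧
    (∀ j < n + 2, x = colN (n + 2) 1 j → j ∈ q') ∧ VisitFrame a b

theorem VisitPost.tick {raw0 : ℕ → ℕ} {src k x : ℕ} {q : List ℕ} {D : ℕ → ℕ} {a b : ASt}
    (h : VisitPost B n E ord raw0 src k x q D a b) (t : ℕ) :
    VisitPost B n E ord raw0 src k x q D a (b.tick t) := by
  obtain ⟨q', D', par', h1, h2, h3, h4⟩ := h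
  exact ⟨q', D', par', h1.of_eq rfl rfl rfl rfl rfl fun _ _ _ => rfl, h2, h3, h4.low, h4.v, h4.arr⟩

theorem getD_append_left {q : List ℕ} {i j : ℕ} (hi : i < q.length) :
    (q ++ [j]).getD i 0 = q.getD i 0 := by
  rw [List.getD_append _ _ _ _ hi]

theorem getD_append_length (q : List ℕ) (j : ℕ) : (q ++ [j]).getD q.length 0 = j := by
  simp

/-- The new position gets distance `D k + 1`. The queue remains sorted because nothing seen so far
is farther away, and the output cells written belong to `j` alone because `ord` is injective. -/
theorem Seen.visit (hp : Params B n E ord M) {raw0 : ℕ → ℕ} {src k j : ℕ} {a b : ASt} {q : List ℕ}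
    {D par : ℕ → ℕ} (h : Seen B n E ord raw0 src a q D par) (hk : k ∈ q)
    (hbd : ∀ j ∈ q, D j ≤ D k + 1) (hB : B k j = 1) (hj1 : 1 ≤ j) (hjn : j ≤ n) (hjq : j ∉ q)
    (hv : b.low 20 = a.low 20) (h22 : b.v 22 = a.v 22) (h23 : b.v 23 = a.v 23)
    (h25 : b.v 25 = a.v 25 + 1)
    (hr : b.raw = Function.update (Function.update a.raw (ord src * n + ord j) (D k + 1))
      (n * n + (ord src * n + ord j)) (ord k))
    (ha : ∀ id, id < 14 → b.arr id = a.arr id)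
    (h15 : b.arr 15 = Function.update (a.arr 15) j src)
    (h16 : b.arr 16 = Function.update (a.arr 16) q.length j) :
    Seen B n E ord raw0 src b (q ++ [j]) (Function.update D j (D k + 1))
      (Function.update par j k) := by
  have hD : ∀ i ∈ q, Function.update D j (D k + 1) i = D i := fun i hi => by
    rw [Function.update_of_ne]; rintro rfl; exact hjq hi
  have hpar : ∀ i ∈ q, Function.update par j k i = par i := fun i hi => by
    rw [Function.update_of_ne]; rintro rfl; exact hjq hi
  have hsj : src ≠ j := by rintro rfl; exact hjq h.mem
  have hsr := h.rng src h.mem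
  have hs := hp.ord_lt src hsr.1 hsr.2
  have hoj := hp.ord_lt j hj1 hjn
  have hbase : ord src * n + n ≤ n * n := by
    have := Nat.mul_le_mul_right n (show ord src + 1 ≤ n by omega)
    rwa [add_mul, one_mul] at this
  have hne : ∀ i, 1 ≤ i → i ≤ n → i ≠ j → ord i ≠ ord j := fun i h1 h2 h3 h4 =>
    h3 (hp.ord_inj i j h1 h2 hj1 hjn h4)
  refine ⟨h.env.of_eq hv ha, h22.trans h.v22, h23.trans h.v23, ?_, ?_, ?_, ?_, ?_, ?_, ?_, ?_, ?_,
    ?_, ?_, ?_, ?_, ?_, ?_⟩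
  · simp [h25, h.len]
  · rw [List.nodup_append]
    refine ⟨h.nodup, List.nodup_singleton _, fun x hx y hy => ?_⟩
    rw [List.mem_singleton.1 hy]
    rintro rfl
    exact hjq hx
  · intro i hi
    rcases List.mem_append.1 hi with hi | hi
    · exact h.rng i hi
    · rw [List.mem_singleton.1 hi]; exact ⟨hj1, hjn⟩
  · intro i
    by_cases hi : i = j
    · simp [h15, hi]
    · simp [h15, hi, h.seen]
  · intro i
    by_cases hi : i = j
    · simp [h15, hi]
    · simp [h15, hi, h.seen_le]
  · intro i hi
    rw [List.length_append, List.length_singleton] at hi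
    rcases Nat.lt_succ_iff_lt_or_eq.1 hi with hi | rfl
    · rw [getD_append_left hi, h16, Function.update_of_ne (by omega), h.queue i hi]
    · rw [getD_append_length, h16, Function.update_self]
  · intro i hi
    rcases List.mem_append.1 hi with hi | hi
    · have hir := h.rng i hi
      have := hp.ord_lt i hir.1 hir.2
      have := hne i hir.1 hir.2 (by intro hij; rw [hij] at hi; exact hjq hi)
      rw [hr, Function.update_of_ne (by omega), Function.update_of_ne (by omega), h.dist i hi, hD i hi]
    · rw [List.mem_singleton.1 hi, hr, Function.update_of_ne (by omega), Function.update_self,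
        Function.update_self]
  · intro i hi1 hin hi
    simp only [List.mem_append, List.mem_singleton, not_or] at hi
    have := hp.ord_lt i hi1 hin
    have := hne i hi1 hin hi.2
    rw [hr, Function.update_of_ne (by omega), Function.update_of_ne (by omega), h.nodist i hi1 hin hi.1]
  · intro i hi his
    rcases List.mem_append.1 hi with hi | hi
    · have hir := h.rng i hi
      have := hp.ord_lt i hir.1 hir.2
      have := hne i hir.1 hir.2 (by intro hij; rw [hij] at hi; exact hjq hi)
      rw [hr, Function.update_of_ne (by omega), Function.update_of_ne (by omega), h.parent i hi his,
        hpar i hi]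
    · rw [List.mem_singleton.1 hi, hr, Function.update_self, Function.update_self]
  · intro y hy
    obtain ⟨y1, y2⟩ := hy _ hoj
    rw [hr, Function.update_of_ne y2, Function.update_of_ne y1, h.other y hy]
  · simp [h.mem]
  · rw [hD _ h.mem, h.dist_src]
  · intro i hi his
    rcases List.mem_append.1 hi with hi | hi
    · obtain ⟨t1, t2, t3⟩ := h.tree i hi his
      rw [hpar i hi, hD i hi, hD _ t1]
      exact ⟨by simp [t1], t2, t3⟩
    · rw [List.mem_singleton.1 hi, Function.update_self, Function.update_self, hD k hk]
      exact ⟨by simp [hk], hB, rfl⟩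
  · rw [List.pairwise_append]
    refine ⟨h.sorted.imp_of_mem fun {x y} hx hy hxy => ?_, List.pairwise_singleton _ _,
      fun x hx y hy => ?_⟩
    · rwa [hD x hx, hD y hy]
    · rw [List.mem_singleton.1 hy, Function.update_self, hD x hx]
      exact hbd x hx
  · intro i hi
    rw [List.length_append, List.length_singleton] at hi
    rcases Nat.lt_succ_iff_lt_or_eq.1 hi with hi | rfl
    · rw [getD_append_left hi, hD _ (by rw [List.getD_eq_getElem _ _ hi]; exact List.getElem_mem hi)]
      exact h.bound i hi
    · rw [getD_append_length, Function.update_self]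
      have := h.dist_le hk
      omega

theorem wp_visitLeaf (hp : Params B n E ord M) {raw0 : ℕ → ℕ} {src k x : ℕ} {a : ASt} {q : List ℕ}
    {D par : ℕ → ℕ} (h : Seen B n E ord raw0 src a q D par) (hk : k ∈ q)
    (hbd : ∀ j ∈ q, D j ≤ D k + 1) (h27 : a.v 27 = D k + 1)
    (h28 : a.v 28 = ord k) (h30 : a.v 30 = x) (hx : Reach E (rowN (n + 2) 1 k) x) (hxV : x < M.V) :
    wp M visitLeaf (fun b => VisitPost B n E ord raw0 src k x q D a b ∧
      b.time ≤ a.time + 150) a := by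
  have hVp := M.Vpos
  have hkr := h.rng k hk
  have hsrc := h.rng src h.mem
  have hV := hp.fitsV
  have hnn : (n + 2) * (n + 2) = n * n + 4 * n + 4 := by ring
  have h1 := h.env.m_eq
  have h0 := h.env.n_eq
  have hleaf := eq_colN_iff (m := n + 2) (x := x) (by omega)
  -- All branches without effect are handled at once: the node is not a column leaf, or its column
  -- has already been seen.
  have skip : (¬ ∃ j < n + 2, x = colN (n + 2) 1 j) ∨ (∃ j ∈ q, x = colN (n + 2) 1 j) →
      ∀ c, c.time ≤ a.time + 100 → c.low 25 = a.low 25 → (∀ z, z < 32 → c.v z = a.v z) →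
      c.raw = a.raw → c.arr = a.arr →
      wp M (block []) (fun b => VisitPost B n E ord raw0 src k x q D a b ∧
        b.time ≤ a.time + 102) c := by
    intro hno c ht hl hv hr ha
    refine wp_block trivial ⟨⟨q, D, par, h.of_eq (ASt.low_mono hl (by omega)) (hv _ (by omega))
      (hv _ (by omega)) (hv _ (by omega)) hr fun id _ _ => congrFun ha id,
      ⟨List.prefix_rfl, fun _ _ => rfl, hbd⟩, fun j hj e => ?_,
      ⟨hl, fun z _ hz => hv z hz, fun id _ _ => congrFun ha id⟩⟩, by simp; omega⟩
    rcases hno with hno | ⟨i, hi, e'⟩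
    · exact absurd ⟨j, hj, e⟩ hno
    · have := h.rng i hi
      rw [e', colN, colN] at e
      obtain rfl : i = j := by omega
      exact hi
  refine wp_cond (by simp [h30]; omega) (lt_of_le_of_lt (Op.eq_le _ _) (by omega)) (fun hc => ?_)
    fun hc => ?_
  · simp [h30] at hc
    refine wp_seq (wp_block (by simp [h30]; omega) ?_)
    have hdv : x / 2 / (n + 2) ≤ x := (Nat.div_le_self _ _).trans (Nat.div_le_self _ _)
    refine wp_cond (by simp [h30, h1]; omega) (lt_of_le_of_lt (Op.eq_le _ _) (by omega))
      (fun hc' => ?_) fun hc' => ?_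
    · simp [h30, h1] at hc'
      obtain ⟨j, hj, rfl⟩ := hleaf.1 ⟨hc, hc'⟩
      have hB := Reach.sound_leaf hp.sound (show k < n + 2 by omega) hj hx
      have hjr := hp.bits.col k j (by omega)
      have hx2 : colN (n + 2) 1 j / 2 = n + 2 + j := by rw [colN]; omega
      refine wp_seq (wp_block (by simp [h30, h1, hx2]; omega) ?_)
      have hs15 : a.arr 15 j ≤ src := h.seen_le j
      refine wp_cond (by simp [h30, h1, hx2]; omega) (lt_of_le_of_lt (Op.eq_le _ _) (by omega))
        (fun hc' => ?_) fun hc' => ?_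
      · simp [h30, h1, hx2, h.v22] at hc'
        refine wp.mono (skip (Or.inr ⟨j, (h.seen j).1 hc', rfl⟩) _ ?_ ?_ (fun z hz => ?_) ?_ ?_) ?_
        · simp
        · simp
        · simp [show z ≠ 32 by omega, show z ≠ 34 by omega]
        · rfl
        · rfl
        · rintro b ⟨b1, b2⟩
          exact ⟨(b1.tick _).tick _, by simp only [ASt.tick_time]; omega⟩
      · simp [h30, h1, hx2, h.v22] at hc'
        have hjq : j ∉ q := fun hh => hc' ((h.seen j).2 hh)
        have hoj := hp.ord_lt j hjr.1 hjr.2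
        have hos := hp.ord_lt src hsrc.1 hsrc.2
        have hok := hp.ord_lt k hkr.1 hkr.2
        have hbase : ord src * n + n ≤ n * n := by
          have := Nat.mul_le_mul_right n (show ord src + 1 ≤ n by omega)
          rwa [add_mul, one_mul] at this
        have hql := h.length_le
        have hDk := h.dist_le hk
        have h7 := h.env.ord_eq j hjr.1 hjr.2
        have hMB := hp.fitsB
        refine wp_block ?_ ?_
        · simp [h30, h1, hx2, h.v22, h.v23, h.len, h27, h7, h0]
          omega
        · refine ⟨⟨_, _, _, h.visit hp (j := j) hk hbd hB hjr.1 hjr.2 hjq ?_ ?_ ?_ ?_ ?_ ?_ ?_ ?_,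
            ⟨⟨[j], rfl⟩, fun i hi => ?_, fun i hi => ?_⟩, fun i hi e => ?_, ⟨?_, ?_, ?_⟩⟩, ?_⟩
          · simp
          · simp
          · simp
          · simp
          · simp [h30, h1, hx2, h.v23, h27, h28, h7, h0]
          · intro id hid
            simp [show id ≠ 15 by omega, show id ≠ 16 by omega]
          · simp [h30, h1, hx2, h.v22]
          · simp [h30, h1, hx2, h.len]
          · rw [Function.update_of_ne]; rintro rfl; exact hjq hi
          · rcases List.mem_append.1 hi with hi | hi
            · rw [Function.update_of_ne]
              · exact hbd i hi
              · intro hij; rw [hij] at hi; exact hjq hi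
            · rw [List.mem_singleton.1 hi, Function.update_self]
          · rw [colN, colN] at e
            obtain rfl : i = j := by omega
            simp
          · simp
          · intro z hz hz'
            simp [show z ≠ 25 by omega, show z ≠ 33 by omega, show z ≠ 32 by omega,
              show z ≠ 34 by omega]
          · intro id h1 h2
            simp [h1, h2]
          · simp
    · simp [h30, h1] at hc'
      refine wp.mono (skip (Or.inl fun hh => hc' (hleaf.2 hh).2) _ ?_ ?_ (fun z hz => ?_) ?_ ?_) ?_
      · simp
      · simp
      · simp [show z ≠ 34 by omega]
      · rfl
      · rfl
      · rintro b ⟨b1, b2⟩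
        exact ⟨b1.tick _, by simp only [ASt.tick_time]; omega⟩
  · simp [h30] at hc
    refine wp.mono (skip (Or.inl fun hh => by have := (hleaf.2 hh).1; omega) _ ?_ rfl (fun z hz => rfl)
      rfl rfl) ?_
    · simp
    rintro b ⟨b1, b2⟩
    exact ⟨b1, by omega⟩

end WordRAM

namespace WordRAM

open Finset

variable {B : ℕ → ℕ → ℕ} {n m : ℕ} {E : List (ℕ × ℕ)} {M : Mach} {ord : ℕ → ℕ}

/-! ### Breadth-first search: the search among the intervals -/

/-- The number of edges from a set of nodes. -/
def outDeg (E : List (ℕ × ℕ)) (F : Finset ℕ) : ℕ := ∑ x ∈ F, (targets E x).length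

/-- Every edge is counted only at its source. -/
theorem outDeg_le (E : List (ℕ × ℕ)) (F : Finset ℕ) : outDeg E F ≤ E.length := by
  induction E with
  | nil => simp [outDeg, targets]
  | cons e E ih =>
    have h : ∀ x, (targets (e :: E) x).length = (if e.1 = x then 1 else 0) + (targets E x).length := by
      intro x
      by_cases hx : e.1 = x
      · simp [targets, hx, add_comm]
      · simp [targets, hx]
    have h2 : outDeg (e :: E) F = (∑ x ∈ F, if e.1 = x then 1 else 0) + outDeg E F := by
      rw [outDeg, outDeg, ← sum_add_distrib]
      exact sum_congr rfl fun x _ => h x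
    have h3 : (∑ x ∈ F, if e.1 = x then 1 else 0) ≤ 1 := by
      rw [sum_ite_eq]
      split_ifs <;> omega
    rw [h2, List.length_cons]
    omega

theorem outDeg_insert {F : Finset ℕ} {x : ℕ} (hx : x ∉ F) :
    outDeg E (insert x F) = outDeg E F + (targets E x).length := by
  rw [outDeg, sum_insert hx, outDeg, add_comm]

theorem Params.target_lt (hp : Params B n E ord M) {x y : ℕ} (h : (x, y) ∈ E) : y < M.V :=
  (hp.sound _ h).target_le.trans_lt hp.fitsV

theorem Params.reach_lt (hp : Params B n E ord M) {k x : ℕ} (hk : k ≤ n)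
    (h : Reach E (rowN (n + 2) 1 k) x) : x < M.V := by
  have hV := hp.fitsV
  rcases Relation.ReflTransGen.cases_tail h with h | ⟨y, -, hy⟩
  · have : (n + 2) * (n + 2) = n * n + 4 * n + 4 := by ring
    rw [h, rowN]; omega
  · exact hp.target_lt hy

/-- All successors of finished nodes have been visited, all finished columns have been seen. -/
def Closed (n : ℕ) (E : List (ℕ × ℕ)) (q : List ℕ) (F : Finset ℕ) (st : List ℕ) : Prop :=
  ∀ y ∈ F, (∀ z ∈ targets E y, z ∈ F ∨ z ∈ st) ∧ ∀ j < n + 2, y = colN (n + 2) 1 j → j ∈ q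

/-- The state of the search from position `k`. -/
structure Dfs (B : ℕ → ℕ → ℕ) (n : ℕ) (E : List (ℕ × ℕ)) (ord raw0 : ℕ → ℕ) (src k h : ℕ)
    (q₀ : List ℕ) (D₀ : ℕ → ℕ) (a b : ASt) (F : Finset ℕ) (st q : List ℕ) (D par : ℕ → ℕ) :
    Prop where
  seen : Seen B n E ord raw0 src b q D par
  search : Search src b F st
  grow : Grow k q₀ D₀ q D
  reach : ∀ y ∈ st, Reach E (rowN (n + 2) 1 k) y
  closed : Closed n E q F st
  low : b.low 25 = a.low 25
  v27 : b.v 27 = D₀ k + 1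
  v28 : b.v 28 = ord k
  -- A node gets onto the stack as one of the `h` starting points or through an edge from a finished
  -- node. This bounds the number of nodes entered without any bound on the number of nodes of the
  -- digraph.
  count : F.card + st.length ≤ h + outDeg E F
  arr : ∀ id, id < 14 → b.arr id = a.arr id

theorem Dfs.tick {raw0 : ℕ → ℕ} {src k h : ℕ} {q₀ st q : List ℕ} {D₀ D par : ℕ → ℕ} {a b : ASt}
    {F : Finset ℕ} (hd : Dfs B n E ord raw0 src k h q₀ D₀ a b F st q D par) (t : ℕ) :
    Dfs B n E ord raw0 src k h q₀ D₀ a (b.tick t) F st q D par :=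
  ⟨hd.seen.of_eq rfl rfl rfl rfl rfl fun _ _ _ => rfl, hd.search.of_eq rfl rfl rfl, hd.grow,
    hd.reach, hd.closed, hd.low, hd.v27, hd.v28, hd.count, hd.arr⟩

/-- Process the node on top of the stack. -/
def popNode : Prog :=
  .seq (block [.asg 29 (.var 29 - 1), .asg 30 (.get 17 (.var 29)), .asg 31 (.get 11 (.var 30))])
    (.seq visitLeaf scanEdges)

/-- The popped node becomes finished and pays for itself and for its outgoing edges, which matches
the growth of `F.card` and `outDeg E F`. -/
theorem wp_popNode (hp : Params B n E ord M) {raw0 : ℕ → ℕ} {src k h x : ℕ} {q₀ st q : List ℕ}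
    {D₀ D par : ℕ → ℕ} {a b : ASt} {F : Finset ℕ} (hk : k ∈ q₀) (hh : h ≤ n)
    (hd : Dfs B n E ord raw0 src k h q₀ D₀ a b F (x :: st) q D par) :
    wp M popNode (fun c => ∃ st' q' D' par',
      Dfs B n E ord raw0 src k h q₀ D₀ a c (insert x F) st' q' D' par' ∧
      st ⊆ st' ∧ c.time ≤ b.time + 150 * (targets E x).length + 300) b := by
  have hVp := M.Vpos
  obtain ⟨d1, d2, d3, d4, d5, d6, d7, d8, d9, d10⟩ := hd
  have hkq := d3.pre.subset hk
  have hkr := d1.rng k hkq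
  have hx := d4 x (by simp)
  have hxV := hp.reach_lt hkr.2 hx
  have hlen := d2.len
  have hxF := d2.disj x (by simp)
  have htop := d2.rep.1
  have hch := (d1.env.adj.chain x)
  have hchle := hch.le
  have hfE := hp.fitsE
  have hdeg := outDeg_le E (insert x F)
  rw [outDeg_insert hxF] at hdeg
  rw [List.length_cons] at hlen d9
  refine wp_seq (wp_block ?_ ?_)
  · simp [hlen, htop]
    omega
  rw [show execB _ b = ((b.set 29 st.length).set 30 x).set 31 (b.arr 11 x) by simp [hlen, htop]]
  refine wp_seq ((wp_visitLeaf (a := (((b.set 29 st.length).set 30 x).set 31 (b.arr 11 x)).tick _)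
    hp (d1.of_eq (by simp) (by simp) (by simp) (by simp) rfl
    fun _ _ _ => rfl) hkq (by
      have := d3.eq k hk
      intro j hj
      rw [this]; exact d3.bound j hj) (by simp [d7, d3.eq k hk]) (by simp [d8]) (by simp) hx hxV).mono ?_)
  rintro c ⟨⟨q', D', par', c1, c2, c3, c4⟩, c5⟩
  have hc31 : c.v 31 = b.arr 11 x := by rw [c4.v 31 (by omega) (by omega)]; simp
  have hcarr : ∀ id, id ≠ 15 → id ≠ 16 → c.arr id = b.arr id := fun id h1 h2 => c4.arr id h1 h2
  have hs : Search src c (insert x F) st := by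
    refine ⟨fun y => ?_, ?_, ?_, ?_, (List.nodup_cons.1 d2.nodup).2, fun y hy => ?_⟩
    · rw [hcarr 14 (by omega) (by omega), d2.vis y]
      simp only [List.mem_cons, mem_insert]
      tauto
    · rw [hcarr 14 (by omega) (by omega)]; exact d2.vis_le
    · rw [c4.v 29 (by omega) (by omega)]; simp
    · rw [hcarr 17 (by omega) (by omega)]; exact d2.rep.2
    · rw [mem_insert, not_or]
      refine ⟨?_, d2.disj y (by simp [hy])⟩
      rintro rfl
      exact (List.nodup_cons.1 d2.nodup).1 hy
  refine (wp_scanEdges hs c1.v22 (cnt := E.length) (r := targets E x) ?_ (by omega) (fun y hy =>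
    hp.target_lt (mem_targets.1 hy)) (by omega)).mono ?_
  · rw [hc31, hcarr 12 (by omega) (by omega), hcarr 13 (by omega) (by omega)]
    exact hch
  rintro d ⟨st', e1, e2, e3, e4, e5, e6, e7⟩
  refine ⟨st', q', D', par', ⟨?_, ?_, ?_, fun y hy => ?_, fun y hy => ?_, ?_, ?_, ?_, ?_,
    fun id hid => ?_⟩, e2, ?_⟩
  · exact c1.of_eq (ASt.low_mono e6.low (by omega)) (ASt.v_eq e6.low _ (by omega))
      (ASt.v_eq e6.low _ (by omega)) (ASt.v_eq e6.low _ (by omega)) e6.raw e6.arr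
  · exact e1.of_eq rfl rfl rfl
  · refine d3.trans (k := k) (q' := q) (D' := D) ?_ hk
    exact c2
  · rcases e4 y hy with hy | hy
    · exact d4 y (by simp [hy])
    · exact hx.tail (mem_targets.1 hy)
  · rcases mem_insert.1 hy with rfl | hy
    · exact ⟨e3, c3⟩
    · obtain ⟨f1, f2⟩ := d5 y hy
      refine ⟨fun z hz => ?_, fun j hj e => c2.pre.subset (f2 j hj e)⟩
      rcases f1 z hz with h | h
      · exact Or.inl (mem_insert_of_mem h)
      · rcases List.mem_cons.1 h with rfl | h
        · exact Or.inl (mem_insert_self _ _)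
        · exact Or.inr (e2 h)
  · have h1 := ASt.low_mono e6.low (show 25 ≤ 29 by omega)
    have h2 := c4.low
    simp at h1 h2 ⊢
    rw [h1, h2, d6]
  · have h1 := ASt.v_eq e6.low 27 (by omega)
    have h2 := c4.v 27 (by omega) (by omega)
    simp at h1 h2 ⊢
    rw [h1, h2, d7]
  · have h1 := ASt.v_eq e6.low 28 (by omega)
    have h2 := c4.v 28 (by omega) (by omega)
    simp at h1 h2 ⊢
    rw [h1, h2, d8]
  · rw [outDeg_insert hxF, card_insert_of_notMem hxF]
    omega
  · have h1 := e6.arr id (by omega) (by omega)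
    have h2 := hcarr id (by omega) (by omega)
    simp at h1 ⊢
    rw [h1, h2, d10 id hid]
  · simp at c5 e7 ⊢
    omega

/-- Search until the stack is empty. -/
def dfs : Prog := whileDo (.op .lt 0 (.var 29)) popNode

/-- The elapsed time is bounded by a potential of the set of finished nodes. Since `F` is kept from
one queue head to the next, the bound amortises over the whole search from `src`. -/
theorem wp_dfs (hp : Params B n E ord M) {raw0 : ℕ → ℕ} {src k h T : ℕ} {q₀ st q : List ℕ}
    {D₀ D par : ℕ → ℕ} {a : ASt} {F : Finset ℕ} (hk : k ∈ q₀) (hh : h ≤ n)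
    (hd : Dfs B n E ord raw0 src k h q₀ D₀ a a F st q D par)
    (ht : a.time ≤ T + 320 * F.card + 150 * outDeg E F) :
    wp M dfs (fun c => ∃ F' q' D' par',
      Dfs B n E ord raw0 src k h q₀ D₀ a c F' [] q' D' par' ∧
      F ⊆ F' ∧ (∀ y ∈ st, y ∈ F') ∧
      c.time ≤ T + 320 * F'.card + 150 * outDeg E F' + 20) a := by
  have hVp := M.Vpos
  refine wp_while (fun i b => ∃ F' st' q' D' par',
      Dfs B n E ord raw0 src k h q₀ D₀ a b F' st' q' D' par' ∧ F ⊆ F' ∧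
      (∀ y ∈ st, y ∈ F' ∨ y ∈ st') ∧ i = h + E.length - F'.card ∧
      b.time ≤ T + 320 * F'.card + 150 * outDeg E F' + 15) (h + E.length - F.card) ?_ ?_ ?_ ?_
  · exact ⟨F, st, q, D, par, hd.tick _, Subset.refl _, fun y hy => Or.inr hy, rfl, by simp; omega⟩
  · rintro i b -
    exact ⟨by simp, lt_of_le_of_lt (Op.lt_le _ _) (by omega)⟩
  · rintro i b ⟨F', st', q', D', par', b1, b2, b3, b4, b5⟩ hc
    have hlen := b1.search.len
    simp [Nat.pos_iff_ne_zero] at hc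
    cases st' with
    | nil => exact absurd hlen hc
    | cons x st' =>
      have hxF := b1.search.disj x (by simp)
      refine (wp_popNode hp hk hh b1).mono ?_
      rintro c ⟨st'', q'', D'', par'', c1, c3, c2⟩
      have hcount := b1.count
      have hdeg := outDeg_le E F'
      rw [List.length_cons] at hcount
      refine ⟨_, ?_, insert x F', st'', q'', D'', par'', c1.tick _, b2.trans (subset_insert _ _),
        fun y hy => ?_, rfl, ?_⟩
      · rw [card_insert_of_notMem hxF]
        omega
      · have hv := (c1.search.vis y).2
        rcases b3 y hy with h | h
        · exact Or.inl (mem_insert_of_mem h)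
        · rcases List.mem_cons.1 h with rfl | h
          · exact Or.inl (mem_insert_self _ _)
          · exact Or.inr (c3 h)
      · rw [card_insert_of_notMem hxF, outDeg_insert hxF]
        simp
        omega
  · rintro i b ⟨F', st', q', D', par', b1, b2, b3, b4, b5⟩ hc
    have hlen := b1.search.len
    simp [Nat.pos_iff_ne_zero] at hc
    cases st' with
    | cons x st' => rw [List.length_cons] at hlen; omega
    | nil =>
      refine ⟨F', q', D', par', b1.tick _, b2, fun y hy => ?_, by simp; omega⟩
      simpa using b3 y hy

end WordRAM

namespace WordRAM

open Finset

variable {B : ℕ → ℕ → ℕ} {n m : ℕ} {E : List (ℕ × ℕ)} {M : Mach} {ord : ℕ → ℕ}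

/-! ### Breadth-first search: the main loops -/

/-- Process the position at the head of the queue. -/
def bfsStep : Prog :=
  .seq (block [.asg 26 (.get 16 (.var 24)), .asg 24 (.var 24 + 1), .asg 28 (.get 7 (.var 26)),
      .asg 27 (.raw (.var 23 + .var 28) + 1),
      .asg 33 ((.var 1 + .var 26) + (.var 1 + .var 26) + 1)])
    (.seq pushNode dfs)

/-- The state of the search from `src` when `h` positions have been processed. -/
structure Bfs (B : ℕ → ℕ → ℕ) (n : ℕ) (E : List (ℕ × ℕ)) (ord raw0 : ℕ → ℕ) (src h : ℕ)
    (a b : ASt) (F : Finset ℕ) (q : List ℕ) (D par : ℕ → ℕ) : Prop where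
  seen : Seen B n E ord raw0 src b q D par
  search : Search src b F []
  closed : Closed n E q F []
  head : b.v 24 = h
  head_le : h ≤ q.length
  done : ∀ i < h, ∀ j, B (q.getD i 0) j = 1 → j ∈ q ∧ D j ≤ D (q.getD i 0) + 1
  -- The usual invariant of breadth-first search: no seen position is farther than one more than any
  -- position still to be processed.
  todo : ∀ i, h ≤ i → i < q.length → ∀ j ∈ q, D j ≤ D (q.getD i 0) + 1
  low : b.low 21 = a.low 21
  count : F.card ≤ h + outDeg E F
  arr : ∀ id, id < 14 → b.arr id = a.arr id

theorem Bfs.tick {raw0 : ℕ → ℕ} {src h : ℕ} {q : List ℕ} {D par : ℕ → ℕ} {a b : ASt}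
    {F : Finset ℕ} (hd : Bfs B n E ord raw0 src h a b F q D par) (t : ℕ) :
    Bfs B n E ord raw0 src h a (b.tick t) F q D par :=
  ⟨hd.seen.of_eq rfl rfl rfl rfl rfl fun _ _ _ => rfl, hd.search.of_eq rfl rfl rfl, hd.closed,
    hd.head, hd.head_le, hd.done, hd.todo, hd.low, hd.count, hd.arr⟩

theorem getD_mem {q : List ℕ} {i : ℕ} (hi : i < q.length) : q.getD i 0 ∈ q := by
  rw [List.getD_eq_getElem _ _ hi]
  exact List.getElem_mem hi

theorem getD_of_prefix {q q' : List ℕ} (h : q <+: q') {i : ℕ} (hi : i < q.length) :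
    q'.getD i 0 = q.getD i 0 := by
  obtain ⟨t, rfl⟩ := h
  rw [List.getD_append _ _ _ _ hi]

/-- With an empty stack, the successors of finished nodes are finished. -/
theorem Closed.mem_of_reach {q : List ℕ} {F : Finset ℕ} (h : Closed n E q F []) {x y : ℕ}
    (hx : x ∈ F) (hr : Reach E x y) : y ∈ F := by
  induction hr with
  | refl => exact hx
  | tail _ hyz ih => simpa using (h _ ih).1 _ (mem_targets.2 hyz)

/-- Nodes finished for earlier queue heads are not entered again. Nothing is lost: the columns
reachable from them have been seen, and by the invariant `todo` at distance at most `D k + 1`. -/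
theorem wp_bfsStep (hp : Params B n E ord M) {raw0 : ℕ → ℕ} {src h T : ℕ} {q : List ℕ}
    {D par : ℕ → ℕ} {a b : ASt} {F : Finset ℕ} (hh : h < q.length)
    (hb : Bfs B n E ord raw0 src h a b F q D par)
    (ht : b.time ≤ T + 320 * F.card + 150 * outDeg E F) :
    wp M bfsStep (fun c => ∃ F' q' D' par', Bfs B n E ord raw0 src (h + 1) a c F' q' D' par' ∧
      c.time ≤ T + 320 * F'.card + 150 * outDeg E F' + 190) b := by
  have hVp := M.Vpos
  obtain ⟨b1, b2, b3, b4, b5, b6, b7, b8, b9, b10⟩ := hb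
  obtain ⟨k, hkdef⟩ : ∃ k, q.getD h 0 = k := ⟨_, rfl⟩
  have hk : k ∈ q := hkdef ▸ getD_mem hh
  have hkr := b1.rng k hk
  have hql := b1.length_le
  have h16 := b1.queue h hh
  rw [hkdef] at h16
  have h7 := b1.env.ord_eq k hkr.1 hkr.2
  have hok := hp.ord_lt k hkr.1 hkr.2
  have hsr := b1.rng src b1.mem
  have hos := hp.ord_lt src hsr.1 hsr.2
  have hbase : ord src * n + n ≤ n * n := by
    have := Nat.mul_le_mul_right n (show ord src + 1 ≤ n by omega)
    rwa [add_mul, one_mul] at this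
  have hV := hp.fitsV
  have hE := hp.fitsE
  have hMB := hp.fitsB
  have hnn : (n + 2) * (n + 2) = n * n + 4 * n + 4 := by ring
  have hDk := b1.dist_le hk
  have hdist := b1.dist k hk
  have h1 := b1.env.m_eq
  refine wp_seq (wp_block ?_ ?_)
  · simp [b4, h16, h7, b1.v23, hdist, h1]
    omega
  have e : execB [.asg 26 (.get 16 (.var 24)), .asg 24 (.var 24 + 1), .asg 28 (.get 7 (.var 26)),
      .asg 27 (.raw (.var 23 + .var 28) + 1),
      .asg 33 ((.var 1 + .var 26) + (.var 1 + .var 26) + 1)] b =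
      ((((b.set 26 k).set 24 (h + 1)).set 28 (ord k)).set 27 (D k + 1)).set 33
        (rowN (n + 2) 1 k) := by
    simp [b4, h16, h7, b1.v23, hdist, h1, rowN]
    ring_nf
  rw [e]
  refine wp_seq ((wp_pushNode (src := src) (y := rowN (n + 2) 1 k) (F := F) (st := [])
    (b2.of_eq (by simp) (by simp) (by simp)) (by simp [b1.v22]) (by simp) (by rw [rowN]; omega)
    (by simp)).mono ?_)
  rintro c ⟨st, c1, c2, c3, c4, c5, c6, -, c8⟩
  have hseen : Seen B n E ord raw0 src c q D par := by
    refine b1.of_eq ?_ ?_ ?_ ?_ ?_ fun id h1 h2 => ?_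
    · rw [ASt.low_mono c6.low (show 20 ≤ 29 by omega)]; simp
    · rw [ASt.v_eq c6.low 22 (by omega)]; simp
    · rw [ASt.v_eq c6.low 23 (by omega)]; simp
    · rw [ASt.v_eq c6.low 25 (by omega)]; simp
    · rw [c6.raw]; simp
    · rw [c6.arr id h1 h2]; simp
  have hdfs : Dfs B n E ord raw0 src k (h + 1) q D c c F st q D par := by
    refine ⟨hseen, c1, ⟨List.prefix_rfl, fun _ _ => rfl, hkdef ▸ b7 h le_rfl hh⟩, fun y hy => ?_,
      fun y hy => ⟨fun z hz => ?_, (b3 y hy).2⟩, rfl, ?_, ?_, ?_, fun _ _ => rfl⟩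
    · rcases c4 y hy with h | h
      · simp at h
      · rw [h]; exact .refl
    · exact Or.inl (by simpa using (b3 y hy).1 z hz)
    · rw [ASt.v_eq c6.low 27 (by omega)]; simp
    · rw [ASt.v_eq c6.low 28 (by omega)]; simp
    · simp only [List.length_nil] at c5
      omega
  refine (wp_dfs hp hk (by omega) hdfs (T := T + 165) ?_).mono ?_
  · simp at c8; omega
  rintro d ⟨F', q', D', par', d1, d2, d3, d4⟩
  have hg := d1.grow
  have hkF : rowN (n + 2) 1 k ∈ F' := by
    rcases c3 with h | h
    · exact d2 h
    · exact d3 _ h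
  refine ⟨F', q', D', par', ⟨?_, ?_, d1.closed, ?_, ?_, fun i hi j hj => ?_, fun i hi hiq j hj => ?_,
    ?_, ?_, fun id hid => ?_⟩, by simp; omega⟩
  · exact d1.seen.of_eq rfl rfl rfl rfl rfl fun _ _ _ => rfl
  · exact d1.search.of_eq rfl rfl rfl
  · have h1 := ASt.v_eq d1.low 24 (by omega)
    have h2 := ASt.v_eq c6.low 24 (by omega)
    simp at h1 h2 ⊢
    rw [h1, h2]
  · have := hg.pre.length_le
    omega
  · rw [getD_of_prefix hg.pre (by omega)] at hj ⊢
    rcases Nat.lt_succ_iff_lt_or_eq.1 hi with hi | rfl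
    · obtain ⟨g1, g2⟩ := b6 i hi j hj
      rw [hg.eq j g1, hg.eq _ (getD_mem (by omega))]
      exact ⟨hg.pre.subset g1, g2⟩
    · rw [hkdef] at hj ⊢
      have hbits := hp.bits.col k j (by omega)
      -- The digraph has a path from the leaf of row `k` to the leaf of column `j`; as the first is
      -- finished, so is the second, and finished columns have been seen.
      have hjq : j ∈ q' := (d1.closed _ (d1.closed.mem_of_reach hkF (hp.complete k j hj))).2 j
        (by omega) rfl
      rw [hg.eq k hk]
      exact ⟨hjq, hg.bound j hjq⟩
  -- Entries behind `k` in the sorted queue have at least its distance, so the bound `D k + 1` on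
  -- all seen positions carries over to them.
  · have hs := d1.seen.sorted
    have h1 : D' k ≤ D' (q'.getD i 0) := by
      have hlen := hg.pre.length_le
      rw [← getD_of_prefix hg.pre hh] at hkdef
      rw [← hkdef, List.getD_eq_getElem _ _ hiq, List.getD_eq_getElem _ _ (by omega)]
      exact List.pairwise_iff_getElem.1 hs h i (by omega) hiq (by omega)
    have h2 := hg.bound j hj
    rw [hg.eq k hk] at h1
    omega
  · have h1 := ASt.low_mono d1.low (show 21 ≤ 25 by omega)
    have h2 := ASt.low_mono c6.low (show 21 ≤ 29 by omega)
    simp at h1 h2 ⊢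
    rw [h1, h2, b8]
  · simpa using d1.count
  · have h1 := d1.arr id hid
    have h2 := c6.arr id (by omega) (by omega)
    simp at h1 h2 ⊢
    rw [h1, h2, b10 id hid]

/-- The output for the position `src` is a tree of shortest paths. -/
def RowOK (B : ℕ → ℕ → ℕ) (n : ℕ) (ord : ℕ → ℕ) (src : ℕ) (raw : ℕ → ℕ) : Prop :=
  ∃ (q : List ℕ) (D par : ℕ → ℕ), src ∈ q ∧ (∀ j ∈ q, 1 ≤ j ∧ j ≤ n) ∧ D src = 0 ∧
    (∀ j ∈ q, j ≠ src → par j ∈ q ∧ B (par j) j = 1 ∧ D j = D (par j) + 1) ∧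
    (∀ k ∈ q, ∀ j, B k j = 1 → j ∈ q ∧ D j ≤ D k + 1) ∧
    (∀ j ∈ q, raw (ord src * n + ord j) = D j) ∧
    (∀ j, 1 ≤ j → j ≤ n → j ∉ q → raw (ord src * n + ord j) = n) ∧
    (∀ j ∈ q, j ≠ src → raw (n * n + (ord src * n + ord j)) = ord (par j))

/-- Breadth-first search from the position after variable `20`. -/
def bfs : Prog :=
  .seq (block [.asg 22 (.var 20 + 1), .asg 23 (.get 7 (.var 22) * .var 0), .asg 24 0, .asg 25 1,
      .asg 29 0])
    (.seq (forUp 21 0 (block [.putRaw (.var 23 + .var 21) (.var 0)]))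
      (.seq (block [.put 15 (.var 22) (.var 22), .put 16 0 (.var 22),
          .putRaw (.var 23 + .get 7 (.var 22)) 0])
        (whileDo (.op .lt (.var 24) (.var 25)) bfsStep)))

theorem wp_bfs (hp : Params B n E ord M) {i : ℕ} {a : ASt} (hE : Env n E ord a) (hi : i < n)
    (h20 : a.v 20 = i) (h14 : ∀ y, a.arr 14 y ≤ i) (h15 : ∀ y, a.arr 15 y ≤ i) :
    wp M bfs (fun b => RowOK B n ord (i + 1) b.raw ∧
      (∀ y, (∀ x < n, y ≠ ord (i + 1) * n + x ∧ y ≠ n * n + (ord (i + 1) * n + x)) →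
        b.raw y = a.raw y) ∧ b.low 21 = a.low 21 ∧ (∀ y, b.arr 14 y ≤ i + 1) ∧
      (∀ y, b.arr 15 y ≤ i + 1) ∧ (∀ id, id < 14 → b.arr id = a.arr id) ∧
      b.time ≤ a.time + 1000 * n + 500 * E.length + 200) a := by
  have hVp := M.Vpos
  have hV := hp.fitsV
  have hMB := hp.fitsB
  have hfE := hp.fitsE
  have hnn : (n + 2) * (n + 2) = n * n + 4 * n + 4 := by ring
  have h7 := hE.ord_eq (i + 1) (by omega) (by omega)
  have hos := hp.ord_lt (i + 1) (by omega) (by omega)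
  have hbase : ord (i + 1) * n + n ≤ n * n := by
    have := Nat.mul_le_mul_right n (show ord (i + 1) + 1 ≤ n by omega)
    rwa [add_mul, one_mul] at this
  have h0 := hE.n_eq
  have h1 := hE.m_eq
  refine wp_seq (wp_block (by simp [h20, h7, h0]; omega) ?_)
  have e : execB [.asg 22 (.var 20 + 1), .asg 23 (.get 7 (.var 22) * .var 0), .asg 24 0, .asg 25 1,
      .asg 29 0] a = ((((a.set 22 (i + 1)).set 23 (ord (i + 1) * n)).set 24 0).set 25 1).set 29 0 := by
    simp [h20, h7, h0]
  rw [e]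
  -- This loop writes `n` as the distance of positions that will not be reached. It overwrites a row
  -- of the input matrix, which the digraph has replaced by now.
  refine wp_seq (wp_for n (fun j b => b.low 21 = a.low 21 ∧ b.v 22 = i + 1 ∧
    b.v 23 = ord (i + 1) * n ∧ b.v 24 = 0 ∧ b.v 25 = 1 ∧ b.v 29 = 0 ∧ b.arr = a.arr ∧
    (∀ x < j, b.raw (ord (i + 1) * n + x) = n) ∧
    (∀ y, (∀ x < n, y ≠ ord (i + 1) * n + x ∧ y ≠ n * n + (ord (i + 1) * n + x)) →
        b.raw y = a.raw y) ∧ b.time ≤ a.time + 50 * j + 100) (by omega) (by omega) (by omega)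
      (by simp [h0]) (by omega) ?_ ?_ ?_)
  · simp
  · rintro j hj b ⟨b1, b2, b3, b4, b5, b6, b7, b8, b9, b10⟩ hb21 hb0
    refine wp_block (by simp [b3, hb21]; omega) ?_
    refine ⟨by simp [hb21], by simp [hb0], by simp [b1], by simp [b2], by simp [b3], by simp [b4],
      by simp [b5], by simp [b6], by simp [b7], fun x hx => ?_, fun y hy => ?_, by simp; omega⟩
    · rcases Nat.lt_succ_iff_lt_or_eq.1 hx with hx | rfl
      · simp [b3, hb21, hb0, show x ≠ j by omega, b8 x hx]
      · simp [b3, hb21, hb0]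
    · have := (hy j hj).1
      simp [b3, hb21, hb0, this, b9 y hy]
  rintro b ⟨b1, b2, b3, b4, b5, b6, b7, b8, b9, b10⟩ hb21 hb0
  refine wp_seq (wp_block (by simp [b2, b3, b7, h7]; omega) ?_)
  have hord0 : ∀ j, 1 ≤ j → j ≤ n → j ≠ i + 1 → ord j ≠ ord (i + 1) := fun j g1 g2 g3 g4 =>
    g3 (hp.ord_inj j (i + 1) g1 g2 (by omega) (by omega) g4)
  generalize hc : ASt.tick (execB _ _) _ = c
  have hcl : c.low 21 = a.low 21 := by rw [← hc]; simp [b1]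
  have hct : c.time ≤ a.time + 50 * n + 200 := by rw [← hc]; simp; omega
  have hca : ∀ id, id ≠ 15 → id ≠ 16 → c.arr id = a.arr id := by
    intro id g1 g2; rw [← hc]; simp [g1, g2, b7]
  have hc15 : ∀ j, c.arr 15 j = if j = i + 1 then i + 1 else a.arr 15 j := by
    intro j; rw [← hc]; simp [b2, b7, Function.update_apply]
  have hseen : Seen B n E ord a.raw (i + 1) c [i + 1] (fun _ => 0) (fun _ => 0) := by
    refine ⟨hE.of_eq (ASt.low_mono hcl (by omega)) fun id hid => hca id (by omega) (by omega), ?_, ?_,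
      ?_, List.nodup_singleton _, ?_, fun j => ?_, fun j => ?_, ?_, ?_, ?_, ?_, ?_, by simp, rfl, ?_,
      List.pairwise_singleton _ _, by simp⟩
    · rw [← hc]; simp [b2]
    · rw [← hc]; simp [b3]
    · rw [← hc]; simp [b5]
    · simp; omega
    · have := h15 j
      rw [hc15]
      split_ifs with hj
      · simp [hj]
      · simp [hj]; omega
    · have := h15 j
      rw [hc15]
      split_ifs <;> omega
    · rw [← hc]; simp [b2]
    · rw [← hc]; simp [b2, b3, b7, h7]
    · intro j g1 g2 g3
      have := hord0 j g1 g2 (by simpa using g3)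
      rw [← hc]; simp [b2, b3, b7, h7, this]
      exact b8 _ (hp.ord_lt j g1 g2)
    · simp
    · intro y hy
      have := (hy _ hos).1
      rw [← hc]; simp [b2, b3, b7, h7, this]
      exact b9 y hy
    · simp
  have hsearch : Search (i + 1) c ∅ [] := by
    refine ⟨fun y => ?_, fun y => ?_, ?_, trivial, List.nodup_nil, by simp⟩
    · have := h14 y
      rw [hca 14 (by omega) (by omega)]
      simp; omega
    · have := h14 y
      rw [hca 14 (by omega) (by omega)]; omega
    · rw [← hc]; simp [b6]
  have hbfs : Bfs B n E ord a.raw (i + 1) 0 a c ∅ [i + 1] (fun _ => 0) (fun _ => 0) := by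
    refine ⟨hseen, hsearch, by simp [Closed], ?_, by simp, by simp, ?_, ?_, by simp, fun id hid => ?_⟩
    · rw [← hc]; simp [b4]
    · simp
    · exact hcl
    · exact hca id (by omega) (by omega)
  -- The potential at the end gives the linear bound: `h ≤ n`, `F.card ≤ h + outDeg E F` and `outDeg
  -- E F ≤ E.length`.
  refine wp_while (fun k d => ∃ h F q D par, k = n - h ∧
    Bfs B n E ord a.raw (i + 1) h a d F q D par ∧
    d.time ≤ a.time + 50 * n + 220 + 200 * h + 320 * F.card + 150 * outDeg E F) n ?_ ?_ ?_ ?_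
  · exact ⟨0, ∅, _, _, _, by simp, hbfs.tick _, by simp [outDeg]; omega⟩
  · rintro k d -
    exact ⟨by simp, lt_of_le_of_lt (Op.lt_le _ _) (by omega)⟩
  · rintro k d ⟨h, F, q, D, par, rfl, d1, d2⟩ hcond
    have hh : h < q.length := by
      simp [d1.head, d1.seen.len] at hcond
      exact hcond
    have hql := d1.seen.length_le
    refine (wp_bfsStep hp hh d1 (T := a.time + 50 * n + 220 + 200 * h) (by omega)).mono ?_
    rintro f ⟨F', q', D', par', f1, f2⟩
    exact ⟨n - (h + 1), by omega, h + 1, F', q', D', par', rfl, f1.tick _, by simp; omega⟩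
  · rintro k d ⟨h, F, q, D, par, rfl, d1, d2⟩ hcond
    have hh : ¬ h < q.length := by
      simp [d1.head, d1.seen.len] at hcond
      omega
    have hql := d1.seen.length_le
    have hcount := d1.count
    have hdeg := outDeg_le E F
    have hhl := d1.head_le
    have hvis := d1.search.vis_le
    have s := d1.seen
    refine ⟨⟨q, D, par, s.mem, s.rng, s.dist_src, s.tree, fun k hk j hj => ?_, s.dist, s.nodist,
      s.parent⟩, s.other, d1.low, hvis, s.seen_le, d1.arr, by simp; omega⟩
    obtain ⟨x, hx, rfl⟩ := List.getElem_of_mem hk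
    have := d1.done x (by omega) j
    rw [List.getD_eq_getElem _ _ hx] at this
    exact this hj

end WordRAM

namespace WordRAM

open Finset

variable {B : ℕ → ℕ → ℕ} {n m : ℕ} {E : List (ℕ × ℕ)} {M : Mach} {ord : ℕ → ℕ}

theorem RowOK.congr {src : ℕ} {raw raw' : ℕ → ℕ} (h : RowOK B n ord src raw)
    (hord : ∀ k, 1 ≤ k → k ≤ n → ord k < n)
    (h1 : ∀ x < n, raw' (ord src * n + x) = raw (ord src * n + x))
    (h2 : ∀ x < n, raw' (n * n + (ord src * n + x)) = raw (n * n + (ord src * n + x))) :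
    RowOK B n ord src raw' := by
  obtain ⟨q, D, par, a1, a2, a3, a4, a5, a6, a7, a8⟩ := h
  refine ⟨q, D, par, a1, a2, a3, a4, a5, fun j hj => ?_, fun j g1 g2 g3 => ?_, fun j hj hne => ?_⟩
  · rw [h1 _ (hord j (a2 j hj).1 (a2 j hj).2), a6 j hj]
  · rw [h1 _ (hord j g1 g2), a7 j g1 g2 g3]
  · rw [h2 _ (hord j (a2 j hj).1 (a2 j hj).2), a8 j hj hne]

/-- Breadth-first search from all positions. -/
def bfsPhase : Prog := forUp 20 0 bfs

theorem wp_bfsPhase (hp : Params B n E ord M) {a : ASt} (hE : Env n E ord a)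
    (h14 : ∀ y, a.arr 14 y = 0) (h15 : ∀ y, a.arr 15 y = 0) :
    wp M bfsPhase (fun b => (∀ k, 1 ≤ k → k ≤ n → RowOK B n ord k b.raw) ∧
      b.time ≤ a.time + n * (1000 * n + 500 * E.length + 300) + 20) a := by
  have hfE := hp.fitsE
  refine wp_for n (fun i b => (∀ k, 1 ≤ k → k ≤ i → RowOK B n ord k b.raw) ∧
    b.low 20 = a.low 20 ∧ (∀ id, id < 14 → b.arr id = a.arr id) ∧ (∀ y, b.arr 14 y ≤ i) ∧
    (∀ y, b.arr 15 y ≤ i) ∧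
    b.time ≤ a.time + i * (1000 * n + 500 * E.length + 300) + 15) (by omega) (by omega) (by omega)
    hE.n_eq (by omega) ?_ ?_ ?_
  · refine ⟨fun k h1 h2 => by omega, by simp, by simp, by simp [h14], by simp [h15], by simp⟩
  · rintro i hi b ⟨b1, b2, b3, b4, b5, b6⟩ hb20 hb0
    refine (wp_bfs hp (hE.of_eq b2 b3) hi hb20 b4 b5).mono ?_
    rintro c ⟨c1, c2, c3, c4, c5, c6, c7⟩
    refine ⟨(ASt.v_eq c3 20 (by omega)).trans hb20, (ASt.v_eq c3 0 (by omega)).trans hb0,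
      fun k g1 g2 => ?_, ?_, fun id hid => (c6 id hid).trans (b3 id hid), c4, c5, ?_⟩
    · rcases Nat.lt_succ_iff_lt_or_eq.1 (Nat.lt_succ_of_le g2) with g2 | rfl
      · have h1 := hp.ord_lt k (by omega) (by omega)
        have h2 := hp.ord_lt (i + 1) (by omega) (by omega)
        have hne : ord k ≠ ord (i + 1) := fun e => by
          have := hp.ord_inj k (i + 1) (by omega) (by omega) (by omega) (by omega) e
          omega
        have hb : ∀ s < n, s * n + n ≤ n * n := fun s hs => by
          have := Nat.mul_le_mul_right n (show s + 1 ≤ n by omega)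
          rwa [add_mul, one_mul] at this
        have hb1 := hb _ h1
        have hb2 := hb _ h2
        -- Output rows of different sources are disjoint, so a later search does not spoil the
        -- result of an earlier one.
        have hsep : ∀ x < n, ∀ y < n, ord k * n + x ≠ ord (i + 1) * n + y := by
          intro x hx y hy e
          rcases lt_or_gt_of_ne hne with h | h
          · have := Nat.mul_le_mul_right n (show ord k + 1 ≤ ord (i + 1) by omega)
            rw [add_mul, one_mul] at this
            omega
          · have := Nat.mul_le_mul_right n (show ord (i + 1) + 1 ≤ ord k by omega)
            rw [add_mul, one_mul] at this
            omega
        refine (b1 k g1 (by omega)).congr hp.ord_lt (fun x hx => c2 _ fun y hy => ?_)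
          fun x hx => c2 _ fun y hy => ?_
        · have := hsep x hx y hy
          omega
        · have := hsep x hx y hy
          omega
      · exact c1
    · have := ASt.low_mono c3 (show 20 ≤ 21 by omega)
      simp [this, b2]
    · simp [add_mul]; omega
  · rintro b ⟨b1, b2, b3, b4, b5, b6⟩ hb20 hb0
    exact ⟨b1, by simp; omega⟩

/-! ### Correctness of the output -/

section

variable {G : SimpleGraph (Fin n)}

/-- The numbers `D` are the distances. Neighbours of seen positions are seen with `D` larger by at
most one, so `D` is at most the length of any walk from the source; following the parents back gives
a walk of length `D`. -/
theorem RowOK.spec {src : ℕ} {raw : ℕ → ℕ} (h : RowOK B n ord src raw)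
    (hord : ∀ k, 1 ≤ k → k ≤ n → ord k < n)
    (hB : ∀ k j, B k j = 1 ↔ ∃ (hk : 1 ≤ k ∧ k ≤ n) (hj : 1 ≤ j ∧ j ≤ n),
      G.Adj ⟨ord k, hord k hk.1 hk.2⟩ ⟨ord j, hord j hj.1 hj.2⟩)
    (hsurj : ∀ x < n, ∃ k, 1 ≤ k ∧ k ≤ n ∧ ord k = x)
    (hinj : ∀ k j, 1 ≤ k → k ≤ n → 1 ≤ j → j ≤ n → ord k = ord j → k = j)
    (hsrc : 1 ≤ src ∧ src ≤ n) {i : Fin n} (hi : ord src = i) (j : Fin n) :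
    (G.Reachable i j → raw ((i : ℕ) * n + j) = G.dist i j) ∧
    (¬ G.Reachable i j → raw ((i : ℕ) * n + j) = n) ∧
    (G.Reachable i j → i ≠ j → ∃ p : Fin n, raw (n * n + (i * n + j)) = p ∧
      G.Adj p j ∧ G.dist i p + 1 = G.dist i j) := by
  obtain ⟨q, D, par, a1, a2, a3, a4, a5, a6, a7, a8⟩ := h
  have hclosed : ∀ (x : Fin n) (p : G.Walk i x), ∃ k ∈ q, ord k = x ∧ D k ≤ p.length := by
    intro x p
    induction p using SimpleGraph.Walk.concatRec with
    | Hnil => exact ⟨src, a1, hi, by simp [a3]⟩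
    | @Hconcat u v w p hadj ih =>
      obtain ⟨k, hk, hku, hD⟩ := ih hi
      obtain ⟨l, l1, l2, hl⟩ := hsurj w w.2
      have : B k l = 1 := (hB _ _).2 ⟨a2 k hk, ⟨l1, l2⟩, by
        have e1 : (⟨ord k, hord k (a2 k hk).1 (a2 k hk).2⟩ : Fin n) = v := Fin.ext hku
        have e2 : (⟨ord l, hord l l1 l2⟩ : Fin n) = w := Fin.ext hl
        rw [e1, e2]
        exact hadj⟩
      obtain ⟨g1, g2⟩ := a5 k hk l this
      exact ⟨l, g1, hl, by rw [SimpleGraph.Walk.length_concat]; omega⟩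
  have hi' : i = ⟨ord src, hord src hsrc.1 hsrc.2⟩ := Fin.ext hi.symm
  have hwalk : ∀ d, ∀ k, ∀ hk : k ∈ q, D k = d →
      ∃ p : G.Walk i ⟨ord k, hord k (a2 k hk).1 (a2 k hk).2⟩, p.length = d := by
    intro d
    induction d with
    | zero =>
      intro k hk hd
      by_cases hks : k = src
      · subst hks
        subst hi'
        exact ⟨.nil, rfl⟩
      · have := (a4 k hk hks).2.2
        omega
    | succ d ih =>
      intro k hk hd
      have hks : k ≠ src := by rintro rfl; omega
      obtain ⟨t1, t2, t3⟩ := a4 k hk hks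
      obtain ⟨p, hp⟩ := ih (par k) t1 (by omega)
      obtain ⟨_, _, hadj⟩ := (hB _ _).1 t2
      exact ⟨p.concat hadj, by simp [hp]⟩
  have hdist : ∀ k (hk : k ∈ q), G.dist i ⟨ord k, hord k (a2 k hk).1 (a2 k hk).2⟩ = D k := by
    intro k hk
    obtain ⟨p, hp⟩ := hwalk _ k hk rfl
    obtain ⟨p', hp'⟩ := p.reachable.exists_walk_length_eq_dist
    obtain ⟨k', h1, h2, h3⟩ := hclosed _ p'
    have : k' = k := hinj k' k (a2 k' h1).1 (a2 k' h1).2 (a2 k hk).1 (a2 k hk).2 h2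
    subst this
    have := SimpleGraph.dist_le p
    omega
  obtain ⟨l, l1, l2, hl⟩ := hsurj j j.2
  have hj : (⟨ord l, hord l l1 l2⟩ : Fin n) = j := Fin.ext hl
  have hreach : G.Reachable i j → l ∈ q := by
    rintro ⟨p⟩
    obtain ⟨k', h1, h2, h3⟩ := hclosed _ p
    have : k' = l := hinj k' l (a2 k' h1).1 (a2 k' h1).2 l1 l2 (h2.trans hl.symm)
    rwa [← this]
  rw [← hi, ← hl]
  refine ⟨fun hr => ?_, fun hr => ?_, fun hr hne => ?_⟩
  · rw [a6 l (hreach hr), ← hdist l (hreach hr), hj]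
  · refine a7 l l1 l2 fun hq => hr ?_
    obtain ⟨p, -⟩ := hwalk _ l hq rfl
    rw [← hj]
    exact p.reachable
  · have hq := hreach hr
    have hls : l ≠ src := by
      rintro rfl
      exact hne (Fin.ext (hi.symm.trans hl))
    obtain ⟨t1, t2, t3⟩ := a4 l hq hls
    refine ⟨⟨ord (par l), hord _ (a2 _ t1).1 (a2 _ t1).2⟩, a8 l hq hls, ?_, ?_⟩
    · obtain ⟨_, _, hadj⟩ := (hB _ _).1 t2
      rw [← hj]; exact hadj
    · rw [hdist _ t1, ← hj, hdist _ hq, t3]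

end

end WordRAM

/-! ### Implementation of the trials -/

namespace WordRAM

open Finset

variable {bt : ℕ → ℕ → ℕ} {S X : Finset ℕ} {n q : ℕ} {M : Mach}

/-! ### Trials -/

theorem rep_lt (hS : S ⊆ range n) {u : ℕ} (hu : u ∈ S) : rep bt S X u < n :=
  mem_range.1 (hS (rep_spec hu).1)

theorem rep_eq_iff {u v : ℕ} (hu : u ∈ S) (hv : v ∈ S) :
    rep bt S X u = rep bt S X v ↔ ∀ x ∈ X, bt u x = bt v x := by
  refine ⟨fun h x hx => ?_, rep_congr⟩
  rw [← (rep_spec (bt := bt) (X := X) hu).2 x hx, h, (rep_spec (bt := bt) hv).2 x hx]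

/-- What the trials read and do not change. -/
structure Input (bt : ℕ → ℕ → ℕ) (n : ℕ) (M : Mach) (a : ASt) : Prop where
  n_eq : a.v 0 = n
  raw : ∀ u < n, ∀ x < n, a.raw (u * n + x) = bt u x
  le_one : ∀ u x, bt u x ≤ 1
  fitsB : M.B = 2 * (n * n)
  fitsV : 2 * (n * n) + 4 * n + 4 < M.V

theorem Input.of_eq {a b : ASt} (h : Input bt n M a) (h0 : b.v 0 = a.v 0) (hr : b.raw = a.raw) :
    Input bt n M b :=
  ⟨h0.trans h.n_eq, by rw [hr]; exact h.raw, h.le_one, h.fitsB, h.fitsV⟩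

/-- Array `1` marks the vertices outside `S`. -/
def Alive (n : ℕ) (S : Finset ℕ) (a : ASt) : Prop :=
  ∀ u < n, (a.arr 1 u = if u ∈ S then 0 else 1)

/-- Array `2` contains the representatives of the vertices in `S`. -/
def HasReps (bt : ℕ → ℕ → ℕ) (S X : Finset ℕ) (a : ASt) : Prop :=
  ∀ u ∈ S, a.arr 2 u = rep bt S X u

/-- Clear the table. -/
def clearTable : Prog :=
  forUp 25 0 (block [.put 3 (.var 25 + .var 25) 0, .put 3 (.var 25 + .var 25 + 1) 0])

/-- Reassign the representative of the vertex in variable `25`. -/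
def refineVertex : Prog :=
  cond (.get 1 (.var 25)) (block [])
    (.seq (block [.asg 26 (.get 2 (.var 25) + .get 2 (.var 25) + .raw (.var 25 * .var 0 + .var 24))])
      (.seq (cond (.get 3 (.var 26)) (block []) (block [.put 3 (.var 26) (.var 25 + 1)]))
        (block [.put 2 (.var 25) (.get 3 (.var 26) - 1)])))

/-- Refine the partition by the neighbourhood of the vertex in variable `24`. -/
def refine : Prog := .seq clearTable (forUp 25 0 refineVertex)

/-- What a refinement does not change. -/
structure RefineFrame (a b : ASt) : Prop where
  low : b.low 25 = a.low 25
  raw : b.raw = a.raw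
  arr : ∀ id, id ≠ 2 → id ≠ 3 → b.arr id = a.arr id

theorem wp_clearTable {a : ASt} (h : Input bt n M a) :
    wp M clearTable (fun b => (∀ i < 2 * n, b.arr 3 i = 0) ∧ b.low 25 = a.low 25 ∧ b.raw = a.raw ∧
      (∀ id, id ≠ 3 → b.arr id = a.arr id) ∧ b.time ≤ a.time + 60 * n + 20) a := by
  have hV := h.fitsV
  refine wp_for n (fun k b => (∀ i < 2 * k, b.arr 3 i = 0) ∧ b.low 25 = a.low 25 ∧ b.raw = a.raw ∧
      (∀ id, id ≠ 3 → b.arr id = a.arr id) ∧ b.time ≤ a.time + 60 * k + 15) (by omega) (by omega)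
    (by omega) h.n_eq (by omega) ?_ ?_ ?_
  · simp +contextual
  · rintro k hk b ⟨b1, b2, b3, b4, b5⟩ hb25 hb0
    refine wp_block (by simp [hb25]; omega) ?_
    refine ⟨by simp [hb25], by simp [hb0], fun i hi => ?_, by simp [b2], by simp [b3],
      fun id hid => by simp [hid, b4], by simp; omega⟩
    simp [hb25, Function.update_apply]
    intro h1 h2
    exact b1 i (by omega)
  · rintro b ⟨b1, b2, b3, b4, b5⟩ hb25 hb0
    exact ⟨b1, b2, b3, b4, by simp; omega⟩

/-- The state during a refinement, when the vertices below `u` have been processed. -/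
structure Refining (bt : ℕ → ℕ → ℕ) (n : ℕ) (S X : Finset ℕ) (x u : ℕ) (a b : ASt) : Prop where
  frame : RefineFrame a b
  old : ∀ v ∈ S, u ≤ v → b.arr 2 v = rep bt S X v
  new : ∀ v ∈ S, v < u → b.arr 2 v = rep bt S (insert x X) v
  entry : ∀ v ∈ S, v < u → b.arr 3 (2 * rep bt S X v + bt v x) = rep bt S (insert x X) v + 1
  none : ∀ i < 2 * n, b.arr 3 i ≠ 0 → ∃ v ∈ S, v < u ∧ i = 2 * rep bt S X v + bt v x

/-- Twice the old representative plus the adjacency to `x` is a key of the refined class. Vertices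
come in increasing order, so the first one with a given key is the least of its class and becomes
the representative. The table in array `3` stores it plus one, with 0 for an unused key. -/
theorem wp_refineVertex {x u : ℕ} {a b : ASt} (h : Input bt n M a) (hS : S ⊆ range n)
    (hA : Alive n S a) (hx : x < n) (h24 : a.v 24 = x) (hb : Refining bt n S X x u a b) (hu : u < n)
    (h25 : b.v 25 = u) :
    wp M refineVertex (fun c => Refining bt n S X x (u + 1) a ((c.set 25 (u + 1)).tick 19) ∧
      c.v 25 = u ∧ c.time ≤ b.time + 200) b := by
  have hV := h.fitsV
  have hVp := M.Vpos
  obtain ⟨⟨f1, f2, f3⟩, g1, g2, g3, g4⟩ := hb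
  have h1 : b.arr 1 u = if u ∈ S then 0 else 1 := by
    rw [f3 1 (by omega) (by omega)]; exact hA u hu
  have h0 : b.v 0 = n := (ASt.v_eq f1 0 (by omega)).trans h.n_eq
  have hb24 : b.v 24 = x := (ASt.v_eq f1 24 (by omega)).trans h24
  refine wp_cond (by simp [h25]; omega) (by simp [h25, h1]; split_ifs <;> omega) (fun hc => ?_)
    fun hc => ?_
  · simp [h25, h1] at hc
    have hne : ∀ v ∈ S, v ≠ u := fun v hv e => hc (e ▸ hv)
    refine wp_block trivial ⟨⟨⟨by simpa using f1, f2, f3⟩, fun v hv hvu => g1 v hv (by omega),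
      fun v hv hvu => g2 v hv ?_, fun v hv hvu => g3 v hv ?_, fun i hi hne => ?_⟩, by simp [h25],
      by simp⟩
    · have := hne v hv; omega
    · have := hne v hv; omega
    · obtain ⟨v, k1, k2, k3⟩ := g4 i hi hne
      exact ⟨v, k1, by omega, k3⟩
  · simp [h25, h1] at hc
    have hrep := rep_lt (bt := bt) (X := X) hS hc
    have hrep' := rep_lt (bt := bt) (X := insert x X) hS hc
    have h2 := g1 u hc le_rfl
    have hraw : b.raw (u * n + x) = bt u x := by rw [f2]; exact h.raw u hu x hx
    have hbit := h.le_one u x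
    have hidx : u * n + n ≤ n * n := by
      have := Nat.mul_le_mul_right n (show u + 1 ≤ n by omega)
      rwa [add_mul, one_mul] at this
    have hMB := h.fitsB
    set K := 2 * rep bt S X u + bt u x with hK
    have hKn : K < 2 * n := by omega
    refine wp_seq (wp_block ?_ ?_)
    · simp [h25, h0, hb24, h2, hraw]
      omega
    rw [show execB _ _ = (b.tick _).set 26 K by simp [h25, h0, hb24, h2, hraw, hK, two_mul]; rfl]
    have hkey : ∀ v ∈ S, 2 * rep bt S X v + bt v x = K →
        rep bt S (insert x X) v = rep bt S (insert x X) u := by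
      intro v hv e
      have := h.le_one v x
      refine rep_congr fun y hy => ?_
      rcases mem_insert.1 hy with rfl | hy
      · omega
      · exact (rep_eq_iff hv hc).1 (by omega) y hy
    have h3 : b.arr 3 K ≤ n := by
      by_cases h0 : b.arr 3 K = 0
      · omega
      · obtain ⟨v, k1, k2, k3⟩ := g4 K hKn h0
        rw [k3, g3 v k1 k2]
        exact rep_lt hS k1
    -- Both branches of the conditional lead to the same final assignment, which is verified once
    -- for the two possible states.
    suffices hfin : ∀ c : ASt, (∃ t, t ≤ 130 ∧ ((c = (b.set 26 K).tick t ∧ b.arr 3 K ≠ 0) ∨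
        (c = ((b.set 26 K).put 3 K (u + 1)).tick t ∧ b.arr 3 K = 0))) →
        wp M (block [.put 2 (.var 25) (.get 3 (.var 26) - 1)]) (fun c =>
          Refining bt n S X x (u + 1) a (((c.tick 2).set 25 (u + 1)).tick 19) ∧
          (c.tick 2).v 25 = u ∧ (c.tick 2).time ≤ b.time + 200) c by
      refine wp_seq (wp_cond (by simp; omega) (by simp; omega) (fun hc' => ?_) fun hc' => ?_)
      · refine wp_block trivial ((hfin _ ⟨_, ?_, Or.inl ⟨by simp; rfl, by simpa using hc'⟩⟩).mono ?_)
        · norm_num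
        · rintro c hc; simpa using hc
      · refine wp_block (by simp [h25]; omega) ((hfin _ ⟨_, ?_, Or.inr ⟨by simp [h25]; rfl, by simpa using hc'⟩⟩).mono ?_)
        · norm_num
        · rintro c hc; simpa using hc
    rintro c ⟨t, ht, hc'⟩
    -- If the key is unused, no smaller vertex belongs to the class: its new representative would be
    -- such a vertex and would have left an entry.
    have hself : b.arr 3 K = 0 → rep bt S (insert x X) u = u := by
      intro h0
      have hle := rep_le (bt := bt) (X := insert x X) (u := u) hc fun _ _ => rfl
      by_contra hne
      have hlt : rep bt S (insert x X) u < u := by omega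
      obtain ⟨k1, k2⟩ := rep_spec (bt := bt) (X := insert x X) hc
      have e1 : rep bt S X (rep bt S (insert x X) u) = rep bt S X u :=
        rep_congr fun y hy => k2 y (mem_insert_of_mem hy)
      have := g3 _ k1 hlt
      rw [e1, k2 x (mem_insert_self _ _), ← hK, h0] at this
      omega
    have hsome : b.arr 3 K ≠ 0 → b.arr 3 K = rep bt S (insert x X) u + 1 := by
      intro h0
      obtain ⟨v, k1, k2, k3⟩ := g4 K hKn h0
      rw [k3, g3 v k1 k2, hkey v k1 k3.symm]
    have hc3 : c.arr 3 K = rep bt S (insert x X) u + 1 := by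
      rcases hc' with ⟨rfl, h0⟩ | ⟨rfl, h0⟩
      · simpa using hsome h0
      · simp [hself h0]
    have hc3' : ∀ i, i ≠ K → c.arr 3 i = b.arr 3 i := by
      intro i hi
      rcases hc' with ⟨rfl, h0⟩ | ⟨rfl, h0⟩
      · simp
      · simp [hi]
    have hca : ∀ id, id ≠ 3 → c.arr id = b.arr id := by
      intro id hi
      rcases hc' with ⟨rfl, h0⟩ | ⟨rfl, h0⟩
      · simp
      · simp [hi]
    have hc25 : c.v 25 = u := by rcases hc' with ⟨rfl, h0⟩ | ⟨rfl, h0⟩ <;> simp [h25]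
    have hc26 : c.v 26 = K := by rcases hc' with ⟨rfl, h0⟩ | ⟨rfl, h0⟩ <;> simp
    have hcr : c.raw = b.raw := by rcases hc' with ⟨rfl, h0⟩ | ⟨rfl, h0⟩ <;> simp
    have hcl : c.low 25 = b.low 25 := by rcases hc' with ⟨rfl, h0⟩ | ⟨rfl, h0⟩ <;> simp
    have hct : c.time ≤ b.time + 130 := by rcases hc' with ⟨rfl, h0⟩ | ⟨rfl, h0⟩ <;> simp [ht]
    clear hc'
    refine wp_block (by simp [hc25, hc26, hc3]; omega) ⟨⟨⟨?_, ?_, fun id i1 i2 => ?_⟩,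
      fun v hv hvu => ?_, fun v hv hvu => ?_, fun v hv hvu => ?_, fun i hi hne => ?_⟩, ?_, ?_⟩
    · simp [hcl, f1]
    · simp [hcr, f2]
    · simp [i1, hca id i2, f3 id i1 i2]
    · simp [hc25, hc26, hc3, show v ≠ u by omega, hca, g1 v hv (by omega)]
    · rcases Nat.lt_succ_iff_lt_or_eq.1 hvu with hvu | rfl
      · simp [hc25, hc26, hc3, show v ≠ u by omega, hca, g2 v hv hvu]
      · simp [hc25, hc26, hc3]
    · simp
      by_cases he : 2 * rep bt S X v + bt v x = K
      · rw [he, hc3, hkey v hv he]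
      · rw [hc3' _ he]
        refine g3 v hv ?_
        rcases Nat.lt_succ_iff_lt_or_eq.1 hvu with hvu | rfl
        · exact hvu
        · exact absurd hK.symm he
    · simp at hne
      by_cases he : i = K
      · exact ⟨u, hc, by omega, he.trans hK⟩
      · rw [hc3' _ he] at hne
        obtain ⟨v, k1, k2, k3⟩ := g4 i hi hne
        exact ⟨v, k1, by omega, k3⟩
    · simp [hc25]
    · simp; omega

end WordRAM

namespace WordRAM

open Finset

variable {bt : ℕ → ℕ → ℕ} {S X : Finset ℕ} {n q : ℕ} {M : Mach} {ρ : ℕ → ℕ}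

theorem RefineFrame.input {a b : ASt} (hf : RefineFrame a b) (h : Input bt n M a) :
    Input bt n M b := h.of_eq (ASt.v_eq hf.low 0 (by omega)) hf.raw

theorem RefineFrame.alive {a b : ASt} (hf : RefineFrame a b) (h : Alive n S a) : Alive n S b := by
  intro u hu
  rw [hf.arr 1 (by omega) (by omega)]
  exact h u hu

theorem wp_refine {x : ℕ} {a : ASt} (h : Input bt n M a) (hS : S ⊆ range n)
    (hA : Alive n S a) (hx : x < n) (h24 : a.v 24 = x) (hr : HasReps bt S X a) :
    wp M refine (fun b => HasReps bt S (insert x X) b ∧ RefineFrame a b ∧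
      b.time ≤ a.time + 300 * n + 60) a := by
  have hV := h.fitsV
  refine wp_seq ((wp_clearTable h).mono ?_)
  rintro b ⟨b1, b2, b3, b4, b5⟩
  have hb0 : b.v 0 = n := (ASt.v_eq b2 0 (by omega)).trans h.n_eq
  refine wp_for n (fun k c => Refining bt n S X x k a c ∧ c.time ≤ a.time + 60 * n + 40 + 230 * k)
    (by omega) (by omega) (by omega) hb0 (by omega) ?_ ?_ ?_
  · refine ⟨⟨⟨by simp [b2], by simp [b3], fun id i1 i2 => by simp [b4 id i2]⟩, fun v hv _ => ?_,
      fun v hv hlt => by omega, fun v hv hlt => by omega, fun i hi hne => ?_⟩, by simp; omega⟩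
    · simp [b4, hr v hv]
    · simp [b1 i hi] at hne
  · rintro k hk c ⟨c1, c2⟩ hc25 hc0
    refine (wp_refineVertex h hS hA hx h24 c1 hk hc25).mono ?_
    rintro d ⟨d1, d2, d3⟩
    refine ⟨d2, ?_, d1, by simp; omega⟩
    have := ASt.v_eq d1.frame.low 0 (by omega)
    simpa [h.n_eq] using this
  · rintro c ⟨c1, c2⟩ hc25 hc0
    refine ⟨fun u hu => ?_, ⟨?_, ?_, fun id i1 i2 => ?_⟩, by simp; omega⟩
    · simpa using c1.new u hu (mem_range.1 (hS hu))
    · simpa using c1.frame.low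
    · simpa using c1.frame.raw
    · simpa using c1.frame.arr id i1 i2

/-- Give all vertices the representative `0`. -/
def initReps : Prog := forUp 25 0 (block [.put 2 (.var 25) 0])

theorem wp_initReps {a : ASt} (h : Input bt n M a) (hS : S ⊆ range n) (h0 : 0 ∈ S) :
    wp M initReps (fun b => HasReps bt S ∅ b ∧ RefineFrame a b ∧ b.time ≤ a.time + 40 * n + 20) a := by
  have hV := h.fitsV
  refine wp_for n (fun k b => (∀ v < k, b.arr 2 v = 0) ∧ RefineFrame a b ∧
    b.time ≤ a.time + 40 * k + 15) (by omega) (by omega) (by omega) h.n_eq (by omega) ?_ ?_ ?_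
  · exact ⟨by omega, ⟨by simp, by simp, by simp⟩, by simp⟩
  · rintro k hk b ⟨b1, b2, b3⟩ hb25 hb0
    refine wp_block (by simp [hb25]; omega) ?_
    refine ⟨by simp [hb25], by simp [hb0], fun v hv => ?_, ⟨?_, ?_, fun id i1 i2 => ?_⟩,
      by simp; omega⟩
    · simp [hb25, Function.update_apply]
      intro hne
      exact b1 v (by omega)
    · simpa using b2.low
    · simpa using b2.raw
    · simp [i1, b2.arr id i1 i2]
  · rintro b ⟨b1, b2, b3⟩ hb25 hb0
    refine ⟨fun u hu => ?_, ⟨?_, ?_, fun id i1 i2 => ?_⟩, by simp; omega⟩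
    · have h1 : rep bt S ∅ u = 0 := Nat.le_zero.1 (rep_le h0 (by simp))
      simpa [h1] using b1 u (mem_range.1 (hS hu))
    · simpa using b2.low
    · simpa using b2.raw
    · simpa using b2.arr id i1 i2

theorem smp_succ (j : ℕ) : smp n (j + 1) ρ S =
    if ρ j % n ∈ S then insert (ρ j % n) (smp n j ρ S) else smp n j ρ S := by
  ext x
  split_ifs with h
  · simp only [mem_smp, mem_insert]
    constructor
    · rintro ⟨⟨i, hi, rfl⟩, hx⟩
      rcases Nat.lt_succ_iff_lt_or_eq.1 hi with hi | rfl
      · exact Or.inr ⟨⟨i, hi, rfl⟩, hx⟩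
      · exact Or.inl rfl
    · rintro (rfl | ⟨⟨i, hi, rfl⟩, hx⟩)
      · exact ⟨⟨j, by omega, rfl⟩, h⟩
      · exact ⟨⟨i, by omega, rfl⟩, hx⟩
  · simp only [mem_smp]
    constructor
    · rintro ⟨⟨i, hi, rfl⟩, hx⟩
      rcases Nat.lt_succ_iff_lt_or_eq.1 hi with hi | rfl
      · exact ⟨⟨i, hi, rfl⟩, hx⟩
      · exact absurd hx h
    · rintro ⟨⟨i, hi, rfl⟩, hx⟩
      exact ⟨⟨i, by omega, rfl⟩, hx⟩

/-- Refine the partition by the samples in array `0` from entry `v22` on, `v23` in number. -/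
def sampleLoop : Prog :=
  forUp 21 23 (.seq (block [.asg 24 (.get 0 (.var 22 + .var 21))])
    (cond (.get 1 (.var 24)) (block []) refine))

/-- What the refinements of a trial do not change. -/
structure SampleFrame (a b : ASt) : Prop where
  low : b.low 21 = a.low 21
  raw : b.raw = a.raw
  arr : ∀ id, id ≠ 2 → id ≠ 3 → b.arr id = a.arr id

/-- Samples that have already been eliminated are skipped, in accordance with `smp`. Each sample
costs O(n), for clearing the table and for passing over all vertices. -/
theorem wp_sampleLoop {a : ASt} {o : ℕ} (h : Input bt n M a) (hn : 0 < n) (hS : S ⊆ range n)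
    (hA : Alive n S a) (h22 : a.v 22 = o) (h23 : a.v 23 = q) (hoV : o + q < M.V)
    (hρ : ∀ j < q, a.arr 0 (o + j) = ρ j % n) (hr : HasReps bt S ∅ a) :
    wp M sampleLoop (fun b => HasReps bt S (smp n q ρ S) b ∧ SampleFrame a b ∧
      b.time ≤ a.time + q * (300 * n + 150) + 20) a := by
  have hV := h.fitsV
  refine wp_for q (fun k b => HasReps bt S (smp n k ρ S) b ∧ SampleFrame a b ∧ b.v 22 = o ∧
    b.v 23 = q ∧ b.time ≤ a.time + k * (300 * n + 150) + 15) (by omega) (by omega) (by omega) h23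
    (by omega) ?_ ?_ ?_
  · refine ⟨?_, ⟨by simp, by simp, by simp⟩, by simp [h22], by simp [h23], by simp⟩
    have : smp n 0 ρ S = ∅ := by simp [smp]
    rw [this]
    simpa [HasReps] using hr
  · rintro k hk b ⟨b1, b2, b3, b4, b5⟩ hb21 -
    have hx : ρ k % n < n := Nat.mod_lt _ hn
    have hb0 : b.v 0 = n := (ASt.v_eq b2.low 0 (by omega)).trans h.n_eq
    have hb : b.arr 0 (o + k) = ρ k % n := by
      rw [b2.arr 0 (by omega) (by omega)]
      exact hρ k hk
    have h1 : b.arr 1 (ρ k % n) = if ρ k % n ∈ S then 0 else 1 := by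
      rw [b2.arr 1 (by omega) (by omega)]
      exact hA _ hx
    have hk' : (k + 1) * (300 * n + 150) = k * (300 * n + 150) + 300 * n + 150 := by ring
    generalize (k + 1) * (300 * n + 150) = T' at hk' ⊢
    generalize k * (300 * n + 150) = T at hk' b5
    refine wp_seq (wp_block (by simp [b3, hb21]; omega) ?_)
    generalize hc : ASt.tick (execB _ _) _ = c
    have c24 : c.v 24 = ρ k % n := by rw [← hc]; simp [b3, hb21, hb]
    have cl : c.low 24 = b.low 24 := by rw [← hc]; simp
    have craw : c.raw = b.raw := by rw [← hc]; simp
    have carr : c.arr = b.arr := by rw [← hc]; simp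
    have ct : c.time = b.time + 19 := by rw [← hc]; simp
    clear hc
    have c22 := ASt.v_eq cl 22 (by omega)
    have c23 := ASt.v_eq cl 23 (by omega)
    have c21 := ASt.v_eq cl 21 (by omega)
    have cl' := ASt.low_mono cl (show 21 ≤ 24 by omega)
    have c0 := ASt.v_eq cl 0 (by omega)
    refine wp_cond (by simp [c24]; omega) (by simp [c24, carr, h1]; split_ifs <;> omega)
      (fun hc => ?_) fun hc => ?_
    · simp [c24, carr, h1] at hc
      rw [smp_succ, if_neg hc]
      refine wp_block trivial ⟨?_, ?_, ?_, ⟨?_, ?_, fun id i1 i2 => ?_⟩, ?_, ?_, ?_⟩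
      · simp [c21, hb21]
      · simp [c23, b4]
      · simpa [HasReps, carr] using b1
      · simpa [cl'] using b2.low
      · simpa [craw] using b2.raw
      · simpa [carr] using b2.arr id i1 i2
      · simp [c22, b3]
      · simp [c23, b4]
      · simp [ct]; omega
    · simp [c24, carr, h1] at hc
      rw [smp_succ, if_pos hc]
      refine (wp_refine (bt := bt) (S := S) (x := ρ k % n) (X := smp n k ρ S) ?_ hS ?_ hx ?_ ?_).mono ?_
      · exact h.of_eq (by simp [c0, hb0, h.n_eq]) (by simp [craw, b2.raw])
      · intro u hu
        simp [carr, b2.arr 1, hA u hu]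
      · simp [c24]
      · simpa [HasReps, carr] using b1
      · rintro d ⟨d1, d2, d3⟩
        have d21 := ASt.v_eq d2.low 21 (by omega)
        have d22 := ASt.v_eq d2.low 22 (by omega)
        have d23 := ASt.v_eq d2.low 23 (by omega)
        have dl := ASt.low_mono d2.low (show 21 ≤ 25 by omega)
        simp at d21 d22 d23 dl d3
        refine ⟨?_, ?_, ?_, ⟨?_, ?_, fun id i1 i2 => ?_⟩, ?_, ?_, ?_⟩
        · simp [d21, c21, hb21]
        · simp [d23, c23, b4]
        · simpa [HasReps] using d1
        · simp [dl, cl', b2.low]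
        · have := d2.raw
          simp at this
          simp [this, craw, b2.raw]
        · have := d2.arr id i1 i2
          simp at this
          simp [this, carr, b2.arr id i1 i2]
        · simp [d22, c22, b3]
        · simp [d23, c23, b4]
        · simp; omega
  · rintro b ⟨b1, b2, b3, b4, b5⟩ hb21 hb23
    refine ⟨by simpa [HasReps] using b1, ⟨?_, ?_, fun id i1 i2 => ?_⟩, by simp; omega⟩
    · simpa using b2.low
    · simpa using b2.raw
    · simpa using b2.arr id i1 i2

/-- Arrays `4` and `5` contain the list `L` of pairs, variable `7` its length. -/
structure PairsRep (L : List (ℕ × ℕ)) (a : ASt) : Prop where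
  len : a.v 7 = L.length
  get : ∀ i p, L[i]? = some p → a.arr 4 i = p.1 ∧ a.arr 5 i = p.2

/-- Eliminate all vertices that do not represent themselves. -/
def elimLoop : Prog :=
  forUp 25 0 (cond (.get 1 (.var 25)) (block [])
    (cond (.op .eq (.get 2 (.var 25)) (.var 25)) (block [])
      (block [.put 4 (.var 7) (.var 25), .put 5 (.var 7) (.get 2 (.var 25)),
        .put 1 (.var 25) 1, .asg 7 (.var 7 + 1)])))

/-- The pairs eliminated among the vertices below `k`. -/
noncomputable def elimBelow (bt : ℕ → ℕ → ℕ) (S X : Finset ℕ) (k : ℕ) : List (ℕ × ℕ) :=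
  ((List.range k).filter fun u => u ∈ S ∧ rep bt S X u ≠ u).map fun u => (u, rep bt S X u)

theorem elimBelow_succ (k : ℕ) : elimBelow bt S X (k + 1) = elimBelow bt S X k ++
    if k ∈ S ∧ rep bt S X k ≠ k then [(k, rep bt S X k)] else [] := by
  simp only [elimBelow, List.range_succ, List.filter_append, List.map_append, List.filter_cons,
    List.filter_nil, decide_eq_true_eq]
  split_ifs <;> simp

theorem length_elimBelow_le (k : ℕ) : (elimBelow bt S X k).length ≤ k := by
  rw [elimBelow, List.length_map]
  exact (List.length_filter_le _ _).trans (by simp)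

/-- What a trial does not change. -/
structure TrialFrame (a b : ASt) : Prop where
  low : ∀ z < 21, z ≠ 7 → b.v z = a.v z
  raw : b.raw = a.raw
  arr : ∀ id, id ∉ ({1, 2, 3, 4, 5} : Finset ℕ) → b.arr id = a.arr id

theorem wp_elimLoop {a : ASt} {L : List (ℕ × ℕ)} (h : Input bt n M a) (hS : S ⊆ range n)
    (hA : Alive n S a) (hr : HasReps bt S X a) (hL : PairsRep L a) (hLn : L.length ≤ n) :
    wp M elimLoop (fun b => PairsRep (L ++ elimPairs bt n S X) b ∧ Alive n (kept bt S X) b ∧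
      TrialFrame a b ∧ b.time ≤ a.time + 150 * n + 20) a := by
  have hV := h.fitsV
  refine wp_for n (fun k b => PairsRep (L ++ elimBelow bt S X k) b ∧
    (∀ v < n, b.arr 1 v = if v ∈ S ∧ ¬ (v < k ∧ rep bt S X v ≠ v) then 0 else 1) ∧
    b.arr 2 = a.arr 2 ∧ TrialFrame a b ∧ b.time ≤ a.time + 150 * k + 15)
    (by omega) (by omega) (by omega) h.n_eq (by omega) ?_ ?_ ?_
  · refine ⟨?_, fun v hv => ?_, by simp, ⟨fun z h1 h2 => ?_, by simp, by simp⟩, by simp⟩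
    · have : elimBelow bt S X 0 = [] := rfl
      rw [this, List.append_nil]
      exact ⟨by simp [hL.len], by simpa using hL.get⟩
    · simp [hA v hv]
    · simp; omega
  · rintro k hk b ⟨b1, b2, b3, b4, b5⟩ hb25 hb0
    have h1 : b.arr 1 k = if k ∈ S then 0 else 1 := by simpa using b2 k hk
    have hlen := length_elimBelow_le (bt := bt) (S := S) (X := X) k
    have h7 := b1.len
    rw [List.length_append] at h7
    have hskip : ∀ t, t ≤ 100 → (k ∉ S ∨ rep bt S X k = k) → b.v 25 = k → b.v 0 = n →
        wp M (block []) (fun c => c.v 25 = k ∧ c.v 0 = n ∧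
          PairsRep (L ++ elimBelow bt S X (k + 1)) ((c.set 25 (k + 1)).tick 19) ∧
          (∀ v < n, ((c.set 25 (k + 1)).tick 19).arr 1 v =
            if v ∈ S ∧ ¬ (v < k + 1 ∧ rep bt S X v ≠ v) then 0 else 1) ∧
          ((c.set 25 (k + 1)).tick 19).arr 2 = a.arr 2 ∧
          TrialFrame a ((c.set 25 (k + 1)).tick 19) ∧
          ((c.set 25 (k + 1)).tick 19).time ≤ a.time + 150 * (k + 1) + 15) (b.tick t) := by
      intro t ht hno _ _
      rw [elimBelow_succ, if_neg (by tauto), List.append_nil]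
      refine wp_block trivial ⟨by simp [hb25], by simp [hb0], ⟨by simp [b1.len], by simpa using b1.get⟩,
        fun v hv => ?_, by simp [b3], ⟨fun z i1 i2 => ?_, by simp [b4.raw], fun id hid => ?_⟩, ?_⟩
      · simp only [execB, ASt.tick_arr, ASt.set_arr, b2 v hv]
        congr 1
        rw [eq_iff_iff]
        refine and_congr_right fun hv => not_congr ?_
        constructor
        · rintro ⟨h1, h2⟩; exact ⟨by omega, h2⟩
        · rintro ⟨h1, h2⟩
          refine ⟨?_, h2⟩
          rcases Nat.lt_succ_iff_lt_or_eq.1 h1 with h | rfl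
          · exact h
          · rcases hno with h | h
            · exact absurd hv h
            · exact absurd h h2
      · simp [show z ≠ 25 by omega, b4.low z i1 i2]
      · simpa using b4.arr id hid
      · simp; omega
    refine wp_cond (by simp [hb25]; omega) (by simp [hb25, h1]; split_ifs <;> omega)
      (fun hc => ?_) fun hc => ?_
    · simp [hb25, h1] at hc
      exact hskip _ (by simp) (Or.inl hc) hb25 hb0
    · simp [hb25, h1] at hc
      have h2 : b.arr 2 k = rep bt S X k := by rw [b3]; exact hr k hc
      have hrep := rep_lt (bt := bt) (X := X) hS hc
      refine wp_cond (by simp [hb25]; omega) (lt_of_le_of_lt (Op.eq_le _ _) (by have := M.Vpos; omega))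
        (fun hc' => ?_) fun hc' => ?_
      · simp [hb25, h2] at hc'
        rw [ASt.tick_tick]
        exact hskip _ (by simp) (Or.inr hc') hb25 hb0
      · simp [hb25, h2] at hc'
        rw [elimBelow_succ, if_pos ⟨hc, hc'⟩, ← List.append_assoc]
        refine wp_block ?_ ⟨?_, ?_, ⟨?_, fun i p hip => ?_⟩, fun v hv => ?_, ?_,
          ⟨fun z i1 i2 => ?_, ?_, fun id hid => ?_⟩, ?_⟩
        · simp [hb25, h2, h7]; omega
        · simp [hb25]
        · simp [hb0]
        · simp [h7]; omega
        · rw [List.getElem?_append] at hip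
          have hl : (L ++ elimBelow bt S X k).length = b.v 7 := b1.len.symm
          rw [hl] at hip
          split_ifs at hip with hi
          · simpa [hi.ne, Function.update_apply] using b1.get i p hip
          · have hi' : i = b.v 7 := by
              by_contra hne
              rw [List.getElem?_eq_none (by simp; omega)] at hip
              simp at hip
            subst hi'
            simp at hip
            subst hip
            simp [hb25, h2]
        · simp [hb25, Function.update_apply, b2 v hv]
          by_cases hvk : v = k
          · subst hvk; simp [hc, hc']
          · rw [if_neg hvk]
            congr 1
            rw [eq_iff_iff]
            refine and_congr_right fun hv => ?_
            constructor
            · intro h3 h4; exact h3 (by omega)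
            · intro h3 h4; exact h3 (by omega)
        · simp [b3]
        · simp [show z ≠ 25 by omega, i2, b4.low z i1 i2]
        · simp [b4.raw]
        · have := b4.arr id hid
          simp at hid
          simp [hid, this]
        · simp; omega
  · rintro b ⟨b1, b2, b3, b4, b5⟩ hb25 hb0
    rw [show elimPairs bt n S X = elimBelow bt S X n from rfl]
    refine ⟨⟨by simpa using b1.len, by simpa using b1.get⟩, fun v hv => ?_,
      ⟨by simpa using b4.low, by simpa using b4.raw, by simpa using b4.arr⟩, by simp; omega⟩
    simp only [ASt.tick_arr, b2 v hv, kept, mem_filter]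
    congr 1
    rw [eq_iff_iff]
    refine and_congr_right fun _ => ?_
    tauto

/-- The trial with number `v20`. -/
def trial : Prog :=
  .seq (block [.asg 22 (.var 20 * .var 3), .asg 23 (.var 3 * .op .lt (.var 20) (.var 4))])
    (.seq initReps (.seq sampleLoop elimLoop))

/-- The number of samples is multiplied by the comparison of the trial number with the limit in
variable `4`. So the same code performs the last round without samples, which eliminates everything
but vertex 0. -/
theorem wp_trial {a : ASt} {o : ℕ} {L : List (ℕ × ℕ)} (h : Input bt n M a) (hn : 0 < n)
    (hS : S ⊆ range n) (h0 : 0 ∈ S) (hA : Alive n S a) (ho : a.v 20 * a.v 3 = o)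
    (hq : (a.v 3 * if a.v 20 < a.v 4 then 1 else 0) = q) (hoV : o + q < M.V)
    (hρ : ∀ j < q, a.arr 0 (o + j) = ρ j % n) (hL : PairsRep L a) (hLn : L.length ≤ n) :
    wp M trial (fun b => PairsRep (L ++ elimPairs bt n S (smp n q ρ S)) b ∧
      Alive n (kept bt S (smp n q ρ S)) b ∧ TrialFrame a b ∧
      b.time ≤ a.time + q * (300 * n + 150) + 190 * n + 100) a := by
  have hVp := M.Vpos
  refine wp_seq (wp_block (by simp [ho, hq]; omega) ?_)
  generalize hc : ASt.tick (execB _ _) _ = c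
  have c22 : c.v 22 = o := by rw [← hc]; simp [ho]
  have c23 : c.v 23 = q := by rw [← hc]; simp [hq]
  have cl : c.low 21 = a.low 21 := by rw [← hc]; simp
  have craw : c.raw = a.raw := by rw [← hc]; simp
  have carr : c.arr = a.arr := by rw [← hc]; simp
  have ct : c.time ≤ a.time + 30 := by rw [← hc]; simp
  clear hc
  have hc : Input bt n M c := h.of_eq (ASt.v_eq cl 0 (by omega)) craw
  refine wp_seq ((wp_initReps hc hS h0).mono ?_)
  rintro d ⟨d1, d2, d3⟩
  have cA : Alive n S c := by intro u hu; rw [carr]; exact hA u hu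
  have hd : Input bt n M d := d2.input hc
  refine wp_seq ((wp_sampleLoop (q := q) (o := o) (ρ := ρ) hd hn hS ?_ ?_ ?_ hoV ?_ ?_).mono ?_)
  · exact d2.alive cA
  · have := ASt.v_eq d2.low 22 (by omega)
    simp [this, c22]
  · have := ASt.v_eq d2.low 23 (by omega)
    simp [this, c23]
  · intro j hj
    simp [d2.arr 0, carr, hρ j hj]
  · exact d1
  rintro e ⟨e1, e2, e3⟩
  have he : Input bt n M e := hd.of_eq (ASt.v_eq e2.low 0 (by omega)) e2.raw
  have hl : ∀ z < 21, e.v z = a.v z := by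
    intro z hz
    have h1 := ASt.v_eq e2.low z hz
    have h2 := ASt.v_eq d2.low z (by omega)
    have h3 := ASt.v_eq cl z hz
    rw [h1, h2, h3]
  have har : ∀ id, id ≠ 2 → id ≠ 3 → e.arr id = a.arr id := by
    intro id h1 h2
    have h3 := e2.arr id h1 h2
    rw [h3, d2.arr id h1 h2, carr]
  refine (wp_elimLoop (S := S) (X := smp n q ρ S) (L := L) he hS ?_ e1 ?_ hLn).mono ?_
  · intro u hu
    simpa [har 1] using hA u hu
  · exact ⟨by simpa [hl 7] using hL.len, by simpa [har 4, har 5] using hL.get⟩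
  rintro f ⟨f1, f2, f3, f4⟩
  refine ⟨⟨by simpa using f1.len, by simpa using f1.get⟩, by simpa [Alive] using f2,
    ⟨fun z h1 h2 => ?_, ?_, fun id hid => ?_⟩, ?_⟩
  · have := f3.low z h1 h2
    simpa [hl z h1] using this
  · have h1 := f3.raw
    have h2 := e2.raw
    have h3 := d2.raw
    simp at h1 h2 ⊢
    rw [h1, h2, h3, craw]
  · have h1 := f3.arr id hid
    simp at h1 hid ⊢
    rw [h1, har id (by tauto) (by tauto)]
  · simp at *; omega

/-- All trials. -/
def trials : Prog :=
  .seq (block [.asg 8 (.var 4 + 1), .asg 7 0]) (forUp 20 8 trial)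

/-- What all trials together do not change. -/
structure TrialsFrame (a b : ASt) : Prop where
  low : ∀ z < 7, b.v z = a.v z
  raw : b.raw = a.raw
  arr : ∀ id, id ∉ ({1, 2, 3, 4, 5} : Finset ℕ) → b.arr id = a.arr id

theorem length_elims_le (ρ : ℕ → ℕ) (r : ℕ) : (elims bt n q ρ r).length ≤ n := by
  have := (elimTo_elims (bt := bt) (n := n) (q := q) ρ r).card
  rw [card_range] at this
  omega

theorem wp_trials {a : ASt} {R : ℕ} (h : Input bt n M a) (hn : 0 < n) (h1 : ∀ u, a.arr 1 u = 0)
    (h3 : a.v 3 = q) (h4 : a.v 4 = R) (hV : R * q + q + R + 2 < M.V)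
    (hρ : ∀ j < R * q, a.arr 0 j = ρ j % n) :
    wp M trials (fun b => PairsRep (allElims bt n q R ρ) b ∧ TrialsFrame a b ∧
      b.time ≤ a.time + R * q * (300 * n + 150) + (R + 1) * (190 * n + 150) + 100) a := by
  have hVp := M.Vpos
  refine wp_seq (wp_block (by simp [h4]; omega) ?_)
  generalize hc : ASt.tick (execB _ _) _ = c
  have c8 : c.v 8 = R + 1 := by rw [← hc]; simp [h4]
  have c7 : c.v 7 = 0 := by rw [← hc]; simp
  have cl : c.low 7 = a.low 7 := by rw [← hc]; simp
  have craw : c.raw = a.raw := by rw [← hc]; simp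
  have carr : c.arr = a.arr := by rw [← hc]; simp
  have ct : c.time ≤ a.time + 15 := by rw [← hc]; simp
  clear hc
  have c3 := (ASt.v_eq cl 3 (by omega)).trans h3
  have c4 := (ASt.v_eq cl 4 (by omega)).trans h4
  have hcI : Input bt n M c := h.of_eq (ASt.v_eq cl 0 (by omega)) craw
  refine wp_for (R + 1) (fun k b => PairsRep (if k ≤ R then elims bt n q ρ k else allElims bt n q R ρ) b ∧
    (k ≤ R → Alive n (remain bt n q (range n) ρ k) b) ∧ (∀ z < 20, z ≠ 7 → b.v z = c.v z) ∧
    b.raw = c.raw ∧ (∀ id, id ∉ ({1, 2, 3, 4, 5} : Finset ℕ) → b.arr id = c.arr id) ∧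
    b.time ≤ a.time + 30 + min k R * q * (300 * n + 150) + k * (190 * n + 150))
    (by omega) (by omega) (by omega) c8 (by omega) ?_ ?_ ?_
  · refine ⟨⟨by simp [elims, c7], by simp [elims]⟩, fun _ u hu => ?_, fun z h1 h2 => ?_, by simp,
      by simp, by simp; omega⟩
    · simp [carr, h1, remain, hu]
    · simp; omega
  · rintro k hk b ⟨b1, b2, b3, b4, b5, b6⟩ hb20 hb8
    have hkR : k ≤ R := by omega
    rw [if_pos hkR] at b1
    have hb3 := (b3 3 (by omega) (by omega)).trans c3
    have hb4 := (b3 4 (by omega) (by omega)).trans c4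
    have hkq : k * q ≤ R * q := Nat.mul_le_mul_right _ hkR
    refine (wp_trial (q := if k < R then q else 0) (o := k * q) (ρ := shiftF (k * q) ρ)
      (hcI.of_eq (b3 0 (by omega) (by omega)) b4) hn (remain_subset _ _ k)
      (zero_mem_remain hn ρ k) (b2 hkR) ?_ ?_ ?_ ?_ b1 (length_elims_le ρ k)).mono ?_
    · rw [hb20, hb3]
    · rw [hb20, hb3, hb4]; split_ifs <;> simp
    · split_ifs <;> omega
    · intro j hj
      split_ifs at hj with hkR'
      · rw [b5 0 (by simp), carr, hρ _ ?_, shiftF]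
        have := Nat.mul_le_mul_right q (show k + 1 ≤ R by omega)
        rw [add_mul, one_mul] at this
        omega
      · omega
    rintro d ⟨d1, d2, d3, d4⟩
    refine ⟨(d3.low 20 (by omega) (by omega)).trans hb20,
      (d3.low 8 (by omega) (by omega)).trans hb8, ?_, fun hk' => ?_, fun z i1 i2 => ?_, ?_,
      fun id hid => ?_, ?_⟩
    · have : (if k + 1 ≤ R then elims bt n q ρ (k + 1) else allElims bt n q R ρ) =
          elims bt n q ρ k ++ elimPairs bt n (remain bt n q (range n) ρ k)
            (smp n (if k < R then q else 0) (shiftF (k * q) ρ) (remain bt n q (range n) ρ k)) := by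
        split_ifs with i1 i2 i2
        · rfl
        · omega
        · omega
        -- The round with number `R` has no samples and completes the elimination sequence.
        · obtain rfl : k = R := by omega
          simp [allElims, smp]
      rw [this]
      exact ⟨by simpa using d1.len, by simpa using d1.get⟩
    · rw [if_pos (by omega)] at d2
      exact fun u hu => d2 u hu
    · simp [show z ≠ 20 by omega, d3.low z (by omega) i2, b3 z i1 i2]
    · simp [d3.raw, b4]
    · simp [d3.arr id hid, b5 id hid]
    · simp
      have e1 : (k + 1) * (190 * n + 150) = k * (190 * n + 150) + 190 * n + 150 := by ring
      have e2 : min (k + 1) R * q * (300 * n + 150) = min k R * q * (300 * n + 150) +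
          (if k < R then q else 0) * (300 * n + 150) := by
        split_ifs with hlt
        · rw [min_eq_left (by omega), min_eq_left (by omega)]; ring
        · rw [min_eq_right (by omega), min_eq_right (by omega)]; ring
      rw [e1, e2]
      omega
  · rintro b ⟨b1, b2, b3, b4, b5, b6⟩ hb20 hb8
    rw [if_neg (by omega)] at b1
    refine ⟨⟨by simpa using b1.len, by simpa using b1.get⟩, ⟨fun z hz => ?_, ?_, fun id hid => ?_⟩, ?_⟩
    · simp [b3 z (by omega) (by omega), ASt.v_eq cl z hz]
    · simp [b4, craw]
    · simp [b5 id hid, carr]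
    · rw [min_eq_right (by omega)] at b6
      simp; omega

end WordRAM

/-! ### Implementation of the vertex order and of the runs -/

namespace WordRAM

open Finset

variable {bt : ℕ → ℕ → ℕ} {S : Finset ℕ} {n : ℕ} {M : Mach} {B : ℕ → ℕ → ℕ}

/-! ### The order of an elimination sequence -/

/-- The link that refers to the head of a list. -/
def link : List ℕ → ℕ
  | [] => 0
  | x :: _ => x + 1

/-- `f` contains the links of the list. -/
def Linked (f : ℕ → ℕ) : List ℕ → Prop
  | [] => True
  | x :: l => f x = link l ∧ Linked f l

theorem Linked.congr {f g : ℕ → ℕ} {l : List ℕ} (h : Linked f l) (hg : ∀ x ∈ l, g x = f x) :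
    Linked g l := by
  induction l with
  | nil => trivial
  | cons x l ih =>
    exact ⟨(hg x (by simp)).trans h.1, ih h.2 fun y hy => hg y (by simp [hy])⟩

theorem Linked.drop {f : ℕ → ℕ} {l : List ℕ} (h : Linked f l) (k : ℕ) : Linked f (l.drop k) := by
  induction k generalizing l with
  | zero => exact h
  | succ k ih =>
    cases l with
    | nil => trivial
    | cons x l => exact ih h.2

theorem link_insAfter {u v : ℕ} {l : List ℕ} (hv : v ∈ l) : link (insAfter v u l) = link l := by
  cases l with
  | nil => simp at hv
  | cons x l => rw [insAfter]; split_ifs <;> rfl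

/-- The usual insertion into a linked list: `u` takes over the link of `v`, then `v` refers to `u`.
The head of the list is never affected. -/
theorem Linked.insAfter {f : ℕ → ℕ} {u v : ℕ} {l : List ℕ} (h : Linked f l) (hl : l.Nodup)
    (hv : v ∈ l) (hu : u ∉ l) :
    Linked (Function.update (Function.update f u (f v)) v (u + 1)) (insAfter v u l) := by
  induction l with
  | nil => simp at hv
  | cons x l ih =>
    rw [List.nodup_cons] at hl
    simp only [List.mem_cons, not_or] at hu
    rw [WordRAM.insAfter]
    split_ifs with hx
    · subst hx
      refine ⟨by simp [link], ?_, h.2.congr fun y hy => ?_⟩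
      · rw [Function.update_of_ne hu.1, Function.update_self]
        exact h.1
      · rw [Function.update_of_ne, Function.update_of_ne]
        · rintro rfl; exact hu.2 hy
        · rintro rfl; exact hl.1 hy
    · have hv' : v ∈ l := by
        rcases List.mem_cons.1 hv with rfl | h'
        · exact absurd rfl hx
        · exact h'
      refine ⟨?_, ih h.2 hl.2 hv' hu.2⟩
      rw [link_insAfter hv', Function.update_of_ne hx, Function.update_of_ne (Ne.symm hu.1)]
      exact h.1

theorem ElimTo.drop {T : Finset ℕ} {L : List (ℕ × ℕ)} (h : ElimTo S L T) (k : ℕ) :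
    ∃ S' ⊆ S, ElimTo S' (L.drop k) T := by
  induction k generalizing S L with
  | zero => exact ⟨S, Subset.rfl, h⟩
  | succ k ih =>
    cases L with
    | nil => exact ⟨S, Subset.rfl, h⟩
    | cons p L =>
      obtain ⟨S', h1, h2⟩ := ih h.2.2.2
      exact ⟨S', h1.trans (erase_subset _ _), h2⟩

theorem ElimTo.length_ord {L : List (ℕ × ℕ)} (h : ElimTo S L {0}) : (ord L).length = #S := by
  obtain ⟨h1, h2⟩ := h.ord_spec
  rw [← List.toFinset_card_of_nodup h1]
  congr 1
  ext x
  rw [List.mem_toFinset, h2]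

/-- Build the linked list of the order. -/
def linkPhase : Prog :=
  forUp 25 7 (block [.asg 26 (.var 7 - 1 - .var 25), .asg 27 (.get 6 (.get 5 (.var 26))),
    .put 6 (.get 4 (.var 26)) (.var 27), .put 6 (.get 5 (.var 26)) (.get 4 (.var 26) + 1)])

/-- The pairs are processed from the last to the first, so that after `k` rounds the list is the
order of the last `k` eliminations. The uniform bound on the entries keeps the links in range. -/
theorem wp_linkPhase {a : ASt} {L : List (ℕ × ℕ)} (hL : PairsRep L a) (he : ElimTo (range n) L {0})
    (hV : n + 2 < M.V) (h6 : ∀ i, a.arr 6 i = 0) :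
    wp M linkPhase (fun b => Linked (b.arr 6) (ord L) ∧ b.low 25 = a.low 25 ∧ b.raw = a.raw ∧
      (∀ id, id ≠ 6 → b.arr id = a.arr id) ∧ b.time ≤ a.time + 150 * n + 20) a := by
  have hVp := M.Vpos
  have hlen := he.card
  rw [card_range, card_singleton] at hlen
  refine wp_for L.length (fun k b => Linked (b.arr 6) (ord (L.drop (L.length - k))) ∧
    (∀ i, b.arr 6 i ≤ n) ∧ b.low 25 = a.low 25 ∧ b.raw = a.raw ∧
    (∀ id, id ≠ 6 → b.arr id = a.arr id) ∧ b.time ≤ a.time + 150 * k + 15)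
    (by omega) (by omega) (by omega) hL.len (by omega) ?_ ?_ ?_
  -- Links are shifted by one with 0 for the end, so the empty array already represents the list
  -- `[0]`.
  · simp [ord, Linked, link, h6]
  · rintro k hk b ⟨b1, b0, b2, b3, b4, b5⟩ hb25 hb7
    obtain ⟨j, hj⟩ : ∃ j, L.length - 1 - k = j := ⟨_, rfl⟩
    have hjL : j < L.length := by omega
    have hdrop : L.drop j = L[j] :: L.drop (L.length - k) := by
      rw [List.drop_eq_getElem_cons hjL]
      congr 2
      omega
    obtain ⟨S', hS', he'⟩ := he.drop j
    rw [hdrop] at he'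
    have hj' : L.length - (k + 1) = j := by omega
    obtain ⟨g4, g5⟩ := hL.get j _ (List.getElem?_eq_getElem hjL)
    generalize L[j] = p at hdrop he' g4 g5
    obtain ⟨i1, i2, i3, i4⟩ := he'
    obtain ⟨o1, o2⟩ := i4.ord_spec
    have hp1 := mem_range.1 (hS' i1)
    have hp2 := mem_range.1 (hS' i2)
    rw [hj', hdrop, ord]
    have e4 : b.arr 4 j = p.1 := by rw [b4 4 (by omega)]; exact g4
    have e5 : b.arr 5 j = p.2 := by rw [b4 5 (by omega)]; exact g5
    have hb0 := b0 p.2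
    refine wp_block ?_ ?_
    · simp [hb25, hb7, hj, e4, e5]
      omega
    rw [show execB _ b = ((((b.set 26 j).set 27 (b.arr 6 p.2)).put 6 p.1 (b.arr 6 p.2)).put 6 p.2
      (p.1 + 1)) by simp [hb25, hb7, hj, e4, e5]]
    refine ⟨by simp [hb25], by simp [hb7], ?_, fun i => ?_, by simp [b2], by simp [b3],
      fun id hid => by simp [hid, b4 id hid], by simp; omega⟩
    · simpa using b1.insAfter o1 ((o2 _).2 (mem_erase.2 ⟨i3.symm, i2⟩)) fun h => by
        simpa using (o2 _).1 h
    · have := b0 i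
      simp [Function.update_apply]
      split_ifs <;> omega
  · rintro b ⟨b1, b0, b2, b3, b4, b5⟩ hb25 hb7
    exact ⟨by simpa using b1, by simpa using b2, by simpa using b3, by simpa using b4,
      by simp; omega⟩

/-- Number the vertices in the order of the linked list. -/
def numberPhase : Prog :=
  .seq (block [.asg 26 1]) (forUp 25 0 (block [.put 7 (.var 25 + 1) (.var 26 - 1),
    .asg 26 (.get 6 (.var 26 - 1))]))

/-- The traversal starts at the link value 1, which refers to vertex 0; `hhd` says that the list
begins there. Positions are counted from 1, leaving position 0 for the zero border. -/
theorem wp_numberPhase {a : ASt} {l : List ℕ} (h0 : a.v 0 = n) (hl : Linked (a.arr 6) l)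
    (hlen : l.length = n) (hlt : ∀ x ∈ l, x < n) (hhd : link l = 1) (hV : n + 2 < M.V) :
    wp M numberPhase (fun b => (∀ k, 1 ≤ k → k ≤ n → b.arr 7 k = l.getD (k - 1) 0) ∧
      b.low 25 = a.low 25 ∧ b.raw = a.raw ∧
      (∀ id, id ≠ 7 → b.arr id = a.arr id) ∧ b.time ≤ a.time + 100 * n + 40) a := by
  have hVp := M.Vpos
  refine wp_seq (wp_block (by simp) ?_)
  refine wp_for n (fun k b => b.v 26 = link (l.drop k) ∧
      (∀ i, 1 ≤ i → i ≤ k → b.arr 7 i = l.getD (i - 1) 0) ∧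
      b.low 25 = a.low 25 ∧ b.raw = a.raw ∧
      (∀ id, id ≠ 7 → b.arr id = a.arr id) ∧ b.time ≤ a.time + 100 * k + 35)
    (by omega) (by omega) (by omega) (by simp [h0]) (by omega) ?_ ?_ ?_
  · refine ⟨by simp [hhd], by intro i h1 h2; omega, by simp, by simp, by simp, by simp⟩
  · rintro k hk b ⟨b1, b2, b3, b4, b5, b6⟩ hb25 hb0
    have hk' : k < l.length := by omega
    have hd := hl.drop k
    rw [List.drop_eq_getElem_cons hk'] at hd b1
    have hx := hlt _ (List.getElem_mem hk')
    have hgd : l.getD k 0 = l[k] := by simp [hk']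
    generalize l[k] = x at hd b1 hx hgd
    simp only [link] at b1
    have h6 : b.arr 6 x = link (l.drop (k + 1)) := by rw [b5 6 (by omega)]; exact hd.1
    have hlink : link (l.drop (k + 1)) ≤ n := by
      rcases hd' : l.drop (k + 1) with _ | ⟨y, l'⟩
      · exact Nat.zero_le _
      · exact hlt y (List.mem_of_mem_drop (hd' ▸ List.mem_cons_self))
    refine wp_block ?_ ?_
    · simp [hb25, b1, h6]
      omega
    refine ⟨by simp [hb25], by simp [hb0], by simp [b1, h6], fun i h1 h2 => ?_, by simp [b3],
      by simp [b4], fun id hid => by simp [hid, b5 id hid], by simp; omega⟩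
    by_cases hi : i = k + 1
    · subst hi
      have : l.getD (k + 1 - 1) 0 = x := hgd
      rw [this]
      simp [hb25, b1]
    · simpa [hb25, hi] using b2 i h1 (by omega)
  · rintro b ⟨b1, b2, b3, b4, b5, b6⟩ hb25 hb0
    exact ⟨by simpa using b2, by simpa using b3, by simpa using b4, by simpa using b5,
      by simp; omega⟩

/-! ### The runs of the permuted matrix -/

/-- What the search for the runs reads. -/
structure MatrixEnv (B : ℕ → ℕ → ℕ) (n : ℕ) (M : Mach) (a : ASt) : Prop where
  n_eq : a.v 0 = n
  m_eq : a.v 1 = n + 2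
  succ_eq : a.v 8 = n + 1
  bits : IsBits B n
  bit : ∀ k j, 1 ≤ k → k ≤ n → 1 ≤ j → j ≤ n → a.raw (a.arr 7 k * n + a.arr 7 j) = B k j
  ord_lt : ∀ k, 1 ≤ k → k ≤ n → a.arr 7 k < n
  fitsB : M.B = 2 * (n * n)
  fitsV : 2 * ((n + 2) * (n + 2)) < M.V

theorem MatrixEnv.of_eq {a b : ASt} (h : MatrixEnv B n M a) (hv : b.low 20 = a.low 20)
    (hr : b.raw = a.raw) (h7 : b.arr 7 = a.arr 7) : MatrixEnv B n M b :=
  ⟨(ASt.v_eq hv 0 (by omega)).trans h.n_eq, (ASt.v_eq hv 1 (by omega)).trans h.m_eq,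
    (ASt.v_eq hv 8 (by omega)).trans h.succ_eq, h.bits, by rw [hr, h7]; exact h.bit,
    by rw [h7]; exact h.ord_lt, h.fitsB, h.fitsV⟩

/-- Read the entry in row `v25 + 1` and column `v26 + 1`. -/
def scanBit : Prog :=
  .seq (block [.asg 28 0]) (cond (.op .lt (.var 26) (.var 0))
    (block [.asg 28 (.raw (.get 7 (.var 25 + 1) * .var 0 + .get 7 (.var 26 + 1)))]) (block []))

theorem wp_scanBit {a : ASt} (h : MatrixEnv B n M a) {k p : ℕ} (h25 : a.v 25 = k) (h26 : a.v 26 = p)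
    (hk : k < n) (hp : p ≤ n) :
    wp M scanBit (fun b => ∃ t ≤ 100, b = (a.set 28 (B (k + 1) (p + 1))).tick t) a := by
  have hVp := M.Vpos
  have hV := h.fitsV
  have hB := h.fitsB
  have hnn : (n + 2) * (n + 2) = n * n + 4 * n + 4 := by ring
  refine wp_seq (wp_block (by simp) (wp_cond (by simp) (lt_of_le_of_lt (Op.lt_le _ _) (by omega))
    (fun hc => ?_) fun hc => ?_))
  · simp [h26, h.n_eq] at hc
    have h1 := h.ord_lt (k + 1) (by omega) (by omega)
    have h2 := h.ord_lt (p + 1) (by omega) (by omega)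
    have h3 := h.bit (k + 1) (p + 1) (by omega) (by omega) (by omega) (by omega)
    have h4 : a.arr 7 (k + 1) * n + n ≤ n * n := by
      have := Nat.mul_le_mul_right n (show a.arr 7 (k + 1) + 1 ≤ n by omega)
      rwa [add_mul, one_mul] at this
    have h5 := h.bits.le_one (k + 1) (p + 1)
    refine wp_block ?_ ?_
    · simp [h25, h26, h.n_eq, h3]
      omega
    refine ⟨?t, ?ht, ?eq⟩
    case eq => simp [h25, h26, h.n_eq, h3]; rfl
    case ht => norm_num
  · simp [h26, h.n_eq] at hc
    have : B (k + 1) (p + 1) = 0 := by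
      by_contra hne
      have := h.bits.col _ _ hne
      omega
    refine wp_block trivial ⟨?t', ?ht', ?eq'⟩
    case eq' => simp [this]; rfl
    case ht' => norm_num

/-- The state of the search in row `k` before column `c`; `s` is the start of the current run,
or `0`. -/
structure Scan (B : ℕ → ℕ → ℕ) (n k c s : ℕ) (f : ℕ → ℕ) : Prop where
  idle : s = 0 → B k (c - 1) = 0
  run : s ≠ 0 → s < c ∧ B k (s - 1) = 0 ∧ ∀ x, s ≤ x → x < c → B k x = 1
  done : ∀ p, 1 ≤ p → p ≤ n → p < c → p ≠ s → f p = runEnd B k p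
  todo : ∀ p, 1 ≤ p → p ≤ n → (c ≤ p ∨ p = s) → f p = 0

theorem runEnd_eq_zero {k p : ℕ} (h : B k p = 0 ∨ B k (p - 1) = 1) : runEnd B k p = 0 := by
  by_contra hne
  have hr := run_runEnd hne
  have h1 := hr.ones p le_rfl hr.lt
  have h2 := hr.left
  omega

/-- A one continues the open run or opens a new one at `c`. Positions inside a run are not starts of
runs, so their entry 0 agrees with `runEnd`. -/
theorem Scan.one {k c s : ℕ} {f : ℕ → ℕ} (h : Scan B n k c s f) (hc : 1 ≤ c) (hb : B k c = 1) :
    Scan B n k (c + 1) (if s = 0 then c else s) f := by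
  by_cases hs : s = 0
  · rw [if_pos hs]
    refine ⟨by omega, fun _ => ⟨by omega, h.idle hs, fun x h1 h2 => ?_⟩, fun p h1 h2 h3 h4 => ?_,
      fun p h1 h2 h3 => ?_⟩
    · rw [show x = c by omega, hb]
    · exact h.done p h1 h2 (by omega) (by omega)
    · exact h.todo p h1 h2 (by omega)
  · rw [if_neg hs]
    obtain ⟨r1, r2, r3⟩ := h.run hs
    refine ⟨by omega, fun _ => ⟨by omega, r2, fun x h1 h2 => ?_⟩, fun p h1 h2 h3 h4 => ?_,
      fun p h1 h2 h3 => ?_⟩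
    · rcases Nat.lt_succ_iff_lt_or_eq.1 h2 with h2 | rfl
      · exact r3 x h1 h2
      · exact hb
    · rcases Nat.lt_succ_iff_lt_or_eq.1 h3 with h3 | rfl
      · exact h.done p h1 h2 h3 h4
      · rw [h.todo p h1 h2 (by omega), runEnd_eq_zero (Or.inr (r3 (p - 1) (by omega) (by omega)))]
    · exact h.todo p h1 h2 (by omega)

/-- A zero closes the open run, whose end is now known and gets recorded at its start. -/
theorem Scan.zero {k c s : ℕ} {f g : ℕ → ℕ} (h : Scan B n k c s f) (hc : 1 ≤ c) (hb : B k c = 0)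
    (hg : s ≠ 0 → g s = c) (hgf : ∀ p, p ≠ 0 → p ≠ s → g p = f p) : Scan B n k (c + 1) 0 g := by
  refine ⟨fun _ => by simpa using hb, by simp, fun p h1 h2 h3 _ => ?_, fun p h1 h2 h3 => ?_⟩
  · by_cases hps : p = s
    · subst hps
      obtain ⟨r1, r2, r3⟩ := h.run (by omega)
      rw [hg (by omega), (Run.runEnd_eq ⟨h1, r1, r2, r3, hb⟩)]
    · rw [hgf p (by omega) hps]
      rcases Nat.lt_succ_iff_lt_or_eq.1 h3 with h3 | rfl
      · exact h.done p h1 h2 h3 hps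
      · rw [h.todo p h1 h2 (by omega), runEnd_eq_zero (Or.inl hb)]
  · by_cases hps : p = s
    · subst hps
      have := (h.run (by omega)).1
      omega
    · rw [hgf p (by omega) hps]
      exact h.todo p h1 h2 (by omega)

/-- Process one entry of the matrix. -/
def scanStep : Prog :=
  .seq scanBit (cond (.var 28) (cond (.var 27) (block []) (block [.asg 27 (.var 26 + 1)]))
    (cond (.var 27) (block [.put 10 ((.var 25 + 1) * .var 1 + .var 27) (.var 26 + 1), .asg 27 0])
      (block [])))

theorem idx_inj {m k p k' p' : ℕ} (h : k * m + p = k' * m + p') (hp : p < m) (hp' : p' < m) :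
    k = k' ∧ p = p' := by
  have hm : 0 < m := by omega
  have h1 := congrArg (· / m) h
  have hdiv : ∀ k p, p < m → (k * m + p) / m = k := fun k p hp => by
    rw [add_comm, Nat.add_mul_div_right _ _ hm, Nat.div_eq_of_lt hp, zero_add]
  simp only [hdiv k p hp, hdiv k' p' hp'] at h1
  subst h1
  exact ⟨rfl, by omega⟩

/-- What the search for the runs in row `k` does not change. -/
structure RowFrame (n k : ℕ) (a b : ASt) : Prop where
  low : b.low 26 = a.low 26
  raw : b.raw = a.raw
  arr : ∀ id, id ≠ 10 → b.arr id = a.arr id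
  rows : ∀ k' p, k' ≠ k → p < n + 2 → b.arr 10 (k' * (n + 2) + p) = a.arr 10 (k' * (n + 2) + p)

theorem wp_scanStep {a : ASt} (h : MatrixEnv B n M a) {k p : ℕ} (h25 : a.v 25 = k) (h26 : a.v 26 = p)
    (hk : k < n) (hp : p ≤ n)
    (hs : Scan B n (k + 1) (p + 1) (a.v 27) fun p => a.arr 10 ((k + 1) * (n + 2) + p)) :
    wp M scanStep (fun b =>
      Scan B n (k + 1) (p + 1 + 1) (b.v 27) (fun p => b.arr 10 ((k + 1) * (n + 2) + p)) ∧
      RowFrame n (k + 1) a b ∧ b.v 26 = p ∧ b.time ≤ a.time + 200) a := by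
  have hVp := M.Vpos
  have hV := h.fitsV
  have hidx : (k + 1) * (n + 2) + (n + 2) ≤ (n + 2) * (n + 2) := by
    have := Nat.mul_le_mul_right (n + 2) (show k + 1 + 1 ≤ n + 2 by omega)
    rwa [add_mul (k + 1), one_mul] at this
  have hnn : (n + 2) * (n + 2) = n * n + 4 * n + 4 := by ring
  have hbit := h.bits.le_one (k + 1) (p + 1)
  have hsle : a.v 27 ≤ n + 1 := by
    by_cases h0 : a.v 27 = 0
    · omega
    · have := (hs.run h0).1
      omega
  refine wp_seq ((wp_scanBit h h25 h26 hk hp).mono ?_)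
  rintro b ⟨t, ht, rfl⟩
  refine wp_cond (by simp) (by simp; omega) (fun hc => ?_) fun hc => ?_
  · simp at hc
    have hone := hs.one (by omega) (show B (k + 1) (p + 1) = 1 by omega)
    refine wp_cond (by simp) (by simp; omega) (fun hc' => ?_) fun hc' => ?_
    · simp at hc'
      rw [if_neg hc'] at hone
      exact wp_block trivial ⟨by simpa using hone, ⟨by simp, by simp, by simp, by simp⟩, by simp [h26],
        by simp; omega⟩
    · simp at hc'
      rw [if_pos hc'] at hone
      exact wp_block (by simp [h26]; omega) ⟨by simpa [h26] using hone,
        ⟨by simp, by simp, by simp, by simp⟩, by simp [h26], by simp; omega⟩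
  · simp at hc
    refine wp_cond (by simp) (by simp; omega) (fun hc' => ?_) fun hc' => ?_
    · simp at hc'
      refine wp_block (by simp [h25, h26, h.m_eq]; omega) ⟨?_,
        ⟨by simp, by simp, fun id hid => by simp [hid], fun k' p' h1 h2 => ?_⟩, by simp [h26],
        by simp; omega⟩
      · simp [h25, h26, h.m_eq]
        refine hs.zero (by omega) hc (fun _ => by simp) fun p' h1 h2 => ?_
        simp [h2]
      · simp [h25, h.m_eq]
        rw [Function.update_of_ne]
        intro e
        exact h1 (idx_inj e h2 (by omega)).1
    · simp at hc'
      refine wp_block trivial ⟨?_, ⟨by simp, by simp, by simp, by simp⟩, by simp [h26],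
        by simp; omega⟩
      have := hs.zero (g := fun p => a.arr 10 ((k + 1) * (n + 2) + p)) (by omega) hc
        (fun h => absurd hc' h) fun _ _ _ => rfl
      simpa [hc'] using this

/-- Find the runs in row `v25 + 1`. -/
def rowScan : Prog := .seq (block [.asg 27 0]) (forUp 26 8 scanStep)

theorem RowFrame.env {k : ℕ} {a b : ASt} (hf : RowFrame n k a b) (h : MatrixEnv B n M a) :
    MatrixEnv B n M b := h.of_eq (ASt.low_mono hf.low (by omega)) hf.raw (hf.arr 7 (by omega))

theorem wp_rowScan {a : ASt} (h : MatrixEnv B n M a) {k : ℕ} (h25 : a.v 25 = k) (hk : k < n)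
    (h10 : ∀ p ≤ n, a.arr 10 ((k + 1) * (n + 2) + p) = 0) :
    wp M rowScan (fun b => (∀ p, 1 ≤ p → p ≤ n →
        b.arr 10 ((k + 1) * (n + 2) + p) = runEnd B (k + 1) p) ∧
      RowFrame n (k + 1) a b ∧ b.time ≤ a.time + 220 * n + 300) a := by
  have hVp := M.Vpos
  have hV := h.fitsV
  have hnn : (n + 2) * (n + 2) = n * n + 4 * n + 4 := by ring
  have hB0 : ∀ k, B k 0 = 0 := fun k => by
    by_contra hne
    have := h.bits.col _ _ hne
    omega
  refine wp_seq (wp_block (by simp) ?_)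
  refine wp_for (n + 1) (fun p b =>
      Scan B n (k + 1) (p + 1) (b.v 27) (fun p => b.arr 10 ((k + 1) * (n + 2) + p)) ∧
      RowFrame n (k + 1) a b ∧ b.time ≤ a.time + 220 * p + 30)
    (by omega) (by omega) (by omega) (by simp [h.succ_eq]) (by omega) ?_ ?_ ?_
  · refine ⟨⟨fun _ => by simpa using hB0 _, by simp, by intro p h1 h2 h3; omega, fun p h1 h2 _ => ?_⟩,
      ⟨by simp, by simp, by simp, by simp⟩, by simp⟩
    simpa using h10 p h2
  · rintro p hp b ⟨b1, b2, b3⟩ hb26 hb8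
    have hb25 := (ASt.v_eq b2.low 25 (by omega)).trans h25
    refine (wp_scanStep (b2.env h) hb25 hb26 hk (by omega) b1).mono ?_
    rintro c ⟨c1, c2, c3, c4⟩
    refine ⟨c3, (ASt.v_eq c2.low 8 (by omega)).trans hb8, by simpa using c1, ⟨?_, ?_, fun id hid => ?_,
      fun k' p' h1 h2 => ?_⟩, by simp; omega⟩
    · simp [c2.low, b2.low]
    · simp [c2.raw, b2.raw]
    · simp [c2.arr id hid, b2.arr id hid]
    · simp [c2.rows k' p' h1 h2, b2.rows k' p' h1 h2]
  · rintro b ⟨b1, b2, b3⟩ hb26 hb8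
    refine ⟨fun p h1 h2 => ?_, ⟨by simpa using b2.low, by simpa using b2.raw, by simpa using b2.arr,
      by simpa using b2.rows⟩, by simp; omega⟩
    -- The scan includes column `n + 1` of the border, whose zero closes any run that is still open.
    have h27 : b.v 27 = 0 := by
      by_contra hne
      have h3 := b1.run hne
      have h4 := h3.2.2 (n + 1) (by omega) (by omega)
      have := h.bits.col (k + 1) (n + 1) (by omega)
      omega
    have := b1.done p h1 h2 (by omega) (by omega)
    simpa using this

/-- Find all runs. -/
def runsPhase : Prog := .seq (block [.asg 8 (.var 0 + 1)]) (forUp 25 0 rowScan)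

theorem wp_runsPhase {a : ASt} (h : MatrixEnv B n M (a.set 8 (n + 1)))
    (h10 : ∀ i, a.arr 10 i = 0) :
    wp M runsPhase (fun b => HasRuns B n b ∧ b.low 8 = a.low 8 ∧ b.raw = a.raw ∧
      (∀ id, id ≠ 10 → b.arr id = a.arr id) ∧ b.time ≤ a.time + n * (220 * n + 350) + 50) a := by
  have hVp := M.Vpos
  have hV := h.fitsV
  have h0 : a.v 0 = n := by simpa using h.n_eq
  have hnn : (n + 2) * (n + 2) = n * n + 4 * n + 4 := by ring
  -- Rows outside `{1, …, n}` are not scanned; their initial entries 0 are already correct.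
  have hrow : ∀ k p, ¬ (1 ≤ k ∧ k ≤ n) → runEnd B k p = 0 := fun k p hk =>
    runEnd_eq_zero (Or.inl (by
      by_contra hne
      exact hk (h.bits.row _ _ hne)))
  refine wp_seq (wp_block (by simp [h0]; omega) ?_)
  rw [show execB _ a = a.set 8 (n + 1) by simp [h0]]
  generalize hc : a.set 8 (n + 1) = c at h ⊢
  have cl : c.low 8 = a.low 8 := by rw [← hc]; simp
  have craw : c.raw = a.raw := by rw [← hc]; simp
  have carr : c.arr = a.arr := by rw [← hc]; simp
  have ct : c.time = a.time := by rw [← hc]; simp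
  clear hc
  refine wp_for n (fun k b =>
      (∀ k' p, k' ≤ k → 1 ≤ p → p ≤ n → b.arr 10 (k' * (n + 2) + p) = runEnd B k' p) ∧
      (∀ k' p, k < k' → p ≤ n → b.arr 10 (k' * (n + 2) + p) = 0) ∧
      b.low 25 = c.low 25 ∧ b.raw = a.raw ∧
      (∀ id, id ≠ 10 → b.arr id = a.arr id) ∧ b.time ≤ a.time + k * (220 * n + 350) + 40)
    (by omega) (by omega) (by omega) (by simpa using h.n_eq) (by omega) ?_ ?_ ?_
  · refine ⟨fun k' p h1 h2 h3 => ?_, by simp [carr, h10], by simp, by simp [craw], by simp [carr],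
      by simp; omega⟩
    simp [carr, h10, hrow k' p (by omega)]
  · rintro k hk b ⟨b1, b2, b3, b4, b5, b6⟩ hb25 hb0
    have hb : MatrixEnv B n M b := h.of_eq (ASt.low_mono b3 (by omega)) (by rw [b4, craw])
      (by rw [b5 7 (by omega), carr])
    refine (wp_rowScan hb hb25 hk fun p hp => b2 _ _ (by omega) hp).mono ?_
    rintro d ⟨d1, d2, d3⟩
    refine ⟨(ASt.v_eq d2.low 25 (by omega)).trans hb25, (ASt.v_eq d2.low 0 (by omega)).trans hb0,
      fun k' p h1 h2 h3 => ?_, fun k' p h1 h2 => ?_, ?_, ?_, fun id hid => ?_, ?_⟩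
    · by_cases hkk : k' = k + 1
      · subst hkk
        simpa using d1 p h2 h3
      · simpa [d2.rows k' p hkk (by omega)] using b1 k' p (by omega) h2 h3
    · simpa [d2.rows k' p (by omega) (by omega)] using b2 k' p (by omega) h2
    · simp [ASt.low_mono d2.low (show 25 ≤ 26 by omega), b3]
    · simp [d2.raw, b4]
    · simp [d2.arr id hid, b5 id hid]
    · have : (k + 1) * (220 * n + 350) = k * (220 * n + 350) + 220 * n + 350 := by ring
      rw [this]
      simp
      linarith
  · rintro b ⟨b1, b2, b3, b4, b5, b6⟩ hb25 hb0
    refine ⟨fun k p h1 h2 h3 => ?_, ?_, by simpa using b4, by simpa using b5, by simp; omega⟩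
    · rcases Nat.lt_or_ge n k with hk | hk
      · simp [b2 k p hk h3, hrow k p (by omega)]
      · simpa using b1 k p hk h2 h3
    · simpa [cl] using ASt.low_mono b3 (show 8 ≤ 25 by omega)

end WordRAM

/-! ### Assembly of the algorithm -/

namespace WordRAM

open Finset

variable {n : ℕ} {M : Mach}

/-! ### From the random numbers to the output -/

open Classical in
/-- The adjacency matrix. -/
noncomputable def adjBit (G : SimpleGraph (Fin n)) (u v : ℕ) : ℕ :=
  if ∃ (hu : u < n) (hv : v < n), G.Adj ⟨u, hu⟩ ⟨v, hv⟩ then 1 else 0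

variable {G : SimpleGraph (Fin n)}

theorem adjBit_le_one (u v : ℕ) : adjBit G u v ≤ 1 := by
  unfold adjBit; split_ifs <;> omega

theorem adjBit_eq_one {u v : ℕ} :
    adjBit G u v = 1 ↔ ∃ (hu : u < n) (hv : v < n), G.Adj ⟨u, hu⟩ ⟨v, hv⟩ := by
  unfold adjBit; split_ifs with h <;> simp [h]

theorem adjBit_comm (u v : ℕ) : adjBit G u v = adjBit G v u := by
  have h : ∀ u v, adjBit G u v = 1 → adjBit G v u = 1 := by
    intro u v h
    obtain ⟨hu, hv, h⟩ := adjBit_eq_one.1 h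
    exact adjBit_eq_one.2 ⟨hv, hu, h.symm⟩
  have := adjBit_le_one (G := G) u v
  have := adjBit_le_one (G := G) v u
  have := h u v
  have := h v u
  omega

theorem adjBit_self (u : ℕ) : adjBit G u u = 0 := by
  unfold adjBit
  rw [if_neg]
  rintro ⟨hu, hv, h⟩
  exact G.loopless.irrefl _ h

theorem permBits_eq {bt : ℕ → ℕ → ℕ} {l : List ℕ} {k j : ℕ} (hk : 1 ≤ k) (hk' : k ≤ l.length)
    (hj : 1 ≤ j) (hj' : j ≤ l.length) :
    permBits bt l k j = bt (l.getD (k - 1) 0) (l.getD (j - 1) 0) := by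
  have key : ∀ k, 1 ≤ k → k ≤ l.length → (pad l).getD k none = some (l.getD (k - 1) 0) := by
    intro k h1 h2
    have h3 : k - 1 < l.length := by omega
    rw [pad_getD, if_neg (by omega)]
    simp [h3]
  rw [permBits, key k hk hk', key j hj hj']
  rfl

open Classical in
theorem sum_stopsIn (B : ℕ → ℕ → ℕ) (n : ℕ) : ∑ k ∈ range n, stopsIn B k n =
    #{x ∈ Icc 1 n ×ˢ Icc 1 n | Stops B x.1 x.2} := by
  have h : ∀ f : ℕ → ℕ, ∑ k ∈ range n, f (k + 1) = ∑ k ∈ Icc 1 n, f k := fun f => by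
    rw [range_eq_Ico, sum_Ico_add' f 0 n 1]
    rfl
  rw [card_filter, sum_product, ← h]
  refine sum_congr rfl fun k _ => ?_
  rw [stopsIn, ← h]

/-- The deterministic part of the algorithm. -/
def solve : Prog :=
  .seq trials (.seq linkPhase (.seq numberPhase (.seq runsPhase
    (.seq tablePhase (.seq emitPhase bfsPhase)))))

/-- The cells contain all distances and shortest-path trees. -/
def Solved (G : SimpleGraph (Fin n)) (raw : ℕ → ℕ) : Prop :=
  ∀ i j : Fin n, (G.Reachable i j → raw ((i : ℕ) * n + j) = G.dist i j) ∧
    (¬ G.Reachable i j → raw ((i : ℕ) * n + j) = n) ∧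
    (G.Reachable i j → i ≠ j → ∃ p : Fin n, raw (n * n + (i * n + j)) = p ∧
      G.Adj p j ∧ G.dist i p + 1 = G.dist i j)

theorem head_ord {S : Finset ℕ} {L : List (ℕ × ℕ)} (h : ElimTo S L {0}) : link (ord L) = 1 := by
  induction L generalizing S with
  | nil => rfl
  | cons p L ih =>
    obtain ⟨h1, h2, h3, h4⟩ := h
    rw [ord, link_insAfter, ih h4]
    exact (h4.ord_spec.2 _).2 (mem_erase.2 ⟨h3.symm, h2⟩)

/-- What the deterministic part assumes about the state. -/
structure Ready (G : SimpleGraph (Fin n)) (q R : ℕ) (ρ : ℕ → ℕ) (a : ASt) : Prop where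
  n_eq : a.v 0 = n
  m_eq : a.v 1 = n + 2
  q_eq : a.v 3 = q
  R_eq : a.v 4 = R
  count : a.v 6 = 0
  raw : ∀ u < n, ∀ x < n, a.raw (u * n + x) = adjBit G u x
  rand : ∀ j < R * q, a.arr 0 j = ρ j % n
  arr : ∀ id, id ≠ 0 → ∀ i, a.arr id i = 0

/-- The correctness part holds for every `ρ`. The random numbers influence only the time, through
the number `S` of rectangles. -/
theorem wp_solve {a : ASt} {q R : ℕ} {ρ : ℕ → ℕ} (h : Ready G q R ρ a) (hn : 1 ≤ n)
    (hB : M.B = 2 * (n * n)) (hV : 8 * ((n + 2) * (n + 2)) < M.V) (hV' : R * q + q + R + 2 < M.V) :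
    wp M solve (fun b => Solved G b.raw ∧ ∃ S ≤ 8 * elimCost (adjBit G) (range n)
        (allElims (adjBit G) n q R ρ),
      b.time ≤ a.time + 450 * (R * q * n) + 340 * ((R + 1) * n) + 3100 * (S * n) +
        6000 * (n * n * (Nat.log 2 n + 1))) a := by
  have hVp := M.Vpos
  have hnn : (n + 2) * (n + 2) = n * n + 4 * n + 4 := by ring
  have hnn' : (n + 1) * (n + 2) = n * n + 3 * n + 2 := by ring
  have hnle : n ≤ n * n := Nat.le_mul_self n
  set bt := adjBit G with hbt
  set L := allElims bt n q R ρ with hLdef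
  have hI : Input bt n M a := ⟨h.n_eq, h.raw, adjBit_le_one, hB, by omega⟩
  have hel : ElimTo (range n) L {0} := elimTo_allElims hn R ρ
  set l := ord L with hl
  have hlen : l.length = n := by rw [hel.length_ord, card_range]
  obtain ⟨hnodup, hmem⟩ : l.Nodup ∧ ∀ x, x ∈ l ↔ x ∈ range n := hel.ord_spec
  set B := permBits bt l with hBdef
  have hbits : IsBits B n := by
    have := isBits_permBits (bt := bt) adjBit_le_one l
    rwa [hlen] at this
  set oF : ℕ → ℕ := fun k => l.getD (k - 1) 0 with hoF
  have hmemF : ∀ k, 1 ≤ k → k ≤ n → oF k ∈ l := by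
    intro k h1 h2
    have h3 : k - 1 < l.length := by omega
    simp only [hoF, List.getD_eq_getElem l 0 h3]
    exact List.getElem_mem h3
  have hordlt : ∀ k, 1 ≤ k → k ≤ n → oF k < n := fun k h1 h2 =>
    mem_range.1 ((hmem _).1 (hmemF k h1 h2))
  have hinj : ∀ k j, 1 ≤ k → k ≤ n → 1 ≤ j → j ≤ n → oF k = oF j → k = j := by
    intro k j h1 h2 h3 h4 he
    have h5 : k - 1 < l.length := by omega
    have h6 : j - 1 < l.length := by omega
    simp only [hoF, List.getD_eq_getElem l 0 h5, List.getD_eq_getElem l 0 h6] at he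
    have := (List.Nodup.getElem_inj_iff hnodup).1 he
    omega
  have hsurj : ∀ x < n, ∃ k, 1 ≤ k ∧ k ≤ n ∧ oF k = x := by
    intro x hx
    obtain ⟨k, hk, rfl⟩ := List.getElem_of_mem ((hmem x).2 (mem_range.2 hx))
    exact ⟨k + 1, by omega, by omega, by simp [hoF, hk]⟩
  have hBeq : ∀ k j, 1 ≤ k → k ≤ n → 1 ≤ j → j ≤ n → B k j = bt (oF k) (oF j) := fun k j h1 h2 h3 h4 =>
    permBits_eq h1 (by omega) h3 (by omega)
  obtain ⟨S, hS⟩ : ∃ S, ∑ k ∈ range n, stopsIn B k n = S := ⟨_, rfl⟩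
  have hS8 : S ≤ 8 * elimCost bt (range n) L := by
    rw [← hS, sum_stopsIn]
    have h1 := card_stops_le_corners (bt := bt) adjBit_le_one l
    have h2 := corners_ord_le (bt := bt) adjBit_comm (adjBit_self 0) hel
    rw [hlen] at h1
    exact h1.trans h2
  -- A bound that does not depend on luck: even in the worst run the number of edges must fit into a
  -- word.
  have hSn : S ≤ n * n := by
    rw [← hS, sum_stopsIn]
    classical
    refine (card_filter_le _ _).trans ?_
    simp [card_product]
  have hlog : Nat.log 2 n ≤ n := (Nat.log_lt_self 2 (by omega)).le
  have hlogn : 4 * n * Nat.log 2 n ≤ 4 * (n * n) := by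
    rw [mul_assoc]
    gcongr
  have hlogn' : 4 * n * (Nat.log 2 n + 1) = 4 * n * Nat.log 2 n + 4 * n := by ring
  refine wp_seq ((wp_trials hI hn (h.arr 1 (by omega)) h.q_eq h.R_eq hV' h.rand).mono ?_)
  rintro b ⟨b1, b2, b3⟩
  refine wp_seq ((wp_linkPhase b1 hel (by omega) (fun i => by
    rw [b2.arr 6 (by simp)]; exact h.arr 6 (by omega) i)).mono ?_)
  rintro c ⟨c1, c2, c3, c4, c5⟩
  have hv : ∀ z < 7, c.v z = a.v z := fun z hz => (ASt.v_eq c2 z (by omega)).trans (b2.low z hz)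
  refine wp_seq ((wp_numberPhase ((hv 0 (by omega)).trans h.n_eq) c1 hlen (fun x hx =>
    mem_range.1 ((hmem x).1 hx)) (head_ord hel) (by omega)).mono ?_)
  rintro d ⟨d1, d2, d3, d4, d5⟩
  have hvd : ∀ z < 7, d.v z = a.v z := fun z hz => (ASt.v_eq d2 z (by omega)).trans (hv z hz)
  have hraw : d.raw = a.raw := by rw [d3, c3, b2.raw]
  have harr : ∀ id, 8 ≤ id → ∀ i, d.arr id i = 0 := by
    intro id hid i
    rw [d4 id (by omega), c4 id (by omega), b2.arr id (by simp; omega)]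
    exact h.arr id (by omega) i
  refine wp_seq ((wp_runsPhase (B := B) ⟨by simp [hvd 0, h.n_eq], by simp [hvd 1, h.m_eq], by simp,
    hbits, fun k j h1 h2 h3 h4 => ?_, fun k h1 h2 => ?_, hB, by omega⟩ (harr 10 (by omega))).mono ?_)
  · simp only [ASt.set_raw, ASt.set_arr, hraw, d1 k h1 h2, d1 j h3 h4]
    rw [hBeq k j h1 h2 h3 h4]
    exact h.raw _ (hordlt k h1 h2) _ (hordlt j h3 h4)
  · simp only [ASt.set_arr, d1 k h1 h2]
    exact hordlt k h1 h2
  rintro e ⟨e1, e2, e3, e4, e5⟩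
  have hve : ∀ z < 7, e.v z = a.v z := fun z hz => (ASt.v_eq e2 z (by omega)).trans (hvd z hz)
  refine wp_seq ((wp_tablePhase (B := B) ((hve 0 (by omega)).trans h.n_eq)
    ((hve 1 (by omega)).trans h.m_eq) hn (by omega) ⟨(hve 6 (by omega)).trans h.count, fun x => ?_⟩
    (by omega)).mono ?_)
  · rw [e4 11 (by omega)]
    exact harr 11 (by omega) x
  rintro f ⟨E, f1, f2, f3, f4, f5, f6⟩
  refine wp_seq ((wp_emitPhase (B := B) (S := S) hbits (fun k p h1 h2 h3 => ?_)
    ((f2.v 0 (by omega) (by omega)).trans ((hve 0 (by omega)).trans h.n_eq))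
    ((f2.v 1 (by omega) (by omega)).trans ((hve 1 (by omega)).trans h.m_eq)) hS (by omega) f1
    (by omega) f3).mono ?_)
  · rw [f2.arr 10 (by omega) (by omega) (by omega)]
    exact e1 k p h1 h2 h3
  rintro g ⟨E', g1, g2, g3, g4⟩
  have hg : ∀ z < 6, g.v z = a.v z := fun z hz =>
    (g1.v z (by omega) (by omega)).trans ((f2.v z (by omega) (by omega)).trans (hve z (by omega)))
  have hga : ∀ id, id ≠ 10 → id ≠ 11 → id ≠ 12 → id ≠ 13 → g.arr id = d.arr id := by
    intro id h0 h1 h2 h3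
    rw [g1.arr id h1 h2 h3, f2.arr id h1 h2 h3, e4 id h0]
  have htab : ∀ h, HasTable n (n + 2) E' h := fun h i h1 h2 => by
    obtain ⟨k1, k2, k3, k4⟩ := f4 h i h1 h2
    exact ⟨g1.sub k1, g1.sub k2, g1.sub k3, g1.sub k4⟩
  have hpar : Params B n E' oF M := ⟨hn, hbits, g1.sound, fun k j hkj =>
    Reach.complete hbits htab (fun k p hs => g2 k p hs) hkj, hordlt, hinj, by omega, by omega, hB⟩
  refine (wp_bfsPhase hpar ⟨(hg 0 (by omega)).trans h.n_eq, (hg 1 (by omega)).trans h.m_eq, g1.rep,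
    fun k h1 h2 => ?_⟩ (fun y => ?_) fun y => ?_).mono ?_
  · rw [hga 7 (by omega) (by omega) (by omega) (by omega)]
    exact d1 k h1 h2
  · rw [hga 14 (by omega) (by omega) (by omega) (by omega)]
    exact harr 14 (by omega) y
  · rw [hga 15 (by omega) (by omega) (by omega) (by omega)]
    exact harr 15 (by omega) y
  rintro r ⟨r1, r2⟩
  refine ⟨fun i j => ?_, S, hS8, ?_⟩
  · obtain ⟨k, k1, k2, k3⟩ := hsurj i i.2
    have := (r1 k k1 k2).spec (G := G) hordlt (fun k j => ?_) hsurj hinj ⟨k1, k2⟩ k3 j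
    · simpa using this
    · constructor
      · intro hkj
        have hk := hbits.row k j (by omega)
        have hj := hbits.col k j (by omega)
        rw [hBeq k j hk.1 hk.2 hj.1 hj.2] at hkj
        obtain ⟨_, _, hadj⟩ := adjBit_eq_one.1 hkj
        exact ⟨hk, hj, hadj⟩
      · rintro ⟨hk, hj, hadj⟩
        rw [hBeq k j hk.1 hk.2 hj.1 hj.2]
        exact adjBit_eq_one.2 ⟨_, _, hadj⟩
  · simp only [ASt.tick_time]
    have hE' : n * (1000 * n + 500 * E'.length + 300) ≤
        1000 * (n * n) + 2000 * (n * n * Nat.log 2 n) + 2000 * (S * n) + 300 * n := by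
      have h1 : E'.length ≤ 4 * n * Nat.log 2 n + 4 * S := by omega
      calc n * (1000 * n + 500 * E'.length + 300)
          ≤ n * (1000 * n + 500 * (4 * n * Nat.log 2 n + 4 * S) + 300) := by gcongr
        _ = _ := by ring
    have t1 : R * q * (300 * n + 150) ≤ 450 * (R * q * n) := by
      have : R * q ≤ R * q * n := Nat.le_mul_of_pos_right _ hn
      linarith
    have t2 : (R + 1) * (190 * n + 150) ≤ 340 * ((R + 1) * n) := by
      have : R + 1 ≤ (R + 1) * n := Nat.le_mul_of_pos_right _ hn
      linarith
    have t3 : (200 * n + 900) * S ≤ 1100 * (S * n) := by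
      have : S ≤ S * n := Nat.le_mul_of_pos_right _ hn
      linarith
    have t4 : 800 * n * (Nat.log 2 n + 1) ≤ 800 * (n * n * (Nat.log 2 n + 1)) := by
      rw [mul_assoc]
      gcongr
    have t5 : n * (220 * n + 350) = 220 * (n * n) + 350 * n := by ring
    have t6 : n * n * (Nat.log 2 n + 1) = n * n * Nat.log 2 n + n * n := by ring
    rw [t5] at e5
    rw [t6] at t4 ⊢
    clear hBeq hsurj hinj hordlt hmemF hlogn hlogn' hV hV' hnn hnn'
    linarith

end WordRAM

namespace WordRAM

open Finset

variable {n : ℕ} {M : Mach} {G : SimpleGraph (Fin n)}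

/-! ### Parameters -/

/-- `s` is the cube root of `n`, rounded up. -/
structure CubeRoot (n s : ℕ) : Prop where
  pos : 1 ≤ s
  le : n ≤ s * s * s
  lt : (s - 1) * (s - 1) * (s - 1) < n

theorem exists_cubeRoot (hn : 1 ≤ n) : ∃ s, CubeRoot n s := by
  have hex : ∃ s, n ≤ s * s * s := ⟨n, by
    calc n = n * 1 * 1 := by ring
      _ ≤ n * n * n := by gcongr⟩
  classical
  have hpos : 1 ≤ Nat.find hex := by
    by_contra h0
    have := Nat.find_spec hex
    rw [show Nat.find hex = 0 by omega] at this
    omega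
  exact ⟨Nat.find hex, hpos, Nat.find_spec hex, not_le.1 (Nat.find_min hex (by omega))⟩

theorem le_cube (s : ℕ) : s ≤ s * s * s := by
  rcases Nat.eq_zero_or_pos s with rfl | h
  · exact le_rfl
  · calc s = s * 1 * 1 := by ring
      _ ≤ s * s * s := by gcongr <;> omega

theorem CubeRoot.le_self {s : ℕ} (h : CubeRoot n s) : s ≤ n := by
  have := le_cube (s - 1)
  have := h.lt
  omega

/-- Compute the parameters. -/
def params (A D : ℕ) : Prog :=
  .seq (block [.asg 2 1]) (.seq
    (whileDo (.op .lt (.var 2 * .var 2 * .var 2) (.var 0)) (block [.asg 2 (.var 2 + 1)]))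
    (block [.asg 4 (.lit A * (.var 2 * .var 2)), .asg 3 (.var 0 / (.lit D * .var 2)),
      .asg 5 (.var 4 * .var 3), .asg 1 (.var 0 + 2), .asg 11 0]))

/-- A bound on all values. -/
def bound (A D n : ℕ) : ℕ := (100 + A + D) * ((n + 2) * (n + 2) * (n + 2))

/-- These are the quantities whose ranges the later proofs need; all are polynomials of degree at
most 3 in `n` with coefficients controlled by `A` and `D`. -/
theorem bound_ge {A D s q : ℕ} (hs : s ≤ n) (hq : q ≤ n) :
    s * s * s + 100 < bound A D n ∧ A * (s * s) * q + q + A * (s * s) + 2 < bound A D n ∧ D * s < bound A D n ∧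
      A * (s * s) < bound A D n ∧ A < bound A D n ∧ D < bound A D n ∧
      8 * ((n + 2) * (n + 2)) < bound A D n ∧ s * s < bound A D n := by
  have h3 : (n + 2) * (n + 2) * (n + 2) = n * n * n + 6 * (n * n) + 12 * n + 8 := by ring
  have hE : bound A D n = 100 * (n * n * n + 6 * (n * n) + 12 * n + 8) +
      A * (n * n * n + 6 * (n * n) + 12 * n + 8) + D * (n * n * n + 6 * (n * n) + 12 * n + 8) := by
    rw [bound, h3]; ring
  have e1 : A * (n * n * n + 6 * (n * n) + 12 * n + 8) =
      A * (n * n * n) + 6 * (A * (n * n)) + 12 * (A * n) + 8 * A := by ring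
  have e2 : D * (n * n * n + 6 * (n * n) + 12 * n + 8) =
      D * (n * n * n) + 6 * (D * (n * n)) + 12 * (D * n) + 8 * D := by ring
  have e3 : (n + 2) * (n + 2) = n * n + 4 * n + 4 := by ring
  have f1 : s * s * s ≤ n * n * n := by gcongr
  have f2 : A * (s * s) * q ≤ A * (n * n * n) := by
    calc A * (s * s) * q ≤ A * (n * n) * n := by gcongr
      _ = _ := by ring
  have f3 : A * (s * s) ≤ A * (n * n) := by gcongr
  have f4 : D * s ≤ D * n := by gcongr
  have f5 : s * s ≤ n * n := by gcongr
  rw [hE, e1, e2, e3]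
  clear e1 e2 e3 hE h3
  refine ⟨?_, ?_, ?_, ?_, ?_, ?_, ?_, ?_⟩ <;> linarith [Nat.zero_le (A * n), Nat.zero_le (D * n),
    Nat.zero_le (A * (n * n)), Nat.zero_le (D * (n * n)), Nat.zero_le (A * (n * n * n)),
    Nat.zero_le (D * (n * n * n)), Nat.zero_le (n * n), Nat.zero_le (n * n * n), Nat.zero_le A,
    Nat.zero_le D]

/-- What the computation of the parameters achieves. -/
structure ParamsRel (A D n s : ℕ) (a b : ASt) : Prop where
  v0 : b.v 0 = n
  v1 : b.v 1 = n + 2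
  v3 : b.v 3 = n / (D * s)
  v4 : b.v 4 = A * (s * s)
  v5 : b.v 5 = A * (s * s) * (n / (D * s))
  v6 : b.v 6 = a.v 6
  v11 : b.v 11 = 0
  raw : b.raw = a.raw
  arr : b.arr = a.arr
  time : b.time ≤ a.time + 100 * s + 200

theorem wp_params {A D s : ℕ} {a : ASt} (h0 : a.v 0 = n) (hs : CubeRoot n s)
    (hV : bound A D n ≤ M.V) : wp M (params A D) (ParamsRel A D n s a) a := by
  have hVp := M.Vpos
  have hsn := hs.le_self
  obtain ⟨V1, V2, V3, V4, V5, V6, V7, V8⟩ :=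
    bound_ge (A := A) (D := D) (n := n) hsn (Nat.div_le_self n (D * s))
  have hq := Nat.div_le_self n (D * s)
  have hss := le_cube s
  refine wp_seq (wp_block (by simp) (wp_seq ?_))
  refine wp_while (fun k b => ∃ x, k = s - x ∧ 1 ≤ x ∧ x ≤ s ∧ b.v 2 = x ∧ b.v 0 = n ∧
    b.v 6 = a.v 6 ∧ b.raw = a.raw ∧ b.arr = a.arr ∧ b.time ≤ a.time + 50 * x + 20) (s - 1)
    ?_ ?_ ?_ ?_
  · exact ⟨1, rfl, le_rfl, hs.pos, by simp, by simp [h0], by simp, by simp, by simp, by simp⟩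
  · rintro k b ⟨x, -, h1, h2, h3, h4, -⟩
    have hx := bound_ge (A := A) (D := D) (n := n) (h2.trans hsn) hq
    refine ⟨?_, lt_of_le_of_lt (Op.lt_le _ _) (by omega)⟩
    simp [h3]
    omega
  · rintro k b ⟨x, hk, h1, h2, h3, h4, h5, h6, h7, h8⟩ hc
    simp [h3, h4] at hc
    have hxs : x < s := by
      by_contra hh
      obtain rfl : x = s := by omega
      have := hs.le
      omega
    refine wp_block (by simp [h3]; omega) ⟨s - (x + 1), by omega, x + 1, rfl, by omega, hxs,
      by simp [h3], by simp [h4], by simp [h5], by simp [h6], by simp [h7], by simp; omega⟩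
  · rintro k b ⟨x, hk, h1, h2, h3, h4, h5, h6, h7, h8⟩ hc
    simp [h3, h4] at hc
    -- A smaller `x` would satisfy `x ^ 3 ≤ (s - 1) ^ 3 < n`, and the loop would continue.
    obtain rfl : x = s := by
      by_contra hne
      have h9 : x * x * x ≤ (s - 1) * (s - 1) * (s - 1) := by
        have : x ≤ s - 1 := by omega
        gcongr
      have := hs.lt
      omega
    refine wp_block ?_ ⟨by simp [h4], by simp [h4], by simp [h3, h4], by simp [h3],
      by simp [h3, h4], by simp [h5], by simp, by simp [h6], by simp [h7], by simp; omega⟩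
    simp [h3, h4]
    generalize n / (D * x) = q at *
    omega

/-- The algorithm for graphs with at least one vertex. -/
def main (A D : ℕ) : Prog :=
  .seq (params A D) (.seq (evalTo fillCond) (.seq fillLoop solve))

/-- The algorithm. -/
def apsp (A D : ℕ) : Prog :=
  .seq (.op .mul 41 0 0) (.seq (.op .add 40 41 41) (cond (.var 0) (main A D) (block [])))

/-- The abstract initial state. -/
noncomputable def initial (G : SimpleGraph (Fin n)) : ASt where
  v := fun x => if x = 0 then n else 0
  raw := (apspInput G).mem
  arr := fun _ _ => 0
  time := 0

/-- The first two instructions compute the base `2 * n ^ 2` of the arrays into register `40`. The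
matrix occupies only cells below `n ^ 2`, so all arrays are zero initially. -/
theorem start_spec (hB : M.B = 2 * (n * n)) (p : Prog) : ∃ s, Sim M (initial G) s ∧
    DSteps M.w 4 ⟨[.seq (.op .mul 41 0 0) (.seq (.op .add 40 41 41) p)], apspInput G⟩ ⟨[p], s⟩ := by
  have hfit := M.fits
  have hpos : 0 < 2 ^ M.w := by positivity
  have h1 : n * n % 2 ^ M.w = n * n := Nat.mod_eq_of_lt (by omega)
  have h2 : (n * n + n * n) % 2 ^ M.w = 2 * (n * n) := by
    rw [Nat.mod_eq_of_lt (by omega)]; ring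
  refine ⟨((apspInput G).setReg 41 (n * n)).setReg 40 (2 * (n * n)), ⟨fun x hx => ?_, ?_,
    fun x _ => rfl, fun id hid i => ?_⟩, ?_⟩
  · simp [State.setReg, apspInput, initial, show x ≠ 40 by omega,
      show x ≠ 41 by omega]
  · simp [State.setReg, hB]
  · simp only [State.setReg, apspInput, initial]
    rw [if_neg]
    rintro ⟨u, v, h, -⟩
    have h3 := Nat.mul_le_mul_right n (show (u : ℕ) + 1 ≤ n from u.2)
    rw [add_mul, one_mul] at h3
    have := v.2
    omega
  · refine .head (fun x => rfl) (.head (c₁ := ⟨[.seq (.op .add 40 41 41) p],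
      (apspInput G).setReg 41 (n * n)⟩) (fun x => ?_) (.head (fun x => rfl) (.one fun x => ?_)))
    · simp [stepWith, Op.eval, apspInput, h1]
    · simp [stepWith, Op.eval, State.setReg, h2]

/-- The state before the random numbers are drawn. -/
structure Drawing (G : SimpleGraph (Fin n)) (A D s : ℕ) (a : ASt) : Prop where
  v0 : a.v 0 = n
  v1 : a.v 1 = n + 2
  v3 : a.v 3 = n / (D * s)
  v4 : a.v 4 = A * (s * s)
  v5 : a.v 5 = A * (s * s) * (n / (D * s))
  v6 : a.v 6 = 0
  v11 : a.v 11 = 0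
  raw : a.raw = (apspInput G).mem
  arr : ∀ id i, a.arr id i = 0

theorem drawing_spec {A D s : ℕ} (hB : M.B = 2 * (n * n)) (hV : bound A D n ≤ M.V)
    (hs : CubeRoot n s) (hn : 1 ≤ n) : ∃ k ≤ 100 * s + 300, ∃ s' a,
      DSteps M.w k ⟨[apsp A D], apspInput G⟩ ⟨[fillLoop, solve], s'⟩ ∧ Sim M a s' ∧
      Drawing G A D s a ∧ s'.reg 41 = fillCond.eval a := by
  have hVp := M.Vpos
  obtain ⟨s0, sim0, d0⟩ := start_spec (G := G) hB (cond (.var 0) (main A D) (block []))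
  have hbd := bound_ge (A := A) (D := D) hs.le_self (Nat.zero_le n)
  have hnn : (n + 2) * (n + 2) = n * n + 4 * n + 4 := by ring
  obtain ⟨s1, d1, sim1⟩ := cond_spec (e := .var 0) (p := main A D) (q := block []) sim0 (by simp)
    (by simp [initial]; omega)
  have hne : (Ex.var 0).eval (initial G) ≠ 0 := by simp [initial]; omega
  have d1 := d1 []
  rw [if_pos hne] at d1
  obtain ⟨t, s2, a2, d2, sim2, t2, r⟩ := wp_params (M := M) (A := A) (D := D) (s := s)
    (a := initial G) (by simp [initial]) hs hV s1 sim1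
  obtain ⟨s3, d3, sim3, r3⟩ := evalTo_spec fillCond a2 s2 sim2 (by simp [fillCond])
    (lt_of_le_of_lt (Op.lt_le _ _) (by omega))
  have htime := r.time
  have h0 : (initial G).time = 0 := rfl
  refine ⟨4 + 7 + 1 + t + 1 + (2 * fillCond.len + 5) + 1, ?_, s3, a2, ?_, sim3,
    ⟨r.v0, r.v1, r.v3, r.v4, r.v5, by rw [r.v6]; rfl, r.v11, by rw [r.raw]; rfl,
      by rw [r.arr]; intro id i; rfl⟩, r3⟩
  · simp [fillCond]
    omega
  · have e1 : DSteps M.w 1 ⟨[main A D], s1⟩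
        ⟨[params A D, .seq (evalTo fillCond) (.seq fillLoop solve)], s1⟩ := .one fun x => rfl
    have e2 : DSteps M.w 1 ⟨[.seq (evalTo fillCond) (.seq fillLoop solve)], s2⟩
        ⟨[evalTo fillCond, .seq fillLoop solve], s2⟩ := .one fun x => rfl
    have e3 : DSteps M.w 1 ⟨[.seq fillLoop solve], s3⟩ ⟨[fillLoop, solve], s3⟩ := .one fun x => rfl
    exact (((((d0.trans d1).trans e1).trans (d2 _)).trans e2).trans (d3 _)).trans e3

theorem Filled.ready {A D s : ℕ} {a b : ASt} {ρ : ℕ → ℕ} {k : ℕ} (h : Drawing G A D s a)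
    (hf : Filled n k ρ a b) : Ready G (n / (D * s)) (A * (s * s)) ρ b := by
  have hv : ∀ z < 11, b.v z = a.v z := ASt.v_eq hf.low
  refine ⟨(hv 0 (by omega)).trans h.v0, (hv 1 (by omega)).trans h.v1, (hv 3 (by omega)).trans h.v3,
    (hv 4 (by omega)).trans h.v4, (hv 6 (by omega)).trans h.v6, fun u hu x hx => ?_, fun j _ => ?_,
    fun id hid i => by rw [hf.arr id hid]; exact h.arr id i⟩
  · rw [hf.raw, h.raw]
    simp only [apspInput, adjBit]
    congr 1
    rw [eq_iff_iff]
    constructor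
    · rintro ⟨i, j, h1, h2⟩
      obtain ⟨rfl, rfl⟩ := idx_inj h1 hx j.2
      exact ⟨i.2, j.2, h2⟩
    · rintro ⟨_, _, h2⟩
      exact ⟨_, _, rfl, h2⟩
  · rw [hf.arr0, h.v11]
    simp

theorem Solved.output {b : ASt} {s : State} (h : Solved G b.raw) (hs : Sim M b s)
    (hB : M.B = 2 * (n * n)) : IsAPSPOutput G s := by
  intro i j
  have h3 := Nat.mul_le_mul_right n (show (i : ℕ) + 1 ≤ n from i.2)
  rw [add_mul, one_mul] at h3
  have hj := j.2
  obtain ⟨h4, h5, h6⟩ := h i j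
  have e : n ^ 2 + (i : ℕ) * n + j = n * n + (i * n + j) := by ring
  rw [e, hs.raw _ (by omega), hs.raw _ (by omega)]
  exact ⟨h4, h5, h6⟩

/-- The machine with the given word length. -/
def mach (A D n w : ℕ) (h : 2 * (n * n) + 32 * bound A D n + 32 ≤ 2 ^ w) : Mach where
  w := w
  V := bound A D n
  B := 2 * (n * n)
  fits := h
  Vpos := by
    have := bound_ge (A := A) (D := D) (Nat.zero_le n) (Nat.zero_le n)
    omega

/-- All runs of the algorithm halt with a correct output. -/
theorem apsp_allRuns {A D w : ℕ} (h : 2 * (n * n) + 32 * bound A D n + 32 ≤ 2 ^ w) :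
    ∃ T, AllRuns w (fun c => c.Halted ∧ IsAPSPOutput G c.state) T ⟨[apsp A D], apspInput G⟩ := by
  set M := mach A D n w h with hM
  have hB : M.B = 2 * (n * n) := rfl
  rcases Nat.eq_zero_or_pos n with hn | hn
  -- The graph without vertices takes the empty branch of the program, and there is nothing to
  -- output.
  · obtain ⟨s0, sim0, d0⟩ := start_spec (G := G) hB (cond (.var 0) (main A D) (block []))
    obtain ⟨s1, d1, sim1⟩ := cond_spec (e := .var 0) (p := main A D) (q := block []) sim0 (by simp)
      (by have := M.Vpos; simp [initial]; omega)
    have hz : (Ex.var 0).eval (initial G) = 0 := by simp [initial, hn]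
    have d1 := d1 []
    rw [if_neg (by simp [hz])] at d1
    obtain ⟨t, s2, a2, d2, -⟩ := wp_block (M := M) (L := []) (Q := fun _ => True) (a := initial G)
      trivial trivial s1 sim1
    refine ⟨_, DSteps.allRuns ((d0.trans d1).trans (d2 [])) (T := 0) ⟨rfl, fun i => ?_⟩⟩
    exact absurd i.2 (by omega)
  · obtain ⟨s, hs⟩ := exists_cubeRoot hn
    obtain ⟨k, -, s', a, d, sim, hd, h41⟩ := drawing_spec (G := G) hB le_rfl hs hn
    have hbd := bound_ge (A := A) (D := D) hs.le_self (Nat.div_le_self n (D * s))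
    have hV : M.V = bound A D n := rfl
    have hNV : A * (s * s) * (n / (D * s)) < M.V :=
      lt_of_le_of_lt (by rw [add_assoc, add_assoc]; exact Nat.le_add_right _ _) hbd.2.1
    have hnn : (n + 2) * (n + 2) = n * n + 4 * n + 4 := by ring
    obtain ⟨T, hT⟩ := fill_sure (M := M) (B := fun c => c.Halted ∧ IsAPSPOutput G c.state)
      (fun c hc => hc.1) hn (by omega) (N := A * (s * s) * (n / (D * s))) hNV [solve] _ a s' sim
      hd.v0 hd.v5 (by rw [hd.v11, zero_add]) (fun j _ => hd.arr 0 j) h41 (fun ρ b s'' hf hs'' => by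
        obtain ⟨t, s3, b3, d3, sim3, -, h3, -⟩ := wp_solve (M := M) (hf.ready hd) hn hB (by omega)
          hbd.2.1 s'' hs''
        exact ⟨t + 0, (d3 []).allRuns ⟨rfl, h3.output sim3 hB⟩⟩)
    exact ⟨_, d.allRuns hT⟩

/-- The probability to halt in time is at least that of a cheap elimination sequence. -/
theorem apsp_prob {A D w s Δ T : ℕ} (h : 2 * (n * n) + 32 * bound A D n + 32 ≤ 2 ^ w)
    (hs : CubeRoot n s) (hn : 1 ≤ n)
    (hT : 100 * s + 300 + (34 * (A * (s * s) * (n / (D * s))) + 1 +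
      (450 * (A * (s * s) * (n / (D * s)) * n) + 340 * ((A * (s * s) + 1) * n) +
        3100 * (8 * (n * Δ) * n) + 6000 * (n * n * (Nat.log 2 n + 1)))) ≤ T) :
    avg (2 ^ w) (A * (s * s) * (n / (D * s))) (ind fun ρ => elimCost (adjBit G) (range n)
        (allElims (adjBit G) n (n / (D * s)) (A * (s * s)) ρ) ≤ n * Δ) ≤
      (haltProb w T ⟨[apsp A D], apspInput G⟩).toReal := by
  set M := mach A D n w h with hM
  have hB : M.B = 2 * (n * n) := rfl
  obtain ⟨k, hk, s', a, d, sim, hd, h41⟩ := drawing_spec (G := G) hB le_rfl hs hn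
  have hbd := bound_ge (A := A) (D := D) hs.le_self (Nat.div_le_self n (D * s))
  have hV : M.V = bound A D n := rfl
  have hNV : A * (s * s) * (n / (D * s)) < M.V :=
    lt_of_le_of_lt (by rw [add_assoc, add_assoc]; exact Nat.le_add_right _ _) hbd.2.1
  have hnn : (n + 2) * (n + 2) = n * n + 4 * n + 4 := by ring
  set N := A * (s * s) * (n / (D * s)) with hN
  -- Unused steps do no harm, since a halted machine stays halted.
  obtain ⟨t, rfl⟩ : ∃ t, T = k + (34 * N + 1 + t) := ⟨T - (k + (34 * N + 1)), by omega⟩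
  change _ ≤ (haltProb M.w _ _).toReal
  rw [d.haltProb]
  refine fill_prob (M := M) (N := N) hn (by omega) hNV [solve] N a s' sim hd.v0 hd.v5
    (by rw [hd.v11, zero_add]) (fun j _ => hd.arr 0 j) h41 _ fun ρ b s'' hf hs'' hP => ?_
  obtain ⟨t', s3, b3, d3, sim3, t3, -, S, hS, h3⟩ := wp_solve (M := M) (hf.ready hd) hn hB (by omega)
    hbd.2.1 s'' hs''
  have hSn : S * n ≤ 8 * (n * Δ) * n := Nat.mul_le_mul_right n (by omega)
  rw [← hN] at h3
  obtain ⟨t'', rfl⟩ : ∃ t'', t = t' + t'' := ⟨t - t', by omega⟩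
  rw [(d3 []).haltProb]
  exact haltProb_halted (show Config.Halted ⟨[], s3⟩ from rfl)

end WordRAM

/-! ### Success probability and final estimates -/

namespace WordRAM

open Finset

variable {n : ℕ} {G : SimpleGraph (Fin n)}

/-! ### Twins -/

/-- The set `dif` may contain `u` and `v` themselves, which `sdPair` disregards; hence the summand
2. The infimum in the definition is attained because `n` is always an admissible value. -/
theorem hasTwins_symmetricDifference (G : SimpleGraph (Fin n)) :
    HasTwins (adjBit G) n (symmetricDifference G + 2) := by
  have hne : {d : ℕ | ∀ S : Set (Fin n), S.Nontrivial →
      ∃ u v : S, u ≠ v ∧ sdPair (G.induce S) u v ≤ d}.Nonempty := by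
    refine ⟨n, fun S hS => ?_⟩
    obtain ⟨u, hu, v, hv, huv⟩ := hS
    refine ⟨⟨u, hu⟩, ⟨v, hv⟩, fun h => huv (congrArg Subtype.val h), ?_⟩
    classical
    refine (Set.ncard_le_card _).trans ?_
    rw [Nat.card_eq_fintype_card]
    exact (Fintype.card_subtype_le _).trans (Fintype.card_fin n).le
  have hspec := Nat.sInf_mem hne
  intro S hS hc
  obtain ⟨x, hx, y, hy, hxy⟩ := one_lt_card.1 (show 1 < #S by omega)
  obtain ⟨⟨u, hu⟩, ⟨v, hv⟩, huv, hd⟩ := hspec {z : Fin n | (z : ℕ) ∈ S}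
    ⟨⟨x, mem_range.1 (hS hx)⟩, hx, ⟨y, mem_range.1 (hS hy)⟩, hy, fun h => hxy (congrArg Fin.val h)⟩
  refine ⟨u, hu, v, hv, fun h => huv (Subtype.ext (Fin.ext h)), ?_⟩
  set T : Set {z : Fin n | (z : ℕ) ∈ S} :=
    symmDiff ((G.induce {z : Fin n | (z : ℕ) ∈ S}).neighborSet ⟨u, hu⟩ \ {⟨v, hv⟩})
      ((G.induce {z : Fin n | (z : ℕ) ∈ S}).neighborSet ⟨v, hv⟩ \ {⟨u, hu⟩}) with hT
  have hTc : T.ncard ≤ symmetricDifference G := hd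
  have hsub : (dif (adjBit G) S u v : Set ℕ) ⊆
      ((fun z : {z : Fin n | (z : ℕ) ∈ S} => ((z : Fin n) : ℕ)) '' T) ∪ {(u : ℕ), (v : ℕ)} := by
    intro z hz
    obtain ⟨hzS, hne⟩ := mem_filter.1 (mem_coe.1 hz)
    have hzn := mem_range.1 (hS hzS)
    by_cases hzu : z = u
    · exact Or.inr (by simp [hzu])
    by_cases hzv : z = v
    · exact Or.inr (by simp [hzv])
    refine Or.inl ⟨⟨⟨z, hzn⟩, hzS⟩, ?_, rfl⟩
    have key : ∀ w : Fin n, adjBit G w z = 1 ↔ G.Adj w ⟨z, hzn⟩ := fun w =>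
      adjBit_eq_one.trans ⟨fun ⟨_, _, h⟩ => h, fun h => ⟨_, _, h⟩⟩
    have hu1 := adjBit_le_one (G := G) u z
    have hv1 := adjBit_le_one (G := G) v z
    have hzu' : (⟨z, hzn⟩ : Fin n) ≠ u := fun h => hzu (congrArg Fin.val h)
    have hzv' : (⟨z, hzn⟩ : Fin n) ≠ v := fun h => hzv (congrArg Fin.val h)
    simp only [hT, Set.mem_symmDiff, Set.mem_sdiff, SimpleGraph.mem_neighborSet,
      SimpleGraph.comap_adj, Function.Embedding.subtype_apply, Set.mem_singleton_iff,
      Subtype.mk.injEq, hzu', hzv', not_false_eq_true, and_true, ← key]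
    omega
  have h1 : (dif (adjBit G) S u v : Set ℕ).ncard ≤ _ := Set.ncard_le_ncard hsub
    ((Set.toFinite T |>.image _).union (Set.toFinite _))
  rw [Set.ncard_coe_finset] at h1
  refine h1.trans ((Set.ncard_union_le _ _).trans (add_le_add ?_ ?_))
  · exact (Set.ncard_image_le (Set.toFinite T)).trans hTc
  · exact Set.ncard_insert_le _ _ |>.trans (by simp)

/-! ### The probability of a cheap elimination sequence -/

/-- As `(3 / 4) ^ 3 ≤ 1 / 2`, the first factor is at most `2 ^ (-(3 * c' + 2) * s ^ 2)`. The second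
one uses up `s ^ 2` of the exponent because `n / s ≤ s ^ 2`. The rest suffices because `n ≤ s ^ 3 ≤
2 ^ (3 * s)`. -/
theorem pow_cubeRoot_bound {s c' : ℕ} (hs : CubeRoot n s) (hn : 1 ≤ n) :
    (3 / 4 : ℝ) ^ (3 * (3 * c' + 2) * (s * s)) * 2 ^ (n / s) ≤ 1 / 2 * ((n : ℝ) ^ c')⁻¹ := by
  have hs1 := hs.pos
  have hdiv : n / s ≤ s * s := by
    rw [Nat.div_le_iff_le_mul_add_pred hs1]
    have := hs.le
    nlinarith
  have hss : s ≤ s * s := Nat.le_mul_self s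
  have h1 : (3 / 4 : ℝ) ^ (3 * (3 * c' + 2) * (s * s)) ≤ (1 / 2) ^ ((3 * c' + 2) * (s * s)) := by
    rw [mul_assoc, pow_mul]
    exact pow_le_pow_left₀ (by positivity) (by norm_num) _
  have h2 : (2 : ℝ) ^ (n / s) ≤ 2 ^ (s * s) := pow_le_pow_right₀ (by norm_num) hdiv
  have h3 : (1 / 2 : ℝ) ^ ((3 * c' + 2) * (s * s)) * 2 ^ (s * s) = (1 / 2) ^ ((3 * c' + 1) * (s * s)) := by
    rw [show (3 * c' + 2) * (s * s) = (3 * c' + 1) * (s * s) + s * s by ring, pow_add, mul_assoc,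
      ← mul_pow]
    norm_num
  have h4 : (1 / 2 : ℝ) ^ ((3 * c' + 1) * (s * s)) ≤ (1 / 2) ^ (3 * c' * s + 1) := by
    refine pow_le_pow_of_le_one (by norm_num) (by norm_num) ?_
    nlinarith [Nat.mul_le_mul_left (3 * c') hss]
  have h5 : (n : ℝ) ^ c' ≤ 2 ^ (3 * c' * s) := by
    have h6 : (n : ℝ) ≤ (2 ^ s) ^ 3 := by
      have h7 : (s : ℝ) ≤ 2 ^ s := by exact_mod_cast Nat.lt_two_pow_self.le
      have h8 : (n : ℝ) ≤ s ^ 3 := by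
        have := hs.le
        have h9 : n ≤ s ^ 3 := by rw [pow_succ, pow_two]; exact this
        exact_mod_cast h9
      exact h8.trans (pow_le_pow_left₀ (by positivity) h7 3)
    calc (n : ℝ) ^ c' ≤ ((2 ^ s) ^ 3) ^ c' := pow_le_pow_left₀ (by positivity) h6 _
      _ = 2 ^ (3 * c' * s) := by rw [← pow_mul, ← pow_mul]; congr 1; ring
  calc _ ≤ (1 / 2 : ℝ) ^ ((3 * c' + 2) * (s * s)) * 2 ^ (s * s) := by gcongr
    _ ≤ (1 / 2) ^ (3 * c' * s + 1) := h3.le.trans h4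
    _ = 1 / 2 * (2 ^ (3 * c' * s))⁻¹ := by rw [pow_succ, one_div, inv_pow]; ring
    _ ≤ _ := by
      have : (0 : ℝ) < n := by exact_mod_cast hn
      gcongr

/-- Everything is compared with powers of `P = 2 ^ (log n + 1)`, which exceeds `n`. The exponential
is at most `P ^ (-(A + c' + 5))` since `1 / e ≤ 1 / 2`; the number of trials is at most `P ^ (A +
2)` and the number of pairs at most `P ^ 2`. This leaves `P ^ (-(c' + 1))`, and `P ≥ 2` gives the
factor 1/2. -/
theorem exp_bound {A c' s q Δ : ℕ} (hs : CubeRoot n s) (hn : 1 ≤ n)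
    (h : 2 * n * ((A + c' + 5) * (Nat.log 2 n + 1)) ≤ Δ * q) :
    ((A * (s * s) : ℕ) : ℝ) * ((n : ℝ) ^ 2 * Real.exp (-(Δ * q / (2 * n) : ℝ))) ≤
      1 / 2 * ((n : ℝ) ^ c')⁻¹ := by
  have hn0 : (0 : ℝ) < n := by exact_mod_cast hn
  set L := Nat.log 2 n + 1 with hL
  set P : ℝ := 2 ^ L with hP
  have hPn : (n : ℝ) ≤ P := by
    have : n < 2 ^ L := Nat.lt_pow_succ_log_self (by omega) n
    calc (n : ℝ) ≤ ((2 ^ L : ℕ) : ℝ) := by exact_mod_cast this.le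
      _ = P := by simp [hP]
  have hP2 : (2 : ℝ) ≤ P := by
    calc (2 : ℝ) = 2 ^ 1 := by norm_num
      _ ≤ 2 ^ L := pow_le_pow_right₀ (by norm_num) (by omega)
  have hP0 : 0 < P := by positivity
  have h1 : (((A + c' + 5) * L : ℕ) : ℝ) ≤ Δ * q / (2 * n) := by
    rw [le_div_iff₀ (by positivity)]
    have h' : (2 * n * ((A + c' + 5) * L) : ℝ) ≤ Δ * q := by exact_mod_cast h
    push_cast
    linarith
  have h2 : Real.exp (-(Δ * q / (2 * n) : ℝ)) ≤ (P ^ (A + c' + 5))⁻¹ := by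
    calc Real.exp (-(Δ * q / (2 * n) : ℝ)) ≤ Real.exp (-(((A + c' + 5) * L : ℕ) : ℝ)) :=
          Real.exp_le_exp.2 (by linarith)
      _ = Real.exp (-1) ^ ((A + c' + 5) * L) := by
          rw [← Real.exp_nat_mul]; congr 1; ring
      _ ≤ (1 / 2) ^ ((A + c' + 5) * L) :=
          pow_le_pow_left₀ (Real.exp_pos _).le (by linarith [Real.exp_neg_one_lt_d9]) _
      _ = (P ^ (A + c' + 5))⁻¹ := by
          rw [hP, ← pow_mul, one_div, inv_pow]; congr 2; ring
  have h3 : ((A * (s * s) : ℕ) : ℝ) ≤ P ^ A * P ^ 2 := by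
    have hA : (A : ℝ) ≤ P ^ A := by
      calc (A : ℝ) ≤ 2 ^ A := by exact_mod_cast Nat.lt_two_pow_self.le
        _ ≤ P ^ A := pow_le_pow_left₀ (by norm_num) hP2 _
    have hsP : (s : ℝ) ≤ P := (by exact_mod_cast hs.le_self : (s : ℝ) ≤ n).trans hPn
    push_cast
    rw [pow_two]
    gcongr
  calc _ ≤ (P ^ A * P ^ 2) * (P ^ 2 * (P ^ (A + c' + 5))⁻¹) := by gcongr
    _ = (P ^ (c' + 1))⁻¹ := by
      rw [show A + c' + 5 = A + 2 + 2 + (c' + 1) by ring, pow_add, pow_add, pow_add]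
      field_simp
    _ = P⁻¹ * (P ^ c')⁻¹ := by rw [pow_succ, mul_inv, mul_comm]
    _ ≤ 1 / 2 * ((n : ℝ) ^ c')⁻¹ := by
      rw [one_div]
      gcongr

/-- There are two ways to fail, too many vertices left or a bad trial, and each has probability at
most half of `n ^ (-c')`. Otherwise `elimCost_allElims_le` applies. -/
theorem elimCost_prob {A D b c' s M Δ : ℕ} (hn : 1 ≤ n) (hM : n ≤ M) (hs : CubeRoot n s)
    (hA : A = 3 * (3 * c' + 2)) (hD : D = 8 * (b + 4)) (hsd : symmetricDifference G ≤ b * s)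
    (hΔ : Δ = 4 * D * s * ((A + c' + 5) * (Nat.log 2 n + 1))) :
    1 - ((n : ℝ) ^ c')⁻¹ ≤ avg M (A * (s * s) * (n / (D * s))) (ind fun ρ =>
      elimCost (adjBit G) (range n) (allElims (adjBit G) n (n / (D * s)) (A * (s * s)) ρ) ≤ n * Δ) := by
  have hs1 := hs.pos
  have hDs : 0 < D * s := Nat.mul_pos (by omega) hs1
  have hk : 1 ≤ (A + c' + 5) * (Nat.log 2 n + 1) := Nat.mul_pos (by omega) (by omega)
  have hΔD : 4 * (D * s) ≤ Δ := by
    rw [hΔ, mul_assoc 4 D s]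
    exact Nat.le_mul_of_pos_right _ hk
  have hsDs : 8 * s ≤ D * s := Nat.mul_le_mul_right s (by omega)
  have hM0 : 0 < M := by omega
  set q := n / (D * s) with hq
  have hqn : q * (D * s) ≤ n := Nat.div_mul_le_self n (D * s)
  rcases Nat.eq_zero_or_pos q with hq0 | hq0
  -- Without samples `n < D * s ≤ Δ`, so that no difference can exceed `Δ` and success is certain.
  · have hnD : n < D * s := by
      rcases Nat.div_eq_zero_iff.1 hq0 with h | h
      · omega
      · exact h
    refine le_trans (b := (1 : ℝ)) ?_ ?_
    · have : (0 : ℝ) ≤ ((n : ℝ) ^ c')⁻¹ := by positivity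
      linarith
    · rw [← avg_const hM0 (A * (s * s) * q) (1 : ℝ)]
      refine avg_mono fun ρ => le_of_eq (ind_of ?_).symm
      refine elimCost_allElims_le hn ρ ?_ ?_
      · rintro i - ⟨u, hu, hd⟩
        have h2 : #(dif (adjBit G) (remain (adjBit G) n q (range n) ρ i) u
            (rep (adjBit G) (remain (adjBit G) n q (range n) ρ i)
              (smp n q (shiftF (i * q) ρ) (remain (adjBit G) n q (range n) ρ i)) u)) ≤ n :=
          (card_filter_le _ _).trans ((card_le_card (remain_subset _ _ _)).trans (card_range n).le)
        omega
      · have := card_le_card (remain_subset (bt := adjBit G) (n := n) (q := q) (range n) ρ (A * (s * s)))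
        rw [card_range] at this
        omega
  · set R := A * (s * s) with hR
    have htw := hasTwins_symmetricDifference G
    -- The constant `D = 8 * (b + 4)` is made for this: with `τ = s`, near-twins of the forest
    -- differ in at most `b * s + 2 + 2 * s ≤ (b + 4) * s` vertices.
    have h8 : 8 * (q * (symmetricDifference G + 2 + 2 * s)) ≤ n := by
      refine le_trans ?_ hqn
      have : symmetricDifference G + 2 + 2 * s ≤ (b + 4) * s := by
        rw [add_mul]; omega
      calc 8 * (q * (symmetricDifference G + 2 + 2 * s)) ≤ 8 * (q * ((b + 4) * s)) := by gcongr
        _ = q * (D * s) := by rw [hD]; ring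
    have e1 := avg_remain_le (M := M) hn hM htw hs1 h8 R (range n) Subset.rfl
    have e2 := avg_bad_le (bt := adjBit G) (q := q) (Δ := Δ) hn hM R (range n) Subset.rfl
    have hlt : n < D * s * (q + 1) := Nat.lt_mul_div_succ n hDs
    -- As `q` is positive, rounding the quotient down loses at most a factor 2; this explains the 4
    -- in `Δ`.
    have hn2 : n ≤ 2 * (q * (D * s)) := by nlinarith
    have e3 := exp_bound (A := A) (c' := c') (q := q) (Δ := Δ) hs hn (by
      calc 2 * n * ((A + c' + 5) * (Nat.log 2 n + 1))
          ≤ 2 * (2 * (q * (D * s))) * ((A + c' + 5) * (Nat.log 2 n + 1)) := by gcongr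
        _ = Δ * q := by rw [hΔ]; ring)
    have e4 := pow_cubeRoot_bound (c' := c') hs hn
    rw [card_range, ← hA, ← hR] at *
    have key : ∀ ρ, (1 : ℝ) ≤ ind (fun ρ => elimCost (adjBit G) (range n)
        (allElims (adjBit G) n q R ρ) ≤ n * Δ) ρ +
        (ind (fun ρ => 2 * s < #(remain (adjBit G) n q (range n) ρ R)) ρ +
        ind (fun ρ => ∃ r < R, BadTrial (adjBit G) n q Δ (range n) ρ r) ρ) := by
      intro ρ
      by_cases h1 : 2 * s < #(remain (adjBit G) n q (range n) ρ R)
      · rw [ind_of (P := fun ρ => 2 * s < #(remain (adjBit G) n q (range n) ρ R)) h1]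
        have := ind_nonneg (fun ρ => elimCost (adjBit G) (range n)
          (allElims (adjBit G) n q R ρ) ≤ n * Δ) ρ
        have := ind_nonneg (fun ρ => ∃ r < R, BadTrial (adjBit G) n q Δ (range n) ρ r) ρ
        linarith
      by_cases h2 : ∃ r < R, BadTrial (adjBit G) n q Δ (range n) ρ r
      · rw [ind_of (P := fun ρ => ∃ r < R, BadTrial (adjBit G) n q Δ (range n) ρ r) h2]
        have := ind_nonneg (fun ρ => elimCost (adjBit G) (range n)
          (allElims (adjBit G) n q R ρ) ≤ n * Δ) ρ
        have := ind_nonneg (fun ρ => 2 * s < #(remain (adjBit G) n q (range n) ρ R)) ρ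
        linarith
      rw [ind_of (P := fun ρ => elimCost (adjBit G) (range n)
          (allElims (adjBit G) n q R ρ) ≤ n * Δ)]
      · have := ind_nonneg (fun ρ => ∃ r < R, BadTrial (adjBit G) n q Δ (range n) ρ r) ρ
        have := ind_nonneg (fun ρ => 2 * s < #(remain (adjBit G) n q (range n) ρ R)) ρ
        linarith
      · push Not at h2
        exact elimCost_allElims_le hn ρ h2 (by omega)
    have h := avg_mono (M := M) (k := R * q) key
    rw [avg_const hM0, avg_add, avg_add] at h
    linarith

end WordRAM

namespace WordRAM

open Finset

/-! ### Word length and running time -/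

/-- With `P = 2 ^ (log n + 1) > n`, a sixth power of `P` dominates `(n + 2) ^ 3`, and the constant
coefficient is at most `P` to the power of itself. The sum of these exponents is the factor demanded
of the word length. -/
theorem fits_of_le {A D n w : ℕ}
    (h : (32 * (100 + A + D) + 34 + 6) * (Nat.log 2 n + 1) ≤ w) :
    2 * (n * n) + 32 * bound A D n + 32 ≤ 2 ^ w := by
  set L := Nat.log 2 n + 1 with hL
  set K := 100 + A + D with hK
  set P := 2 ^ L with hP
  have hPn : n + 1 ≤ P := Nat.lt_pow_succ_log_self (by omega) n
  have hP2 : 2 ≤ P := by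
    calc 2 = 2 ^ 1 := by norm_num
      _ ≤ 2 ^ L := Nat.pow_le_pow_right (by omega) (by omega)
  have hn2 : n + 2 ≤ P * P := by nlinarith
  have h3 : (n + 2) * (n + 2) * (n + 2) ≤ P ^ 6 := by
    calc (n + 2) * (n + 2) * (n + 2) ≤ (P * P) * (P * P) * (P * P) := by gcongr
      _ = P ^ 6 := by ring
  have h4 : 32 * K + 34 ≤ P ^ (32 * K + 34) :=
    Nat.lt_two_pow_self.le.trans (Nat.pow_le_pow_left hP2 _)
  have h5 : n * n ≤ (n + 2) * (n + 2) * (n + 2) := by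
    calc n * n = n * n * 1 := by ring
      _ ≤ (n + 2) * (n + 2) * (n + 2) := by gcongr <;> omega
  have h6 : 1 ≤ (n + 2) * (n + 2) * (n + 2) := Nat.mul_pos (Nat.mul_pos (by omega) (by omega)) (by omega)
  have h7 : bound A D n = K * ((n + 2) * (n + 2) * (n + 2)) := rfl
  by_cases hn : n = 0
  · subst hn
    have h8 : 32 * bound A D 0 + 32 ≤ 2 ^ (32 * (100 + A + D) + 34 + 6) := by
      have h9 : 32 * (100 + A + D) + 34 ≤ 2 ^ (32 * (100 + A + D) + 34) := Nat.lt_two_pow_self.le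
      rw [pow_add, bound]
      norm_num
      omega
    have : 2 ^ (32 * (100 + A + D) + 34 + 6) ≤ 2 ^ w := Nat.pow_le_pow_right (by omega) (by
      have : L = 1 := by simp [hL]
      rw [this] at h
      omega)
    omega
  have h5' : 2 * (n * n) + 32 ≤ 34 * ((n + 2) * (n + 2) * (n + 2)) := by omega
  calc 2 * (n * n) + 32 * bound A D n + 32
      ≤ (32 * K + 34) * ((n + 2) * (n + 2) * (n + 2)) := by
        rw [h7, show (32 * K + 34) * ((n + 2) * (n + 2) * (n + 2)) =
          32 * (K * ((n + 2) * (n + 2) * (n + 2))) + 34 * ((n + 2) * (n + 2) * (n + 2)) by ring]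
        omega
    _ ≤ P ^ (32 * K + 34) * P ^ 6 := Nat.mul_le_mul h4 h3
    _ = 2 ^ ((32 * K + 34 + 6) * L) := by rw [← pow_add, hP, ← pow_mul, mul_comm]
    _ ≤ 2 ^ w := Nat.pow_le_pow_right (by omega) h

/-- All summands are at most multiples of `n ^ 2 * s * log n`. For the trials this uses `s * q ≤ n`,
which turns `s ^ 2 * q * n` into `n ^ 2 * s`. -/
theorem time_le {A D n s k : ℕ} (hs : CubeRoot n s) (hn : 1 ≤ n) (hD : 1 ≤ D) :
    100 * s + 300 + (34 * (A * (s * s) * (n / (D * s))) + 1 +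
      (450 * (A * (s * s) * (n / (D * s)) * n) + 340 * ((A * (s * s) + 1) * n) +
        3100 * (8 * (n * (4 * D * s * (k * (Nat.log 2 n + 1)))) * n) +
        6000 * (n * n * (Nat.log 2 n + 1)))) ≤
    (401 + 34 * A + 450 * A + 340 * (A + 1) + 3100 * (32 * D * k) + 6000) *
      (n * n * s * (Nat.log 2 n + 1)) := by
  set L := Nat.log 2 n + 1 with hL
  set q := n / (D * s) with hq
  have hs1 := hs.pos
  have hsn := hs.le_self
  have hL1 : 1 ≤ L := by omega
  have hqs : s * q ≤ n := by
    calc s * q = q * s := mul_comm _ _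
      _ ≤ q * (D * s) := by gcongr; exact Nat.le_mul_of_pos_left _ hD
      _ ≤ n := Nat.div_mul_le_self _ _
  set U := n * n * s * L with hU
  have hU1 : s ≤ U := by
    calc s = 1 * 1 * s * 1 := by ring
      _ ≤ n * n * s * L := by gcongr
  have hU2 : A * (s * s) * q * n ≤ A * U := by
    calc A * (s * s) * q * n = A * (n * (s * q) * s * 1) := by ring
      _ ≤ A * (n * n * s * L) := by gcongr
  have hU3 : A * (s * s) * q ≤ A * U := le_trans (Nat.le_mul_of_pos_right _ hn) hU2
  have hU4 : (A * (s * s) + 1) * n ≤ (A + 1) * U := by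
    calc (A * (s * s) + 1) * n ≤ (A * (s * s) + s * s) * n := by
          gcongr; exact Nat.mul_pos hs1 hs1
      _ = (A + 1) * (n * s * s * 1) := by ring
      _ ≤ (A + 1) * (n * n * s * L) := by
          rw [show n * n * s * L = n * n * s * L from rfl]
          gcongr
  have hU5 : 8 * (n * (4 * D * s * (k * L))) * n = 32 * D * k * U := by rw [hU]; ring
  have hU6 : n * n * L ≤ U := by
    calc n * n * L = n * n * 1 * L := by ring
      _ ≤ n * n * s * L := by gcongr
  rw [hU5]
  calc _ ≤ 100 * U + 300 * U + (34 * (A * U) + U + (450 * (A * U) + 340 * ((A + 1) * U) +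
        3100 * (32 * D * k * U) + 6000 * U)) := by
        have h300 : 300 ≤ 300 * U := by omega
        have h1 : 1 ≤ U := by omega
        gcongr
    _ = _ := by ring

/-- The factor 4 comes from `s ≤ 2 * n ^ (1 / 3)` and `log n + 1 ≤ 2 * (log n) ^ 2`, both valid for
`n ≥ 2`. The second estimate gives away a logarithm. -/
theorem realTime_le {n s : ℕ} (C : ℕ) (hs : CubeRoot n s) (hn : 2 ≤ n) :
    ((C * (n * n * s * (Nat.log 2 n + 1)) : ℕ) : ℝ) ≤
      (4 * C : ℝ) * (n : ℝ) ^ (7 / 3 : ℝ) * Real.logb 2 n ^ 2 := by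
  have hn0 : (0 : ℝ) < n := by exact_mod_cast (by omega : 0 < n)
  have hn2 : (2 : ℝ) ≤ n := by exact_mod_cast hn
  set x : ℝ := (n : ℝ) ^ (1 / 3 : ℝ) with hx
  have hx0 : 0 ≤ x := by positivity
  have hx1 : 1 ≤ x := Real.one_le_rpow (by linarith) (by norm_num)
  have hx3 : x ^ 3 = n := by
    rw [hx, ← Real.rpow_natCast, ← Real.rpow_mul hn0.le]
    norm_num
  have hs2 : (s : ℝ) ≤ 2 * x := by
    have h1 : ((s - 1 : ℕ) : ℝ) ^ 3 < x ^ 3 := by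
      rw [hx3]
      have : (s - 1) ^ 3 < n := by rw [pow_succ, pow_two]; exact hs.lt
      exact_mod_cast this
    have h2 := lt_of_pow_lt_pow_left₀ 3 hx0 h1
    rw [Nat.cast_sub hs.pos] at h2
    push_cast at h2
    linarith
  have h73 : (n : ℝ) ^ (7 / 3 : ℝ) = n * n * x := by
    rw [show (7 / 3 : ℝ) = 1 + 1 + 1 / 3 by norm_num, Real.rpow_add hn0, Real.rpow_add hn0,
      Real.rpow_one]
  have hlog1 : 1 ≤ Real.logb 2 n := by
    rw [Real.le_logb_iff_rpow_le (by norm_num) hn0]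
    simpa using hn2
  have hL : ((Nat.log 2 n + 1 : ℕ) : ℝ) ≤ 2 * Real.logb 2 n ^ 2 := by
    have h1 := Real.natLog_le_logb n 2
    push_cast at h1 ⊢
    nlinarith
  rw [h73]
  push_cast
  calc (C : ℝ) * (n * n * s * (Nat.log 2 n + 1))
      ≤ C * (n * n * (2 * x) * (2 * Real.logb 2 n ^ 2)) := by
        push_cast at hL
        gcongr
    _ = _ := by ring

end WordRAM

open WordRAM in
theorem theorem6 (β c : ℝ) (hβ : 0 < β) (hc : 0 < c) :
    ∃ (P : WordRAM.Prog) (κ : ℕ) (C : ℝ),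
      ∀ (n w : ℕ) (G : SimpleGraph (Fin n)),
        κ * (Nat.log 2 n + 1) ≤ w →
        (symmetricDifference G : ℝ) ≤ β * (n : ℝ) ^ (1 / 3 : ℝ) →
        -- every halting run outputs a correct solution
        (∀ (t : ℕ) (d : WordRAM.Config), d ∈ (WordRAM.run w t ⟨[P], apspInput G⟩).support →
          d.Halted → IsAPSPOutput G d.state) ∧
        -- the algorithm halts almost surely
        Filter.Tendsto (fun t : ℕ => WordRAM.haltProb w t ⟨[P], apspInput G⟩)
          Filter.atTop (nhds 1) ∧
        -- the running time is as claimed with high probability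
        (2 ≤ n →
          ENNReal.ofReal (1 - (n : ℝ) ^ (-c)) ≤
            WordRAM.haltProb w ⌊C * (n : ℝ) ^ (7 / 3 : ℝ) * Real.logb 2 n ^ 2⌋₊
              ⟨[P], apspInput G⟩) := by
  -- The real parameters are rounded up, since the constants in the program text are natural
  -- numbers.
  obtain ⟨b, hb⟩ := exists_nat_ge β
  obtain ⟨c', hc'⟩ := exists_nat_ge c
  obtain ⟨A, hA⟩ : ∃ A, A = 3 * (3 * c' + 2) := ⟨_, rfl⟩
  obtain ⟨D, hD⟩ : ∃ D, D = 8 * (b + 4) := ⟨_, rfl⟩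
  obtain ⟨C, hC⟩ : ∃ C, C = 401 + 34 * A + 450 * A + 340 * (A + 1) +
    3100 * (32 * D * (A + c' + 5)) + 6000 := ⟨_, rfl⟩
  refine ⟨apsp A D, 32 * (100 + A + D) + 34 + 6, 4 * C, fun n w G hw hsd => ?_⟩
  have hfit := fits_of_le hw
  obtain ⟨T, hT⟩ := apsp_allRuns (G := G) hfit
  have hB : ∀ d : Config, (d.Halted ∧ IsAPSPOutput G d.state) → d.Halted := fun d hd => hd.1
  refine ⟨fun t d hd hh => (hT.of_mem_support hB hd hh).2, ?_, fun hn => ?_⟩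
  -- The halting probability is not only convergent to 1 but equal to 1 from time `T` on.
  · refine tendsto_const_nhds.congr' ?_
    filter_upwards [Filter.eventually_ge_atTop T] with t ht
    exact ((hT.mono hB ht).haltProb_eq hB).symm
  · obtain ⟨s, hs⟩ := exists_cubeRoot (show 1 ≤ n by omega)
    have hn1 : (1 : ℝ) ≤ n := by exact_mod_cast (by omega : 1 ≤ n)
    have hsd' : symmetricDifference G ≤ b * s := by
      have h1 : (n : ℝ) ^ (1 / 3 : ℝ) ≤ s := by
        have h2 : (n : ℝ) ≤ (s : ℝ) ^ 3 := by
          have : n ≤ s ^ 3 := by rw [pow_succ, pow_two]; exact hs.le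
          exact_mod_cast this
        calc (n : ℝ) ^ (1 / 3 : ℝ) ≤ ((s : ℝ) ^ 3) ^ (1 / 3 : ℝ) :=
              Real.rpow_le_rpow (by positivity) h2 (by norm_num)
          _ = s := by
              rw [← Real.rpow_natCast, ← Real.rpow_mul (by positivity)]
              norm_num
      have h3 : (symmetricDifference G : ℝ) ≤ b * s := hsd.trans (by gcongr)
      exact_mod_cast h3
    have hnw : n ≤ 2 ^ w := by nlinarith
    refine ENNReal.ofReal_le_of_le_toReal (le_trans ?_ (apsp_prob (G := G)
      (Δ := 4 * D * s * ((A + c' + 5) * (Nat.log 2 n + 1))) hfit hs (by omega) ?_))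
    · refine le_trans ?_ (elimCost_prob (by omega) hnw hs hA hD hsd' rfl)
      have : ((n : ℝ) ^ c')⁻¹ ≤ (n : ℝ) ^ (-c) := by
        rw [← Real.rpow_natCast, ← Real.rpow_neg (by positivity)]
        exact Real.rpow_le_rpow_of_exponent_le hn1 (by linarith)
      linarith
    · refine (time_le hs (by omega) (by omega)).trans (Nat.le_floor ?_)
      rw [← hC]
      exact realTime_le C hs hn
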